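/- **Setting.** Let $(\mathcal G,\Delta,\epsilon,\phi,S,\alpha,\beta)$ be a finite dimensional quasi-Hopf algebra over $\mathbb C$: $\mathcal G$ is a unital associative algebra, $\Delta:\mathcal G\to\mathcal G\otimes\mathcal G$ and $\epsilon:\mathcal G\to\mathbb C$ are unital algebra morphisms, $\phi\in\mathcal G^{\otimes 3}$ is invertible, $S:\mathcal G\to\mathcal G$ is a bijective linear algebra antimorphism, $\alpha,\beta\in\mathcal G$, and, writing $\phi=X\otimes Y\otimes Z$, $\phi^{-1}=P\otimes Q\otimes R$ (summation suppressed), for all $a \in \mathcal G$ $$({\rm id}\otimes\Delta)(\Delta(a))\,\phi=\phi\,(\Delta\otimes{\rm id})(\Delta(a)),\qquad ({\rm id}\otimes{\rm id}\otimes\Delta)(\phi)\,(\Delta\otimes{\rm id}\otimes{\rm id})(\phi)=({\bf 1}\otimes\phi)\,({\rm id}\otimes\Delta\otimes{\rm id})(\phi)\,(\phi\otimes{\bf 1}),$$ $$(\epsilon\otimes{\rm id})\Delta={\rm id}=({\rm id}\otimes\epsilon)\Delta,\qquad ({\rm id}\otimes\epsilon\otimes{\rm id})(\phi)={\bf 1}\otimes{\bf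 1},$$ $$S(a_{(1)})\alpha a_{(2)}=\epsilon(a)\alpha,\quad a_{(1)}\beta S(a_{(2)})=\epsilon(a)\beta,\quad X\beta S(Y)\alpha Z={\bf 1}=S(P)\alpha Q\beta S(R).$$ Assume that $\alpha$ is normalized by $\epsilon(\alpha)=1$. An R-matrix of a quasi-Hopf algebra is an invertible $\mathcal R\in\mathcal G\otimes\mathcal G$ with $\Delta^{op}(a)\mathcal R=\mathcal R\Delta(a)$ for all $a$ and $$(\Delta\otimes{\rm id})(\mathcal R)=\phi^{312}\mathcal R^{13}(\phi^{-1})^{132}\mathcal R^{23}\phi,\qquad ({\rm id}\otimes\Delta)(\mathcal R)=(\phi^{-1})^{231}\mathcal R^{13}\phi^{213}\mathcal R^{12}\phi^{-1};$$ a quasi-Hopf algebra with an R-matrix is called quasitriangular. Here $\psi^{n_1\dots n_m}$ has the $k$-th factor of $\psi$ in slot $n_k$ and ${\bf 1}$ in the remaining slots, and ${}^{op}$ exchanges the two tensor factors. **The elements $f$, $p_\rho$, $\Omega$.** Put $$\gamma=S(U)\alpha V\otimes S(T)\alpha W,\quad T\otimes U\otimes V\otimes W=({\bf 1}\otimes\phi^{-1})({\rm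 id}\otimes{\rm id}\otimes\Delta)(\phi),$$ $$\bar\delta=K\beta S(N)\otimes L\beta S(M),\quad K\otimes L\otimes M\otimes N=(\Delta\otimes{\rm id}\otimes{\rm id})(\phi)(\phi^{-1}\otimes{\bf 1}),$$ $$f=(S\otimes S)(\Delta^{op}(P))\,\gamma\,\Delta(Q\beta S(R)),\qquad f'=\Delta(S(P)\alpha Q)\,\bar\delta\,(S\otimes S)(\Delta^{op}(R)),$$ $p_\rho=P\otimes Q\beta S(R)$, $\delta=(\Delta\otimes{\rm id})\circ\Delta$, and $$\Phi=[({\rm id}\otimes\Delta\otimes{\rm id})(\phi)\otimes{\bf 1}]\,[\phi\otimes{\bf 1}\otimes{\bf 1}]\,[(\delta\otimes{\rm id}\otimes{\rm id})(\phi^{-1})],\qquad \Omega=({\rm id}^{\otimes 3}\otimes S^{-1}\otimes S^{-1})\big(({\bf 1}^{\otimes 3}\otimes f)\,\Phi^{-1}\big)=\Omega^1\otimes\dots\otimes\Omega^5 .$$ **The double.** Let $\hat{\mathcal G}$ be the dual space of $\mathcal G$, with coproduct dual to the product of $\mathcal G$, with $(a\rightharpoonup\varphi)(x)=\varphi(xa)$,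 $(\varphi\leftharpoonup a)(x)=\varphi(ax)$, the (in general non-associative) product $(\varphi\psi)(x)=(\varphi\otimes\psi)(\Delta(x))$ with unit $\hat{\bf 1}=\epsilon$, and $\hat S(\varphi)=\varphi\circ S$; for $\varphi,\psi \in \hat{\mathcal G}$, $a\in\mathcal G$ let $\varphi\triangleright a\triangleleft\psi=(\psi\otimes{\rm id}\otimes\varphi)(\delta(a))$. The double $\mathcal D(\mathcal G)$ is the vector space $\hat{\mathcal G}\otimes\mathcal G$, whose elements $\varphi\otimes a$ are also written $\varphi\bowtie a$, with the product $$(\varphi\bowtie a)(\psi\bowtie b)=\big[(\Omega^1\rightharpoonup\varphi\leftharpoonup\Omega^5)(\Omega^2\rightharpoonup\psi_{(2)}\leftharpoonup\Omega^4)\big]\bowtie\big[\Omega^3\,(\hat S^{-1}(\psi_{(1)})\triangleright a\triangleleft\psi_{(3)})\,b\big].$$ Let $i_D(a)=\hat{\bf 1}\bowtie a$ and, for a basis $e_\mu$ of $\mathcal G$ with dual basis $e^\mu$ and $p_\rho=p^1\otimes p^2$, let $${\bf D}=\sum_\mu S^{-1}(p^2)\,e_\mu\,p^1_{(1)}\otimes(e^\mu\bowtie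 p^1_{(2)})\ \in\ \mathcal G\otimes\mathcal D(\mathcal G)$$ (the universal $\Delta$-flip operator). **Theorem.** The element $f$ is invertible with $f^{-1}=f'$, and $\mathcal D(\mathcal G)$ is an associative algebra with unit $\hat{\bf 1}\bowtie{\bf 1}$. In it, $i_D$ is injective and, for all $a,b\in\mathcal G$, with $\phi$ read as $({\rm id}\otimes{\rm id}\otimes i_D)(\phi)$ in the last equation, $$i_D(a)i_D(b)=i_D(ab),\quad {\bf D}\,({\rm id}\otimes i_D)(\Delta(a))=({\rm id}\otimes i_D)(\Delta^{op}(a))\,{\bf D},\quad \phi^{312}{\bf D}^{13}(\phi^{-1})^{132}{\bf D}^{23}\phi=(\Delta\otimes{\rm id})({\bf D}).$$ Moreover ${\bf D}$ is invertible and $(\epsilon\otimes{\rm id})({\bf D})={\bf 1}_{\mathcal D(\mathcal G)}$. Put $$\phi_D=(i_D\otimes i_D\otimes i_D)(\phi),\quad \alpha_D=i_D(\alpha),\quad \beta_D=i_D(\beta),\quad R_D=(i_D\otimes{\rm id})({\bf D}).$$ Then there are a unique unital algebra morphism $\Delta_D:\mathcal D(\mathcal G)\to\mathcal D(\mathcal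 G)\otimes\mathcal D(\mathcal G)$, a unique unital algebra morphism $\epsilon_D:\mathcal D(\mathcal G)\to\mathbb C$ and a unique linear algebra antimorphism $S_D:\mathcal D(\mathcal G)\to\mathcal D(\mathcal G)$ such that, for all $a\in\mathcal G$, $$\Delta_D(i_D(a))=(i_D\otimes i_D)(\Delta(a)),\qquad (i_D\otimes\Delta_D)({\bf D})=(\phi_D^{-1})^{231}\,R_D^{13}\,\phi_D^{213}\,R_D^{12}\,\phi_D^{-1},$$ $$\epsilon_D(i_D(a))=\epsilon(a),\qquad ({\rm id}\otimes\epsilon_D)({\bf D})={\bf 1}_{\mathcal G},$$ $$S_D(i_D(a))=i_D(S(a)),\qquad (S\otimes S_D)({\bf D})=({\rm id}\otimes i_D)(f^{op})\,{\bf D}\,({\rm id}\otimes i_D)(f^{-1}).$$ The map $S_D$ is bijective, $(\mathcal D(\mathcal G),\Delta_D,\epsilon_D,\phi_D,S_D,\alpha_D,\beta_D)$ is a quasi-Hopf algebra, and $R_D$ is an R-matrix of it. Thus $\mathcal D(\mathcal G)$ is a quasitriangular quasi-Hopf algebra. -/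

import Mathlib

open scoped TensorProduct

-- instances on tensor powers of degree up to five
set_option maxSynthPendingDepth 6

noncomputable section

namespace QH

universe u v

section Tensor

variable {K : Type u} [Field K]

/-- For linear maps `f`, `g` into an algebra `E`, the linear map `a ⊗ b ↦ f a * g b`.
Sweedler-type expressions are written with it: the factors of a tensor are consumed from left
to right, each leg being sent into `E`, and the images are multiplied in that order. -/
def mulTensor {M N E : Type*} [AddCommGroup M] [Module K M] [AddCommGroup N] [Module K N]
    [Ring E] [Algebra K E] (f : M →ₗ[K] E) (g : N →ₗ[K] E) : M ⊗[K] N →ₗ[K] E :=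
  LinearMap.mul' K E ∘ₗ TensorProduct.map f g

infixr:70 " ⊛ " => mulTensor

@[simp] theorem mulTensor_tmul {M N E : Type*} [AddCommGroup M] [Module K M] [AddCommGroup N]
    [Module K N] [Ring E] [Algebra K E] (f : M →ₗ[K] E) (g : N →ₗ[K] E) (m : M) (n : N) :
    (f ⊛ g) (m ⊗ₜ[K] n) = f m * g n := by
  simp [mulTensor]

/-- The same for maps into the algebra of endomorphisms of `W`, whose product is composition:
`a ⊗ b ↦ f a ∘ g b`. -/
def compTensor {M N W : Type*} [AddCommGroup M] [Module K M] [AddCommGroup N] [Module K N]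
    [AddCommGroup W] [Module K W] (f : M →ₗ[K] Module.End K W) (g : N →ₗ[K] Module.End K W) :
    M ⊗[K] N →ₗ[K] Module.End K W :=
  mulTensor (E := Module.End K W) f g

infixr:70 " ⊚ " => compTensor

@[simp] theorem compTensor_tmul {M N W : Type*} [AddCommGroup M] [Module K M] [AddCommGroup N]
    [Module K N] [AddCommGroup W] [Module K W] (f : M →ₗ[K] Module.End K W)
    (g : N →ₗ[K] Module.End K W) (m : M) (n : N) (w : W) :
    (f ⊚ g) (m ⊗ₜ[K] n) w = f m (g n w) := by
  simp [compTensor]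

variable {A B C : Type*} [Ring A] [Algebra K A] [Ring B] [Algebra K B] [Ring C] [Algebra K C]

/-- `R¹²`: `a ⊗ b ↦ a ⊗ b ⊗ 1`. Threefold tensor powers are nested to the right. -/
def leg12 : A ⊗[K] B →ₐ[K] A ⊗[K] (B ⊗[K] C) :=
  Algebra.TensorProduct.map (AlgHom.id K A) Algebra.TensorProduct.includeLeft

/-- `R¹³`: `a ⊗ b ↦ a ⊗ 1 ⊗ b`. -/
def leg13 : A ⊗[K] B →ₐ[K] A ⊗[K] (C ⊗[K] B) :=
  Algebra.TensorProduct.map (AlgHom.id K A) Algebra.TensorProduct.includeRight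

/-- `R²³`: `a ⊗ b ↦ 1 ⊗ a ⊗ b`. -/
def leg23 : A ⊗[K] B →ₐ[K] C ⊗[K] (A ⊗[K] B) :=
  Algebra.TensorProduct.includeRight

/-- `ψ¹³²`: `x ⊗ y ⊗ z ↦ x ⊗ z ⊗ y`. In `ψ^{klm}` the first, second and third factor of `ψ`
are put into the slots `k`, `l`, `m`, respectively. -/
def perm132 : A ⊗[K] (A ⊗[K] A) →ₐ[K] A ⊗[K] (A ⊗[K] A) :=
  Algebra.TensorProduct.map (AlgHom.id K A) (Algebra.TensorProduct.comm K A A).toAlgHom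

/-- `ψ²¹³`: `x ⊗ y ⊗ z ↦ y ⊗ x ⊗ z`. -/
def perm213 : A ⊗[K] (A ⊗[K] A) →ₐ[K] A ⊗[K] (A ⊗[K] A) :=
  (Algebra.TensorProduct.leftComm K A A A).toAlgHom

/-- `ψ³¹²`: `x ⊗ y ⊗ z ↦ y ⊗ z ⊗ x`. -/
def perm312 : A ⊗[K] (A ⊗[K] A) →ₐ[K] A ⊗[K] (A ⊗[K] A) :=
  (Algebra.TensorProduct.assoc K K K A A A).toAlgHom.comp
    (Algebra.TensorProduct.comm K A (A ⊗[K] A)).toAlgHom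

/-- `ψ²³¹`: `x ⊗ y ⊗ z ↦ z ⊗ x ⊗ y`. -/
def perm231 : A ⊗[K] (A ⊗[K] A) →ₐ[K] A ⊗[K] (A ⊗[K] A) :=
  (Algebra.TensorProduct.comm K (A ⊗[K] A) A).toAlgHom.comp
    (Algebra.TensorProduct.assoc K K K A A A).symm.toAlgHom

/-- `ψ ⊗ 1`, for `ψ` of tensor degree three: `x ⊗ y ⊗ z ↦ x ⊗ y ⊗ z ⊗ 1`. -/
def leg123 : A ⊗[K] (A ⊗[K] A) →ₐ[K] A ⊗[K] (A ⊗[K] (A ⊗[K] A)) :=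
  Algebra.TensorProduct.map (AlgHom.id K A)
    (Algebra.TensorProduct.map (AlgHom.id K A) Algebra.TensorProduct.includeLeft)

/-- If `G` acts on `M` by `T`, it acts on `M ⊗ N` by `T ⊗ id`. -/
def onLeft {G M : Type*} (N : Type*) [AddCommGroup G] [Module K G] [AddCommGroup M] [Module K M]
    [AddCommGroup N] [Module K N] (T : G →ₗ[K] Module.End K M) :
    G →ₗ[K] Module.End K (M ⊗[K] N) :=
  LinearMap.rTensorHom N ∘ₗ T

/-- If `G` acts on `N` by `T`, it acts on `M ⊗ N` by `id ⊗ T`. -/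
def onRight {G N : Type*} (M : Type*) [AddCommGroup G] [Module K G] [AddCommGroup M] [Module K M]
    [AddCommGroup N] [Module K N] (T : G →ₗ[K] Module.End K N) :
    G →ₗ[K] Module.End K (M ⊗[K] N) :=
  LinearMap.lTensorHom M ∘ₗ T

/-- Left multiplication, `a ↦ (x ↦ a x)`. -/
def lmul : A →ₗ[K] Module.End K A := LinearMap.mul K A

/-- Right multiplication, `a ↦ (x ↦ x a)`. -/
def rmul : A →ₗ[K] Module.End K A := (LinearMap.mul K A).flip

end Tensor

/-- A quasi-bialgebra structure `(Δ, ε, φ)` on the algebra `A`. -/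
structure QuasiBialgebra (K : Type u) (A : Type v) [Field K] [Ring A] [Algebra K A] where
  /-- the coproduct -/
  Δ : A →ₐ[K] A ⊗[K] A
  /-- the counit -/
  ε : A →ₐ[K] K
  /-- the reassociator -/
  φ : (A ⊗[K] (A ⊗[K] A))ˣ
  /-- `(id ⊗ Δ)(Δ a) φ = φ (Δ ⊗ id)(Δ a)` -/
  quasi_coassoc : ∀ a : A,
    Algebra.TensorProduct.map (AlgHom.id K A) Δ (Δ a) * (φ : A ⊗[K] (A ⊗[K] A)) =
      φ * Algebra.TensorProduct.assoc K K K A A A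
        (Algebra.TensorProduct.map Δ (AlgHom.id K A) (Δ a))
  /-- `(id ⊗ id ⊗ Δ)(φ) (Δ ⊗ id ⊗ id)(φ) = (1 ⊗ φ) (id ⊗ Δ ⊗ id)(φ) (φ ⊗ 1)` -/
  pentagon :
    Algebra.TensorProduct.map (AlgHom.id K A) (Algebra.TensorProduct.map (AlgHom.id K A) Δ)
        (φ : A ⊗[K] (A ⊗[K] A)) *
      Algebra.TensorProduct.assoc K K K A A (A ⊗[K] A)
        (Algebra.TensorProduct.map Δ (AlgHom.id K (A ⊗[K] A)) (φ : A ⊗[K] (A ⊗[K] A))) =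
    ((1 : A) ⊗ₜ[K] (φ : A ⊗[K] (A ⊗[K] A))) *
      Algebra.TensorProduct.map (AlgHom.id K A)
        ((Algebra.TensorProduct.assoc K K K A A A).toAlgHom.comp
          (Algebra.TensorProduct.map Δ (AlgHom.id K A))) (φ : A ⊗[K] (A ⊗[K] A)) *
      leg123 (φ : A ⊗[K] (A ⊗[K] A))
  /-- `(ε ⊗ id) ∘ Δ = id` -/
  counit_left : ∀ a : A, Algebra.TensorProduct.lid K A
    (Algebra.TensorProduct.map ε (AlgHom.id K A) (Δ a)) = a
  /-- `(id ⊗ ε) ∘ Δ = id` -/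
  counit_right : ∀ a : A, Algebra.TensorProduct.rid K K A
    (Algebra.TensorProduct.map (AlgHom.id K A) ε (Δ a)) = a
  /-- `(id ⊗ ε ⊗ id)(φ) = 1 ⊗ 1` -/
  counit_mid : Algebra.TensorProduct.map (AlgHom.id K A)
    ((Algebra.TensorProduct.lid K A).toAlgHom.comp
      (Algebra.TensorProduct.map ε (AlgHom.id K A))) (φ : A ⊗[K] (A ⊗[K] A)) = 1

/-- A quasi-Hopf algebra structure `(Δ, ε, φ, S, α, β)` with invertible antipode on `A`. -/
structure QuasiHopfAlgebra (K : Type u) (A : Type v) [Field K] [Ring A] [Algebra K A] extends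
    QuasiBialgebra K A where
  /-- the antipode -/
  S : A ≃ₗ[K] A
  /-- the antipode is an algebra antimorphism -/
  S_mul : ∀ a b : A, S (a * b) = S b * S a
  α : A
  β : A
  /-- `S(a₍₁₎) α a₍₂₎ = ε(a) α` -/
  antipode_left : ∀ a : A, (S.toLinearMap ⊛ LinearMap.mulLeft K α) (Δ a) = ε a • α
  /-- `a₍₁₎ β S(a₍₂₎) = ε(a) β` -/
  antipode_right : ∀ a : A,
    (LinearMap.id ⊛ (LinearMap.mulLeft K β ∘ₗ S.toLinearMap)) (Δ a) = ε a • β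
  /-- `X β S(Y) α Z = 1`, where `φ = X ⊗ Y ⊗ Z` -/
  reassoc_antipode :
    (LinearMap.id ⊛ (LinearMap.mulLeft K β ∘ₗ S.toLinearMap) ⊛ LinearMap.mulLeft K α)
      (φ : A ⊗[K] (A ⊗[K] A)) = 1
  /-- `S(P) α Q β S(R) = 1`, where `φ⁻¹ = P ⊗ Q ⊗ R` -/
  reassoc_inv_antipode :
    (S.toLinearMap ⊛ LinearMap.mulLeft K α ⊛ (LinearMap.mulLeft K β ∘ₗ S.toLinearMap))
      (↑φ⁻¹ : A ⊗[K] (A ⊗[K] A)) = 1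

namespace QuasiBialgebra

variable {K : Type u} {A : Type v} [Field K] [Ring A] [Algebra K A] (H : QuasiBialgebra K A)

/-- The opposite coproduct. -/
def Δop : A →ₐ[K] A ⊗[K] A :=
  (Algebra.TensorProduct.comm K A A).toAlgHom.comp H.Δ

/-- `R` is a quasitriangular R-matrix. -/
structure IsRMatrix (R : A ⊗[K] A) : Prop where
  isUnit : IsUnit R
  /-- `Δᵒᵖ(a) R = R Δ(a)` -/
  intertwines : ∀ a : A, H.Δop a * R = R * H.Δ a
  /-- `(Δ ⊗ id)(R) = φ³¹² R¹³ (φ⁻¹)¹³² R²³ φ` -/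
  hexagon_left :
    Algebra.TensorProduct.assoc K K K A A A
        (Algebra.TensorProduct.map H.Δ (AlgHom.id K A) R) =
      perm312 (H.φ : A ⊗[K] (A ⊗[K] A)) * leg13 R * perm132 (↑H.φ⁻¹ : A ⊗[K] (A ⊗[K] A)) *
        leg23 R * (H.φ : A ⊗[K] (A ⊗[K] A))
  /-- `(id ⊗ Δ)(R) = (φ⁻¹)²³¹ R¹³ φ²¹³ R¹² φ⁻¹` -/
  hexagon_right :
    Algebra.TensorProduct.map (AlgHom.id K A) H.Δ R =
      perm231 (↑H.φ⁻¹ : A ⊗[K] (A ⊗[K] A)) * leg13 R * perm213 (H.φ : A ⊗[K] (A ⊗[K] A)) *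
        leg12 R * (↑H.φ⁻¹ : A ⊗[K] (A ⊗[K] A))

/-- The two-sided coaction `δ = (Δ ⊗ id) ∘ Δ` of the quasi-bialgebra on itself. -/
def δ₂ : A →ₐ[K] A ⊗[K] (A ⊗[K] A) :=
  (Algebra.TensorProduct.assoc K K K A A A).toAlgHom.comp
    ((Algebra.TensorProduct.map H.Δ (AlgHom.id K A)).comp H.Δ)

/-- `δ ⊗ id ⊗ id`, into the fivefold tensor power. -/
def δ₂₁₁ : A ⊗[K] (A ⊗[K] A) →ₐ[K] A ⊗[K] (A ⊗[K] (A ⊗[K] (A ⊗[K] A))) :=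
  (Algebra.TensorProduct.map (AlgHom.id K A)
      (Algebra.TensorProduct.assoc K K K A A (A ⊗[K] A)).toAlgHom).comp
    ((Algebra.TensorProduct.assoc K K K A (A ⊗[K] A) (A ⊗[K] A)).toAlgHom.comp
      (Algebra.TensorProduct.map H.δ₂ (AlgHom.id K (A ⊗[K] A))))

/-- `x ↦ (id ⊗ Δ ⊗ id)(x) ⊗ 1`, into the fivefold tensor power. -/
def midΔ : A ⊗[K] (A ⊗[K] A) →ₐ[K] A ⊗[K] (A ⊗[K] (A ⊗[K] (A ⊗[K] A))) :=
  Algebra.TensorProduct.map (AlgHom.id K A)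
    ((leg123 (K := K) (A := A)).comp
      ((Algebra.TensorProduct.assoc K K K A A A).toAlgHom.comp
        (Algebra.TensorProduct.map H.Δ (AlgHom.id K A))))

/-- `x ↦ x ⊗ 1 ⊗ 1`, into the fivefold tensor power. -/
def pad₃ : A ⊗[K] (A ⊗[K] A) →ₐ[K] A ⊗[K] (A ⊗[K] (A ⊗[K] (A ⊗[K] A))) :=
  Algebra.TensorProduct.map (AlgHom.id K A)
    (Algebra.TensorProduct.map (AlgHom.id K A) Algebra.TensorProduct.includeLeft)

/-- `Φ = [(id ⊗ Δ ⊗ id)(φ) ⊗ 1] [φ ⊗ 1 ⊗ 1] [(δ ⊗ id ⊗ id)(φ⁻¹)]`. -/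
def Φ : (A ⊗[K] (A ⊗[K] (A ⊗[K] (A ⊗[K] A))))ˣ :=
  Units.map (H.midΔ : _ →* _) H.φ *
    Units.map (pad₃ (K := K) (A := A) : _ →* _) H.φ *
    Units.map (H.δ₂₁₁ : _ →* _) H.φ⁻¹

end QuasiBialgebra

namespace QuasiHopfAlgebra

variable {K : Type u} {G : Type v} [Field K] [Ring G] [Algebra K G] (H : QuasiHopfAlgebra K G)

/-- `S⁻¹` as a linear map. -/
def Sinv : G →ₗ[K] G := H.S.symm.toLinearMap

/-- `a ↦ (S ⊗ S)(Δᵒᵖ(a))`. -/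
def SSΔop : G →ₗ[K] G ⊗[K] G :=
  TensorProduct.map H.S.toLinearMap H.S.toLinearMap ∘ₗ H.Δop.toLinearMap

/-- `a ↦ a ⊗ 1`. -/
def inl : G →ₗ[K] G ⊗[K] G :=
  (Algebra.TensorProduct.includeLeft : G →ₐ[K] G ⊗[K] G).toLinearMap

/-- `a ↦ 1 ⊗ a`. -/
def inr : G →ₗ[K] G ⊗[K] G :=
  (Algebra.TensorProduct.includeRight : G →ₐ[K] G ⊗[K] G).toLinearMap

/-- `γ = S(U) α V ⊗ S(T) α W`, where `T ⊗ U ⊗ V ⊗ W = (1 ⊗ φ⁻¹) (id ⊗ id ⊗ Δ)(φ)`. -/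
def γ : G ⊗[K] G :=
  ((inr ∘ₗ H.S.toLinearMap) ⊛ (inl ∘ₗ H.S.toLinearMap) ⊛
      (inl ∘ₗ LinearMap.mulLeft K H.α) ⊛ (inr ∘ₗ LinearMap.mulLeft K H.α))
    (((1 : G) ⊗ₜ[K] (↑H.φ⁻¹ : G ⊗[K] (G ⊗[K] G))) *
      Algebra.TensorProduct.map (AlgHom.id K G) (Algebra.TensorProduct.map (AlgHom.id K G) H.Δ)
        (H.φ : G ⊗[K] (G ⊗[K] G)))

/-- `δ = M β S(N') ⊗ N β S(M')`, where
`M ⊗ N ⊗ M' ⊗ N' = (Δ ⊗ id ⊗ id)(φ) (φ⁻¹ ⊗ 1)`. -/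
def δ : G ⊗[K] G :=
  (inl ⊛ inr ⊛
      (inr ∘ₗ LinearMap.mulLeft K H.β ∘ₗ H.S.toLinearMap) ⊛
      (inl ∘ₗ LinearMap.mulLeft K H.β ∘ₗ H.S.toLinearMap))
    (Algebra.TensorProduct.assoc K K K G G (G ⊗[K] G)
        (Algebra.TensorProduct.map H.Δ (AlgHom.id K (G ⊗[K] G)) (H.φ : G ⊗[K] (G ⊗[K] G))) *
      leg123 (↑H.φ⁻¹ : G ⊗[K] (G ⊗[K] G)))

/-- The Drinfeld twist `f = (S ⊗ S)(Δᵒᵖ(P)) γ Δ(Q β S(R))`, where `φ⁻¹ = P ⊗ Q ⊗ R`. -/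
def f : G ⊗[K] G :=
  (H.SSΔop ⊛ (LinearMap.mulLeft K H.γ ∘ₗ H.Δ.toLinearMap ∘ₗ LinearMap.mulRight K H.β) ⊛
    (H.Δ.toLinearMap ∘ₗ H.S.toLinearMap)) (↑H.φ⁻¹ : G ⊗[K] (G ⊗[K] G))

/-- The inverse `Δ(S(P) α Q) δ (S ⊗ S)(Δᵒᵖ(R))` of the Drinfeld twist `f`. -/
def fInv : G ⊗[K] G :=
  ((H.Δ.toLinearMap ∘ₗ H.S.toLinearMap) ⊛
    (H.Δ.toLinearMap ∘ₗ LinearMap.mulLeft K H.α) ⊛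
    (LinearMap.mulLeft K H.δ ∘ₗ H.SSΔop)) (↑H.φ⁻¹ : G ⊗[K] (G ⊗[K] G))

/-- `p_ρ = P ⊗ Q β S(R)`, where `φ⁻¹ = P ⊗ Q ⊗ R`. -/
def pρ : G ⊗[K] G :=
  TensorProduct.map LinearMap.id
    (LinearMap.mulRight K H.β ⊛ H.S.toLinearMap) (↑H.φ⁻¹ : G ⊗[K] (G ⊗[K] G))

/-- `Ω = (id ⊗ id ⊗ id ⊗ S⁻¹ ⊗ S⁻¹)((1 ⊗ 1 ⊗ 1 ⊗ f) Φ⁻¹)`. -/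
def Ω : G ⊗[K] (G ⊗[K] (G ⊗[K] (G ⊗[K] G))) :=
  TensorProduct.map LinearMap.id (TensorProduct.map LinearMap.id
      (TensorProduct.map LinearMap.id (TensorProduct.map H.Sinv H.Sinv)))
    (((1 : G) ⊗ₜ[K] ((1 : G) ⊗ₜ[K] ((1 : G) ⊗ₜ[K] H.f))) *
      (↑H.Φ⁻¹ : G ⊗[K] (G ⊗[K] (G ⊗[K] (G ⊗[K] G)))))

/-! ### The double -/

/-- The left action on the dual: `(a ⇀ φ)(x) = φ(x a)`. -/
def lact : G →ₗ[K] Module.End K (Module.Dual K G) :=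
  Module.Dual.transpose ∘ₗ (LinearMap.mul K G).flip

/-- The right action on the dual: `(φ ↼ a)(x) = φ(a x)`. -/
def ract : G →ₗ[K] Module.End K (Module.Dual K G) :=
  Module.Dual.transpose ∘ₗ LinearMap.mul K G

/-- The product of the dual: `(φ ψ)(x) = (φ ⊗ ψ)(Δ x)`. -/
def dualMul : Module.Dual K G ⊗[K] Module.Dual K G →ₗ[K] Module.Dual K G :=
  Module.Dual.transpose H.Δ.toLinearMap ∘ₗ TensorProduct.dualDistrib K G G

/-- The endomorphism `ψ ⊗ b ↦ (a₍₋₁₎ ⇀ ψ ↼ S⁻¹(a₍₁₎)) ⊗ a₍₀₎ b` of the dual tensor `G`, where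
`δ(a) = a₍₋₁₎ ⊗ a₍₀₎ ⊗ a₍₁₎`. By the definition of the actions and of the coproduct of the dual it
is `ψ ⊗ b ↦ ψ₍₂₎ ⊗ (Ŝ⁻¹(ψ₍₁₎) ▹ a ◃ ψ₍₃₎) b`. -/
def exch : G →ₗ[K] Module.End K (Module.Dual K G ⊗[K] G) :=
  (onLeft G lact ⊚ onRight (Module.Dual K G) lmul ⊚ onLeft G (ract ∘ₗ H.Sinv)) ∘ₗ
    H.δ₂.toLinearMap

/-- The endomorphism of the space of `φ ⊗ ψ ⊗ c` by which
`Ω¹ ⊗ Ω² ⊗ Ω³ ⊗ Ω⁴ ⊗ Ω⁵` acts: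
`φ ⊗ ψ ⊗ c ↦ (Ω¹ ⇀ φ ↼ Ω⁵) ⊗ (Ω² ⇀ ψ ↼ Ω⁴) ⊗ Ω³ c`. -/
def fiveAct : G ⊗[K] (G ⊗[K] (G ⊗[K] (G ⊗[K] G))) →ₗ[K]
    Module.End K (Module.Dual K G ⊗[K] (Module.Dual K G ⊗[K] G)) :=
  onLeft (Module.Dual K G ⊗[K] G) lact ⊚
  onRight (Module.Dual K G) (onLeft G lact) ⊚
  onRight (Module.Dual K G) (onRight (Module.Dual K G) lmul) ⊚
  onRight (Module.Dual K G) (onLeft G ract) ⊚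
  onLeft (Module.Dual K G ⊗[K] G) ract

/-- `φ ↦ (ψ ⊗ c ↦ [(Ω¹ ⇀ φ ↼ Ω⁵) (Ω² ⇀ ψ ↼ Ω⁴)] ⊗ Ω³ c)`. -/
def outer : Module.Dual K G →ₗ[K] Module.End K (Module.Dual K G ⊗[K] G) :=
  (LinearMap.llcomp K (Module.Dual K G ⊗[K] G)
      (Module.Dual K G ⊗[K] (Module.Dual K G ⊗[K] G)) (Module.Dual K G ⊗[K] G)
      (TensorProduct.map H.dualMul LinearMap.id ∘ₗ
        (TensorProduct.assoc K (Module.Dual K G) (Module.Dual K G) G).symm.toLinearMap ∘ₗ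
        fiveAct H.Ω)) ∘ₗ
    TensorProduct.mk K (Module.Dual K G) (Module.Dual K G ⊗[K] G)

/-- The product of the diagonal crossed product, as a bilinear map on the dual tensor `G`:
`(φ ⋈ a)(ψ ⋈ b) = [(Ω¹ ⇀ φ ↼ Ω⁵) (Ω² ⇀ ψ₍₂₎ ↼ Ω⁴)] ⋈ [Ω³ (Ŝ⁻¹(ψ₍₁₎) ▹ a ◃ ψ₍₃₎) b]`. -/
def doubleMul : Module.Dual K G ⊗[K] G →ₗ[K] Module.End K (Module.Dual K G ⊗[K] G) :=
  H.outer ⊚ H.exch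

/-- The unit `1̂ ⋈ 1` of the double; the unit `1̂` of the dual is the counit. -/
def doubleOne : Module.Dual K G ⊗[K] G := H.ε.toLinearMap ⊗ₜ[K] (1 : G)

/-- The product of the double is associative with unit `1̂ ⋈ 1`. -/
structure DoubleIsAlgebra : Prop where
  mul_assoc : ∀ x y z, H.doubleMul (H.doubleMul x y) z = H.doubleMul x (H.doubleMul y z)
  one_mul : ∀ x, H.doubleMul H.doubleOne x = x
  mul_one : ∀ x, H.doubleMul x H.doubleOne = x

/-- The quantum double: the dual tensor `G`, with `doubleMul` as product. -/
def Double (_ : H.DoubleIsAlgebra) : Type (max u v) := Module.Dual K G ⊗[K] G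

variable (h : H.DoubleIsAlgebra)

instance : Ring (H.Double h) :=
  { (inferInstance : AddCommGroup (Module.Dual K G ⊗[K] G)) with
    mul := fun x y => H.doubleMul x y
    one := H.doubleOne
    mul_assoc := h.mul_assoc
    one_mul := h.one_mul
    mul_one := h.mul_one
    left_distrib := fun x y z => (H.doubleMul x).map_add y z
    right_distrib := fun x y z => H.doubleMul.map_add₂ x y z
    zero_mul := fun x => H.doubleMul.map_zero₂ x
    mul_zero := fun x => (H.doubleMul x).map_zero }

instance : Algebra K (H.Double h) :=
  letI : Module K (H.Double h) :=
    { (inferInstance : Module K (Module.Dual K G ⊗[K] G)) with }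
  Algebra.ofModule (fun r x y => H.doubleMul.map_smul₂ r x y)
    (fun r x y => (H.doubleMul x).map_smul r y)

/-- The identity, from the dual tensor `G` to the double. -/
def toDouble : Module.Dual K G ⊗[K] G ≃ₗ[K] H.Double h where
  toFun x := x
  invFun x := x
  map_add' _ _ := rfl
  map_smul' _ _ := rfl
  left_inv _ := rfl
  right_inv _ := rfl

/-- The canonical embedding `i_D(a) = 1̂ ⋈ a`. -/
def iD : G →ₗ[K] H.Double h :=
  (H.toDouble h).toLinearMap ∘ₗ
    TensorProduct.mk K (Module.Dual K G) G H.ε.toLinearMap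

/-- The canonical element `∑ e_μ ⊗ (e^μ ⊗ 1)` of `G ⊗ (Ĝ ⊗ G)`. -/
def canonElt [FiniteDimensional K G] : G ⊗[K] (Module.Dual K G ⊗[K] G) :=
  ∑ μ, Module.finBasis K G μ ⊗ₜ[K] ((Module.finBasis K G).coord μ ⊗ₜ[K] (1 : G))

/-- The universal `Δ`-flip operator
`D = ∑ S⁻¹(p²) e_μ p¹₍₁₎ ⊗ (e^μ ⊗ p¹₍₂₎)`, where `p_ρ = p¹ ⊗ p²`. -/
def flipOp [FiniteDimensional K G] : G ⊗[K] H.Double h :=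
  TensorProduct.map LinearMap.id (H.toDouble h).toLinearMap
    ((((onLeft (Module.Dual K G ⊗[K] G) rmul ⊚
            onRight G (onRight (Module.Dual K G) lmul)) ∘ₗ H.Δ.toLinearMap) ⊚
        onLeft (Module.Dual K G ⊗[K] G) (lmul ∘ₗ H.Sinv)) H.pρ canonElt)

/-- `R_D = (i_D ⊗ id)(D)`. -/
def RD [FiniteDimensional K G] : H.Double h ⊗[K] H.Double h :=
  TensorProduct.map (H.iD h) LinearMap.id (H.flipOp h)

/-- `φ_D = (i_D ⊗ i_D ⊗ i_D)(φ)`, and likewise for any element in place of `φ`. -/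
def iD₃ : G ⊗[K] (G ⊗[K] G) →ₗ[K] H.Double h ⊗[K] (H.Double h ⊗[K] H.Double h) :=
  TensorProduct.map (H.iD h) (TensorProduct.map (H.iD h) (H.iD h))

/-- `id ⊗ i_D`. -/
def idiD : G ⊗[K] G →ₗ[K] G ⊗[K] H.Double h :=
  TensorProduct.map LinearMap.id (H.iD h)

/-- `id ⊗ id ⊗ i_D`. -/
def ididiD : G ⊗[K] (G ⊗[K] G) →ₗ[K] G ⊗[K] (G ⊗[K] H.Double h) :=
  TensorProduct.map LinearMap.id (TensorProduct.map LinearMap.id (H.iD h))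

/-- The defining relations of the double: `i_D` is multiplicative,
`D (id ⊗ i_D)(Δ(a)) = (id ⊗ i_D)(Δᵒᵖ(a)) D`, and
`φ³¹² D¹³ (φ⁻¹)¹³² D²³ φ = (Δ ⊗ id)(D)`. -/
structure DoubleRelations [FiniteDimensional K G] : Prop where
  iD_mul : ∀ a b : G, H.iD h a * H.iD h b = H.iD h (a * b)
  flip_intertwines : ∀ a : G,
    H.flipOp h * H.idiD h (H.Δ a) = H.idiD h (H.Δop a) * H.flipOp h
  flip_coherent :
    H.ididiD h (perm312 (H.φ : G ⊗[K] (G ⊗[K] G))) * leg13 (H.flipOp h) *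
        H.ididiD h (perm132 (↑H.φ⁻¹ : G ⊗[K] (G ⊗[K] G))) * leg23 (H.flipOp h) *
        H.ididiD h (H.φ : G ⊗[K] (G ⊗[K] G)) =
      Algebra.TensorProduct.assoc K K K G G (H.Double h)
        (Algebra.TensorProduct.map H.Δ (AlgHom.id K (H.Double h)) (H.flipOp h))

/-- The equations that prescribe `Δ_D`: `Δ_D(i_D(a)) = (i_D ⊗ i_D)(Δ(a))` and
`(i_D ⊗ Δ_D)(D) = (φ_D⁻¹)²³¹ D¹³ φ_D²¹³ D¹² φ_D⁻¹`. On the right-hand side of the latter, `D` is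
mapped to `D(G) ⊗ D(G)` by `i_D ⊗ id`. -/
structure IsCoproduct [FiniteDimensional K G]
    (Δ' : H.Double h →ₐ[K] H.Double h ⊗[K] H.Double h) : Prop where
  on_iD : ∀ a : G, Δ' (H.iD h a) = TensorProduct.map (H.iD h) (H.iD h) (H.Δ a)
  on_flip :
    TensorProduct.map (H.iD h) Δ'.toLinearMap (H.flipOp h) =
      perm231 (H.iD₃ h (↑H.φ⁻¹ : G ⊗[K] (G ⊗[K] G))) * leg13 (H.RD h) *
        perm213 (H.iD₃ h (H.φ : G ⊗[K] (G ⊗[K] G))) * leg12 (H.RD h) *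
        H.iD₃ h (↑H.φ⁻¹ : G ⊗[K] (G ⊗[K] G))

/-- The equations that prescribe `ε_D`: `ε_D(i_D(a)) = ε(a)` and `(id ⊗ ε_D)(D) = 1`. -/
structure IsCounit [FiniteDimensional K G] (ε' : H.Double h →ₐ[K] K) : Prop where
  on_iD : ∀ a : G, ε' (H.iD h a) = H.ε a
  on_flip : TensorProduct.rid K G
    (TensorProduct.map LinearMap.id ε'.toLinearMap (H.flipOp h)) = 1

/-- The equations that prescribe `S_D`, an algebra antimorphism: `S_D(i_D(a)) = i_D(S(a))` and
`(S ⊗ S_D)(D) = (id ⊗ i_D)(fᵒᵖ) D (id ⊗ i_D)(f⁻¹)`. -/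
structure IsAntipode [FiniteDimensional K G] (S' : H.Double h →ₗ[K] H.Double h) : Prop where
  anti_mul : ∀ x y : H.Double h, S' (x * y) = S' y * S' x
  on_iD : ∀ a : G, S' (H.iD h a) = H.iD h (H.S a)
  on_flip :
    TensorProduct.map H.S.toLinearMap S' (H.flipOp h) =
      H.idiD h (Algebra.TensorProduct.comm K G G H.f) * H.flipOp h * H.idiD h H.fInv

end QuasiHopfAlgebra

end QH

end

/-!
The proof computes with *legs*. Commuting algebra homomorphisms `a, b, c : G → B` place a tensor
in `B` (`pl`), they have a convolution `a ⋆ b`, and they carry a reassociator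
`φ[a, b, c]` which intertwines `(a ⋆ b) ⋆ c` with `a ⋆ (b ⋆ c)`. In this language every identity
between elements built from `φ` is a coherence statement: two rebracketings of the same word of
legs coincide, by the pentagon and by naturality. The antipode axioms say that the linear
functionals `x* ⊗ x ↦ S(x*) α x` and `x ⊗ x* ↦ x β S(x*)` collapse a convolution of neighbouring
legs to the counit (`LeftEq`, `RightEq`); under such a functional, all reassociators that treat
the two legs as a unit disappear.

*The twist.* For a homomorphism `θ` on `G`, an antipode along `θ` is unique up to a unique
comparison element (`antipodeTwist`). Both `Δ ∘ S` and `(S ⊗ S) ∘ Δᵒᵖ` are antipodes along `Δ`, the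
latter with `γ` and `δ` (`antipodeAlong_SSop`), and `f` is the comparison element. This gives
`f f' = f' f = 1`, `f Δ(S(a)) = (S ⊗ S)(Δᵒᵖ(a)) f`, `f Δ(α) = γ` and `δ f = Δ(β)`; the same
uniqueness on threefold coproducts shows that `f` twists `φ` into `(S ⊗ S ⊗ S)(φ³²¹)`
(`f_compat`).

*Associativity.* An element of `Ĝ ⊗ G` is read as a linear map `G → G` (`hat`). Then elements of
`G` act through the two-sided coaction `δ`, and functionals through `f` and `Φ⁻¹` (`hat_exch`,
`hat_outer`). Associativity reduces to the two exchange rules `exch_outer` and `outer_outer`; the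
second one amounts to `f_compat` and to a pentagon for `Φ` (`reasΦInv_pentagon`). The unit laws
follow from the normalization of `φ` and `f`, where `ε(α) = 1` is used.

*The universal property.* For a homomorphism `j : G → A`, an element `T` of `G ⊗ A` is a flip
operator if it intertwines `(id ⊗ j) Δ` with `(id ⊗ j) Δᵒᵖ`, and it is coherent if `(Δ ⊗ id)(T)` is
given by the hexagon. The assignments `T ↦ q T` and `L ↦ p_ρ`-sandwich of `L` are inverse to each
other (`genOfFlip_flipOfGen`, `flipOfGen_genOfFlip`). They translate flip operators into elements
`L` that are moved past `j(a)` like the canonical element of the double, and coherence into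
multiplicativity of `L` with respect to the product of the double. Hence `𝐃` is a coherent flip
operator, and homomorphisms `𝒟(G) → A` correspond to pairs of a homomorphism `j` and a coherent
flip operator `T` with `(ε ⊗ id)(T) = 1` (`liftDouble`, `double_hom_ext`). Such a `T` with values in
a finite-dimensional algebra is invertible: by coherence, `T v = 0` forces `v = 0` after evaluating
a pair of legs (`IsFlip.eq_zero`), and an injective endomorphism of a finite-dimensional space is
surjective.

*The structure maps.* By the universal property, each structure map is a choice of a flip operator,
and its uniqueness comes for free. Two flip operators have a product, given by the second hexagon
(`flipCostar`, `prodFlip`), and this defines `Δ_D`; the flip operator `1` for `ε` defines `ε_D`; and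
`fᵒᵖ 𝐃 f⁻¹`, read in the opposite algebra, is again a coherent flip operator (`opFlip`), because
of `f_compat`, and defines `S_D`.

*The axioms.* The double is generated by `i_D(G)` and the slices of `𝐃` (`IsGenerating`), so that
relations such as quasi-coassociativity need to be checked only on `i_D(G)`, where they hold in `G`,
and on `𝐃`, where they become naturality of the product of flip operators. For the antipode axioms,
one applies `S(y) α x` and `S_D(n) α_D t` simultaneously to legs of `G` and of the double:
the flip operator between the pairs is then invisible (`left_flipCostar`), since
`f Δ(α) = γ` permits it to change from the legs `y`, `n` to the legs `x`, `t`, and this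
yields the axioms on the slices of `𝐃` (`evD_coproduct`, `coevD_coproduct`). The image of `S_D` is a
subalgebra containing the generators, so that `S_D` is surjective and, in finite dimension,
bijective.
-/

noncomputable section

namespace QH

universe u v

/-! ### Placing tensors along commuting homomorphisms -/

section Commuting

variable {K : Type u} [Field K]
variable {A B C D E : Type*} [Ring A] [Algebra K A] [Ring B] [Algebra K B] [Ring C] [Algebra K C]
  [Ring D] [Algebra K D] [Ring E] [Algebra K E]

/-- The images of two algebra homomorphisms commute elementwise. A family of pairwise commuting
homomorphisms into one algebra `B` plays the role of the legs of a tensor power. -/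
class Commuting (f : A →ₐ[K] B) (g : C →ₐ[K] B) : Prop where
  comm : ∀ x y, Commute (f x) (g y)

theorem Commuting.eq (f : A →ₐ[K] B) (g : C →ₐ[K] B) [Commuting f g] (x : A) (y : C) :
    f x * g y = g y * f x := Commuting.comm x y

theorem Commuting.symm {f : A →ₐ[K] B} {g : C →ₐ[K] B} (h : Commuting f g) : Commuting g f :=
  ⟨fun x y => (h.comm y x).symm⟩

/-- The element `x` of `A ⊗ C` placed at the legs `f`, `g`: `a ⊗ c ↦ f a * g c`. -/
def pl (f : A →ₐ[K] B) (g : C →ₐ[K] B) [Commuting f g] : A ⊗[K] C →ₐ[K] B :=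
  Algebra.TensorProduct.lift f g Commuting.comm

@[simp] theorem pl_tmul (f : A →ₐ[K] B) (g : C →ₐ[K] B) [Commuting f g] (x : A) (y : C) :
    pl f g (x ⊗ₜ y) = f x * g y := rfl

/-- The first leg of a tensor product. -/
def iL : A →ₐ[K] A ⊗[K] C := Algebra.TensorProduct.includeLeft

/-- The second leg of a tensor product. -/
def iR : C →ₐ[K] A ⊗[K] C := Algebra.TensorProduct.includeRight

@[simp] theorem iL_apply (x : A) : (iL : A →ₐ[K] A ⊗[K] C) x = x ⊗ₜ 1 := rfl

@[simp] theorem iR_apply (x : C) : (iR : C →ₐ[K] A ⊗[K] C) x = 1 ⊗ₜ x := rfl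

theorem tensorHom_ext {f g : A ⊗[K] C →ₐ[K] B} (h₁ : f.comp iL = g.comp iL)
    (h₂ : f.comp iR = g.comp iR) : f = g :=
  Algebra.TensorProduct.ext h₁ h₂

instance : Commuting (iL : A →ₐ[K] A ⊗[K] C) iR := ⟨fun x y => by simp [Commute, SemiconjBy]⟩
instance : Commuting (iR : C →ₐ[K] A ⊗[K] C) iL := ⟨fun x y => by simp [Commute, SemiconjBy]⟩

instance (f : A →ₐ[K] B) (h : D →ₐ[K] A) (g : C →ₐ[K] B) [Commuting f g] :
    Commuting (f.comp h) g := ⟨fun _ y => Commuting.comm (f := f) (g := g) _ y⟩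

instance (f : A →ₐ[K] B) (h : D →ₐ[K] A) (g : C →ₐ[K] B) [Commuting g f] :
    Commuting g (f.comp h) := ⟨fun x _ => Commuting.comm (f := g) (g := f) x _⟩

instance (f : A →ₐ[K] C) (g : B →ₐ[K] C) (h : C →ₐ[K] D) [Commuting f g] :
    Commuting (h.comp f) (h.comp g) :=
  ⟨fun x y => (Commuting.comm (f := f) (g := g) x y).map h⟩

-- The next two instances only shorten the search.
instance (f : D →ₐ[K] A) (g : E →ₐ[K] C) :
    Commuting ((iL : A →ₐ[K] A ⊗[K] C).comp f) (iR.comp g) :=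
  ⟨fun _ _ => by simp [Commute, SemiconjBy]⟩

instance (f : D →ₐ[K] A) (g : E →ₐ[K] C) :
    Commuting ((iR : C →ₐ[K] A ⊗[K] C).comp g) (iL.comp f) :=
  ⟨fun _ _ => by simp [Commute, SemiconjBy]⟩

instance (f : A →ₐ[K] B) (g : C →ₐ[K] B) (h : D →ₐ[K] B) [Commuting f g] [Commuting f h]
    [Commuting g h] : Commuting (pl f g) h :=
  ⟨fun x y => by
    induction x using TensorProduct.induction_on with
    | zero => simp
    | add x y hx hy => rw [map_add]; exact hx.add_left hy
    | tmul a c => exact (Commuting.comm _ _).mul_left (Commuting.comm _ _)⟩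

instance (f : A →ₐ[K] B) (g : C →ₐ[K] B) (h : D →ₐ[K] B) [Commuting f g] [Commuting h f]
    [Commuting h g] : Commuting h (pl f g) :=
  haveI : Commuting f h := Commuting.symm inferInstance
  haveI : Commuting g h := Commuting.symm inferInstance
  Commuting.symm inferInstance

theorem comp_pl (h : B →ₐ[K] D) (f : A →ₐ[K] B) (g : C →ₐ[K] B) [Commuting f g] :
    h.comp (pl f g) = pl (h.comp f) (h.comp g) :=
  tensorHom_ext (by ext; simp) (by ext; simp)

theorem map_pl (h : B →ₐ[K] D) (f : A →ₐ[K] B) (g : C →ₐ[K] B) [Commuting f g] (x) :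
    h (pl f g x) = pl (h.comp f) (h.comp g) x := DFunLike.congr_fun (comp_pl h f g) x

@[simp] theorem pl_comp_iL (f : A →ₐ[K] B) (g : C →ₐ[K] B) [Commuting f g] :
    (pl f g).comp iL = f := by ext; simp

@[simp] theorem pl_comp_iR (f : A →ₐ[K] B) (g : C →ₐ[K] B) [Commuting f g] :
    (pl f g).comp iR = g := by ext; simp

@[simp] theorem pl_iL (f : A →ₐ[K] B) (g : C →ₐ[K] B) [Commuting f g] (x) :
    pl f g (iL x) = f x := by simp

@[simp] theorem pl_iR (f : A →ₐ[K] B) (g : C →ₐ[K] B) [Commuting f g] (x) :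
    pl f g (iR x) = g x := by simp

theorem pl_iL_iR : pl (iL : A →ₐ[K] A ⊗[K] C) iR = AlgHom.id K _ :=
  tensorHom_ext (by ext; simp) (by ext; simp)

theorem eq_pl_apply {h : A ⊗[K] C →ₐ[K] B} {f : A →ₐ[K] B} {g : C →ₐ[K] B} [Commuting f g]
    (h₁ : h.comp iL = f) (h₂ : h.comp iR = g) (x) : h x = pl f g x := by
  subst h₁ h₂
  exact DFunLike.congr_fun
    (tensorHom_ext (f := h) (g := pl (h.comp iL) (h.comp iR)) (by simp) (by simp)) x

theorem pl_swap (f : A →ₐ[K] B) (g : C →ₐ[K] B) [Commuting f g] [Commuting g f] (x : A ⊗[K] C) :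
    pl g f (Algebra.TensorProduct.comm K A C x) = pl f g x := by
  refine (eq_pl_apply (h := (pl g f).comp (Algebra.TensorProduct.comm K A C).toAlgHom)
    ?_ ?_ x)
  · ext; simp
  · ext; simp

theorem pl_map (f : A →ₐ[K] B) (g : C →ₐ[K] B) [Commuting f g] (h : D →ₐ[K] A) (k : E →ₐ[K] C)
    (x) : pl f g (Algebra.TensorProduct.map h k x) = pl (f.comp h) (g.comp k) x := by
  refine eq_pl_apply (h := (pl f g).comp (Algebra.TensorProduct.map h k)) ?_ ?_ x
  · ext; simp
  · ext; simp

/-- `u f(x) = f'(x) u` for all `x`. -/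
class Intw (u : B) (f f' : A →ₐ[K] B) : Prop where
  eq : ∀ x, u * f x = f' x * u

theorem Intw.mul {u v : B} {f f' f'' : A →ₐ[K] B} (hu : Intw u f' f'') (hv : Intw v f f') :
    Intw (u * v) f f'' :=
  ⟨fun x => by rw [mul_assoc, hv.eq, ← mul_assoc, hu.eq, mul_assoc]⟩

instance (z : C) (g : C →ₐ[K] B) (f : A →ₐ[K] B) [Commuting g f] : Intw (g z) f f :=
  ⟨fun x => Commuting.comm z x⟩

instance Intw.pl (u : B) (f f' : A →ₐ[K] B) (g g' : C →ₐ[K] B) [Commuting f g] [Commuting f' g']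
    [Intw u f f'] [Intw u g g'] : Intw u (pl f g) (pl f' g') :=
  ⟨fun x => by
    induction x using TensorProduct.induction_on with
    | zero => simp
    | add x y hx hy => rw [map_add, map_add, mul_add, add_mul, hx, hy]
    | tmul a c =>
      rw [pl_tmul, pl_tmul, ← mul_assoc, Intw.eq (u := u) (f := f) (f' := f'), mul_assoc,
        Intw.eq (u := u) (f := g) (f' := g'), mul_assoc]⟩

theorem Intw.pl_eq (u : B) (f f' : A →ₐ[K] B) (g g' : C →ₐ[K] B) [Commuting f g]
    [Commuting f' g'] [Intw u f f'] [Intw u g g'] (x) : u * QH.pl f g x = QH.pl f' g' x * u :=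
  (Intw.pl u f f' g g').eq x

theorem mul_rw {a b c : B} (h : a * b = c) (r : B) : a * (b * r) = c * r := by
  rw [← h, mul_assoc]

end Commuting

/-! ### The reassociator along commuting legs -/

namespace QuasiBialgebra

variable {K : Type u} [Field K] {G : Type v} [Ring G] [Algebra K G] (H : QuasiBialgebra K G)
variable {A B C D : Type*} [Ring A] [Algebra K A] [Ring B] [Algebra K B] [Ring C] [Algebra K C]
  [Ring D] [Algebra K D]

/-- The convolution `a ↦ f(a₍₁₎) g(a₍₂₎)` of two commuting legs. -/
def star (f g : G →ₐ[K] B) [Commuting f g] : G →ₐ[K] B := (pl f g).comp H.Δ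

/-- The reassociator placed at three commuting legs. -/
def reas (f g h : G →ₐ[K] B) [Commuting f g] [Commuting f h] [Commuting g h] : B :=
  pl f (pl g h) (H.φ : G ⊗[K] (G ⊗[K] G))

/-- The inverse reassociator placed at three commuting legs. -/
def reasInv (f g h : G →ₐ[K] B) [Commuting f g] [Commuting f h] [Commuting g h] : B :=
  pl f (pl g h) (↑H.φ⁻¹ : G ⊗[K] (G ⊗[K] G))

/-- The trivial leg `a ↦ ε(a) 1`. -/
def triv : G →ₐ[K] B := (Algebra.ofId K B).comp H.ε

@[simp] theorem triv_apply (x : G) : (H.triv : G →ₐ[K] B) x = algebraMap K B (H.ε x) := rfl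

local infixl:72 " ⋆ " => star H
local notation "φ[" a ", " b ", " c "]" => reas H a b c
local notation "φ⁻[" a ", " b ", " c "]" => reasInv H a b c

theorem star_apply (f g : G →ₐ[K] B) [Commuting f g] (x : G) : (f ⋆ g) x = pl f g (H.Δ x) := rfl

instance (f g : G →ₐ[K] B) (h : C →ₐ[K] B) [Commuting f g] [Commuting f h] [Commuting g h] :
    Commuting (f ⋆ g) h := ⟨fun _ _ => Commuting.comm (f := pl f g) _ _⟩

instance (f g : G →ₐ[K] B) (h : C →ₐ[K] B) [Commuting f g] [Commuting h f] [Commuting h g] :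
    Commuting h (f ⋆ g) := ⟨fun _ _ => Commuting.comm (g := pl f g) _ _⟩

instance (h : C →ₐ[K] B) : Commuting H.triv h := ⟨fun _ _ => Algebra.commutes _ _⟩

instance (h : C →ₐ[K] B) : Commuting h H.triv := ⟨fun _ _ => (Algebra.commutes _ _).symm⟩

section
variable (a b c d : G →ₐ[K] B) [Commuting a b] [Commuting a c] [Commuting b c]

@[simp] theorem reas_mul_reasInv : φ[a, b, c] * φ⁻[a, b, c] = 1 := by
  rw [reas, reasInv, ← map_mul, Units.mul_inv, map_one]

@[simp] theorem reasInv_mul_reas : φ⁻[a, b, c] * φ[a, b, c] = 1 := by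
  rw [reas, reasInv, ← map_mul, Units.inv_mul, map_one]

@[simp] theorem reas_mul_reasInv_mul (x : B) : φ[a, b, c] * (φ⁻[a, b, c] * x) = x := by
  rw [← mul_assoc, reas_mul_reasInv, one_mul]

@[simp] theorem reasInv_mul_reas_mul (x : B) : φ⁻[a, b, c] * (φ[a, b, c] * x) = x := by
  rw [← mul_assoc, reasInv_mul_reas, one_mul]

theorem isUnit_reas : IsUnit φ[a, b, c] :=
  ⟨⟨φ[a, b, c], φ⁻[a, b, c], by simp, by simp⟩, rfl⟩

theorem isUnit_reasInv : IsUnit φ⁻[a, b, c] :=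
  ⟨⟨φ⁻[a, b, c], φ[a, b, c], by simp, by simp⟩, rfl⟩

theorem comp_star (h : B →ₐ[K] D) : h.comp (a ⋆ b) = h.comp a ⋆ h.comp b := by
  simp only [star, ← comp_pl]; rfl

theorem map_reas (h : B →ₐ[K] D) : h φ[a, b, c] = φ[h.comp a, h.comp b, h.comp c] := by
  simp only [reas, map_pl, comp_pl]

theorem map_reasInv (h : B →ₐ[K] D) : h φ⁻[a, b, c] = φ⁻[h.comp a, h.comp b, h.comp c] := by
  simp only [reasInv, map_pl, comp_pl]

/-- A homomorphism from a threefold tensor power is determined by its three legs. -/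
theorem eq_pl₃ {h : G ⊗[K] (G ⊗[K] G) →ₐ[K] B} (h₁ : h.comp iL = a)
    (h₂ : h.comp (iR.comp iL) = b) (h₃ : h.comp (iR.comp iR) = c) (x) :
    h x = pl a (pl b c) x :=
  eq_pl_apply h₁ (tensorHom_ext (by rw [pl_comp_iL, AlgHom.comp_assoc, h₂])
    (by rw [pl_comp_iR, AlgHom.comp_assoc, h₃])) x

theorem apply_eq_reas {h : G ⊗[K] (G ⊗[K] G) →ₐ[K] B} (h₁ : h.comp iL = a)
    (h₂ : h.comp (iR.comp iL) = b) (h₃ : h.comp (iR.comp iR) = c) :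
    h H.φ = φ[a, b, c] := eq_pl₃ a b c h₁ h₂ h₃ _

theorem apply_eq_reasInv {h : G ⊗[K] (G ⊗[K] G) →ₐ[K] B} (h₁ : h.comp iL = a)
    (h₂ : h.comp (iR.comp iL) = b) (h₃ : h.comp (iR.comp iR) = c) :
    h (↑H.φ⁻¹ : G ⊗[K] (G ⊗[K] G)) = φ⁻[a, b, c] := eq_pl₃ a b c h₁ h₂ h₃ _

instance intw_reas : Intw φ[a, b, c] ((a ⋆ b) ⋆ c) (a ⋆ (b ⋆ c)) :=
  ⟨fun x => by
    have h₁ : pl a (pl b c) (Algebra.TensorProduct.assoc K K K G G G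
        (Algebra.TensorProduct.map H.Δ (AlgHom.id K G) (H.Δ x))) = ((a ⋆ b) ⋆ c) x := by
      refine eq_pl_apply (h := ((pl a (pl b c)).comp
        (Algebra.TensorProduct.assoc K K K G G G).toAlgHom).comp
        (Algebra.TensorProduct.map H.Δ (AlgHom.id K G))) ?_ ?_ _
      · rw [star, AlgHom.comp_assoc]
        have : (Algebra.TensorProduct.map H.Δ (AlgHom.id K G)).comp (iL : G →ₐ[K] G ⊗[K] G)
            = iL.comp H.Δ := by ext; simp
        rw [this, ← AlgHom.comp_assoc]
        congr 1
        exact tensorHom_ext (by ext; simp)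
          (by ext; simp)
      · ext; simp [Algebra.TensorProduct.one_def]
    have h₂ : pl a (pl b c) (Algebra.TensorProduct.map (AlgHom.id K G) H.Δ (H.Δ x)) =
        (a ⋆ (b ⋆ c)) x :=
      eq_pl_apply (h := (pl a (pl b c)).comp
        (Algebra.TensorProduct.map (AlgHom.id K G) H.Δ)) (by ext; simp) (by ext; simp [star]) _
    have h := (congrArg (pl a (pl b c)) (H.quasi_coassoc x)).symm
    rw [map_mul, map_mul, h₁, h₂] at h
    exact h⟩

instance intw_reasInv : Intw φ⁻[a, b, c] (a ⋆ (b ⋆ c)) ((a ⋆ b) ⋆ c) :=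
  ⟨fun x => by
    have h := (H.intw_reas a b c).eq x
    calc _ = φ⁻[a, b, c] * (((a ⋆ (b ⋆ c)) x) * φ[a, b, c]) * φ⁻[a, b, c] := by
          simp only [mul_assoc, reas_mul_reasInv, mul_one]
      _ = _ := by rw [← h]; simp only [← mul_assoc, reasInv_mul_reas, one_mul]⟩

instance (f : C →ₐ[K] B) [Commuting a f] [Commuting b f] [Commuting c f] :
    Intw φ[a, b, c] f f := inferInstanceAs (Intw (pl a (pl b c) _) f f)

instance (f : C →ₐ[K] B) [Commuting a f] [Commuting b f] [Commuting c f] :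
    Intw φ⁻[a, b, c] f f := inferInstanceAs (Intw (pl a (pl b c) _) f f)

end

instance (u : B) (f f' g g' : G →ₐ[K] B) [Commuting f g] [Commuting f' g']
    [Intw u f f'] [Intw u g g'] : Intw u (f ⋆ g) (f' ⋆ g') :=
  ⟨fun x => (Intw.pl u f f' g g').eq (H.Δ x)⟩

theorem intw_reas_eq (u : B) (a b c a' b' c' : G →ₐ[K] B) [Commuting a b] [Commuting a c]
    [Commuting b c] [Commuting a' b'] [Commuting a' c'] [Commuting b' c']
    [Intw u a a'] [Intw u b b'] [Intw u c c'] : u * φ[a, b, c] = φ[a', b', c'] * u :=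
  Intw.pl_eq u a a' (pl b c) (pl b' c') _

theorem intw_reasInv_eq (u : B) (a b c a' b' c' : G →ₐ[K] B) [Commuting a b] [Commuting a c]
    [Commuting b c] [Commuting a' b'] [Commuting a' c'] [Commuting b' c']
    [Intw u a a'] [Intw u b b'] [Intw u c c'] : u * φ⁻[a, b, c] = φ⁻[a', b', c'] * u :=
  Intw.pl_eq u a a' (pl b c) (pl b' c') _

section
variable (a b c d : G →ₐ[K] B) [Commuting a b] [Commuting a c] [Commuting a d] [Commuting b c]
  [Commuting b d] [Commuting c d]

theorem pl_map_map_Δ : pl a (pl b (pl c d)) (Algebra.TensorProduct.map (AlgHom.id K G)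
    (Algebra.TensorProduct.map (AlgHom.id K G) H.Δ) (H.φ : G ⊗[K] (G ⊗[K] G))) =
    φ[a, b, c ⋆ d] := by
  refine (H.apply_eq_reas a b (c ⋆ d) (h := (pl a (pl b (pl c d))).comp
      (Algebra.TensorProduct.map (AlgHom.id K G) (Algebra.TensorProduct.map (AlgHom.id K G) H.Δ)))
      ?_ ?_ ?_)
  · ext; simp [Algebra.TensorProduct.one_def]
  · ext; simp [Algebra.TensorProduct.one_def]
  · ext; simp [star]

theorem pl_assoc_map_Δ : pl a (pl b (pl c d)) (Algebra.TensorProduct.assoc K K K G G (G ⊗[K] G)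
    (Algebra.TensorProduct.map H.Δ (AlgHom.id K (G ⊗[K] G)) (H.φ : G ⊗[K] (G ⊗[K] G)))) =
    φ[a ⋆ b, c, d] := by
  refine (H.apply_eq_reas (a ⋆ b) c d (h := ((pl a (pl b (pl c d))).comp
      (Algebra.TensorProduct.assoc K K K G G (G ⊗[K] G)).toAlgHom).comp
      (Algebra.TensorProduct.map H.Δ (AlgHom.id K (G ⊗[K] G)))) ?_ ?_ ?_)
  · have : (Algebra.TensorProduct.map H.Δ (AlgHom.id K (G ⊗[K] G))).comp
        (iL : G →ₐ[K] G ⊗[K] (G ⊗[K] G)) = iL.comp H.Δ := by ext; simp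
    rw [AlgHom.comp_assoc, this, ← AlgHom.comp_assoc, star]
    congr 1
    exact tensorHom_ext (by ext; simp [Algebra.TensorProduct.one_def])
      (by ext; simp [Algebra.TensorProduct.one_def])
  · ext; simp [Algebra.TensorProduct.one_def]
  · ext; simp [Algebra.TensorProduct.one_def]

theorem pl_map_assoc_map_Δ (w : G ⊗[K] (G ⊗[K] G)) :
    pl a (pl b (pl c d)) (Algebra.TensorProduct.map (AlgHom.id K G)
      ((Algebra.TensorProduct.assoc K K K G G G).toAlgHom.comp
        (Algebra.TensorProduct.map H.Δ (AlgHom.id K G))) w) = pl a (pl (b ⋆ c) d) w := by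
  refine (eq_pl₃ a (b ⋆ c) d (h := (pl a (pl b (pl c d))).comp
    (Algebra.TensorProduct.map (AlgHom.id K G)
    ((Algebra.TensorProduct.assoc K K K G G G).toAlgHom.comp
      (Algebra.TensorProduct.map H.Δ (AlgHom.id K G))))) ?_ ?_ ?_ _)
  · ext; simp [Algebra.TensorProduct.one_def]
  · have : (Algebra.TensorProduct.map H.Δ (AlgHom.id K G)).comp
        (iL : G →ₐ[K] G ⊗[K] G) = iL.comp H.Δ := by ext; simp
    have h2 : (Algebra.TensorProduct.map (AlgHom.id K G)
        ((Algebra.TensorProduct.assoc K K K G G G).toAlgHom.comp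
        (Algebra.TensorProduct.map H.Δ (AlgHom.id K G)))).comp
        ((iR : _ →ₐ[K] G ⊗[K] (G ⊗[K] G)).comp iL) =
        iR.comp ((Algebra.TensorProduct.assoc K K K G G G).toAlgHom.comp (iL.comp H.Δ)) := by
      ext; simp
    rw [AlgHom.comp_assoc, h2, ← AlgHom.comp_assoc, pl_comp_iR, star, ← AlgHom.comp_assoc,
      ← AlgHom.comp_assoc]
    congr 1
    exact tensorHom_ext (by ext; simp)
      (by ext; simp)
  · ext; simp [Algebra.TensorProduct.one_def]

theorem pl_leg123 (w : G ⊗[K] (G ⊗[K] G)) :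
    pl a (pl b (pl c d)) (leg123 w) = pl a (pl b c) w := by
  refine (eq_pl₃ a b c (h := (pl a (pl b (pl c d))).comp leg123) ?_ ?_ ?_ _)
  · ext; simp [leg123, Algebra.TensorProduct.one_def]
  · ext; simp [leg123]
  · ext; simp [leg123]

theorem pl_one_tmul (w : G ⊗[K] (G ⊗[K] G)) :
    pl a (pl b (pl c d)) ((1 : G) ⊗ₜ[K] w) = pl b (pl c d) w := by
  rw [pl_tmul, map_one, one_mul]

theorem reas_pentagon : φ[a, b, c ⋆ d] * φ[a ⋆ b, c, d] =
    φ[b, c, d] * φ[a, b ⋆ c, d] * φ[a, b, c] := by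
  have h := congrArg (pl a (pl b (pl c d))) H.pentagon
  simp only [map_mul] at h
  rwa [pl_map_map_Δ, pl_assoc_map_Δ, pl_map_assoc_map_Δ, pl_leg123, pl_one_tmul] at h

end

/-! ### Counits and the trivial leg -/

@[simp] theorem triv_star (f : G →ₐ[K] B) : H.triv ⋆ f = f := by
  ext x
  conv_rhs => rw [← H.counit_left x]
  refine (eq_pl_apply (h := (f.comp (Algebra.TensorProduct.lid K G).toAlgHom).comp
    (Algebra.TensorProduct.map H.ε (AlgHom.id K G))) ?_ ?_ _).symm
  · ext; simp [Algebra.algebraMap_eq_smul_one]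
  · ext; simp

@[simp] theorem star_triv (f : G →ₐ[K] B) : f ⋆ H.triv = f := by
  ext x
  conv_rhs => rw [← H.counit_right x]
  refine (eq_pl_apply (h := (f.comp (Algebra.TensorProduct.rid K K G).toAlgHom).comp
    (Algebra.TensorProduct.map (AlgHom.id K G) H.ε)) ?_ ?_ _).symm
  · ext; simp
  · ext; simp [Algebra.algebraMap_eq_smul_one]

variable (a b : G →ₐ[K] B) [Commuting a b]

@[simp] theorem reas_triv_mid : φ[a, H.triv, b] = 1 := by
  have h := congrArg (pl a b) H.counit_mid
  rw [map_one] at h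
  rw [← h]
  refine (H.apply_eq_reas _ _ _ (h := (pl a b).comp (Algebra.TensorProduct.map (AlgHom.id K G)
    ((Algebra.TensorProduct.lid K G).toAlgHom.comp
      (Algebra.TensorProduct.map H.ε (AlgHom.id K G))))) ?_ ?_ ?_).symm
  · ext; simp [Algebra.TensorProduct.one_def]
  · ext; simp [Algebra.algebraMap_eq_smul_one]
  · ext; simp

@[simp] theorem reas_triv_left : φ[H.triv, a, b] = 1 := by
  have h := H.reas_pentagon H.triv H.triv a b
  simp only [triv_star, reas_triv_mid, one_mul, mul_one] at h
  exact (H.isUnit_reas H.triv a b).mul_left_cancel (h.symm.trans (mul_one _).symm)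

@[simp] theorem reas_triv_right : φ[a, b, H.triv] = 1 := by
  have h := H.reas_pentagon a b H.triv H.triv
  simp only [star_triv, reas_triv_mid, one_mul, mul_one] at h
  exact (H.isUnit_reas a b H.triv).mul_left_cancel (h.symm.trans (mul_one _).symm)

@[simp] theorem reasInv_triv_mid : φ⁻[a, H.triv, b] = 1 := by
  simpa using H.reas_mul_reasInv a H.triv b

@[simp] theorem reasInv_triv_left : φ⁻[H.triv, a, b] = 1 := by
  simpa using H.reas_mul_reasInv H.triv a b

@[simp] theorem reasInv_triv_right : φ⁻[a, b, H.triv] = 1 := by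
  simpa using H.reas_mul_reasInv a b H.triv

end QuasiBialgebra

/-! ### Linear functionals under which a pair of legs collapses to the counit -/

section Collapse

variable {K : Type u} [Field K]
variable {A B C D : Type*} [Ring A] [Algebra K A] [Ring B] [Algebra K B] [Ring C] [Algebra K C]
  [Ring D] [Algebra K D] {M N : Type*} [AddCommGroup M] [Module K M] [AddCommGroup N] [Module K N]

/-- Under the linear map `F`, a left factor `f x` may be replaced by `f' x`. -/
class LeftEq (F : B →ₗ[K] M) (f f' : A →ₐ[K] B) : Prop where
  eq : ∀ x w, F (f x * w) = F (f' x * w)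

/-- Under the linear map `F`, a right factor `f x` may be replaced by `f' x`. -/
class RightEq (F : B →ₗ[K] M) (f f' : A →ₐ[K] B) : Prop where
  eq : ∀ x w, F (w * f x) = F (w * f' x)

instance (priority := low) (F : B →ₗ[K] M) (f : A →ₐ[K] B) : LeftEq F f f := ⟨fun _ _ => rfl⟩
instance (priority := low) (F : B →ₗ[K] M) (f : A →ₐ[K] B) : RightEq F f f := ⟨fun _ _ => rfl⟩

instance LeftEq.pl (F : B →ₗ[K] M) (f f' : A →ₐ[K] B) (g g' : C →ₐ[K] B) [Commuting f g]
    [Commuting f' g'] [Commuting f' g] [LeftEq F f f'] [LeftEq F g g'] :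
    LeftEq F (pl f g) (pl f' g') :=
  ⟨fun x w => by
    induction x using TensorProduct.induction_on with
    | zero => simp
    | add x y hx hy => simp only [map_add, add_mul, hx, hy]
    | tmul a c =>
      rw [pl_tmul, pl_tmul, mul_assoc, LeftEq.eq (f := f) (f' := f') (F := F), ← mul_assoc,
        Commuting.eq f' g, mul_assoc, LeftEq.eq (f := g) (f' := g') (F := F), ← mul_assoc,
        Commuting.eq f' g']⟩

instance RightEq.pl (F : B →ₗ[K] M) (f f' : A →ₐ[K] B) (g g' : C →ₐ[K] B) [Commuting f g]
    [Commuting f' g'] [Commuting f g'] [RightEq F f f'] [RightEq F g g'] :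
    RightEq F (pl f g) (pl f' g') :=
  ⟨fun x w => by
    induction x using TensorProduct.induction_on with
    | zero => simp
    | add x y hx hy => simp only [map_add, mul_add, hx, hy]
    | tmul a c =>
      rw [pl_tmul, pl_tmul, ← mul_assoc, RightEq.eq (f := g) (f' := g') (F := F), mul_assoc,
        Commuting.eq f g', ← mul_assoc, RightEq.eq (f := f) (f' := f') (F := F), mul_assoc,
        Commuting.eq f' g']⟩

theorem LeftEq.postcomp {F : B →ₗ[K] M} {f f' : A →ₐ[K] B} (h : LeftEq F f f')
    (k : M →ₗ[K] N) : LeftEq (k ∘ₗ F) f f' := ⟨fun x w => congrArg k (h.eq x w)⟩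

theorem RightEq.postcomp {F : B →ₗ[K] M} {f f' : A →ₐ[K] B} (h : RightEq F f f')
    (k : M →ₗ[K] N) : RightEq (k ∘ₗ F) f f' := ⟨fun x w => congrArg k (h.eq x w)⟩

theorem LeftEq.map_left {F : B →ₗ[K] M} {f f' : A →ₐ[K] B} (h : LeftEq F f f')
    (F' : C →ₗ[K] N) : LeftEq (TensorProduct.map F F') (iL.comp f) (iL.comp f') :=
  ⟨fun x w => by
    induction w using TensorProduct.induction_on with
    | zero => simp
    | add y z hy hz => simp only [mul_add, map_add, hy, hz]
    | tmul b c => simp [h.eq]⟩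

theorem LeftEq.map_right {F : B →ₗ[K] M} {f f' : A →ₐ[K] B} (h : LeftEq F f f')
    (F' : C →ₗ[K] N) : LeftEq (TensorProduct.map F' F) (iR.comp f) (iR.comp f') :=
  ⟨fun x w => by
    induction w using TensorProduct.induction_on with
    | zero => simp
    | add y z hy hz => simp only [mul_add, map_add, hy, hz]
    | tmul b c => simp [h.eq]⟩

theorem RightEq.map_left {F : B →ₗ[K] M} {f f' : A →ₐ[K] B} (h : RightEq F f f')
    (F' : C →ₗ[K] N) : RightEq (TensorProduct.map F F') (iL.comp f) (iL.comp f') :=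
  ⟨fun x w => by
    induction w using TensorProduct.induction_on with
    | zero => simp
    | add y z hy hz => simp only [add_mul, map_add, hy, hz]
    | tmul b c => simp [h.eq]⟩

theorem RightEq.map_right {F : B →ₗ[K] M} {f f' : A →ₐ[K] B} (h : RightEq F f f')
    (F' : C →ₗ[K] N) : RightEq (TensorProduct.map F' F) (iR.comp f) (iR.comp f') :=
  ⟨fun x w => by
    induction w using TensorProduct.induction_on with
    | zero => simp
    | add y z hy hz => simp only [add_mul, map_add, hy, hz]
    | tmul b c => simp [h.eq]⟩

/-- The linear map `x ↦ s(x)` underlying an antihomomorphism. -/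
def unopLin (s : A →ₐ[K] Bᵐᵒᵖ) : A →ₗ[K] B :=
  (MulOpposite.opLinearEquiv K).symm.toLinearMap ∘ₗ s.toLinearMap

@[simp] theorem unopLin_apply (s : A →ₐ[K] Bᵐᵒᵖ) (x : A) : unopLin s x = (s x).unop := rfl

end Collapse

namespace QuasiBialgebra

variable {K : Type u} [Field K] {G : Type v} [Ring G] [Algebra K G] (H : QuasiBialgebra K G)
variable {A B C D : Type*} [Ring A] [Algebra K A] [Ring B] [Algebra K B] [Ring C] [Algebra K C]
  [Ring D] [Algebra K D] {M N : Type*} [AddCommGroup M] [Module K M] [AddCommGroup N] [Module K N]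

local infixl:72 " ⋆ " => star H
local notation "φ[" a ", " b ", " c "]" => reas H a b c
local notation "φ⁻[" a ", " b ", " c "]" => reasInv H a b c

@[simp] theorem comp_triv (h : B →ₐ[K] C) : h.comp H.triv = H.triv := by
  ext x; simp

instance (F : B →ₗ[K] M) (f f' g g' : G →ₐ[K] B) [Commuting f g]
    [Commuting f' g'] [Commuting f' g] [LeftEq F f f'] [LeftEq F g g'] :
    LeftEq F (f ⋆ g) (f' ⋆ g') := ⟨fun x w => (LeftEq.pl F f f' g g').eq (H.Δ x) w⟩

instance (F : B →ₗ[K] M) (f f' g g' : G →ₐ[K] B) [Commuting f g]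
    [Commuting f' g'] [Commuting f g'] [RightEq F f f'] [RightEq F g g'] :
    RightEq F (f ⋆ g) (f' ⋆ g') := ⟨fun x w => (RightEq.pl F f f' g g').eq (H.Δ x) w⟩

instance (F : B →ₗ[K] M) (f f' g : G →ₐ[K] B) [Commuting f g] [LeftEq F f f']
    [LeftEq F g H.triv] : LeftEq F (f ⋆ g) f' :=
  ⟨fun x w => by
    rw [LeftEq.eq (F := F) (f := f ⋆ g) (f' := f ⋆ H.triv), star_triv, LeftEq.eq (f' := f')]⟩

instance (F : B →ₗ[K] M) (f g g' : G →ₐ[K] B) [Commuting f g] [LeftEq F f H.triv]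
    [LeftEq F g g'] : LeftEq F (f ⋆ g) g' :=
  ⟨fun x w => by
    rw [LeftEq.eq (F := F) (f := f ⋆ g) (f' := H.triv ⋆ g), triv_star, LeftEq.eq (f' := g')]⟩

instance (F : B →ₗ[K] M) (f f' g : G →ₐ[K] B) [Commuting f g] [RightEq F f f']
    [RightEq F g H.triv] : RightEq F (f ⋆ g) f' :=
  ⟨fun x w => by
    rw [RightEq.eq (F := F) (f := f ⋆ g) (f' := f ⋆ H.triv), star_triv, RightEq.eq (f' := f')]⟩

instance (F : B →ₗ[K] M) (f g g' : G →ₐ[K] B) [Commuting f g] [RightEq F f H.triv]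
    [RightEq F g g'] : RightEq F (f ⋆ g) g' :=
  ⟨fun x w => by
    rw [RightEq.eq (F := F) (f := f ⋆ g) (f' := H.triv ⋆ g), triv_star, RightEq.eq (f' := g')]⟩

section
variable (F : B →ₗ[K] M) (a b c a' b' c' : G →ₐ[K] B) [Commuting a b] [Commuting a c]
  [Commuting b c] [Commuting a' b'] [Commuting a' c'] [Commuting b' c'] (w : B)

theorem leftEq_reas [Commuting a' b] [Commuting a' c] [Commuting b' c]
    [LeftEq F a a'] [LeftEq F b b'] [LeftEq F c c'] :
    F (φ[a, b, c] * w) = F (φ[a', b', c'] * w) :=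
  LeftEq.eq (F := F) (f := pl a (pl b c)) (f' := pl a' (pl b' c')) _ _

theorem leftEq_reasInv [Commuting a' b] [Commuting a' c] [Commuting b' c]
    [LeftEq F a a'] [LeftEq F b b'] [LeftEq F c c'] :
    F (φ⁻[a, b, c] * w) = F (φ⁻[a', b', c'] * w) :=
  LeftEq.eq (F := F) (f := pl a (pl b c)) (f' := pl a' (pl b' c')) _ _

theorem rightEq_reas [Commuting a b'] [Commuting a c'] [Commuting b c']
    [RightEq F a a'] [RightEq F b b'] [RightEq F c c'] :
    F (w * φ[a, b, c]) = F (w * φ[a', b', c']) :=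
  RightEq.eq (F := F) (f := pl a (pl b c)) (f' := pl a' (pl b' c')) _ _

theorem rightEq_reasInv [Commuting a b'] [Commuting a c'] [Commuting b c']
    [RightEq F a a'] [RightEq F b b'] [RightEq F c c'] :
    F (w * φ⁻[a, b, c]) = F (w * φ⁻[a', b', c']) :=
  RightEq.eq (F := F) (f := pl a (pl b c)) (f' := pl a' (pl b' c')) _ _

end

section
variable (F : B →ₗ[K] M) (a b c : G →ₐ[K] B) [Commuting a b] [Commuting a c]
  [Commuting b c] (w : B)

theorem left_reas₁ [LeftEq F a H.triv] : F (φ[a, b, c] * w) = F w := by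
  rw [H.leftEq_reas F a b c H.triv b c, reas_triv_left, one_mul]
theorem left_reas₂ [LeftEq F b H.triv] : F (φ[a, b, c] * w) = F w := by
  rw [H.leftEq_reas F a b c a H.triv c, reas_triv_mid, one_mul]
theorem left_reas₃ [LeftEq F c H.triv] : F (φ[a, b, c] * w) = F w := by
  rw [H.leftEq_reas F a b c a b H.triv, reas_triv_right, one_mul]
theorem left_reasInv₁ [LeftEq F a H.triv] : F (φ⁻[a, b, c] * w) = F w := by
  rw [H.leftEq_reasInv F a b c H.triv b c, reasInv_triv_left, one_mul]
theorem left_reasInv₂ [LeftEq F b H.triv] : F (φ⁻[a, b, c] * w) = F w := by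
  rw [H.leftEq_reasInv F a b c a H.triv c, reasInv_triv_mid, one_mul]
theorem left_reasInv₃ [LeftEq F c H.triv] : F (φ⁻[a, b, c] * w) = F w := by
  rw [H.leftEq_reasInv F a b c a b H.triv, reasInv_triv_right, one_mul]
theorem right_reas₁ [RightEq F a H.triv] : F (w * φ[a, b, c]) = F w := by
  rw [H.rightEq_reas F a b c H.triv b c, reas_triv_left, mul_one]
theorem right_reas₂ [RightEq F b H.triv] : F (w * φ[a, b, c]) = F w := by
  rw [H.rightEq_reas F a b c a H.triv c, reas_triv_mid, mul_one]
theorem right_reas₃ [RightEq F c H.triv] : F (w * φ[a, b, c]) = F w := by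
  rw [H.rightEq_reas F a b c a b H.triv, reas_triv_right, mul_one]
theorem right_reasInv₁ [RightEq F a H.triv] : F (w * φ⁻[a, b, c]) = F w := by
  rw [H.rightEq_reasInv F a b c H.triv b c, reasInv_triv_left, mul_one]
theorem right_reasInv₂ [RightEq F b H.triv] : F (w * φ⁻[a, b, c]) = F w := by
  rw [H.rightEq_reasInv F a b c a H.triv c, reasInv_triv_mid, mul_one]
theorem right_reasInv₃ [RightEq F c H.triv] : F (w * φ⁻[a, b, c]) = F w := by
  rw [H.rightEq_reasInv F a b c a b H.triv, reasInv_triv_right, mul_one]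

end

section
variable {F : B →ₗ[K] M} {a b : G →ₐ[K] B} [Commuting a b]

theorem leftEq_star_map_left (h : LeftEq F (a ⋆ b) H.triv) (F' : C →ₗ[K] N) :
    LeftEq (TensorProduct.map F F') (iL.comp a ⋆ iL.comp b) H.triv := by
  simpa only [comp_star, comp_triv] using h.map_left F'

theorem leftEq_star_map_right (h : LeftEq F (a ⋆ b) H.triv) (F' : C →ₗ[K] N) :
    LeftEq (TensorProduct.map F' F) (iR.comp a ⋆ iR.comp b) H.triv := by
  simpa only [comp_star, comp_triv] using h.map_right F'

theorem rightEq_star_map_left (h : RightEq F (a ⋆ b) H.triv) (F' : C →ₗ[K] N) :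
    RightEq (TensorProduct.map F F') (iL.comp a ⋆ iL.comp b) H.triv := by
  simpa only [comp_star, comp_triv] using h.map_left F'

theorem rightEq_star_map_right (h : RightEq F (a ⋆ b) H.triv) (F' : C →ₗ[K] N) :
    RightEq (TensorProduct.map F' F) (iR.comp a ⋆ iR.comp b) H.triv := by
  simpa only [comp_star, comp_triv] using h.map_right F'

end

/-! ### Evaluation and coevaluation -/

/-- `s(g₁) α θ(g₂) = ε(g) α`, for an antihomomorphism `s` and a homomorphism `θ`. -/
class IsEv (θ : G →ₐ[K] A) (s : G →ₐ[K] Aᵐᵒᵖ) (α : A) : Prop where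
  eq : ∀ g, (unopLin s ⊛ (LinearMap.mulLeft K α ∘ₗ θ.toLinearMap)) (H.Δ g) = H.ε g • α

/-- `θ(g₁) β s(g₂) = ε(g) β`, for an antihomomorphism `s` and a homomorphism `θ`. -/
class IsCoev (θ : G →ₐ[K] A) (s : G →ₐ[K] Aᵐᵒᵖ) (β : A) : Prop where
  eq : ∀ g, (θ.toLinearMap ⊛ (LinearMap.mulLeft K β ∘ₗ unopLin s)) (H.Δ g) = H.ε g • β

variable (θ : G →ₐ[K] A) (s : G →ₐ[K] Aᵐᵒᵖ) (α β : A)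

theorem leftEq_ev [IsEv H θ s α] :
    LeftEq (unopLin s ⊛ (LinearMap.mulLeft K α ∘ₗ θ.toLinearMap)) (iL ⋆ iR) H.triv :=
  ⟨fun x w => by
    induction w using TensorProduct.induction_on with
    | zero => simp
    | add y z hy hz => simp only [mul_add, map_add, hy, hz]
    | tmul b c =>
      have key : ∀ d : G ⊗[K] G, (unopLin s ⊛ (LinearMap.mulLeft K α ∘ₗ θ.toLinearMap))
          (pl iL iR d * b ⊗ₜ c) = unopLin s b *
          (unopLin s ⊛ (LinearMap.mulLeft K α ∘ₗ θ.toLinearMap)) d * θ c := by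
        intro d
        induction d using TensorProduct.induction_on with
        | zero => simp
        | add y z hy hz => simp only [mul_add, add_mul, map_add, hy, hz]
        | tmul p q => simp [mul_assoc]
      rw [star_apply, key, IsEv.eq]
      simp [Algebra.algebraMap_eq_smul_one, mul_assoc]⟩

theorem rightEq_coev [IsCoev H θ s β] :
    RightEq (θ.toLinearMap ⊛ (LinearMap.mulLeft K β ∘ₗ unopLin s)) (iL ⋆ iR) H.triv :=
  ⟨fun x w => by
    induction w using TensorProduct.induction_on with
    | zero => simp
    | add y z hy hz => simp only [add_mul, map_add, hy, hz]
    | tmul b c =>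
      have key : ∀ d : G ⊗[K] G, (θ.toLinearMap ⊛ (LinearMap.mulLeft K β ∘ₗ unopLin s))
          (b ⊗ₜ c * pl iL iR d) = θ b *
          (θ.toLinearMap ⊛ (LinearMap.mulLeft K β ∘ₗ unopLin s)) d * unopLin s c := by
        intro d
        induction d using TensorProduct.induction_on with
        | zero => simp
        | add y z hy hz => simp only [mul_add, add_mul, map_add, hy, hz]
        | tmul p q => simp [mul_assoc]
      rw [star_apply, key, IsCoev.eq]
      simp [Algebra.algebraMap_eq_smul_one, mul_assoc]⟩

theorem leftEq_ev_tail [IsEv H θ s α] (R : C →ₗ[K] A) :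
    LeftEq (unopLin s ⊛ (LinearMap.mulLeft K α ∘ₗ θ.toLinearMap) ⊛ R) (iL ⋆ iR.comp iL)
      H.triv :=
  ⟨fun x w => by
    suffices h : (unopLin s ⊛ (LinearMap.mulLeft K α ∘ₗ θ.toLinearMap) ⊛ R) ∘ₗ
        LinearMap.mulLeft K ((iL ⋆ iR.comp iL) x) =
        (unopLin s ⊛ (LinearMap.mulLeft K α ∘ₗ θ.toLinearMap) ⊛ R) ∘ₗ
        LinearMap.mulLeft K (H.triv x) from DFunLike.congr_fun h w
    ext b c n
    have key : ∀ d : G ⊗[K] G, (unopLin s ⊛ (LinearMap.mulLeft K α ∘ₗ θ.toLinearMap) ⊛ R)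
        (pl iL (iR.comp iL) d * b ⊗ₜ (c ⊗ₜ n)) = unopLin s b *
        (unopLin s ⊛ (LinearMap.mulLeft K α ∘ₗ θ.toLinearMap)) d * θ c * R n := by
      intro d
      induction d using TensorProduct.induction_on with
      | zero => simp
      | add y z hy hz => simp only [mul_add, add_mul, map_add, hy, hz]
      | tmul p q => simp [mul_assoc]
    simp only [TensorProduct.AlgebraTensorModule.curry_apply, LinearMap.restrictScalars_self,
      TensorProduct.curry_apply, LinearMap.comp_apply, LinearMap.mulLeft_apply]
    rw [star_apply, key, IsEv.eq]
    simp [Algebra.algebraMap_eq_smul_one, mul_assoc]⟩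

theorem rightEq_coev_tail [IsCoev H θ s β] (R : C →ₗ[K] A) :
    RightEq (θ.toLinearMap ⊛ (LinearMap.mulLeft K β ∘ₗ unopLin s) ⊛ R) (iL ⋆ iR.comp iL)
      H.triv :=
  ⟨fun x w => by
    suffices h : (θ.toLinearMap ⊛ (LinearMap.mulLeft K β ∘ₗ unopLin s) ⊛ R) ∘ₗ
        LinearMap.mulRight K ((iL ⋆ iR.comp iL) x) =
        (θ.toLinearMap ⊛ (LinearMap.mulLeft K β ∘ₗ unopLin s) ⊛ R) ∘ₗ
        LinearMap.mulRight K (H.triv x) from DFunLike.congr_fun h w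
    ext b c n
    have key : ∀ d : G ⊗[K] G, (θ.toLinearMap ⊛ (LinearMap.mulLeft K β ∘ₗ unopLin s) ⊛ R)
        (b ⊗ₜ (c ⊗ₜ n) * pl iL (iR.comp iL) d) = θ b *
        (θ.toLinearMap ⊛ (LinearMap.mulLeft K β ∘ₗ unopLin s)) d * unopLin s c * R n := by
      intro d
      induction d using TensorProduct.induction_on with
      | zero => simp
      | add y z hy hz => simp only [mul_add, add_mul, map_add, hy, hz]
      | tmul p q => simp [mul_assoc]
    simp only [TensorProduct.AlgebraTensorModule.curry_apply, LinearMap.restrictScalars_self,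
      TensorProduct.curry_apply, LinearMap.comp_apply, LinearMap.mulRight_apply]
    rw [star_apply, key, IsCoev.eq]
    simp [Algebra.algebraMap_eq_smul_one, mul_assoc]⟩

end QuasiBialgebra

/-! ### Words in the reassociator -/

theorem Commuting.flip {K : Type u} [Field K] {A B C : Type*} [Ring A] [Algebra K A] [Ring B]
    [Algebra K B] [Ring C] [Algebra K C] {f : A →ₐ[K] B} {g : C →ₐ[K] B} [h : Commuting f g] :
    Commuting g f := h.symm

namespace QuasiBialgebra

variable {K : Type u} [Field K] {G : Type v} [Ring G] [Algebra K G] (H : QuasiBialgebra K G)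
variable {B : Type*} [Ring B] [Algebra K B]

local infixl:72 " ⋆ " => star H
local notation "φ[" a ", " b ", " c "]" => reas H a b c
local notation "φ⁻[" a ", " b ", " c "]" => reasInv H a b c

attribute [local instance 10] Commuting.flip

theorem eq_of_inv {x y x' y' : B} (h : x = y) (hx : x' * x = 1) (hy : y * y' = 1) :
    x' = y' := by
  rw [← mul_one x', ← hy, ← h, ← mul_assoc, hx, one_mul]

section
variable (a b c d : G →ₐ[K] B) [Commuting a b] [Commuting a c] [Commuting a d] [Commuting b c]
  [Commuting b d] [Commuting c d]

/-- The pentagon, solved for one of its five reassociators; likewise for the next four lemmas. -/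
theorem reas_right : φ[a, b, c ⋆ d] =
    φ[b, c, d] * (φ[a, b ⋆ c, d] * (φ[a, b, c] * φ⁻[a ⋆ b, c, d])) := by
  rw [← mul_assoc, ← mul_assoc, ← reas_pentagon, mul_assoc, reas_mul_reasInv, mul_one]

theorem reas_left : φ[a ⋆ b, c, d] =
    φ⁻[a, b, c ⋆ d] * (φ[b, c, d] * (φ[a, b ⋆ c, d] * φ[a, b, c])) := by
  rw [← mul_assoc φ[b, c, d], ← reas_pentagon, ← mul_assoc, reasInv_mul_reas, one_mul]

theorem reas_mid : φ[a, b ⋆ c, d] =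
    φ⁻[b, c, d] * (φ[a, b, c ⋆ d] * (φ[a ⋆ b, c, d] * φ⁻[a, b, c])) := by
  rw [reas_right]; simp [mul_assoc]

theorem reasInv_right : φ⁻[a, b, c ⋆ d] =
    φ[a ⋆ b, c, d] * (φ⁻[a, b, c] * (φ⁻[a, b ⋆ c, d] * φ⁻[b, c, d])) :=
  eq_of_inv (H.reas_right a b c d) (by simp) (by simp [mul_assoc])

theorem reasInv_left : φ⁻[a ⋆ b, c, d] =
    φ⁻[a, b, c] * (φ⁻[a, b ⋆ c, d] * (φ⁻[b, c, d] * φ[a, b, c ⋆ d])) :=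
  eq_of_inv (H.reas_left a b c d) (by simp) (by simp [mul_assoc])

end

section
variable (p q r a b c a' b' c' : G →ₐ[K] B) [Commuting p q] [Commuting p r] [Commuting q r]
  [Commuting a b] [Commuting a c] [Commuting b c] [Commuting a' b'] [Commuting a' c']
  [Commuting b' c']

/-- Naturality of the reassociator, with respect to a rebracketing of one of its arguments by
another reassociator. -/
theorem reas_conj [Intw φ[p, q, r] a a'] [Intw φ[p, q, r] b b'] [Intw φ[p, q, r] c c'] :
    φ[a', b', c'] = φ[p, q, r] * (φ[a, b, c] * φ⁻[p, q, r]) := by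
  rw [← mul_assoc, H.intw_reas_eq φ[p, q, r] a b c a' b' c', mul_assoc, reas_mul_reasInv, mul_one]

theorem reasInv_conj [Intw φ[p, q, r] a a'] [Intw φ[p, q, r] b b'] [Intw φ[p, q, r] c c'] :
    φ⁻[a', b', c'] = φ[p, q, r] * (φ⁻[a, b, c] * φ⁻[p, q, r]) := by
  rw [← mul_assoc, H.intw_reasInv_eq φ[p, q, r] a b c a' b' c', mul_assoc, reas_mul_reasInv,
    mul_one]

theorem reas_conjInv [Intw φ⁻[p, q, r] a a'] [Intw φ⁻[p, q, r] b b'] [Intw φ⁻[p, q, r] c c'] :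
    φ[a', b', c'] = φ⁻[p, q, r] * (φ[a, b, c] * φ[p, q, r]) := by
  rw [← mul_assoc, H.intw_reas_eq φ⁻[p, q, r] a b c a' b' c', mul_assoc, reasInv_mul_reas,
    mul_one]

theorem reasInv_conjInv [Intw φ⁻[p, q, r] a a'] [Intw φ⁻[p, q, r] b b']
    [Intw φ⁻[p, q, r] c c'] :
    φ⁻[a', b', c'] = φ⁻[p, q, r] * (φ⁻[a, b, c] * φ[p, q, r]) := by
  rw [← mul_assoc, H.intw_reasInv_eq φ⁻[p, q, r] a b c a' b' c', mul_assoc, reasInv_mul_reas,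
    mul_one]

end

section
variable (l₁ l₂ l₃ l₄ l₅ l₆ : G →ₐ[K] B) [Commuting l₁ l₂] [Commuting l₁ l₃] [Commuting l₁ l₄]
  [Commuting l₁ l₅] [Commuting l₁ l₆] [Commuting l₂ l₃] [Commuting l₂ l₄] [Commuting l₂ l₅]
  [Commuting l₂ l₆] [Commuting l₃ l₄] [Commuting l₃ l₅] [Commuting l₃ l₆] [Commuting l₄ l₅]
  [Commuting l₄ l₆] [Commuting l₅ l₆]

/-- Both sides are the canonical rebracketing `((1(23))4)(56) → (12)(3((45)6))`; on the right-hand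
side, the pairs `23`, `45` are kept together. -/
theorem reas_six₁ :
    φ⁻[l₄, l₅, l₆] * (φ[l₃, l₄, l₅ ⋆ l₆] * (φ[l₁ ⋆ l₂, l₃ ⋆ l₄, l₅ ⋆ l₆] *
      (φ[l₁ ⋆ l₂, l₃, l₄] * φ⁻[l₁, l₂, l₃]))) =
    φ⁻[l₁, l₂, l₃ ⋆ (l₄ ⋆ l₅ ⋆ l₆)] * (φ[l₂, l₃, l₄ ⋆ l₅ ⋆ l₆] *
      (φ[l₁, l₂ ⋆ l₃, l₄ ⋆ l₅ ⋆ l₆] * (φ[l₁ ⋆ (l₂ ⋆ l₃), l₄ ⋆ l₅, l₆] *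
      (φ[l₁ ⋆ (l₂ ⋆ l₃), l₄, l₅] * φ⁻[l₁ ⋆ (l₂ ⋆ l₃) ⋆ l₄, l₅, l₆])))) := by
  have e₂ : φ[l₁ ⋆ l₂ ⋆ l₃, l₄, l₅ ⋆ l₆] = _ :=
    H.reas_conjInv l₁ l₂ l₃ (l₁ ⋆ (l₂ ⋆ l₃)) l₄ (l₅ ⋆ l₆) _ _ _
  have e₅ : φ[l₁, l₂ ⋆ l₃, l₄ ⋆ l₅ ⋆ l₆] = _ :=
    H.reas_conjInv l₄ l₅ l₆ l₁ (l₂ ⋆ l₃) (l₄ ⋆ (l₅ ⋆ l₆)) _ _ _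
  have e₆ : φ[l₂, l₃, l₄ ⋆ l₅ ⋆ l₆] = _ :=
    H.reas_conjInv l₄ l₅ l₆ l₂ l₃ (l₄ ⋆ (l₅ ⋆ l₆)) _ _ _
  have e₇ : φ⁻[l₁, l₂, l₃ ⋆ (l₄ ⋆ l₅ ⋆ l₆)] = _ :=
    H.reasInv_conjInv l₄ l₅ l₆ l₁ l₂ (l₃ ⋆ (l₄ ⋆ (l₅ ⋆ l₆))) _ _ _
  simp [H.reas_mid (l₁ ⋆ l₂) l₃ l₄ (l₅ ⋆ l₆), e₂, H.reas_left l₁ l₂ l₃ (l₄ ⋆ (l₅ ⋆ l₆)),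
    H.reas_right (l₁ ⋆ (l₂ ⋆ l₃)) l₄ l₅ l₆, e₅, e₆, e₇, mul_assoc]

/-- Both sides are the canonical rebracketing `(12)((3(45))6) → (1((23)4))(56)`; on the right-hand
side, the pairs `23`, `45` are kept together. -/
theorem reas_six₂ :
    φ⁻[l₂, l₃, l₄] * (φ[l₁, l₂, l₃ ⋆ l₄] * (φ⁻[l₁ ⋆ l₂, l₃ ⋆ l₄, l₅ ⋆ l₆] *
      (φ[l₃ ⋆ l₄, l₅, l₆] * φ⁻[l₃, l₄, l₅]))) =
    φ[l₁ ⋆ ((l₂ ⋆ l₃) ⋆ l₄), l₅, l₆] * (φ⁻[l₁, (l₂ ⋆ l₃) ⋆ l₄, l₅] *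
      (φ⁻[l₁, (l₂ ⋆ l₃ ⋆ l₄) ⋆ l₅, l₆] * (φ⁻[l₂ ⋆ l₃, l₄, l₅] *
      (φ⁻[l₂, l₃, l₄ ⋆ l₅] * (φ⁻[l₂, l₃ ⋆ (l₄ ⋆ l₅), l₆] *
        φ[l₁, l₂, (l₃ ⋆ (l₄ ⋆ l₅)) ⋆ l₆]))))) := by
  have e₁ : φ⁻[l₁ ⋆ l₂, l₃ ⋆ (l₄ ⋆ l₅), l₆] = _ :=
    H.reasInv_conj l₃ l₄ l₅ (l₁ ⋆ l₂) (l₃ ⋆ l₄ ⋆ l₅) l₆ _ _ _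
  have e₂ : φ[l₁, l₂, l₃ ⋆ (l₄ ⋆ l₅)] = _ :=
    H.reas_conj l₃ l₄ l₅ l₁ l₂ (l₃ ⋆ l₄ ⋆ l₅) _ _ _
  have e₃ : φ[l₁, l₂ ⋆ (l₃ ⋆ (l₄ ⋆ l₅)), l₆] = _ :=
    H.reas_conj l₃ l₄ l₅ l₁ (l₂ ⋆ (l₃ ⋆ l₄ ⋆ l₅)) l₆ _ _ _
  have e₄ : φ[l₁, l₂ ⋆ (l₃ ⋆ l₄ ⋆ l₅), l₆] = _ :=
    H.reas_conj l₂ (l₃ ⋆ l₄) l₅ l₁ (l₂ ⋆ (l₃ ⋆ l₄) ⋆ l₅) l₆ _ _ _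
  have e₅ : φ[l₁, l₂ ⋆ (l₃ ⋆ l₄) ⋆ l₅, l₆] = _ :=
    H.reas_conj l₂ l₃ l₄ l₁ (l₂ ⋆ l₃ ⋆ l₄ ⋆ l₅) l₆ _ _ _
  have e₇ : φ[l₁ ⋆ l₂ ⋆ (l₃ ⋆ l₄), l₅, l₆] = _ :=
    H.reas_conjInv l₁ l₂ (l₃ ⋆ l₄) (l₁ ⋆ (l₂ ⋆ (l₃ ⋆ l₄))) l₅ l₆ _ _ _
  have e₈ : φ[l₁ ⋆ (l₂ ⋆ (l₃ ⋆ l₄)), l₅, l₆] = _ :=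
    H.reas_conj l₂ l₃ l₄ (l₁ ⋆ (l₂ ⋆ l₃ ⋆ l₄)) l₅ l₆ _ _ _
  have e₉ : φ⁻[l₁, l₂ ⋆ (l₃ ⋆ l₄), l₅] = _ :=
    H.reasInv_conj l₂ l₃ l₄ l₁ (l₂ ⋆ l₃ ⋆ l₄) l₅ _ _ _
  simp [H.reasInv_right (l₁ ⋆ l₂) (l₃ ⋆ l₄) l₅ l₆, H.reasInv_left l₁ l₂ (l₃ ⋆ l₄) l₅,
    H.reas_right l₁ l₂ (l₃ ⋆ (l₄ ⋆ l₅)) l₆, H.reasInv_right l₂ l₃ l₄ l₅, e₁, e₂, e₃, e₄, e₅,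
    e₇, e₈, e₉, mul_assoc]

end

end QuasiBialgebra

/-! ### Antipodes along a homomorphism and the twist between two of them -/

section Collapse

variable {K : Type u} [Field K]
variable {A B C D : Type*} [Ring A] [Algebra K A] [Ring B] [Algebra K B] [Ring C] [Algebra K C]
  [Ring D] [Algebra K D]

theorem LeftEq.mulTensor_right {F : B →ₗ[K] D} {f f' : A →ₐ[K] B} (h : LeftEq F f f')
    (P : C →ₗ[K] D) : LeftEq (P ⊛ F) (iR.comp f) (iR.comp f') :=
  (h.map_right P).postcomp _

theorem RightEq.mulTensor_right {F : B →ₗ[K] D} {f f' : A →ₐ[K] B} (h : RightEq F f f')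
    (P : C →ₗ[K] D) : RightEq (P ⊛ F) (iR.comp f) (iR.comp f') :=
  (h.map_right P).postcomp _

theorem mulLeft_comp_mulTensor (d : D) (P : A →ₗ[K] D) (Q : C →ₗ[K] D) :
    (LinearMap.mulLeft K d ∘ₗ P) ⊛ Q = LinearMap.mulLeft K d ∘ₗ (P ⊛ Q) := by
  ext; simp [mul_assoc]

end Collapse

namespace QuasiBialgebra

variable {K : Type u} [Field K] {G : Type v} [Ring G] [Algebra K G] (H : QuasiBialgebra K G)
variable {A B C D : Type*} [Ring A] [Algebra K A] [Ring B] [Algebra K B] [Ring C] [Algebra K C]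
  [Ring D] [Algebra K D]

local infixl:72 " ⋆ " => star H
local notation "φ[" a ", " b ", " c "]" => reas H a b c
local notation "φ⁻[" a ", " b ", " c "]" => reasInv H a b c

attribute [local instance 10] Commuting.flip

/-- The antihomomorphism `s` with `α`, `β` is an antipode for the `G`-algebra structure `θ`: the
antipode axioms, with `G` acting through `θ`. -/
structure AntipodeAlong (θ : G →ₐ[K] A) (s : G →ₐ[K] Aᵐᵒᵖ) (α β : A) : Prop where
  ev : IsEv H θ s α
  coev : IsCoev H θ s β
  zigzag : (θ.toLinearMap ⊛ (LinearMap.mulLeft K β ∘ₗ unopLin s) ⊛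
    (LinearMap.mulLeft K α ∘ₗ θ.toLinearMap)) (H.φ : G ⊗[K] (G ⊗[K] G)) = 1
  zigzag_inv : (unopLin s ⊛ (LinearMap.mulLeft K α ∘ₗ θ.toLinearMap) ⊛
    (LinearMap.mulLeft K β ∘ₗ unopLin s)) (↑H.φ⁻¹ : G ⊗[K] (G ⊗[K] G)) = 1

/-- The element `s'(P) α' θ(Q) β s(R)`, for `φ⁻¹ = P ⊗ Q ⊗ R`, that carries `s`, `α`, `β` to
`s'`, `α'`, `β'`. -/
def antipodeTwist (θ : G →ₐ[K] A) (s s' : G →ₐ[K] Aᵐᵒᵖ) (α' β : A) : A :=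
  (unopLin s' ⊛ (LinearMap.mulLeft K α' ∘ₗ θ.toLinearMap) ⊛
    (LinearMap.mulLeft K β ∘ₗ unopLin s)) (↑H.φ⁻¹ : G ⊗[K] (G ⊗[K] G))

theorem leftEq_ev_tail' {θ : G →ₐ[K] A} {s : G →ₐ[K] Aᵐᵒᵖ} {α : A} (h : IsEv H θ s α) 
    (R : C →ₗ[K] A) (β : A) :
    LeftEq ((LinearMap.mulLeft K β ∘ₗ unopLin s) ⊛ (LinearMap.mulLeft K α ∘ₗ θ.toLinearMap) ⊛ R)
      (iL ⋆ iR.comp iL) H.triv := by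
  rw [mulLeft_comp_mulTensor]
  exact (H.leftEq_ev_tail θ s α R).postcomp _

theorem leftEq_ev' {θ : G →ₐ[K] A} {s : G →ₐ[K] Aᵐᵒᵖ} {α : A} (h : IsEv H θ s α) (β : A) :
    LeftEq ((LinearMap.mulLeft K β ∘ₗ unopLin s) ⊛ (LinearMap.mulLeft K α ∘ₗ θ.toLinearMap))
      (iL ⋆ iR) H.triv := by
  rw [mulLeft_comp_mulTensor]
  exact (H.leftEq_ev θ s α).postcomp _

theorem rightEq_coev_tail' {θ : G →ₐ[K] A} {s : G →ₐ[K] Aᵐᵒᵖ} {β : A} (h : IsCoev H θ s β)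
    (R : C →ₗ[K] A) (α : A) :
    RightEq ((LinearMap.mulLeft K α ∘ₗ θ.toLinearMap) ⊛ (LinearMap.mulLeft K β ∘ₗ unopLin s) ⊛ R)
      (iL ⋆ iR.comp iL) H.triv := by
  rw [mulLeft_comp_mulTensor]
  exact (H.rightEq_coev_tail θ s β R).postcomp _

theorem rightEq_coev' {θ : G →ₐ[K] A} {s : G →ₐ[K] Aᵐᵒᵖ} {β : A} (h : IsCoev H θ s β) (α : A) :
    RightEq ((LinearMap.mulLeft K α ∘ₗ θ.toLinearMap) ⊛ (LinearMap.mulLeft K β ∘ₗ unopLin s))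
      (iL ⋆ iR) H.triv := by
  rw [mulLeft_comp_mulTensor]
  exact (H.rightEq_coev θ s β).postcomp _

theorem reas_legs : φ[iL, iR.comp iL, iR.comp iR] = (H.φ : G ⊗[K] (G ⊗[K] G)) := by
  exact (H.apply_eq_reas _ _ _ (h := AlgHom.id K _) rfl rfl rfl).symm

theorem reasInv_legs : φ⁻[iL, iR.comp iL, iR.comp iR] = (↑H.φ⁻¹ : G ⊗[K] (G ⊗[K] G)) := by
  exact (H.apply_eq_reasInv _ _ _ (h := AlgHom.id K _) rfl rfl rfl).symm

section
variable {H} {θ : G →ₐ[K] A} {s s' s'' : G →ₐ[K] Aᵐᵒᵖ} {α β α' β' α'' β'' : A}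

/-- An element commuting with the image of `s` is determined by its action on `α`: in the zigzag
`s(P) α θ(Q) β s(R) = 1` it can be moved next to `α`. -/
theorem AntipodeAlong.eq_one (h : H.AntipodeAlong θ s α β) {c : A}
    (hc : ∀ x, c * unopLin s x = unopLin s x * c) (hα : c * α = α) : c = 1 := by
  have key : ∀ w, c * (unopLin s ⊛ (LinearMap.mulLeft K α ∘ₗ θ.toLinearMap) ⊛
      (LinearMap.mulLeft K β ∘ₗ unopLin s)) w = (unopLin s ⊛
      (LinearMap.mulLeft K α ∘ₗ θ.toLinearMap) ⊛ (LinearMap.mulLeft K β ∘ₗ unopLin s)) w := by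
    intro w
    suffices e : LinearMap.mulLeft K c ∘ₗ (unopLin s ⊛ (LinearMap.mulLeft K α ∘ₗ θ.toLinearMap) ⊛
      (LinearMap.mulLeft K β ∘ₗ unopLin s)) = (unopLin s ⊛
      (LinearMap.mulLeft K α ∘ₗ θ.toLinearMap) ⊛ (LinearMap.mulLeft K β ∘ₗ unopLin s)) from
      DFunLike.congr_fun e w
    ext x y z
    have h1 := hc x
    simp only [unopLin_apply] at h1
    simp only [TensorProduct.AlgebraTensorModule.curry_apply, LinearMap.restrictScalars_self,
      TensorProduct.curry_apply, LinearMap.comp_apply, LinearMap.mulLeft_apply, mulTensor_tmul,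
      unopLin_apply, AlgHom.toLinearMap_apply]
    rw [← mul_assoc, h1, mul_assoc, ← mul_assoc c, ← mul_assoc c, hα]
  simpa [h.zigzag_inv] using key (↑H.φ⁻¹ : G ⊗[K] (G ⊗[K] G))

/-- The pentagon in four legs, under a functional that annihilates the first and the last two legs
from the left, and the middle two from the right. -/
theorem antipodeTwist_mul_α (h : H.AntipodeAlong θ s α β) (h' : H.AntipodeAlong θ s' α' β') :
    H.antipodeTwist θ s s' α' β * α = α' := by
  let F : G ⊗[K] (G ⊗[K] (G ⊗[K] G)) →ₗ[K] A := unopLin s' ⊛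
    (LinearMap.mulLeft K α' ∘ₗ θ.toLinearMap) ⊛ (LinearMap.mulLeft K β ∘ₗ unopLin s) ⊛
    (LinearMap.mulLeft K α ∘ₗ θ.toLinearMap)
  let i₁ : G →ₐ[K] G ⊗[K] (G ⊗[K] (G ⊗[K] G)) := iL
  let i₂ : G →ₐ[K] G ⊗[K] (G ⊗[K] (G ⊗[K] G)) := iR.comp iL
  let i₃ : G →ₐ[K] G ⊗[K] (G ⊗[K] (G ⊗[K] G)) := iR.comp (iR.comp iL)
  let i₄ : G →ₐ[K] G ⊗[K] (G ⊗[K] (G ⊗[K] G)) := iR.comp (iR.comp iR)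
  have := h.ev; have := h.coev; have := h'.ev; have := h'.coev
  have : LeftEq F (i₁ ⋆ i₂) H.triv := H.leftEq_ev_tail θ s' α' _
  have : LeftEq F (i₃ ⋆ i₄) H.triv := by
    simpa only [comp_star, comp_triv] using
      ((H.leftEq_ev' h.ev β).mulTensor_right _).mulTensor_right _
  have : RightEq F (i₂ ⋆ i₃) H.triv := by
    simpa only [comp_star, comp_triv] using (H.rightEq_coev_tail' h.coev _ _).mulTensor_right _
  have e₁ : F φ⁻[i₁, i₂, i₃] = H.antipodeTwist θ s s' α' β * α := by
    have e : φ⁻[i₁, i₂, i₃] = leg123 (↑H.φ⁻¹ : G ⊗[K] (G ⊗[K] G)) :=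
      (H.apply_eq_reasInv _ _ _ (by ext; simp [leg123, i₁, Algebra.TensorProduct.one_def])
        (by ext; simp [leg123, i₂, Algebra.TensorProduct.one_def])
        (by ext; simp [leg123, i₃, Algebra.TensorProduct.one_def])).symm
    rw [e]
    suffices F ∘ₗ (leg123 : _ →ₐ[K] G ⊗[K] (G ⊗[K] (G ⊗[K] G))).toLinearMap =
      LinearMap.mulRight K α ∘ₗ (unopLin s' ⊛ (LinearMap.mulLeft K α' ∘ₗ θ.toLinearMap) ⊛
      (LinearMap.mulLeft K β ∘ₗ unopLin s)) from DFunLike.congr_fun this _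
    ext; simp [leg123, F, mul_assoc]
  have e₂ : F φ[i₂, i₃, i₄] = α' := by
    have e : φ[i₂, i₃, i₄] = iR (H.φ : G ⊗[K] (G ⊗[K] G)) := by
      rw [← reas_legs, map_reas]
    rw [e]
    suffices F ∘ₗ (iR : _ →ₐ[K] G ⊗[K] (G ⊗[K] (G ⊗[K] G))).toLinearMap =
      LinearMap.mulLeft K α' ∘ₗ (θ.toLinearMap ⊛ (LinearMap.mulLeft K β ∘ₗ unopLin s) ⊛
      (LinearMap.mulLeft K α ∘ₗ θ.toLinearMap)) from
      (DFunLike.congr_fun this _).trans (by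
        rw [LinearMap.comp_apply, h.zigzag, LinearMap.mulLeft_apply, mul_one])
    ext; simp [F, mul_assoc]
  calc _ = F φ⁻[i₁, i₂, i₃] := e₁.symm
    _ = F (φ[i₁ ⋆ i₂, i₃, i₄] * (φ⁻[i₁, i₂, i₃] * φ⁻[i₁, i₂ ⋆ i₃, i₄])) := by
      rw [left_reas₁, right_reasInv₂]
    _ = F (φ⁻[i₁, i₂, i₃ ⋆ i₄] * φ[i₂, i₃, i₄]) := by
      rw [H.reas_left]; simp [mul_assoc]
    _ = F φ[i₂, i₃, i₄] := by rw [left_reasInv₃]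
    _ = α' := e₂

/-- The counterpart of `antipodeTwist_mul_α`, with evaluations and coevaluations exchanged. -/
theorem β_mul_antipodeTwist (h : H.AntipodeAlong θ s α β) (h' : H.AntipodeAlong θ s' α' β') :
    β' * H.antipodeTwist θ s s' α' β = β := by
  let F : G ⊗[K] (G ⊗[K] (G ⊗[K] G)) →ₗ[K] A := θ.toLinearMap ⊛
    (LinearMap.mulLeft K β' ∘ₗ unopLin s') ⊛ (LinearMap.mulLeft K α' ∘ₗ θ.toLinearMap) ⊛
    (LinearMap.mulLeft K β ∘ₗ unopLin s)
  let i₁ : G →ₐ[K] G ⊗[K] (G ⊗[K] (G ⊗[K] G)) := iL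
  let i₂ : G →ₐ[K] G ⊗[K] (G ⊗[K] (G ⊗[K] G)) := iR.comp iL
  let i₃ : G →ₐ[K] G ⊗[K] (G ⊗[K] (G ⊗[K] G)) := iR.comp (iR.comp iL)
  let i₄ : G →ₐ[K] G ⊗[K] (G ⊗[K] (G ⊗[K] G)) := iR.comp (iR.comp iR)
  have := h.ev; have := h.coev; have := h'.ev; have := h'.coev
  have : RightEq F (i₁ ⋆ i₂) H.triv := H.rightEq_coev_tail θ s' β' _
  have : RightEq F (i₃ ⋆ i₄) H.triv := by
    simpa only [comp_star, comp_triv] using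
      ((H.rightEq_coev' h.coev α').mulTensor_right _).mulTensor_right _
  have : LeftEq F (i₂ ⋆ i₃) H.triv := by
    simpa only [comp_star, comp_triv] using (H.leftEq_ev_tail' h'.ev _ _).mulTensor_right _
  have e₁ : F φ[i₁, i₂, i₃] = β := by
    have e : φ[i₁, i₂, i₃] = leg123 (H.φ : G ⊗[K] (G ⊗[K] G)) :=
      (H.apply_eq_reas _ _ _ (by ext; simp [leg123, i₁, Algebra.TensorProduct.one_def])
        (by ext; simp [leg123, i₂, Algebra.TensorProduct.one_def])
        (by ext; simp [leg123, i₃, Algebra.TensorProduct.one_def])).symm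
    rw [e]
    suffices F ∘ₗ (leg123 : _ →ₐ[K] G ⊗[K] (G ⊗[K] (G ⊗[K] G))).toLinearMap =
      LinearMap.mulRight K β ∘ₗ (θ.toLinearMap ⊛ (LinearMap.mulLeft K β' ∘ₗ unopLin s') ⊛
      (LinearMap.mulLeft K α' ∘ₗ θ.toLinearMap)) from
      (DFunLike.congr_fun this _).trans (by
        rw [LinearMap.comp_apply, h'.zigzag, LinearMap.mulRight_apply, one_mul])
    ext; simp [leg123, F, mul_assoc]
  have e₂ : F φ⁻[i₂, i₃, i₄] = β' * H.antipodeTwist θ s s' α' β := by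
    have e : φ⁻[i₂, i₃, i₄] = iR (↑H.φ⁻¹ : G ⊗[K] (G ⊗[K] G)) := by
      rw [← reasInv_legs, map_reasInv]
    rw [e]
    suffices F ∘ₗ (iR : _ →ₐ[K] G ⊗[K] (G ⊗[K] (G ⊗[K] G))).toLinearMap =
      LinearMap.mulLeft K β' ∘ₗ (unopLin s' ⊛ (LinearMap.mulLeft K α' ∘ₗ θ.toLinearMap) ⊛
    (LinearMap.mulLeft K β ∘ₗ unopLin s)) from DFunLike.congr_fun this _
    ext; simp [F, mul_assoc]
  calc _ = F φ⁻[i₂, i₃, i₄] := e₂.symm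
    _ = F (φ⁻[i₁, i₂ ⋆ i₃, i₄] * (φ⁻[i₂, i₃, i₄] * φ[i₁, i₂, i₃ ⋆ i₄])) := by
      rw [left_reasInv₂, right_reas₃]
    _ = F (φ[i₁, i₂, i₃] * φ⁻[i₁ ⋆ i₂, i₃, i₄]) := by
      rw [H.reas_right]; simp [mul_assoc]
    _ = F φ[i₁, i₂, i₃] := by rw [right_reasInv₁]
    _ = β := e₁

theorem antipodeTwist_intertwines (h : IsCoev H θ s β) (h' : IsEv H θ s' α') (x : G) :
    H.antipodeTwist θ s s' α' β * unopLin s x =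
      unopLin s' x * H.antipodeTwist θ s s' α' β := by
  let F : G ⊗[K] (G ⊗[K] G) →ₗ[K] A := unopLin s' ⊛
    (LinearMap.mulLeft K α' ∘ₗ θ.toLinearMap) ⊛ (LinearMap.mulLeft K β ∘ₗ unopLin s)
  let i₁ : G →ₐ[K] G ⊗[K] (G ⊗[K] G) := iL
  let i₂ : G →ₐ[K] G ⊗[K] (G ⊗[K] G) := iR.comp iL
  let i₃ : G →ₐ[K] G ⊗[K] (G ⊗[K] G) := iR.comp iR
  have : LeftEq F (i₁ ⋆ i₂) H.triv := H.leftEq_ev_tail θ s' α' _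
  have : RightEq F (i₂ ⋆ i₃) H.triv := by
    simpa only [comp_star, comp_triv] using (H.rightEq_coev' h _).mulTensor_right _
  have e : φ⁻[i₁, i₂, i₃] = (↑H.φ⁻¹ : G ⊗[K] (G ⊗[K] G)) := H.reasInv_legs
  have e₁ : ∀ w, F (i₃ x * w) = F w * unopLin s x := by
    intro w
    suffices F ∘ₗ LinearMap.mulLeft K (i₃ x) = LinearMap.mulRight K (unopLin s x) ∘ₗ F from
      DFunLike.congr_fun this w
    ext; simp [F, i₃, mul_assoc]
  have e₂ : ∀ w, F (w * i₁ x) = unopLin s' x * F w := by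
    intro w
    suffices F ∘ₗ LinearMap.mulRight K (i₁ x) = LinearMap.mulLeft K (unopLin s' x) ∘ₗ F from
      DFunLike.congr_fun this w
    ext; simp [F, i₁, mul_assoc]
  calc _ = F (i₃ x * φ⁻[i₁, i₂, i₃]) := by rw [e₁, e]; rfl
    _ = F (((i₁ ⋆ i₂) ⋆ i₃) x * φ⁻[i₁, i₂, i₃]) :=
      (LeftEq.eq (F := F) (f := (i₁ ⋆ i₂) ⋆ i₃) (f' := i₃) _ _).symm
    _ = F (φ⁻[i₁, i₂, i₃] * (i₁ ⋆ (i₂ ⋆ i₃)) x) := by rw [(H.intw_reasInv i₁ i₂ i₃).eq]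
    _ = F (φ⁻[i₁, i₂, i₃] * i₁ x) :=
      (RightEq.eq (F := F) (f := i₁ ⋆ (i₂ ⋆ i₃)) (f' := i₁) _ _)
    _ = _ := by rw [e₂, e]; rfl

theorem antipodeTwist_mul_antipodeTwist (h : H.AntipodeAlong θ s α β)
    (h' : H.AntipodeAlong θ s' α' β') :
    H.antipodeTwist θ s' s α β' * H.antipodeTwist θ s s' α' β = 1 := by
  refine h.eq_one (fun x => ?_) ?_
  · rw [mul_assoc, antipodeTwist_intertwines h.coev h'.ev, ← mul_assoc,
      antipodeTwist_intertwines h'.coev h.ev, mul_assoc]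
  · rw [mul_assoc, antipodeTwist_mul_α h h', antipodeTwist_mul_α h' h]

end

end QuasiBialgebra

/-! ### The antipode of a quasi-Hopf algebra along its coproduct -/

section Collapse

variable {K : Type u} [Field K]
variable {A B C D : Type*} [Ring A] [Algebra K A] [Ring B] [Algebra K B] [Ring C] [Algebra K C]
  [Ring D] [Algebra K D] {M N : Type*} [AddCommGroup M] [Module K M] [AddCommGroup N] [Module K N]

theorem LeftEq.trans {F : B →ₗ[K] M} {f g h : A →ₐ[K] B} (h₁ : LeftEq F f g) (h₂ : LeftEq F g h) :
    LeftEq F f h := ⟨fun x w => (h₁.eq x w).trans (h₂.eq x w)⟩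

theorem RightEq.trans {F : B →ₗ[K] M} {f g h : A →ₐ[K] B} (h₁ : RightEq F f g)
    (h₂ : RightEq F g h) : RightEq F f h := ⟨fun x w => (h₁.eq x w).trans (h₂.eq x w)⟩

instance (F : B →ₗ[K] M) (u : B) (f f' : A →ₐ[K] B) [LeftEq F f f'] [Intw u f f]
    [Intw u f' f'] : LeftEq (F ∘ₗ LinearMap.mulLeft K u) f f' :=
  ⟨fun x w => by
    simp only [LinearMap.comp_apply, LinearMap.mulLeft_apply]
    rw [← mul_assoc, Intw.eq (u := u) (f := f) (f' := f), mul_assoc, LeftEq.eq (f' := f'),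
      ← mul_assoc, ← Intw.eq (u := u) (f := f') (f' := f'), mul_assoc]⟩

instance (F : B →ₗ[K] M) (u : B) (f f' : A →ₐ[K] B) [RightEq F f f'] [Intw u f f]
    [Intw u f' f'] : RightEq (F ∘ₗ LinearMap.mulRight K u) f f' :=
  ⟨fun x w => by
    simp only [LinearMap.comp_apply, LinearMap.mulRight_apply]
    rw [mul_assoc, ← Intw.eq (u := u) (f := f) (f' := f), ← mul_assoc, RightEq.eq (f' := f'),
      mul_assoc, Intw.eq (u := u) (f := f') (f' := f'), mul_assoc]⟩

instance (u v : B) (f : A →ₐ[K] B) [Intw u f f] [Intw v f f] : Intw (u * v) f f :=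
  Intw.mul (f' := f) inferInstance inferInstance

instance (f : A →ₐ[K] B) (g : C →ₐ[K] B) [Commuting g f] :
    Commuting (AlgHom.op f) (AlgHom.op g) :=
  ⟨fun x y => MulOpposite.unop_injective (Commuting.comm (f := g) (g := f) y.unop x.unop)⟩

end Collapse

namespace QuasiBialgebra

variable {K : Type u} [Field K] {G : Type v} [Ring G] [Algebra K G] {H : QuasiBialgebra K G}
variable {A B : Type*} [Ring A] [Algebra K A] [Ring B] [Algebra K B]

/-- Antipodes are carried along by homomorphisms. -/
theorem AntipodeAlong.map {θ : G →ₐ[K] A} {s : G →ₐ[K] Aᵐᵒᵖ} {α β : A}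
    (h : H.AntipodeAlong θ s α β) (k : A →ₐ[K] B) :
    H.AntipodeAlong (k.comp θ) ((AlgHom.op k).comp s) (k α) (k β) where
  ev := ⟨fun g => by
    rw [← map_smul, ← h.ev.eq]
    suffices unopLin ((AlgHom.op k).comp s) ⊛ LinearMap.mulLeft K (k α) ∘ₗ (k.comp θ).toLinearMap =
      k.toLinearMap ∘ₗ (unopLin s ⊛ LinearMap.mulLeft K α ∘ₗ θ.toLinearMap) from
      DFunLike.congr_fun this _
    ext; simp⟩
  coev := ⟨fun g => by
    rw [← map_smul, ← h.coev.eq]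
    suffices (k.comp θ).toLinearMap ⊛ LinearMap.mulLeft K (k β) ∘ₗ unopLin ((AlgHom.op k).comp s) =
      k.toLinearMap ∘ₗ (θ.toLinearMap ⊛ LinearMap.mulLeft K β ∘ₗ unopLin s) from
      DFunLike.congr_fun this _
    ext; simp⟩
  zigzag := by
    rw [← map_one k, ← h.zigzag]
    suffices (k.comp θ).toLinearMap ⊛ (LinearMap.mulLeft K (k β) ∘ₗ
        unopLin ((AlgHom.op k).comp s)) ⊛ (LinearMap.mulLeft K (k α) ∘ₗ (k.comp θ).toLinearMap) =
      k.toLinearMap ∘ₗ (θ.toLinearMap ⊛ (LinearMap.mulLeft K β ∘ₗ unopLin s) ⊛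
        (LinearMap.mulLeft K α ∘ₗ θ.toLinearMap)) from
      DFunLike.congr_fun this _
    ext; simp
  zigzag_inv := by
    rw [← map_one k, ← h.zigzag_inv]
    suffices unopLin ((AlgHom.op k).comp s) ⊛ (LinearMap.mulLeft K (k α) ∘ₗ
        (k.comp θ).toLinearMap) ⊛ (LinearMap.mulLeft K (k β) ∘ₗ
        unopLin ((AlgHom.op k).comp s)) =
      k.toLinearMap ∘ₗ (unopLin s ⊛ (LinearMap.mulLeft K α ∘ₗ θ.toLinearMap) ⊛
        (LinearMap.mulLeft K β ∘ₗ unopLin s)) from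
      DFunLike.congr_fun this _
    ext; simp

end QuasiBialgebra

namespace QuasiHopfAlgebra

open QuasiBialgebra

variable {K : Type u} [Field K] {G : Type v} [Ring G] [Algebra K G] (H : QuasiHopfAlgebra K G)
variable {A B C : Type*} [Ring A] [Algebra K A] [Ring B] [Algebra K B] [Ring C] [Algebra K C]

local infixl:72 " ⋆ " => QuasiBialgebra.star (toQuasiBialgebra H)
local notation "φ[" a ", " b ", " c "]" => reas (toQuasiBialgebra H) a b c
local notation "φ⁻[" a ", " b ", " c "]" => reasInv (toQuasiBialgebra H) a b c

attribute [local instance 10] Commuting.flip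

theorem S_one : H.S 1 = 1 := by
  obtain ⟨a, ha⟩ := H.S.surjective 1
  have h := H.S_mul a 1
  rwa [mul_one, ha, mul_one, eq_comm] at h

/-- The antipode, as a homomorphism into the opposite algebra. -/
def Sop : G →ₐ[K] Gᵐᵒᵖ :=
  AlgHom.ofLinearMap ((MulOpposite.opLinearEquiv K).toLinearMap ∘ₗ H.S.toLinearMap)
    (by simp [S_one]) (by simp [S_mul])

@[simp] theorem unop_Sop (x : G) : (H.Sop x).unop = H.S x := rfl

/-- The antipode axioms of `H`. -/
theorem antipodeAlong_id : H.AntipodeAlong (AlgHom.id K G) H.Sop H.α H.β where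
  ev := ⟨H.antipode_left⟩
  coev := ⟨H.antipode_right⟩
  zigzag := H.reassoc_antipode
  zigzag_inv := H.reassoc_inv_antipode

/-- The antipode of `H` pushed forward along a homomorphism. -/
theorem antipodeAlong (θ : G →ₐ[K] A) :
    H.AntipodeAlong θ ((AlgHom.op θ).comp H.Sop) (θ H.α) (θ H.β) :=
  H.antipodeAlong_id.map θ

/-- The antihomomorphism `x ↦ (S ⊗ S)(Δᵒᵖ x)`. -/
def SSop : G →ₐ[K] (G ⊗[K] G)ᵐᵒᵖ :=
  ((AlgHom.op iR).comp H.Sop) ⋆ ((AlgHom.op iL).comp H.Sop)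

theorem unopLin_SSop : unopLin H.SSop = H.SSΔop := by
  ext x
  suffices h : ∀ d : G ⊗[K] G, (pl ((AlgHom.op iR).comp H.Sop)
      ((AlgHom.op iL).comp H.Sop) d).unop = TensorProduct.map H.S.toLinearMap H.S.toLinearMap
      (Algebra.TensorProduct.comm K G G d) from h _
  intro d
  induction d using TensorProduct.induction_on with
  | zero => simp
  | add x y hx hy => simp only [map_add, MulOpposite.unop_add, hx, hy]
  | tmul a b => simp

/-! ### Evaluations and coevaluations on two pairs of legs -/

/-- `x* ⊗ x ↦ S(x*) α x`. -/
def evLin : G ⊗[K] G →ₗ[K] G := H.S.toLinearMap ⊛ LinearMap.mulLeft K H.α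

/-- `x ⊗ x* ↦ x β S(x*)`. -/
def coevLin : G ⊗[K] G →ₗ[K] G := LinearMap.id ⊛ (LinearMap.mulLeft K H.β ∘ₗ H.S.toLinearMap)

/-- `x ⊗ x* ⊗ x' ↦ x β S(x*) α x'`. -/
def zigLin : G ⊗[K] (G ⊗[K] G) →ₗ[K] G :=
  LinearMap.id ⊛ (LinearMap.mulLeft K H.β ∘ₗ H.S.toLinearMap) ⊛ LinearMap.mulLeft K H.α

/-- `x* ⊗ x ⊗ x*' ↦ S(x*) α x β S(x*')`. -/
def zagLin : G ⊗[K] (G ⊗[K] G) →ₗ[K] G :=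
  H.S.toLinearMap ⊛ LinearMap.mulLeft K H.α ⊛ (LinearMap.mulLeft K H.β ∘ₗ H.S.toLinearMap)

theorem leftEq_evLin : LeftEq H.evLin (iL ⋆ iR) H.triv :=
  haveI := H.antipodeAlong_id.ev
  H.leftEq_ev (AlgHom.id K G) H.Sop H.α

theorem rightEq_coevLin : RightEq H.coevLin (iL ⋆ iR) H.triv :=
  haveI := H.antipodeAlong_id.coev
  H.rightEq_coev (AlgHom.id K G) H.Sop H.β

theorem rightEq_zigLin : RightEq H.zigLin (iL ⋆ iR.comp iL) H.triv :=
  haveI := H.antipodeAlong_id.coev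
  H.rightEq_coev_tail (AlgHom.id K G) H.Sop H.β _

theorem leftEq_zigLin : LeftEq H.zigLin (iR.comp iL ⋆ iR.comp iR) H.triv := by
  have h := (H.leftEq_ev' H.antipodeAlong_id.ev H.β).mulTensor_right LinearMap.id
  simp only [comp_star, comp_triv] at h
  exact h

theorem leftEq_zagLin : LeftEq H.zagLin (iL ⋆ iR.comp iL) H.triv :=
  haveI := H.antipodeAlong_id.ev
  H.leftEq_ev_tail (AlgHom.id K G) H.Sop H.α _

theorem rightEq_zagLin : RightEq H.zagLin (iR.comp iL ⋆ iR.comp iR) H.triv := by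
  have h := (H.rightEq_coev' H.antipodeAlong_id.coev H.α).mulTensor_right H.S.toLinearMap
  simp only [comp_star, comp_triv] at h
  exact h

/-- `x* ⊗ x ⊗ y* ⊗ y ↦ S(x*) α x ⊗ S(y*) α y`. -/
def ev₂ : (G ⊗[K] G) ⊗[K] (G ⊗[K] G) →ₗ[K] G ⊗[K] G := TensorProduct.map H.evLin H.evLin

/-- `x ⊗ x* ⊗ y ⊗ y* ↦ x β S(x*) ⊗ y β S(y*)`. -/
def coev₂ : (G ⊗[K] G) ⊗[K] (G ⊗[K] G) →ₗ[K] G ⊗[K] G := TensorProduct.map H.coevLin H.coevLin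

section Legs

/-- Legs of `(G ⊗ G) ⊗ (G ⊗ G)`. -/
abbrev e₁ : G →ₐ[K] (G ⊗[K] G) ⊗[K] (G ⊗[K] G) := iL.comp iL
abbrev e₂ : G →ₐ[K] (G ⊗[K] G) ⊗[K] (G ⊗[K] G) := iL.comp iR
abbrev e₃ : G →ₐ[K] (G ⊗[K] G) ⊗[K] (G ⊗[K] G) := iR.comp iL
abbrev e₄ : G →ₐ[K] (G ⊗[K] G) ⊗[K] (G ⊗[K] G) := iR.comp iR

end Legs

theorem γ_eq : H.γ = H.ev₂ (φ⁻[e₁, e₂, e₄] * φ[e₃, e₁, e₂ ⋆ e₄]) := by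
  rw [show φ⁻[e₁, e₂, e₄] = pl e₃ (pl e₁ (pl e₂ e₄)) _ from (pl_one_tmul ..).symm,
    ← pl_map_map_Δ, ← map_mul, γ]
  refine DFunLike.congr_fun (?_ : _ = H.ev₂ ∘ₗ (pl e₃ (pl e₁ (pl e₂ e₄))).toLinearMap) _
  ext; simp [ev₂, evLin, inl, inr]

theorem δ_eq : H.δ = H.coev₂ (φ[e₁ ⋆ e₃, e₄, e₂] * φ⁻[e₁, e₃, e₄]) := by
  rw [show φ⁻[e₁, e₃, e₄] = pl e₁ (pl e₃ (pl e₄ e₂)) _ from (pl_leg123 ..).symm,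
    ← pl_assoc_map_Δ, ← map_mul, δ]
  refine DFunLike.congr_fun (?_ : _ = H.coev₂ ∘ₗ (pl e₁ (pl e₃ (pl e₄ e₂))).toLinearMap) _
  ext; simp [coev₂, coevLin, inl, inr]

/-! ### The Drinfeld twist -/

theorem ev₂_mul_pl (w) (d : G ⊗[K] G) : H.ev₂ (w * pl e₂ e₄ d) = H.ev₂ w * d := by
  induction d using TensorProduct.induction_on with
  | zero => simp
  | add x y hx hy => simp only [map_add, mul_add, hx, hy]
  | tmul a b =>
    suffices H.ev₂ ∘ₗ LinearMap.mulRight K (pl e₂ e₄ (a ⊗ₜ[K] b)) =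
      LinearMap.mulRight K (a ⊗ₜ[K] b) ∘ₗ H.ev₂ from DFunLike.congr_fun this w
    ext; simp [ev₂, evLin, mul_assoc]

theorem ev₂_mul_pl' (w) (d : G ⊗[K] G) : H.ev₂ (w * pl e₃ e₁ d) =
    TensorProduct.map H.S.toLinearMap H.S.toLinearMap (Algebra.TensorProduct.comm K G G d) *
      H.ev₂ w := by
  induction d using TensorProduct.induction_on with
  | zero => simp
  | add x y hx hy => simp only [map_add, mul_add, add_mul, hx, hy]
  | tmul a b =>
    suffices H.ev₂ ∘ₗ LinearMap.mulRight K (pl e₃ e₁ (a ⊗ₜ[K] b)) =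
      LinearMap.mulLeft K (H.S b ⊗ₜ[K] H.S a) ∘ₗ H.ev₂ from
      (DFunLike.congr_fun this w).trans (by simp)
    ext; simp [ev₂, evLin, mul_assoc, S_mul]

theorem coev₂_pl_mul (w) (d : G ⊗[K] G) : H.coev₂ (pl e₁ e₃ d * w) = d * H.coev₂ w := by
  induction d using TensorProduct.induction_on with
  | zero => simp
  | add x y hx hy => simp only [map_add, add_mul, hx, hy]
  | tmul a b =>
    suffices H.coev₂ ∘ₗ LinearMap.mulLeft K (pl e₁ e₃ (a ⊗ₜ[K] b)) =
      LinearMap.mulLeft K (a ⊗ₜ[K] b) ∘ₗ H.coev₂ from DFunLike.congr_fun this w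
    ext; simp [coev₂, coevLin, mul_assoc]

theorem coev₂_pl_mul' (w) (d : G ⊗[K] G) : H.coev₂ (pl e₄ e₂ d * w) = H.coev₂ w *
    TensorProduct.map H.S.toLinearMap H.S.toLinearMap (Algebra.TensorProduct.comm K G G d) := by
  induction d using TensorProduct.induction_on with
  | zero => simp
  | add x y hx hy => simp only [map_add, mul_add, add_mul, hx, hy]
  | tmul a b =>
    suffices H.coev₂ ∘ₗ LinearMap.mulLeft K (pl e₄ e₂ (a ⊗ₜ[K] b)) =
      LinearMap.mulRight K (H.S b ⊗ₜ[K] H.S a) ∘ₗ H.coev₂ from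
      (DFunLike.congr_fun this w).trans (by simp)
    ext; simp [coev₂, coevLin, mul_assoc, S_mul]

theorem ev₂_mul_star (w) (x : G) : H.ev₂ (w * (e₂ ⋆ e₄) x) = H.ev₂ w * H.Δ x := ev₂_mul_pl ..

theorem ev₂_mul_star' (w) (x : G) : H.ev₂ (w * (e₃ ⋆ e₁) x) = H.SSΔop x * H.ev₂ w :=
  ev₂_mul_pl' ..

theorem coev₂_star_mul (w) (x : G) : H.coev₂ ((e₁ ⋆ e₃) x * w) = H.Δ x * H.coev₂ w :=
  coev₂_pl_mul ..

theorem coev₂_star_mul' (w) (x : G) : H.coev₂ ((e₄ ⋆ e₂) x * w) = H.coev₂ w * H.SSΔop x :=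
  coev₂_pl_mul' ..

/-- The word of `γ` intertwines `(e₃ ⋆ e₁) ⋆ (e₂ ⋆ e₄)` with `e₃ ⋆ ((e₁ ⋆ e₂) ⋆ e₄)`, where the pair
`e₁`, `e₂` is annihilated inside the pair `e₃`, `e₄`. -/
theorem isEv_Δ : IsEv H.toQuasiBialgebra H.Δ H.SSop H.γ := ⟨fun g => by
  have h₁ : LeftEq H.ev₂ (e₁ ⋆ e₂) H.triv := leftEq_star_map_left _ H.leftEq_evLin _
  have h₂ : LeftEq H.ev₂ (e₃ ⋆ e₄) H.triv := leftEq_star_map_right _ H.leftEq_evLin _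
  have key : ∀ d : G ⊗[K] G, (unopLin H.SSop ⊛ LinearMap.mulLeft K H.γ ∘ₗ H.Δ.toLinearMap) d =
      H.ev₂ (φ⁻[e₁, e₂, e₄] * φ[e₃, e₁, e₂ ⋆ e₄] * pl (e₃ ⋆ e₁) (e₂ ⋆ e₄) d) := by
    intro d
    induction d using TensorProduct.induction_on with
    | zero => simp
    | add x y hx hy => simp only [map_add, mul_add, hx, hy]
    | tmul a b =>
      rw [mulTensor_tmul, unopLin_SSop, LinearMap.comp_apply, LinearMap.mulLeft_apply,
        AlgHom.toLinearMap_apply, pl_tmul, ← mul_assoc (_ * φ[e₃, e₁, e₂ ⋆ e₄]),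
        ev₂_mul_star, ev₂_mul_star', ← γ_eq, mul_assoc]
  rw [key, ← star_apply, mul_assoc, (H.intw_reas e₃ e₁ (e₂ ⋆ e₄)).eq, ← mul_assoc,
    Intw.eq (u := φ⁻[e₁, e₂, e₄]) (f := e₃ ⋆ (e₁ ⋆ (e₂ ⋆ e₄))) (f' := e₃ ⋆ (e₁ ⋆ e₂ ⋆ e₄)),
    mul_assoc,
    LeftEq.eq (F := H.ev₂) (f := e₃ ⋆ (e₁ ⋆ e₂ ⋆ e₄)) (f' := e₃ ⋆ e₄),
    LeftEq.eq (F := H.ev₂) (f := e₃ ⋆ e₄) (f' := H.triv), γ_eq]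
  simp [Algebra.algebraMap_eq_smul_one]⟩

/-- The counterpart of `isEv_Δ` for `δ`. -/
theorem isCoev_Δ : IsCoev H.toQuasiBialgebra H.Δ H.SSop H.δ := ⟨fun g => by
  have h₁ : RightEq H.coev₂ (e₁ ⋆ e₂) H.triv := rightEq_star_map_left _ H.rightEq_coevLin _
  have h₂ : RightEq H.coev₂ (e₃ ⋆ e₄) H.triv := rightEq_star_map_right _ H.rightEq_coevLin _
  have key : ∀ d : G ⊗[K] G, (H.Δ.toLinearMap ⊛ LinearMap.mulLeft K H.δ ∘ₗ unopLin H.SSop) d =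
      H.coev₂ (pl (e₁ ⋆ e₃) (e₄ ⋆ e₂) d * (φ[e₁ ⋆ e₃, e₄, e₂] * φ⁻[e₁, e₃, e₄])) := by
    intro d
    induction d using TensorProduct.induction_on with
    | zero => simp
    | add x y hx hy => simp only [map_add, add_mul, hx, hy]
    | tmul a b =>
      rw [mulTensor_tmul, unopLin_SSop, LinearMap.comp_apply, LinearMap.mulLeft_apply,
        AlgHom.toLinearMap_apply, pl_tmul, mul_assoc, coev₂_star_mul, coev₂_star_mul', ← δ_eq]
  rw [key, ← star_apply, ← mul_assoc, ← (H.intw_reas (e₁ ⋆ e₃) e₄ e₂).eq, mul_assoc,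
    ← Intw.eq (u := φ⁻[e₁, e₃, e₄]) (f := e₁ ⋆ (e₃ ⋆ e₄) ⋆ e₂) (f' := e₁ ⋆ e₃ ⋆ e₄ ⋆ e₂),
    ← mul_assoc,
    RightEq.eq (F := H.coev₂) (f := e₁ ⋆ (e₃ ⋆ e₄) ⋆ e₂) (f' := e₁ ⋆ e₂),
    RightEq.eq (F := H.coev₂) (f := e₁ ⋆ e₂) (f' := H.triv), δ_eq]
  simp [Algebra.algebraMap_eq_smul_one, ← Algebra.commutes]⟩

/-- The legs of `(G ⊗ G ⊗ G) ⊗ (G ⊗ G ⊗ G)`. -/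
abbrev d₁ : G →ₐ[K] (G ⊗[K] (G ⊗[K] G)) ⊗[K] (G ⊗[K] (G ⊗[K] G)) := iL.comp iL
abbrev d₂ : G →ₐ[K] (G ⊗[K] (G ⊗[K] G)) ⊗[K] (G ⊗[K] (G ⊗[K] G)) := iL.comp (iR.comp iL)
abbrev d₃ : G →ₐ[K] (G ⊗[K] (G ⊗[K] G)) ⊗[K] (G ⊗[K] (G ⊗[K] G)) := iL.comp (iR.comp iR)
abbrev d₄ : G →ₐ[K] (G ⊗[K] (G ⊗[K] G)) ⊗[K] (G ⊗[K] (G ⊗[K] G)) := iR.comp iL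
abbrev d₅ : G →ₐ[K] (G ⊗[K] (G ⊗[K] G)) ⊗[K] (G ⊗[K] (G ⊗[K] G)) := iR.comp (iR.comp iL)
abbrev d₆ : G →ₐ[K] (G ⊗[K] (G ⊗[K] G)) ⊗[K] (G ⊗[K] (G ⊗[K] G)) := iR.comp (iR.comp iR)

/-- The inclusion of the first two factors of each triple. -/
def firstTwo : (G ⊗[K] G) ⊗[K] (G ⊗[K] G) →ₐ[K]
    (G ⊗[K] (G ⊗[K] G)) ⊗[K] (G ⊗[K] (G ⊗[K] G)) :=
  Algebra.TensorProduct.map leg12 leg12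

/-- The inclusion of the last two factors of each triple. -/
def lastTwo : (G ⊗[K] G) ⊗[K] (G ⊗[K] G) →ₐ[K]
    (G ⊗[K] (G ⊗[K] G)) ⊗[K] (G ⊗[K] (G ⊗[K] G)) :=
  Algebra.TensorProduct.map leg23 leg23

theorem firstTwo_e₁ : firstTwo.comp (e₁ : G →ₐ[K] _) = d₁ := by
  ext; simp [firstTwo, leg12, Algebra.TensorProduct.one_def]
theorem firstTwo_e₂ : firstTwo.comp (e₂ : G →ₐ[K] _) = d₂ := by
  ext; simp [firstTwo, leg12, Algebra.TensorProduct.one_def]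
theorem firstTwo_e₃ : firstTwo.comp (e₃ : G →ₐ[K] _) = d₄ := by
  ext; simp [firstTwo, leg12, Algebra.TensorProduct.one_def]
theorem firstTwo_e₄ : firstTwo.comp (e₄ : G →ₐ[K] _) = d₅ := by
  ext; simp [firstTwo, leg12, Algebra.TensorProduct.one_def]
theorem lastTwo_e₁ : lastTwo.comp (e₁ : G →ₐ[K] _) = d₂ := by
  ext; simp [lastTwo, leg23, Algebra.TensorProduct.one_def]
theorem lastTwo_e₂ : lastTwo.comp (e₂ : G →ₐ[K] _) = d₃ := by
  ext; simp [lastTwo, leg23, Algebra.TensorProduct.one_def]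
theorem lastTwo_e₃ : lastTwo.comp (e₃ : G →ₐ[K] _) = d₅ := by
  ext; simp [lastTwo, leg23, Algebra.TensorProduct.one_def]
theorem lastTwo_e₄ : lastTwo.comp (e₄ : G →ₐ[K] _) = d₆ := by
  ext; simp [lastTwo, leg23, Algebra.TensorProduct.one_def]

/-- Two copies of `x β S(x*) α x'`. -/
def zig₂ : (G ⊗[K] (G ⊗[K] G)) ⊗[K] (G ⊗[K] (G ⊗[K] G)) →ₗ[K] G ⊗[K] G :=
  TensorProduct.map H.zigLin H.zigLin

/-- Two copies of `S(x*) α x β S(x*')`. -/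
def zag₂ : (G ⊗[K] (G ⊗[K] G)) ⊗[K] (G ⊗[K] (G ⊗[K] G)) →ₗ[K] G ⊗[K] G :=
  TensorProduct.map H.zagLin H.zagLin

theorem zig₂_mul (u v) : H.zig₂ (lastTwo v * firstTwo u) = H.coev₂ u * H.ev₂ v := by
  suffices h : ((LinearMap.mul K _).compl₁₂ lastTwo.toLinearMap firstTwo.toLinearMap).compr₂ H.zig₂
      = ((LinearMap.mul K _).compl₁₂ H.coev₂ H.ev₂).flip from
    DFunLike.congr_fun (DFunLike.congr_fun h v) u
  ext
  simp [zig₂, ev₂, coev₂, zigLin, evLin, coevLin, lastTwo, firstTwo, leg12, leg23, S_mul,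
    mul_assoc]

theorem zag₂_mul (u v) : H.zag₂ (firstTwo v * lastTwo u) = H.ev₂ v * H.coev₂ u := by
  suffices h : ((LinearMap.mul K _).compl₁₂ firstTwo.toLinearMap lastTwo.toLinearMap).compr₂ H.zag₂
      = ((LinearMap.mul K _).compl₁₂ H.ev₂ H.coev₂) from
    DFunLike.congr_fun (DFunLike.congr_fun h v) u
  ext
  simp [zag₂, ev₂, coev₂, zagLin, evLin, coevLin, lastTwo, firstTwo, leg12, leg23, S_mul,
    mul_assoc]

theorem zig₂_eval : H.zig₂ (φ[d₄, d₅, d₆] * φ[d₁, d₂, d₃]) = 1 := by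
  have h₁ : φ[d₁, d₂, d₃] = iL (H.φ : G ⊗[K] (G ⊗[K] G)) := by
    rw [← reas_legs, map_reas]
  have h₂ : φ[d₄, d₅, d₆] = iR (H.φ : G ⊗[K] (G ⊗[K] G)) := by
    rw [← reas_legs, map_reas]
  rw [h₁, h₂, iL_apply, iR_apply, Algebra.TensorProduct.tmul_mul_tmul, one_mul, mul_one, zig₂,
    TensorProduct.map_tmul, zigLin, H.reassoc_antipode, Algebra.TensorProduct.one_def]

theorem zag₂_eval : H.zag₂ (φ⁻[d₄, d₅, d₆] * φ⁻[d₁, d₂, d₃]) = 1 := by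
  have h₁ : φ⁻[d₁, d₂, d₃] = iL (↑H.φ⁻¹ : G ⊗[K] (G ⊗[K] G)) := by
    rw [← reasInv_legs, map_reasInv]
  have h₂ : φ⁻[d₄, d₅, d₆] = iR (↑H.φ⁻¹ : G ⊗[K] (G ⊗[K] G)) := by
    rw [← reasInv_legs, map_reasInv]
  rw [h₁, h₂, iL_apply, iR_apply, Algebra.TensorProduct.tmul_mul_tmul, one_mul, mul_one, zag₂,
    TensorProduct.map_tmul, zagLin, H.reassoc_inv_antipode, Algebra.TensorProduct.one_def]

/-- The zigzag for the product of the two legs: the inner pairs are created and annihilated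
first, as in `reas_six₁`. -/
theorem zig₂_word : H.zig₂ (φ⁻[d₂, d₃, d₆] * (φ[d₅, d₂, d₃ ⋆ d₆] *
    (φ[d₁ ⋆ d₄, d₅ ⋆ d₂, d₃ ⋆ d₆] * (φ[d₁ ⋆ d₄, d₅, d₂] * φ⁻[d₁, d₄, d₅])))) = 1 := by
  have h₁₄ : RightEq H.zig₂ (d₁ ⋆ d₂) H.triv := rightEq_star_map_left _ H.rightEq_zigLin _
  have h₂₃ : RightEq H.zig₂ (d₄ ⋆ d₅) H.triv := rightEq_star_map_right _ H.rightEq_zigLin _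
  have h₄₅ : LeftEq H.zig₂ (d₂ ⋆ d₃) H.triv := leftEq_star_map_left _ H.leftEq_zigLin _
  have h₃₆ : LeftEq H.zig₂ (d₅ ⋆ d₆) H.triv := leftEq_star_map_right _ H.leftEq_zigLin _
  have h₁ : LeftEq H.zig₂ (d₅ ⋆ (d₂ ⋆ d₃ ⋆ d₆)) H.triv :=
    LeftEq.trans (g := d₅ ⋆ d₆) inferInstance h₃₆
  have h₂ : RightEq H.zig₂ (d₁ ⋆ (d₄ ⋆ d₅) ⋆ d₂) H.triv :=
    RightEq.trans (g := d₁ ⋆ d₂) inferInstance h₁₄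
  have h := H.reas_six₁ (d₁ : G →ₐ[K] _) d₄ d₅ d₂ d₃ d₆
  rw [h, left_reasInv₃]
  simp only [← mul_assoc]
  rw [right_reasInv₁, H.rightEq_reas H.zig₂ (d₁ ⋆ (d₄ ⋆ d₅)) d₂ d₃ d₁ d₂ d₃]
  simp only [mul_assoc]
  rw [H.leftEq_reas H.zig₂ d₄ d₅ (d₂ ⋆ d₃ ⋆ d₆) d₄ d₅ d₆]
  -- the pair `d₄`, `d₅` commutes with `φ[d₁, d₂, d₃]`, and then with `φ[d₁, d₂ ⋆ d₃, d₆]`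
  have h₃ := H.rightEq_reas (H.zig₂ ∘ₗ LinearMap.mulRight K φ[d₁, d₂, d₃]) (d₁ ⋆ (d₄ ⋆ d₅))
    (d₂ ⋆ d₃) d₆ d₁ (d₂ ⋆ d₃) d₆ (φ[d₄, d₅, d₆] * φ[d₁, d₄ ⋆ d₅, d₂ ⋆ d₃ ⋆ d₆])
  have h₄ := H.right_reas₂ (H.zig₂ ∘ₗ LinearMap.mulRight K
    (φ[d₁, d₂ ⋆ d₃, d₆] * φ[d₁, d₂, d₃])) d₁ (d₄ ⋆ d₅) (d₂ ⋆ d₃ ⋆ d₆) φ[d₄, d₅, d₆]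
  have h₅ := H.left_reas₂ (H.zig₂ ∘ₗ LinearMap.mulLeft K φ[d₄, d₅, d₆]) d₁ (d₂ ⋆ d₃) d₆
    φ[d₁, d₂, d₃]
  simp only [LinearMap.comp_apply, LinearMap.mulRight_apply, LinearMap.mulLeft_apply,
    mul_assoc] at h₃ h₄ h₅
  rw [h₃, h₄, h₅, zig₂_eval]

/-- The word for `γ` times `δ`; it is rebracketed by `reas_six₂`. -/
theorem zag₂_word : H.zag₂ (φ⁻[d₁, d₂, d₅] * (φ[d₄, d₁, d₂ ⋆ d₅] *
    (φ⁻[d₄ ⋆ d₁, d₂ ⋆ d₅, d₆ ⋆ d₃] * (φ[d₂ ⋆ d₅, d₆, d₃] * φ⁻[d₂, d₅, d₆])))) = 1 := by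
  have h₂₃ : LeftEq H.zag₂ (d₁ ⋆ d₂) H.triv := leftEq_star_map_left _ H.leftEq_zagLin _
  have h₁₄ : LeftEq H.zag₂ (d₄ ⋆ d₅) H.triv := leftEq_star_map_right _ H.leftEq_zagLin _
  have h₃₆ : RightEq H.zag₂ (d₂ ⋆ d₃) H.triv := rightEq_star_map_left _ H.rightEq_zagLin _
  have h₄₅ : RightEq H.zag₂ (d₅ ⋆ d₆) H.triv := rightEq_star_map_right _ H.rightEq_zagLin _
  have h₁ : LeftEq H.zag₂ (d₄ ⋆ (d₁ ⋆ d₂ ⋆ d₅)) H.triv :=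
    LeftEq.trans (g := d₄ ⋆ d₅) inferInstance h₁₄
  have h₂ : RightEq H.zag₂ (d₂ ⋆ (d₅ ⋆ d₆) ⋆ d₃) H.triv :=
    RightEq.trans (g := d₂ ⋆ d₃) inferInstance h₃₆
  have h := H.reas_six₂ (d₄ : G →ₐ[K] _) d₁ d₂ d₅ d₆ d₃
  rw [h, left_reas₁]
  simp only [← mul_assoc]
  rw [right_reas₃, H.rightEq_reasInv H.zag₂ d₁ (d₂ ⋆ (d₅ ⋆ d₆)) d₃ d₁ d₂ d₃]
  simp only [mul_assoc]
  rw [H.leftEq_reasInv H.zag₂ d₄ (d₁ ⋆ d₂ ⋆ d₅) d₆ d₄ d₅ d₆]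
  -- the pair `d₁`, `d₂` commutes with `φ⁻[d₄, d₅, d₆]`, and then with `φ⁻[d₄, d₅ ⋆ d₆, d₃]`
  have h₃ := H.leftEq_reasInv (H.zag₂ ∘ₗ LinearMap.mulLeft K φ⁻[d₄, d₅, d₆]) d₄
    (d₁ ⋆ d₂ ⋆ d₅ ⋆ d₆) d₃ d₄ (d₅ ⋆ d₆) d₃
    (φ⁻[d₁ ⋆ d₂, d₅, d₆] * (φ⁻[d₁, d₂, d₅ ⋆ d₆] * φ⁻[d₁, d₂, d₃]))
  have h₄ := H.left_reasInv₁ (H.zag₂ ∘ₗ LinearMap.mulLeft K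
    (φ⁻[d₄, d₅, d₆] * φ⁻[d₄, d₅ ⋆ d₆, d₃])) (d₁ ⋆ d₂) d₅ d₆
    (φ⁻[d₁, d₂, d₅ ⋆ d₆] * φ⁻[d₁, d₂, d₃])
  have h₅ := H.right_reasInv₃ (H.zag₂ ∘ₗ LinearMap.mulRight K φ⁻[d₁, d₂, d₃]) d₁ d₂ (d₅ ⋆ d₆)
    (φ⁻[d₄, d₅, d₆] * φ⁻[d₄, d₅ ⋆ d₆, d₃])
  have h₆ := H.right_reasInv₂ (H.zag₂ ∘ₗ LinearMap.mulRight K φ⁻[d₁, d₂, d₃]) d₄ (d₅ ⋆ d₆) d₃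
    φ⁻[d₄, d₅, d₆]
  simp only [LinearMap.comp_apply, LinearMap.mulRight_apply, LinearMap.mulLeft_apply,
    mul_assoc] at h₃ h₄ h₅ h₆
  rw [h₃, h₄, h₅, h₆, zag₂_eval]

theorem zigzag_Δ : (H.Δ.toLinearMap ⊛ (LinearMap.mulLeft K H.δ ∘ₗ unopLin H.SSop) ⊛
    (LinearMap.mulLeft K H.γ ∘ₗ H.Δ.toLinearMap)) (H.φ : G ⊗[K] (G ⊗[K] G)) = 1 := by
  rw [← zig₂_word H]
  have hγ : φ⁻[d₂, d₃, d₆] * φ[d₅, d₂, d₃ ⋆ d₆] =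
      lastTwo (φ⁻[e₁, e₂, e₄] * φ[e₃, e₁, e₂ ⋆ e₄]) := by
    simp only [map_mul, map_reas, map_reasInv, comp_star, lastTwo_e₁, lastTwo_e₂, lastTwo_e₃,
      lastTwo_e₄]
  have hδ : φ[d₁ ⋆ d₄, d₅, d₂] * φ⁻[d₁, d₄, d₅] =
      firstTwo (φ[e₁ ⋆ e₃, e₄, e₂] * φ⁻[e₁, e₃, e₄]) := by
    simp only [map_mul, map_reas, map_reasInv, comp_star, firstTwo_e₁, firstTwo_e₂, firstTwo_e₃,
      firstTwo_e₄]
  rw [← mul_assoc, hγ, hδ, reas]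
  suffices h : (H.Δ.toLinearMap ⊛ (LinearMap.mulLeft K H.δ ∘ₗ unopLin H.SSop) ⊛
      (LinearMap.mulLeft K H.γ ∘ₗ H.Δ.toLinearMap)) = H.zig₂ ∘ₗ
      LinearMap.mulLeft K (lastTwo (φ⁻[e₁, e₂, e₄] * φ[e₃, e₁, e₂ ⋆ e₄])) ∘ₗ
      LinearMap.mulRight K (firstTwo (φ[e₁ ⋆ e₃, e₄, e₂] * φ⁻[e₁, e₃, e₄])) ∘ₗ
      (pl (d₁ ⋆ d₄) (pl (d₅ ⋆ d₂) (d₃ ⋆ d₆))).toLinearMap from DFunLike.congr_fun h _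
  refine TensorProduct.ext_threefold' fun a b c => ?_
  simp only [mulTensor_tmul, LinearMap.comp_apply, LinearMap.mulLeft_apply,
    LinearMap.mulRight_apply, AlgHom.toLinearMap_apply, pl_tmul]
  have ha : (d₁ ⋆ d₄) a = firstTwo ((e₁ ⋆ e₃) a) := by
    rw [← AlgHom.comp_apply]
    simp only [comp_star, firstTwo_e₁, firstTwo_e₃]
  have hb : (d₅ ⋆ d₂) b = firstTwo ((e₄ ⋆ e₂) b) := by
    rw [← AlgHom.comp_apply]
    simp only [comp_star, firstTwo_e₂, firstTwo_e₄]
  have hc : (d₃ ⋆ d₆) c = lastTwo ((e₂ ⋆ e₄) c) := by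
    rw [← AlgHom.comp_apply]
    simp only [comp_star, lastTwo_e₂, lastTwo_e₄]
  rw [Commuting.eq (d₅ ⋆ d₂) (d₃ ⋆ d₆), ← mul_assoc ((d₁ ⋆ d₄) a),
    Commuting.eq (d₁ ⋆ d₄) (d₃ ⋆ d₆), ha, hb, hc]
  trans H.zig₂ (lastTwo (φ⁻[e₁, e₂, e₄] * φ[e₃, e₁, e₂ ⋆ e₄] * (e₂ ⋆ e₄) c) *
    firstTwo ((e₁ ⋆ e₃) a * ((e₄ ⋆ e₂) b * (φ[e₁ ⋆ e₃, e₄, e₂] * φ⁻[e₁, e₃, e₄]))))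
  · rw [zig₂_mul, coev₂_star_mul, coev₂_star_mul', ev₂_mul_star, ← γ_eq, ← δ_eq, unopLin_SSop]
    simp only [mul_assoc]
  · simp only [map_mul, mul_assoc]

theorem zigzag_inv_Δ : (unopLin H.SSop ⊛ (LinearMap.mulLeft K H.γ ∘ₗ H.Δ.toLinearMap) ⊛
    (LinearMap.mulLeft K H.δ ∘ₗ unopLin H.SSop)) (↑H.φ⁻¹ : G ⊗[K] (G ⊗[K] G)) = 1 := by
  rw [← zag₂_word H]
  have hγ : φ⁻[d₁, d₂, d₅] * φ[d₄, d₁, d₂ ⋆ d₅] =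
      firstTwo (φ⁻[e₁, e₂, e₄] * φ[e₃, e₁, e₂ ⋆ e₄]) := by
    simp only [map_mul, map_reas, map_reasInv, comp_star, firstTwo_e₁, firstTwo_e₂, firstTwo_e₃,
      firstTwo_e₄]
  have hδ : φ[d₂ ⋆ d₅, d₆, d₃] * φ⁻[d₂, d₅, d₆] =
      lastTwo (φ[e₁ ⋆ e₃, e₄, e₂] * φ⁻[e₁, e₃, e₄]) := by
    simp only [map_mul, map_reas, map_reasInv, comp_star, lastTwo_e₁, lastTwo_e₂, lastTwo_e₃,
      lastTwo_e₄]
  rw [← mul_assoc, hγ, hδ, reasInv]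
  suffices h : (unopLin H.SSop ⊛ (LinearMap.mulLeft K H.γ ∘ₗ H.Δ.toLinearMap) ⊛
      (LinearMap.mulLeft K H.δ ∘ₗ unopLin H.SSop)) = H.zag₂ ∘ₗ
      LinearMap.mulLeft K (firstTwo (φ⁻[e₁, e₂, e₄] * φ[e₃, e₁, e₂ ⋆ e₄])) ∘ₗ
      LinearMap.mulRight K (lastTwo (φ[e₁ ⋆ e₃, e₄, e₂] * φ⁻[e₁, e₃, e₄])) ∘ₗ
      (pl (d₄ ⋆ d₁) (pl (d₂ ⋆ d₅) (d₆ ⋆ d₃))).toLinearMap from DFunLike.congr_fun h _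
  refine TensorProduct.ext_threefold' fun a b c => ?_
  simp only [mulTensor_tmul, LinearMap.comp_apply, LinearMap.mulLeft_apply,
    LinearMap.mulRight_apply, AlgHom.toLinearMap_apply, pl_tmul]
  have ha : (d₄ ⋆ d₁) a = firstTwo ((e₃ ⋆ e₁) a) := by
    rw [← AlgHom.comp_apply]
    simp only [comp_star, firstTwo_e₁, firstTwo_e₃]
  have hb : (d₂ ⋆ d₅) b = firstTwo ((e₂ ⋆ e₄) b) := by
    rw [← AlgHom.comp_apply]
    simp only [comp_star, firstTwo_e₂, firstTwo_e₄]
  have hc : (d₆ ⋆ d₃) c = lastTwo ((e₄ ⋆ e₂) c) := by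
    rw [← AlgHom.comp_apply]
    simp only [comp_star, lastTwo_e₂, lastTwo_e₄]
  rw [← mul_assoc ((d₄ ⋆ d₁) a), Commuting.eq (d₄ ⋆ d₁) (d₂ ⋆ d₅), ha, hb, hc]
  trans H.zag₂ (firstTwo (φ⁻[e₁, e₂, e₄] * φ[e₃, e₁, e₂ ⋆ e₄] * (e₂ ⋆ e₄) b * (e₃ ⋆ e₁) a) *
    lastTwo ((e₄ ⋆ e₂) c * (φ[e₁ ⋆ e₃, e₄, e₂] * φ⁻[e₁, e₃, e₄])))
  · rw [zag₂_mul, coev₂_star_mul', ev₂_mul_star', ev₂_mul_star, ← γ_eq, ← δ_eq, unopLin_SSop]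
    simp only [mul_assoc]
  · simp only [map_mul, mul_assoc]

/-- The Drinfeld twist compares the antipode pushed forward along `Δ` with `(S ⊗ S) Δᵒᵖ`. -/
theorem antipodeAlong_SSop : H.AntipodeAlong H.Δ H.SSop H.γ H.δ where
  ev := H.isEv_Δ
  coev := H.isCoev_Δ
  zigzag := H.zigzag_Δ
  zigzag_inv := H.zigzag_inv_Δ

/-- The Drinfeld twist compares two antipodes along `Δ`: the image of `S` under `Δ`, and `(S ⊗ S)
Δᵒᵖ`. Its invertibility and its intertwining properties are those of such comparisons. -/
theorem f_eq : H.f = H.antipodeTwist H.Δ ((AlgHom.op H.Δ).comp H.Sop) H.SSop H.γ (H.Δ H.β) := by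
  rw [f, antipodeTwist, unopLin_SSop]
  refine DFunLike.congr_fun ?_ _
  refine TensorProduct.ext_threefold' fun a b c => ?_
  simp [mul_assoc]

theorem fInv_eq :
    H.fInv = H.antipodeTwist H.Δ H.SSop ((AlgHom.op H.Δ).comp H.Sop) (H.Δ H.α) H.δ := by
  rw [fInv, antipodeTwist, unopLin_SSop]
  refine DFunLike.congr_fun ?_ _
  refine TensorProduct.ext_threefold' fun a b c => ?_
  simp [mul_assoc]

theorem f_mul_fInv : H.f * H.fInv = 1 := by
  rw [f_eq, fInv_eq]
  exact antipodeTwist_mul_antipodeTwist H.antipodeAlong_SSop (H.antipodeAlong H.Δ)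

theorem fInv_mul_f : H.fInv * H.f = 1 := by
  rw [f_eq, fInv_eq]
  exact antipodeTwist_mul_antipodeTwist (H.antipodeAlong H.Δ) H.antipodeAlong_SSop

theorem f_mul_Δ_S (x : G) : H.f * H.Δ (H.S x) = H.SSΔop x * H.f := by
  rw [f_eq, ← unopLin_SSop]
  exact antipodeTwist_intertwines (H.antipodeAlong H.Δ).coev H.isEv_Δ x

theorem f_mul_Δ_α : H.f * H.Δ H.α = H.γ := by
  rw [f_eq]
  exact antipodeTwist_mul_α (H.antipodeAlong H.Δ) H.antipodeAlong_SSop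

theorem δ_mul_f : H.δ * H.f = H.Δ H.β := by
  rw [f_eq]
  exact β_mul_antipodeTwist (H.antipodeAlong H.Δ) H.antipodeAlong_SSop

end QuasiHopfAlgebra

/-! ### The Drinfeld twist and the reassociator -/

namespace QuasiBialgebra

variable {K : Type u} [Field K] {G : Type v} [Ring G] [Algebra K G] (H : QuasiBialgebra K G)
variable {B : Type*} [Ring B] [Algebra K B]

local infixl:72 " ⋆ " => star H
local notation "φ[" a ", " b ", " c "]" => reas H a b c
local notation "φ⁻[" a ", " b ", " c "]" => reasInv H a b c

attribute [local instance 10] Commuting.flip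

/-- Both sides are the canonical rebracketing `((t₃t₂)t₁)((ab)c) → t₃((t₂((t₁a)b))c)`; on the
right-hand side, the pair `t₁`, `a` is formed first. -/
theorem reas_six₃ (t₃ t₂ t₁ a b c : G →ₐ[K] B) [Commuting t₃ t₂] [Commuting t₃ t₁]
    [Commuting t₃ a] [Commuting t₃ b] [Commuting t₃ c] [Commuting t₂ t₁] [Commuting t₂ a]
    [Commuting t₂ b] [Commuting t₂ c] [Commuting t₁ a] [Commuting t₁ b] [Commuting t₁ c]
    [Commuting a b] [Commuting a c] [Commuting b c] :
    φ⁻[t₁, a, b] * (φ[t₂, t₁, a ⋆ b] * (φ⁻[t₂ ⋆ t₁, a ⋆ b, c] *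
      (φ[t₃, t₂ ⋆ t₁, a ⋆ b ⋆ c] * φ[t₃, t₂, t₁]))) =
    φ⁻[t₂, t₁ ⋆ a ⋆ b, c] * (φ[t₃, t₂, t₁ ⋆ a ⋆ b ⋆ c] * (φ⁻[t₁ ⋆ a, b, c] *
      (φ⁻[t₁, a, b ⋆ c] * (φ[t₃ ⋆ t₂, t₁, a ⋆ (b ⋆ c)] * φ[a, b, c])))) := by
  have e₁ : φ[t₃, t₂, t₁ ⋆ (a ⋆ b ⋆ c)] = _ :=
    H.reas_conj t₁ (a ⋆ b) c t₃ t₂ (t₁ ⋆ (a ⋆ b) ⋆ c) _ _ _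
  have e₂ : φ[t₃, t₂, t₁ ⋆ (a ⋆ b) ⋆ c] = _ :=
    H.reas_conj t₁ a b t₃ t₂ (t₁ ⋆ a ⋆ b ⋆ c) _ _ _
  have e₃ : φ⁻[t₂, t₁ ⋆ (a ⋆ b), c] = _ :=
    H.reasInv_conj t₁ a b t₂ (t₁ ⋆ a ⋆ b) c _ _ _
  have e₄ : φ[t₃ ⋆ t₂, t₁, a ⋆ b ⋆ c] = _ :=
    H.reas_conjInv a b c (t₃ ⋆ t₂) t₁ (a ⋆ (b ⋆ c)) _ _ _
  simp [H.reas_mid t₃ t₂ t₁ (a ⋆ b ⋆ c), H.reasInv_right t₂ t₁ (a ⋆ b) c,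
    H.reasInv_left t₁ a b c, e₁, e₂, e₃, e₄, mul_assoc]

end QuasiBialgebra

namespace QuasiHopfAlgebra

open QuasiBialgebra

variable {K : Type u} [Field K] {G : Type v} [Ring G] [Algebra K G] (H : QuasiHopfAlgebra K G)
variable {A B C : Type*} [Ring A] [Algebra K A] [Ring B] [Algebra K B] [Ring C] [Algebra K C]

local infixl:72 " ⋆ " => QuasiBialgebra.star (toQuasiBialgebra H)
local notation "φ[" a ", " b ", " c "]" => reas (toQuasiBialgebra H) a b c
local notation "φ⁻[" a ", " b ", " c "]" => reasInv (toQuasiBialgebra H) a b c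

attribute [local instance 10] Commuting.flip

/-- The antipode followed by the leg `a`, as a leg of the opposite algebra. -/
abbrev opLeg (a : G →ₐ[K] B) : G →ₐ[K] Bᵐᵒᵖ := (AlgHom.op a).comp H.Sop

/-- Three copies of `S(x*) α x`. -/
def ev₃ : (G ⊗[K] G) ⊗[K] ((G ⊗[K] G) ⊗[K] (G ⊗[K] G)) →ₗ[K] G ⊗[K] (G ⊗[K] G) :=
  TensorProduct.map H.evLin H.ev₂

/-- The legs `x*`, `x` of the three copies of `S(x*) α x`. -/
abbrev t₁ : G →ₐ[K] (G ⊗[K] G) ⊗[K] ((G ⊗[K] G) ⊗[K] (G ⊗[K] G)) := iL.comp iL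
abbrev x₁ : G →ₐ[K] (G ⊗[K] G) ⊗[K] ((G ⊗[K] G) ⊗[K] (G ⊗[K] G)) := iL.comp iR
abbrev t₂ : G →ₐ[K] (G ⊗[K] G) ⊗[K] ((G ⊗[K] G) ⊗[K] (G ⊗[K] G)) := iR.comp e₁
abbrev x₂ : G →ₐ[K] (G ⊗[K] G) ⊗[K] ((G ⊗[K] G) ⊗[K] (G ⊗[K] G)) := iR.comp e₂
abbrev t₃ : G →ₐ[K] (G ⊗[K] G) ⊗[K] ((G ⊗[K] G) ⊗[K] (G ⊗[K] G)) := iR.comp e₃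
abbrev x₃ : G →ₐ[K] (G ⊗[K] G) ⊗[K] ((G ⊗[K] G) ⊗[K] (G ⊗[K] G)) := iR.comp e₄

theorem ev₃_mul_pl (w) (d : G ⊗[K] (G ⊗[K] G)) : H.ev₃ (w * pl x₁ (pl x₂ x₃) d) = H.ev₃ w * d := by
  suffices h : ((LinearMap.mul K _).compl₁₂ LinearMap.id
    (pl x₁ (pl x₂ x₃)).toLinearMap).compr₂ H.ev₃ =
    (LinearMap.mul K _).compl₁₂ H.ev₃ LinearMap.id from
    DFunLike.congr_fun (DFunLike.congr_fun h w) d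
  ext
  simp [ev₃, ev₂, evLin, mul_assoc]

theorem ev₃_mul_pl' (w) (d : G ⊗[K] (G ⊗[K] G)) : H.ev₃ (w * pl t₃ (pl t₂ t₁) d) =
    (pl (H.opLeg (iR.comp iR)) (pl (H.opLeg (iR.comp iL)) (H.opLeg iL)) d).unop * H.ev₃ w := by
  suffices h : ((LinearMap.mul K _).compl₁₂ LinearMap.id
    (pl t₃ (pl t₂ t₁)).toLinearMap).compr₂ H.ev₃ =
    ((LinearMap.mul K _).compl₁₂ (unopLin (pl (H.opLeg (iR.comp iR)) (pl (H.opLeg (iR.comp iL))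
      (H.opLeg iL)))) H.ev₃).flip from
    DFunLike.congr_fun (DFunLike.congr_fun h w) d
  ext
  simp [ev₃, ev₂, evLin, mul_assoc, S_mul]

theorem ev₃_mul_right (z : G ⊗[K] G) (u : (G ⊗[K] G) ⊗[K] (G ⊗[K] G)) :
    H.ev₃ (iR u * iL z) = iR (H.ev₂ u) * iL (H.evLin z) := by
  simp [ev₃]

theorem ev₃_mul_left (z : G ⊗[K] G) (u : (G ⊗[K] G) ⊗[K] (G ⊗[K] G)) :
    H.ev₃ (leg12 u * iR (iR z)) = leg12 (H.ev₂ u) * iR (iR (H.evLin z)) := by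
  induction u using TensorProduct.induction_on with
  | zero => simp
  | add x y hx hy => simp only [map_add, add_mul, hx, hy]
  | tmul a b => simp [ev₃, ev₂, leg12]

theorem f_mul_evLin (p q : G) : H.f * H.Δ (H.evLin (p ⊗ₜ q)) =
    H.ev₂ (φ⁻[e₁, e₂, e₄] * φ[e₃, e₁, e₂ ⋆ e₄] * ((e₃ ⋆ e₁) p * (e₂ ⋆ e₄) q)) := by
  rw [← mul_assoc (_ * φ[e₃, e₁, e₂ ⋆ e₄]), ev₂_mul_star, ev₂_mul_star', ← γ_eq, ← f_mul_Δ_α,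
    ← mul_assoc (H.SSΔop p), ← f_mul_Δ_S]
  simp [evLin, mul_assoc]

/-- Two pairs, the first of which is doubled. -/
def doubleFst : (G ⊗[K] G) ⊗[K] (G ⊗[K] G) →ₐ[K]
    (G ⊗[K] G) ⊗[K] ((G ⊗[K] G) ⊗[K] (G ⊗[K] G)) :=
  pl (pl (t₂ ⋆ t₁) (x₁ ⋆ x₂)) (pl t₃ x₃)

/-- Two pairs, the second of which is doubled. -/
def doubleSnd : (G ⊗[K] G) ⊗[K] (G ⊗[K] G) →ₐ[K]
    (G ⊗[K] G) ⊗[K] ((G ⊗[K] G) ⊗[K] (G ⊗[K] G)) :=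
  pl (pl t₁ x₁) (pl (t₃ ⋆ t₂) (x₂ ⋆ x₃))

/-- The coproduct of the first factor of an evaluation of two pairs is, up to the twist `f`, an
evaluation of three pairs. -/
theorem leg12_f_mul (w : (G ⊗[K] G) ⊗[K] (G ⊗[K] G)) :
    leg12 H.f * pl (iL ⋆ iR.comp iL) (iR.comp iR) (H.ev₂ w) =
      H.ev₃ (φ⁻[t₁, x₁, x₂] * φ[t₂, t₁, x₁ ⋆ x₂] * H.doubleFst w) := by
  induction w using TensorProduct.induction_on with
  | zero => simp
  | add x y hx hy => simp only [map_add, mul_add, hx, hy]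
  | tmul y z =>
    induction y using TensorProduct.induction_on with
    | zero => simp
    | add x y hx hy => simp only [map_add, mul_add, TensorProduct.add_tmul, hx, hy]
    | tmul p q =>
      have h₁ : (iL ⋆ iR.comp iL : G →ₐ[K] G ⊗[K] (G ⊗[K] G)) = leg12.comp H.Δ := by
        rw [QuasiBialgebra.star]; congr 1
        exact tensorHom_ext (by ext; simp [leg12, Algebra.TensorProduct.one_def])
          (by ext; simp [leg12])
      have h₂ : φ⁻[t₁, x₁, x₂] * φ[t₂, t₁, x₁ ⋆ x₂] * ((t₂ ⋆ t₁) p * (x₁ ⋆ x₂) q) =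
         leg12 (φ⁻[e₁, e₂, e₄] * φ[e₃, e₁, e₂ ⋆ e₄] * ((e₃ ⋆ e₁) p * (e₂ ⋆ e₄) q)) := by
        have k₁ : leg12.comp (e₁ : G →ₐ[K] _) = t₁ := by
          ext; simp [leg12, Algebra.TensorProduct.one_def]
        have k₂ : leg12.comp (e₂ : G →ₐ[K] _) = x₁ := by
          ext; simp [leg12, Algebra.TensorProduct.one_def]
        have k₃ : leg12.comp (e₃ : G →ₐ[K] _) = t₂ := by
          ext; simp [leg12, Algebra.TensorProduct.one_def]
        have k₄ : leg12.comp (e₄ : G →ₐ[K] _) = x₂ := by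
          ext; simp [leg12, Algebra.TensorProduct.one_def]
        simp only [map_mul, map_reas, map_reasInv, comp_star, k₁, k₂, k₃, k₄, ← AlgHom.comp_apply]
      have h₃ : pl t₃ x₃ z = iR (iR z) := by
        refine (eq_pl_apply (h := iR.comp iR) ?_ ?_ z).symm <;> rfl
      rw [doubleFst, pl_tmul, pl_tmul, h₃, ← mul_assoc, h₂, ev₃_mul_left, ← f_mul_evLin, ev₂,
        TensorProduct.map_tmul, pl_tmul, h₁, ← mul_assoc, AlgHom.comp_apply, map_mul]
      rfl

/-- The mirror image of `leg12_f_mul`. -/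
theorem iR_f_mul (w : (G ⊗[K] G) ⊗[K] (G ⊗[K] G)) :
    iR H.f * pl iL (iR.comp iL ⋆ iR.comp iR) (H.ev₂ w) =
      H.ev₃ (φ⁻[t₂, x₂, x₃] * φ[t₃, t₂, x₂ ⋆ x₃] * H.doubleSnd w) := by
  induction w using TensorProduct.induction_on with
  | zero => simp
  | add x y hx hy => simp only [map_add, mul_add, hx, hy]
  | tmul z y =>
    induction y using TensorProduct.induction_on with
    | zero => simp
    | add x y hx hy => simp only [map_add, mul_add, TensorProduct.tmul_add, hx, hy]
    | tmul p q =>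
      have h₁ : (iR.comp iL ⋆ iR.comp iR : G →ₐ[K] G ⊗[K] (G ⊗[K] G)) = iR.comp H.Δ := by
        rw [← comp_star, QuasiBialgebra.star, pl_iL_iR, AlgHom.id_comp]
      have h₂ : φ⁻[t₂, x₂, x₃] * φ[t₃, t₂, x₂ ⋆ x₃] * ((t₃ ⋆ t₂) p * (x₂ ⋆ x₃) q) =
         iR (φ⁻[e₁, e₂, e₄] * φ[e₃, e₁, e₂ ⋆ e₄] * ((e₃ ⋆ e₁) p * (e₂ ⋆ e₄) q)) := by
        simp only [map_mul, map_reas, map_reasInv, comp_star, ← AlgHom.comp_apply]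
      have h₃ : pl t₁ x₁ z = iL z := by
        refine (eq_pl_apply (h := iL) ?_ ?_ z).symm <;> rfl
      rw [doubleSnd, pl_tmul, Commuting.eq (pl t₁ x₁) (pl (t₃ ⋆ t₂) (x₂ ⋆ x₃)), pl_tmul, h₃,
        ← mul_assoc, h₂, ev₃_mul_right, ← f_mul_evLin, ev₂,
        TensorProduct.map_tmul, pl_tmul, h₁, Commuting.eq iL (iR.comp H.Δ), ← mul_assoc,
        AlgHom.comp_apply, map_mul]

/-- The images of `γ` under the two iterated coproducts. -/
theorem γ_compat : (φ[H.opLeg (iR.comp iR), H.opLeg (iR.comp iL), H.opLeg iL]).unop *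
      (leg12 H.f * pl (iL ⋆ iR.comp iL) (iR.comp iR) H.γ) =
    iR H.f * pl iL (iR.comp iL ⋆ iR.comp iR) H.γ * φ[iL, iR.comp iL, iR.comp iR] := by
  have k : LeftEq H.ev₃ (t₁ ⋆ x₁) H.triv := leftEq_star_map_left _ H.leftEq_evLin _
  have h₁ : H.doubleFst (φ⁻[e₁, e₂, e₄] * φ[e₃, e₁, e₂ ⋆ e₄]) =
      φ⁻[t₂ ⋆ t₁, x₁ ⋆ x₂, x₃] * φ[t₃, t₂ ⋆ t₁, x₁ ⋆ x₂ ⋆ x₃] := by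
    have k₁ : H.doubleFst.comp e₁ = t₂ ⋆ t₁ := by rw [doubleFst, ← AlgHom.comp_assoc]; simp
    have k₂ : H.doubleFst.comp e₂ = x₁ ⋆ x₂ := by rw [doubleFst, ← AlgHom.comp_assoc]; simp
    have k₃ : H.doubleFst.comp e₃ = t₃ := by rw [doubleFst, ← AlgHom.comp_assoc]; simp
    have k₄ : H.doubleFst.comp e₄ = x₃ := by rw [doubleFst, ← AlgHom.comp_assoc]; simp
    simp only [map_mul, map_reas, map_reasInv, comp_star, k₁, k₂, k₃, k₄]
  have h₂ : H.doubleSnd (φ⁻[e₁, e₂, e₄] * φ[e₃, e₁, e₂ ⋆ e₄]) =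
      φ⁻[t₁, x₁, x₂ ⋆ x₃] * φ[t₃ ⋆ t₂, t₁, x₁ ⋆ (x₂ ⋆ x₃)] := by
    have k₁ : H.doubleSnd.comp e₁ = t₁ := by rw [doubleSnd, ← AlgHom.comp_assoc]; simp
    have k₂ : H.doubleSnd.comp e₂ = x₁ := by rw [doubleSnd, ← AlgHom.comp_assoc]; simp
    have k₃ : H.doubleSnd.comp e₃ = t₃ ⋆ t₂ := by rw [doubleSnd, ← AlgHom.comp_assoc]; simp
    have k₄ : H.doubleSnd.comp e₄ = x₂ ⋆ x₃ := by rw [doubleSnd, ← AlgHom.comp_assoc]; simp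
    simp only [map_mul, map_reas, map_reasInv, comp_star, k₁, k₂, k₃, k₄]
  have h₃ : H.ev₃ (φ⁻[t₁, x₁, x₂] * φ[t₂, t₁, x₁ ⋆ x₂] *
      (φ⁻[t₂ ⋆ t₁, x₁ ⋆ x₂, x₃] * φ[t₃, t₂ ⋆ t₁, x₁ ⋆ x₂ ⋆ x₃]) * φ[t₃, t₂, t₁]) =
      H.ev₃ (φ⁻[t₂, x₂, x₃] * φ[t₃, t₂, x₂ ⋆ x₃] *
      (φ⁻[t₁, x₁, x₂ ⋆ x₃] * φ[t₃ ⋆ t₂, t₁, x₁ ⋆ (x₂ ⋆ x₃)]) * φ[x₁, x₂, x₃]) := by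
    simp only [mul_assoc]
    rw [reas_six₃, H.leftEq_reasInv H.ev₃ t₂ (t₁ ⋆ x₁ ⋆ x₂) x₃ t₂ x₂ x₃]
    have h₄ := H.leftEq_reas (H.ev₃ ∘ₗ LinearMap.mulLeft K φ⁻[t₂, x₂, x₃]) t₃ t₂
      (t₁ ⋆ x₁ ⋆ x₂ ⋆ x₃) t₃ t₂ (x₂ ⋆ x₃) (φ⁻[t₁ ⋆ x₁, x₂, x₃] * (φ⁻[t₁, x₁, x₂ ⋆ x₃] *
      (φ[t₃ ⋆ t₂, t₁, x₁ ⋆ (x₂ ⋆ x₃)] * φ[x₁, x₂, x₃])))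
    have h₅ := H.left_reasInv₁ (H.ev₃ ∘ₗ LinearMap.mulLeft K (φ⁻[t₂, x₂, x₃] *
      φ[t₃, t₂, x₂ ⋆ x₃])) (t₁ ⋆ x₁) x₂ x₃ (φ⁻[t₁, x₁, x₂ ⋆ x₃] *
      (φ[t₃ ⋆ t₂, t₁, x₁ ⋆ (x₂ ⋆ x₃)] * φ[x₁, x₂, x₃]))
    simp only [LinearMap.comp_apply, LinearMap.mulLeft_apply, mul_assoc] at h₄ h₅
    rw [h₄, h₅]
  rw [γ_eq, leg12_f_mul, iR_f_mul, h₁, h₂, reas_legs, ← ev₃_mul_pl, reas, ← ev₃_mul_pl']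
  exact h₃

/-- The Drinfeld twist at two legs carries the antipode of their convolution to the convolution
of their antipodes. -/
instance intw_op_f (a b : G →ₐ[K] B) [Commuting a b] :
    Intw (MulOpposite.op (pl a b H.f)) (H.opLeg b ⋆ H.opLeg a) (H.opLeg (a ⋆ b)) :=
  ⟨fun x => MulOpposite.unop_injective <| by
    have h := congrArg (pl a b) (H.f_mul_Δ_S x)
    rw [map_mul, map_mul] at h
    have h₁ : ((H.opLeg b ⋆ H.opLeg a) x).unop = pl a b (H.SSΔop x) := by
      rw [← unopLin_SSop, unopLin_apply, SSop]
      have : H.opLeg b ⋆ H.opLeg a = (AlgHom.op (pl a b)).comp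
          (((AlgHom.op iR).comp H.Sop) ⋆ ((AlgHom.op iL).comp H.Sop)) := by
        rw [comp_star]
        congr 1 <;> ext <;> simp
      rw [this]; rfl
    rw [MulOpposite.unop_mul, MulOpposite.unop_mul, h₁, MulOpposite.unop_op, ← h]
    rfl⟩

instance intw_op_reas (a b c : G →ₐ[K] B) [Commuting a b] [Commuting a c] [Commuting b c] :
    Intw (MulOpposite.op φ[a, b, c]) (H.opLeg (a ⋆ (b ⋆ c))) (H.opLeg (a ⋆ b ⋆ c)) :=
  ⟨fun x => MulOpposite.unop_injective ((H.intw_reas a b c).eq (H.S x)).symm⟩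

instance (a b : G →ₐ[K] B) (c : G →ₐ[K] B) [Commuting a b] [Commuting a c] [Commuting b c]
    (w : G ⊗[K] G) : Intw (MulOpposite.op (pl a b w)) (H.opLeg c) (H.opLeg c) :=
  ⟨fun x => MulOpposite.unop_injective (Commuting.eq (pl a b) c w (H.S x)).symm⟩

/-- Two invertible elements that intertwine `s` with `s'` coincide if they agree on `α`. -/
theorem _root_.QH.QuasiBialgebra.AntipodeAlong.eq_of {H : QuasiBialgebra K G} {θ : G →ₐ[K] B}
    {s s' : G →ₐ[K] Bᵐᵒᵖ} {α β u u' v : B} (h : H.AntipodeAlong θ s α β) (hv : v * u' = 1)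
    (hv' : u' * v = 1) (hu : Intw (MulOpposite.op u) s' s) (hu' : Intw (MulOpposite.op u') s' s)
    (hα : u * α = u' * α) : u = u' := by
  have k : ∀ x, u * (s x).unop = (s' x).unop * u := fun x =>
    (congrArg MulOpposite.unop (hu.eq x)).symm
  have k' : ∀ x, u' * (s x).unop = (s' x).unop * u' := fun x =>
    (congrArg MulOpposite.unop (hu'.eq x)).symm
  have k'' : ∀ x, v * (s' x).unop = (s x).unop * v := fun x => by
    rw [← mul_one (v * _), ← hv', mul_assoc, ← mul_assoc _ u', ← k', ← mul_assoc, ← mul_assoc,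
      hv, one_mul]
  have e := h.eq_one (c := v * u) (fun x => by
    simp only [unopLin_apply]
    rw [mul_assoc, k, ← mul_assoc, k'', mul_assoc]) (by
    rw [mul_assoc, hα, ← mul_assoc, hv, one_mul])
  rw [← one_mul u, ← hv', mul_assoc, e, mul_one]

theorem pl_γ_compat (a b c : G →ₐ[K] B) [Commuting a b] [Commuting a c] [Commuting b c] :
    (φ[H.opLeg c, H.opLeg b, H.opLeg a]).unop * (pl a b H.f * pl (a ⋆ b) c H.γ) =
      pl b c H.f * pl a (b ⋆ c) H.γ * φ[a, b, c] := by
  have h := congrArg (pl a (pl b c)) H.γ_compat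
  have p₁ : leg12 H.f = pl iL (iR.comp iL) H.f :=
    eq_pl_apply (h := (leg12 : G ⊗[K] G →ₐ[K] G ⊗[K] (G ⊗[K] G)))
      (by ext; simp [leg12, Algebra.TensorProduct.one_def]) (by ext; simp [leg12]) _
  have p₂ : iR H.f = pl (iR.comp iL) (iR.comp iR) H.f :=
    eq_pl_apply (h := (iR : G ⊗[K] G →ₐ[K] G ⊗[K] (G ⊗[K] G))) rfl rfl _
  rw [p₁, p₂] at h
  have k₃ : (pl a (pl b c)).comp (iR.comp iL) = b := by ext; simp
  have k₄ : (pl a (pl b c)).comp (iR.comp iR) = c := by ext; simp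
  have k₅ : (pl a (pl b c)).comp iL = a := by simp
  have k₆ : (pl a (pl b c)) (φ[H.opLeg (iR.comp iR), H.opLeg (iR.comp iL), H.opLeg iL]).unop =
      (φ[H.opLeg c, H.opLeg b, H.opLeg a]).unop := by
    have l₁ : (AlgHom.op (pl a (pl b c))).comp (H.opLeg iL) = H.opLeg a := by
      ext; simp
    have l₂ : (AlgHom.op (pl a (pl b c))).comp (H.opLeg (iR.comp iL)) = H.opLeg b := by
      ext; simp
    have l₃ : (AlgHom.op (pl a (pl b c))).comp (H.opLeg (iR.comp iR)) = H.opLeg c := by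
      ext; simp
    have l := H.map_reas (H.opLeg (iR.comp iR)) (H.opLeg (iR.comp iL)) (H.opLeg iL)
      (AlgHom.op (pl a (pl b c)))
    simp only [l₁, l₂, l₃] at l
    rw [← l]; rfl
  simp only [map_mul, map_pl, map_reas, comp_star, k₃, k₄, k₅, k₆] at h
  exact h

/-- The Drinfeld twist is a twist of the reassociator into its image under the antipode. -/
theorem f_compat (a b c : G →ₐ[K] B) [Commuting a b] [Commuting a c] [Commuting b c] :
    (φ[H.opLeg c, H.opLeg b, H.opLeg a]).unop * (pl a b H.f * pl (a ⋆ b) c H.f) =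
      pl b c H.f * pl a (b ⋆ c) H.f * φ[a, b, c] := by
  refine (H.antipodeAlong (a ⋆ b ⋆ c)).eq_of (s' := H.opLeg c ⋆ H.opLeg b ⋆ H.opLeg a)
    (v := φ⁻[a, b, c] * (pl a (b ⋆ c) H.fInv * pl b c H.fInv)) ?_ ?_ ?_ ?_ ?_
  · calc _ = φ⁻[a, b, c] * (pl a (b ⋆ c) H.fInv * (pl b c (H.fInv * H.f)) *
          pl a (b ⋆ c) H.f) * φ[a, b, c] := by simp only [map_mul, mul_assoc]
      _ = 1 := by rw [fInv_mul_f, map_one, mul_one, ← map_mul, fInv_mul_f, map_one, mul_one,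
        reasInv_mul_reas]
  · calc _ = pl b c H.f * (pl a (b ⋆ c) H.f * (φ[a, b, c] * φ⁻[a, b, c]) *
          pl a (b ⋆ c) H.fInv) * pl b c H.fInv := by simp only [mul_assoc]
      _ = 1 := by rw [reas_mul_reasInv, mul_one, ← map_mul, f_mul_fInv, map_one, mul_one,
        ← map_mul, f_mul_fInv, map_one]
  · rw [MulOpposite.op_mul, MulOpposite.op_mul, MulOpposite.op_unop]
    have i₁ : Intw (MulOpposite.op (pl a b H.f)) (H.opLeg c ⋆ (H.opLeg b ⋆ H.opLeg a))
      (H.opLeg c ⋆ H.opLeg (a ⋆ b)) := inferInstance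
    exact Intw.mul (Intw.mul inferInstance i₁) inferInstance
  · rw [MulOpposite.op_mul, MulOpposite.op_mul]
    have i₁ : Intw (MulOpposite.op (pl b c H.f)) (H.opLeg c ⋆ H.opLeg b ⋆ H.opLeg a)
      (H.opLeg (b ⋆ c) ⋆ H.opLeg a) := inferInstance
    exact Intw.mul (H.intw_op_reas a b c) (Intw.mul inferInstance i₁)
  · have e₁ : pl (a ⋆ b) c H.f * (a ⋆ b ⋆ c) H.α = pl (a ⋆ b) c H.γ := by
      rw [star_apply H.toQuasiBialgebra (a ⋆ b) c, ← map_mul, f_mul_Δ_α]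
    have e₂ : pl a (b ⋆ c) H.f * (a ⋆ (b ⋆ c)) H.α = pl a (b ⋆ c) H.γ := by
      rw [star_apply H.toQuasiBialgebra a (b ⋆ c), ← map_mul, f_mul_Δ_α]
    rw [mul_assoc _ _ ((a ⋆ b ⋆ c) H.α), mul_assoc _ _ ((a ⋆ b ⋆ c) H.α), e₁,
      mul_assoc _ _ ((a ⋆ b ⋆ c) H.α), (H.intw_reas a b c).eq, ← mul_assoc (_ * _) _ φ[a, b, c],
      mul_assoc _ _ ((a ⋆ (b ⋆ c)) H.α), e₂]
    exact H.pl_γ_compat a b c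

end QuasiHopfAlgebra

/-! ### The element `Φ` and the inverse antipode -/

namespace QuasiBialgebra

variable {K : Type u} [Field K] {G : Type v} [Ring G] [Algebra K G] (H : QuasiBialgebra K G)
variable {B : Type*} [Ring B] [Algebra K B]

local infixl:72 " ⋆ " => QuasiBialgebra.star H
local notation "φ[" a ", " b ", " c "]" => reas H a b c
local notation "φ⁻[" a ", " b ", " c "]" => reasInv H a b c

attribute [local instance 10] Commuting.flip

section
variable (l₁ l₂ l₃ l₄ l₅ : G →ₐ[K] B) [Commuting l₁ l₂] [Commuting l₁ l₃] [Commuting l₁ l₄]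
  [Commuting l₁ l₅] [Commuting l₂ l₃] [Commuting l₂ l₄] [Commuting l₂ l₅] [Commuting l₃ l₄]
  [Commuting l₃ l₅] [Commuting l₄ l₅]

/-- The inverse of `Φ`, placed at five commuting legs. -/
def reasΦInv : B := φ[l₁ ⋆ l₂ ⋆ l₃, l₄, l₅] * (φ⁻[l₁, l₂, l₃] * φ⁻[l₁, l₂ ⋆ l₃, l₄])

theorem pl_midΔ (w : G ⊗[K] (G ⊗[K] G)) :
    pl l₁ (pl l₂ (pl l₃ (pl l₄ l₅))) (H.midΔ w) = pl l₁ (pl (l₂ ⋆ l₃) l₄) w := by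
  rw [← pl_map_assoc_map_Δ]
  suffices h : (pl l₁ (pl l₂ (pl l₃ (pl l₄ l₅)))).comp (Algebra.TensorProduct.map (AlgHom.id K G)
      (leg123 (K := K) (A := G))) = pl l₁ (pl l₂ (pl l₃ l₄)) by
    rw [← h, midΔ, AlgHom.comp_apply, ← AlgHom.comp_apply (Algebra.TensorProduct.map _ _),
      ← Algebra.TensorProduct.map_comp, AlgHom.id_comp]
  refine tensorHom_ext (by ext; simp [Algebra.TensorProduct.one_def, leg123]) ?_
  rw [pl_comp_iR]
  ext x
  · simp [leg123, Algebra.TensorProduct.one_def]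
  · simp [leg123, Algebra.TensorProduct.one_def]
  · simp [leg123, Algebra.TensorProduct.one_def]

theorem pl_pad₃ (w : G ⊗[K] (G ⊗[K] G)) :
    pl l₁ (pl l₂ (pl l₃ (pl l₄ l₅))) (pad₃ w) = pl l₁ (pl l₂ l₃) w := by
  refine eq_pl₃ l₁ l₂ l₃ (h := (pl l₁ (pl l₂ (pl l₃ (pl l₄ l₅)))).comp pad₃) ?_ ?_ ?_ _
  · ext; simp [pad₃, Algebra.TensorProduct.one_def]
  · ext; simp [pad₃, Algebra.TensorProduct.one_def]
  · ext; simp [pad₃, Algebra.TensorProduct.one_def]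

theorem pl_δ₂ (x : G) : pl l₁ (pl l₂ l₃) (H.δ₂ x) = (l₁ ⋆ l₂ ⋆ l₃) x := by
  refine eq_pl_apply (h := ((pl l₁ (pl l₂ l₃)).comp
    (Algebra.TensorProduct.assoc K K K G G G).toAlgHom).comp
    (Algebra.TensorProduct.map H.Δ (AlgHom.id K G))) ?_ ?_ _
  · rw [QuasiBialgebra.star, AlgHom.comp_assoc]
    have : (Algebra.TensorProduct.map H.Δ (AlgHom.id K G)).comp (iL : G →ₐ[K] G ⊗[K] G)
        = iL.comp H.Δ := by ext; simp
    rw [this, ← AlgHom.comp_assoc]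
    congr 1
    exact tensorHom_ext (by ext; simp) (by ext; simp)
  · ext; simp [Algebra.TensorProduct.one_def]

theorem pl_δ₂₁₁ (w : G ⊗[K] (G ⊗[K] G)) :
    pl l₁ (pl l₂ (pl l₃ (pl l₄ l₅))) (H.δ₂₁₁ w) = pl (l₁ ⋆ l₂ ⋆ l₃) (pl l₄ l₅) w := by
  refine eq_pl_apply (h := (pl l₁ (pl l₂ (pl l₃ (pl l₄ l₅)))).comp H.δ₂₁₁) ?_ ?_ _
  · have h₁ : H.δ₂₁₁.comp (iL : G →ₐ[K] G ⊗[K] (G ⊗[K] G)) =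
      (Algebra.TensorProduct.map (AlgHom.id K G) (Algebra.TensorProduct.map (AlgHom.id K G)
        (Algebra.TensorProduct.includeLeft : G →ₐ[K] G ⊗[K] (G ⊗[K] G)))).comp H.δ₂ := by
      suffices h : ((Algebra.TensorProduct.map (AlgHom.id K G)
        (Algebra.TensorProduct.assoc K K K G G (G ⊗[K] G)).toAlgHom).comp
        (Algebra.TensorProduct.assoc K K K G (G ⊗[K] G) (G ⊗[K] G)).toAlgHom).comp iL =
        (Algebra.TensorProduct.map (AlgHom.id K G) (Algebra.TensorProduct.map (AlgHom.id K G)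
        (Algebra.TensorProduct.includeLeft : G →ₐ[K] G ⊗[K] (G ⊗[K] G)))) by
        rw [← h]; ext; simp [δ₂₁₁]
      ext <;> simp [Algebra.TensorProduct.one_def]
    ext x
    rw [AlgHom.comp_assoc, h₁, ← pl_δ₂, AlgHom.comp_apply, AlgHom.comp_apply]
    exact pl_pad₃ l₁ l₂ l₃ l₄ l₅ _
  · ext <;> simp [δ₂₁₁, Algebra.TensorProduct.one_def]

theorem pl_ΦInv : pl l₁ (pl l₂ (pl l₃ (pl l₄ l₅)))
    (↑H.Φ⁻¹ : G ⊗[K] (G ⊗[K] (G ⊗[K] (G ⊗[K] G)))) = H.reasΦInv l₁ l₂ l₃ l₄ l₅ := by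
  have h : (↑H.Φ⁻¹ : G ⊗[K] (G ⊗[K] (G ⊗[K] (G ⊗[K] G)))) =
      H.δ₂₁₁ (H.φ : G ⊗[K] (G ⊗[K] G)) * (pad₃ (↑H.φ⁻¹ : G ⊗[K] (G ⊗[K] G)) *
      H.midΔ (↑H.φ⁻¹ : G ⊗[K] (G ⊗[K] G))) := by
    simp [Φ, ← map_inv]
  rw [h, map_mul, map_mul, pl_δ₂₁₁, pl_pad₃, pl_midΔ]
  rfl

theorem reasΦInv_intw (x : G) : H.reasΦInv l₁ l₂ l₃ l₄ l₅ * (l₁ ⋆ (l₂ ⋆ l₃ ⋆ l₄) ⋆ l₅) x =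
    (l₁ ⋆ l₂ ⋆ l₃ ⋆ (l₄ ⋆ l₅)) x * H.reasΦInv l₁ l₂ l₃ l₄ l₅ := by
  have i₁ : Intw φ⁻[l₁, l₂ ⋆ l₃, l₄] (l₁ ⋆ (l₂ ⋆ l₃ ⋆ l₄) ⋆ l₅) (l₁ ⋆ (l₂ ⋆ l₃) ⋆ l₄ ⋆ l₅) :=
    inferInstance
  have i₂ : Intw φ⁻[l₁, l₂, l₃] (l₁ ⋆ (l₂ ⋆ l₃) ⋆ l₄ ⋆ l₅) (l₁ ⋆ l₂ ⋆ l₃ ⋆ l₄ ⋆ l₅) :=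
    inferInstance
  exact ((H.intw_reas (l₁ ⋆ l₂ ⋆ l₃) l₄ l₅).mul (i₂.mul i₁)).eq x

end

/-- Both sides are the canonical rebracketing
`(1((2((3c)m₃))m₂))m₁ → (((12)3)c)(m₃(m₂m₁))`. -/
theorem reasΦInv_pentagon (l₁ l₂ l₃ c m₃ m₂ m₁ : G →ₐ[K] B) [Commuting l₁ l₂] [Commuting l₁ l₃]
    [Commuting l₁ c] [Commuting l₁ m₃] [Commuting l₁ m₂] [Commuting l₁ m₁] [Commuting l₂ l₃]
    [Commuting l₂ c] [Commuting l₂ m₃] [Commuting l₂ m₂] [Commuting l₂ m₁] [Commuting l₃ c]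
    [Commuting l₃ m₃] [Commuting l₃ m₂] [Commuting l₃ m₁] [Commuting c m₃] [Commuting c m₂]
    [Commuting c m₁] [Commuting m₃ m₂] [Commuting m₃ m₁] [Commuting m₂ m₁] :
    φ[m₃, m₂, m₁] * (φ⁻[l₁, l₂, l₃] * (H.reasΦInv l₁ (l₂ ⋆ l₃) c (m₃ ⋆ m₂) m₁ *
      H.reasΦInv l₂ l₃ c m₃ m₂)) =
    H.reasΦInv (l₁ ⋆ l₂) l₃ c m₃ (m₂ ⋆ m₁) * H.reasΦInv l₁ l₂ (l₃ ⋆ c ⋆ m₃) m₂ m₁ := by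
  have e₁ : φ[l₁ ⋆ (l₂ ⋆ l₃) ⋆ c, m₃ ⋆ m₂, m₁] = _ :=
    H.reas_conj l₁ l₂ l₃ (l₁ ⋆ l₂ ⋆ l₃ ⋆ c) (m₃ ⋆ m₂) m₁ _ _ _
  have e₂ : φ[l₁ ⋆ l₂ ⋆ l₃ ⋆ c, m₃, m₂] = _ :=
    H.reas_conjInv l₁ l₂ l₃ (l₁ ⋆ (l₂ ⋆ l₃) ⋆ c) m₃ m₂ _ _ _
  have e₃ : φ[l₁ ⋆ (l₂ ⋆ l₃) ⋆ c, m₃, m₂] = _ :=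
    H.reas_conjInv l₁ (l₂ ⋆ l₃) c (l₁ ⋆ (l₂ ⋆ l₃ ⋆ c)) m₃ m₂ _ _ _
  have e₄ : φ⁻[l₁ ⋆ l₂ ⋆ l₃ ⋆ c ⋆ m₃, m₂, m₁] = _ :=
    H.reasInv_conjInv (l₁ ⋆ l₂) l₃ c (l₁ ⋆ l₂ ⋆ (l₃ ⋆ c) ⋆ m₃) m₂ m₁ _ _ _
  have e₅ : φ⁻[l₁ ⋆ l₂ ⋆ (l₃ ⋆ c) ⋆ m₃, m₂, m₁] = _ :=
    H.reasInv_conjInv (l₁ ⋆ l₂) (l₃ ⋆ c) m₃ (l₁ ⋆ l₂ ⋆ (l₃ ⋆ c ⋆ m₃)) m₂ m₁ _ _ _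
  have e₆ : φ⁻[l₁, l₂ ⋆ l₃ ⋆ c ⋆ m₃, m₂] = _ :=
    H.reasInv_conjInv l₂ l₃ c l₁ (l₂ ⋆ (l₃ ⋆ c) ⋆ m₃) m₂ _ _ _
  have e₇ : φ⁻[l₁, l₂ ⋆ (l₃ ⋆ c) ⋆ m₃, m₂] = _ :=
    H.reasInv_conjInv l₂ (l₃ ⋆ c) m₃ l₁ (l₂ ⋆ (l₃ ⋆ c ⋆ m₃)) m₂ _ _ _
  have e₈ : φ⁻[l₁, l₂ ⋆ l₃ ⋆ c, m₃] = _ :=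
    H.reasInv_conjInv l₂ l₃ c l₁ (l₂ ⋆ (l₃ ⋆ c)) m₃ _ _ _
  simp only [reasΦInv]
  simp [H.reas_right (l₁ ⋆ l₂ ⋆ l₃ ⋆ c) m₃ m₂ m₁, H.reasInv_right l₁ (l₂ ⋆ l₃ ⋆ c) m₃ m₂,
    H.reasInv_right l₁ l₂ (l₃ ⋆ c) m₃, H.reasInv_right l₁ l₂ l₃ c, e₁, e₂, e₃, e₄, e₅, e₆, e₇,
    e₈, mul_assoc]

end QuasiBialgebra

/-! ### The Drinfeld twist and the inverse antipode -/

namespace QuasiHopfAlgebra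

open QuasiBialgebra

variable {K : Type u} [Field K] {G : Type v} [Ring G] [Algebra K G] (H : QuasiHopfAlgebra K G)
variable {A B C : Type*} [Ring A] [Algebra K A] [Ring B] [Algebra K B] [Ring C] [Algebra K C]

local infixl:72 " ⋆ " => QuasiBialgebra.star (toQuasiBialgebra H)
local notation "φ[" a ", " b ", " c "]" => reas (toQuasiBialgebra H) a b c
local notation "φ⁻[" a ", " b ", " c "]" => reasInv (toQuasiBialgebra H) a b c

attribute [local instance 10] Commuting.flip

@[simp] theorem S_Sinv (x : G) : H.S (H.Sinv x) = x := H.S.apply_symm_apply x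

@[simp] theorem Sinv_S (x : G) : H.Sinv (H.S x) = x := H.S.symm_apply_apply x

@[simp] theorem Sinv_one : H.Sinv 1 = 1 := by
  rw [← H.S_one, Sinv_S, H.S_one]

theorem Sinv_mul (x y : G) : H.Sinv (x * y) = H.Sinv y * H.Sinv x :=
  H.S.injective (by
    change H.S (H.Sinv (x * y)) = H.S (H.Sinv y * H.Sinv x)
    rw [S_mul, S_Sinv, S_Sinv, S_Sinv])

/-- The inverse antipode, as a homomorphism into the opposite algebra. -/
def Sinvop : G →ₐ[K] Gᵐᵒᵖ :=
  AlgHom.ofLinearMap ((MulOpposite.opLinearEquiv K).toLinearMap ∘ₗ H.Sinv)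
    (by simp) (by simp [Sinv_mul])

@[simp] theorem unop_Sinvop (x : G) : (H.Sinvop x).unop = H.Sinv x := rfl

/-- The inverse antipode followed by the leg `a`, as a leg of the opposite algebra. -/
abbrev invLeg (a : G →ₐ[K] B) : G →ₐ[K] Bᵐᵒᵖ := (AlgHom.op a).comp H.Sinvop

/-- The element `S⁻¹(f²) ⊗ S⁻¹(f¹)`. -/
def fσ : G ⊗[K] G :=
  Algebra.TensorProduct.comm K G G (TensorProduct.map H.Sinv H.Sinv H.f)

theorem pl_invLeg (a b : G →ₐ[K] B) [Commuting a b] (w : G ⊗[K] G) :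
    pl (H.invLeg b) (H.invLeg a) w = MulOpposite.op (pl a b
      (Algebra.TensorProduct.comm K G G (TensorProduct.map H.Sinv H.Sinv w))) := by
  induction w using TensorProduct.induction_on with
  | zero => simp
  | add x y hx hy => simp only [map_add, MulOpposite.op_add, hx, hy]
  | tmul p q => exact MulOpposite.unop_injective (by simp)

theorem pl_invLeg_f (a b : G →ₐ[K] B) [Commuting a b] :
    pl (H.invLeg b) (H.invLeg a) H.f = MulOpposite.op (pl a b H.fσ) := H.pl_invLeg a b _

instance intw_op_fσ (a b : G →ₐ[K] B) [Commuting a b] :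
    Intw (MulOpposite.op (pl a b H.fσ)) (H.invLeg b ⋆ H.invLeg a) (H.invLeg (a ⋆ b)) :=
  ⟨fun x => by
    have h := congrArg (pl (H.invLeg b) (H.invLeg a)) (H.f_mul_Δ_S (H.Sinv x))
    rw [S_Sinv, map_mul, map_mul, pl_invLeg_f] at h
    refine h.trans (congrArg (· * _) ?_)
    rw [SSΔop, pl_invLeg]
    suffices k : ∀ w : G ⊗[K] G, Algebra.TensorProduct.comm K G G (TensorProduct.map H.Sinv H.Sinv
        (TensorProduct.map H.S.toLinearMap H.S.toLinearMap
          (Algebra.TensorProduct.comm K G G w))) = w from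
      congrArg (fun w => MulOpposite.op (pl a b w)) (k _)
    intro w
    induction w using TensorProduct.induction_on with
    | zero => simp
    | add x y hx hy => simp only [map_add, hx, hy]
    | tmul p q => simp⟩

theorem fσ_mul_Δ_Sinv (x : G) :
    H.fσ * H.Δ (H.Sinv x) = ((H.invLeg iR ⋆ H.invLeg iL) x).unop * H.fσ := by
  have h := congrArg MulOpposite.unop ((H.intw_op_fσ iL iR).eq x)
  simp only [MulOpposite.unop_mul, MulOpposite.unop_op, pl_iL_iR, AlgHom.id_apply] at h
  rw [h, AlgHom.comp_apply]
  have : (iL ⋆ iR : G →ₐ[K] G ⊗[K] G) = H.Δ := by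
    rw [QuasiBialgebra.star, pl_iL_iR, AlgHom.id_comp]
  rw [this]; rfl

instance (a b c : G →ₐ[K] B) [Commuting a b] [Commuting a c] [Commuting b c] (w : G ⊗[K] G) :
    Intw (MulOpposite.op (pl a b w)) (H.invLeg c) (H.invLeg c) :=
  ⟨fun x => MulOpposite.unop_injective (Commuting.eq (pl a b) c w (H.Sinv x)).symm⟩

theorem fσ_compat (a b c : G →ₐ[K] B) [Commuting a b] [Commuting a c] [Commuting b c] :
    pl b c H.fσ * pl a (b ⋆ c) H.fσ * φ[a, b, c] =
      (φ[H.invLeg c, H.invLeg b, H.invLeg a]).unop * (pl a b H.fσ * pl (a ⋆ b) c H.fσ) := by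
  have h := congrArg MulOpposite.unop (H.f_compat (H.invLeg c) (H.invLeg b) (H.invLeg a))
  have k₁ := congrArg MulOpposite.unop (Intw.pl_eq (MulOpposite.op (pl b c H.fσ))
    (H.invLeg c ⋆ H.invLeg b) (H.invLeg (b ⋆ c)) (H.invLeg a) (H.invLeg a) H.f)
  have k₂ := congrArg MulOpposite.unop (Intw.pl_eq (MulOpposite.op (pl a b H.fσ))
    (H.invLeg c) (H.invLeg c) (H.invLeg b ⋆ H.invLeg a) (H.invLeg (a ⋆ b)) H.f)
  have l : ∀ x : G →ₐ[K] B, H.opLeg (H.invLeg x) =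
      (AlgEquiv.opOp K B).toAlgHom.comp x := fun x => by ext; simp
  have k₃ : φ[H.opLeg (H.invLeg a), H.opLeg (H.invLeg b), H.opLeg (H.invLeg c)].unop.unop =
      φ[a, b, c] := by
    have := H.map_reas a b c (AlgEquiv.opOp K B).toAlgHom
    simp only [l]
    rw [← this]; rfl
  simp only [MulOpposite.unop_mul, k₃, pl_invLeg_f, MulOpposite.unop_op] at h k₁ k₂
  rw [← k₁, h, k₂]

end QuasiHopfAlgebra

/-! ### Elements of the double as functions -/

section

variable {K : Type u} [Field K] {G M N : Type*} [Ring G] [Algebra K G] [AddCommGroup M]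
  [Module K M] [AddCommGroup N] [Module K N]

@[simp] theorem onLeft_tmul (T : G →ₗ[K] Module.End K M) (g : G) (m : M) (n : N) :
    onLeft N T g (m ⊗ₜ n) = T g m ⊗ₜ n := rfl

@[simp] theorem onRight_tmul (T : G →ₗ[K] Module.End K N) (g : G) (m : M) (n : N) :
    onRight M T g (m ⊗ₜ n) = m ⊗ₜ T g n := rfl

@[simp] theorem QuasiHopfAlgebra.lact_apply (a x : G) (ψ : Module.Dual K G) :
    QuasiHopfAlgebra.lact a ψ x = ψ (x * a) := rfl

@[simp] theorem QuasiHopfAlgebra.ract_apply (a x : G) (ψ : Module.Dual K G) :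
    QuasiHopfAlgebra.ract a ψ x = ψ (a * x) := rfl

end

namespace QuasiHopfAlgebra

open QuasiBialgebra

variable {K : Type u} [Field K] {G : Type v} [Ring G] [Algebra K G] (H : QuasiHopfAlgebra K G)
variable {A B C : Type*} [Ring A] [Algebra K A] [Ring B] [Algebra K B] [Ring C] [Algebra K C]

local infixl:72 " ⋆ " => QuasiBialgebra.star (toQuasiBialgebra H)
local notation "φ[" a ", " b ", " c "]" => reas (toQuasiBialgebra H) a b c
local notation "φ⁻[" a ", " b ", " c "]" => reasInv (toQuasiBialgebra H) a b c

attribute [local instance 10] Commuting.flip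

section
variable {V V' W W' M : Type*} [AddCommGroup V] [Module K V] [AddCommGroup V'] [Module K V']
  [AddCommGroup W] [Module K W] [AddCommGroup W'] [Module K W'] [AddCommGroup M] [Module K M]

/-- The action `v ↦ S⁻¹(q) v p` of `p ⊗ q` on `G`. -/
def sand : G ⊗[K] G →ₗ[K] Module.End K G := rmul ⊚ (lmul ∘ₗ H.Sinv)

@[simp] theorem sand_tmul (p q v : G) : H.sand (p ⊗ₜ q) v = H.Sinv q * (v * p) := by
  simp [sand, rmul, lmul, mul_assoc]

theorem sand_mul (d d' : G ⊗[K] G) (v : G) : H.sand (d * d') v = H.sand d' (H.sand d v) := by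
  induction d using TensorProduct.induction_on with
  | zero => simp
  | add x y hx hy => simp only [add_mul, map_add, LinearMap.add_apply, hx, hy]
  | tmul p q =>
    induction d' using TensorProduct.induction_on with
    | zero => simp
    | add x y hx hy => simp only [mul_add, map_add, LinearMap.add_apply, hx, hy]
    | tmul p' q' => simp [Sinv_mul, mul_assoc]

/-- For `g : G → G`, the functional `v, (p ⊗ q) ⊗ c ↦ c g(S⁻¹(q) v p)`. -/
def fnAct (g : G →ₗ[K] G) : G →ₗ[K] (G ⊗[K] G) ⊗[K] G →ₗ[K] G :=
  ((lmul ⊚ (LinearMap.llcomp K G G G g ∘ₗ H.sand)) ∘ₗ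
    (TensorProduct.comm K (G ⊗[K] G) G).toLinearMap).flip

@[simp] theorem fnAct_tmul (g : G →ₗ[K] G) (v : G) (d : G ⊗[K] G) (c : G) :
    H.fnAct g v (d ⊗ₜ c) = c * g (H.sand d v) := by
  simp [fnAct, lmul]

@[simp] theorem fnAct_zero : H.fnAct 0 = 0 := by ext; simp

theorem fnAct_add (g h : G →ₗ[K] G) : H.fnAct (g + h) = H.fnAct g + H.fnAct h := by
  ext; simp [mul_add]

theorem fnAct_tmul_mul (g : G →ₗ[K] G) (v : G) (d : G ⊗[K] G) (c : G) (w) :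
    H.fnAct g v (d ⊗ₜ c * w) = c * H.fnAct g (H.sand d v) w := by
  induction w using TensorProduct.induction_on with
  | zero => simp
  | add x y hx hy => simp only [mul_add, map_add, hx, hy]
  | tmul d' c' => simp [sand_mul, mul_assoc]

/-- For a functional `χ` and a bilinear map `R`, the bilinear map
`v₁ ⊗ v, (p ⊗ q) ⊗ w ↦ χ(S⁻¹(q) v₁ p) R(v, w)`. -/
def dualAct (χ : Module.Dual K G) (R : V →ₗ[K] W →ₗ[K] M) :
    G ⊗[K] V →ₗ[K] (G ⊗[K] G) ⊗[K] W →ₗ[K] M :=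
  (TensorProduct.map₂ (H.sand.flip.compr₂ χ) R).compr₂ (TensorProduct.lid K M).toLinearMap

@[simp] theorem dualAct_tmul (χ : Module.Dual K G) (R : V →ₗ[K] W →ₗ[K] M) (v₁ : G) (v : V)
    (d : G ⊗[K] G) (w : W) :
    H.dualAct χ R (v₁ ⊗ₜ v) (d ⊗ₜ w) = χ (H.sand d v₁) • R v w := by
  simp [dualAct]

@[simp] theorem dualAct_zero (χ : Module.Dual K G) :
    H.dualAct χ (0 : V →ₗ[K] W →ₗ[K] M) = 0 := by ext; simp

theorem dualAct_add (χ : Module.Dual K G) (R R' : V →ₗ[K] W →ₗ[K] M) :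
    H.dualAct χ (R + R') = H.dualAct χ R + H.dualAct χ R' := by ext; simp

theorem dualAct_compl (χ : Module.Dual K G) (R : V →ₗ[K] W →ₗ[K] M) (g : V' →ₗ[K] V)
    (h : W' →ₗ[K] W) (v) (w) :
    H.dualAct χ (R.compl₁₂ g h) v w =
      H.dualAct χ R (TensorProduct.map LinearMap.id g v) (TensorProduct.map LinearMap.id h w) := by
  suffices k : H.dualAct χ (R.compl₁₂ g h) = (H.dualAct χ R).compl₁₂
      (TensorProduct.map LinearMap.id g) (TensorProduct.map LinearMap.id h) by rw [k]; rfl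
  ext; simp

end

section Legs

/-- Legs of `(G ⊗ G) ⊗ G`. -/
abbrev k₁ : G →ₐ[K] (G ⊗[K] G) ⊗[K] G := iL.comp iL
abbrev k₁' : G →ₐ[K] (G ⊗[K] G) ⊗[K] G := iL.comp iR
abbrev k₀ : G →ₐ[K] (G ⊗[K] G) ⊗[K] G := iR

/-- Legs of `(G ⊗ G) ⊗ ((G ⊗ G) ⊗ G)`. -/
abbrev l₁ : G →ₐ[K] (G ⊗[K] G) ⊗[K] ((G ⊗[K] G) ⊗[K] G) := iL.comp iL
abbrev l₁' : G →ₐ[K] (G ⊗[K] G) ⊗[K] ((G ⊗[K] G) ⊗[K] G) := iL.comp iR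
abbrev l₂ : G →ₐ[K] (G ⊗[K] G) ⊗[K] ((G ⊗[K] G) ⊗[K] G) := iR.comp k₁
abbrev l₂' : G →ₐ[K] (G ⊗[K] G) ⊗[K] ((G ⊗[K] G) ⊗[K] G) := iR.comp k₁'
abbrev l₀ : G →ₐ[K] (G ⊗[K] G) ⊗[K] ((G ⊗[K] G) ⊗[K] G) := iR.comp k₀

/-- Legs of `(G ⊗ G) ⊗ ((G ⊗ G) ⊗ ((G ⊗ G) ⊗ G))`. -/
abbrev m₁ : G →ₐ[K] (G ⊗[K] G) ⊗[K] ((G ⊗[K] G) ⊗[K] ((G ⊗[K] G) ⊗[K] G)) := iL.comp iL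
abbrev m₁' : G →ₐ[K] (G ⊗[K] G) ⊗[K] ((G ⊗[K] G) ⊗[K] ((G ⊗[K] G) ⊗[K] G)) := iL.comp iR
abbrev m₂ : G →ₐ[K] (G ⊗[K] G) ⊗[K] ((G ⊗[K] G) ⊗[K] ((G ⊗[K] G) ⊗[K] G)) := iR.comp l₁
abbrev m₂' : G →ₐ[K] (G ⊗[K] G) ⊗[K] ((G ⊗[K] G) ⊗[K] ((G ⊗[K] G) ⊗[K] G)) := iR.comp l₁'
abbrev m₃ : G →ₐ[K] (G ⊗[K] G) ⊗[K] ((G ⊗[K] G) ⊗[K] ((G ⊗[K] G) ⊗[K] G)) := iR.comp l₂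
abbrev m₃' : G →ₐ[K] (G ⊗[K] G) ⊗[K] ((G ⊗[K] G) ⊗[K] ((G ⊗[K] G) ⊗[K] G)) := iR.comp l₂'
abbrev m₀ : G →ₐ[K] (G ⊗[K] G) ⊗[K] ((G ⊗[K] G) ⊗[K] ((G ⊗[K] G) ⊗[K] G)) := iR.comp l₀

end Legs

/-- The element `∑ φ ⊗ a` of the dual tensor `G`, as the function `x ↦ ∑ φ(x) a`. -/
abbrev hat (z : Module.Dual K G ⊗[K] G) : G →ₗ[K] G := dualTensorHom K G G z

theorem hat_injective [FiniteDimensional K G] :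
    Function.Injective (hat : Module.Dual K G ⊗[K] G → G →ₗ[K] G) := by
  have h : (dualTensorHom K G G) = (dualTensorHomEquiv K G G).toLinearMap := by
    ext; simp
  change Function.Injective (dualTensorHom K G G)
  rw [h]
  exact (dualTensorHomEquiv K G G).injective

/-- Moving `a` past a functional is, on functions `G → G`, a composition with the two-sided coaction
`δ(a)`. -/
theorem hat_exch (a : G) (z : Module.Dual K G ⊗[K] G) (x : G) :
    hat (H.exch a z) x = H.fnAct (hat z) x ((k₁ ⋆ k₀ ⋆ k₁') a) := by
  rw [← pl_δ₂, exch, LinearMap.comp_apply, AlgHom.toLinearMap_apply]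
  generalize H.δ₂ a = t
  induction t using TensorProduct.induction_on with
  | zero => simp
  | add x y hx hy => simp only [map_add, LinearMap.add_apply, hx, hy]
  | tmul p t =>
    induction t using TensorProduct.induction_on with
    | zero => simp
    | add x y hx hy => simp only [TensorProduct.tmul_add, map_add, LinearMap.add_apply, hx, hy]
    | tmul c q =>
      induction z using TensorProduct.induction_on with
      | zero => simp
      | add x y hx hy =>
        simp only [map_add, LinearMap.add_apply, fnAct_add, ← hx, ← hy]
      | tmul ψ b => simp [lmul]

theorem fnAct_exch (a : G) (z : Module.Dual K G ⊗[K] G) (v : G) (w) :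
    H.fnAct (hat (H.exch a z)) v w = H.fnAct (hat z) v (w * (k₁ ⋆ k₀ ⋆ k₁') a) := by
  induction w using TensorProduct.induction_on with
  | zero => simp
  | add x y hx hy => simp only [add_mul, map_add, hx, hy]
  | tmul d c => rw [fnAct_tmul, hat_exch, fnAct_tmul_mul]

/-- The action of a functional on an element of the double, as an operation on functions `G → G`.
The factor `f` of `Ω` appears as `fσ`, on the side of the argument, and `Φ⁻¹` acts by its legs. -/
theorem hat_outer (χ : Module.Dual K G) (z : Module.Dual K G ⊗[K] G) (x : G) :
    hat (H.outer χ z) x = H.dualAct χ (H.fnAct (hat z)) (H.fσ * H.Δ x)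
      (H.reasΦInv l₁ l₂ l₀ l₂' l₁') := by
  have key : ∀ (F : G ⊗[K] G) (t : G ⊗[K] (G ⊗[K] (G ⊗[K] (G ⊗[K] G)))),
      hat (TensorProduct.map H.dualMul LinearMap.id
        ((TensorProduct.assoc K (Module.Dual K G) (Module.Dual K G) G).symm
        (fiveAct (TensorProduct.map LinearMap.id (TensorProduct.map LinearMap.id
      (TensorProduct.map LinearMap.id (TensorProduct.map H.Sinv H.Sinv)))
      (((1 : G) ⊗ₜ[K] ((1 : G) ⊗ₜ[K] ((1 : G) ⊗ₜ[K] F))) * t)) (χ ⊗ₜ z)))) x =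
      H.dualAct χ (H.fnAct (hat z)) (Algebra.TensorProduct.comm K G G
        (TensorProduct.map H.Sinv H.Sinv F) * H.Δ x)
      (pl l₁ (pl l₂ (pl l₀ (pl l₂' l₁'))) t) := by
    intro F t
    induction F using TensorProduct.induction_on with
    | zero => simp
    | add F F' hx hy =>
      simp only [TensorProduct.tmul_add, add_mul, map_add, LinearMap.add_apply, hx, hy]
    | tmul f₁ f₂ =>
    induction t using TensorProduct.induction_on with
    | zero => simp
    | add x y hx hy => simp only [mul_add, map_add, LinearMap.add_apply, hx, hy]
    | tmul t₁ t =>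
    induction t using TensorProduct.induction_on with
    | zero => simp
    | add x y hx hy =>
      simp only [TensorProduct.tmul_add, mul_add, map_add, LinearMap.add_apply, hx, hy]
    | tmul t₂ t =>
    induction t using TensorProduct.induction_on with
    | zero => simp
    | add x y hx hy =>
      simp only [TensorProduct.tmul_add, mul_add, map_add, LinearMap.add_apply, hx, hy]
    | tmul t₃ t =>
    induction t using TensorProduct.induction_on with
    | zero => simp
    | add x y hx hy =>
      simp only [TensorProduct.tmul_add, mul_add, map_add, LinearMap.add_apply, hx, hy]
    | tmul t₄ t₅ =>
    induction z using TensorProduct.induction_on with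
    | zero => simp
    | add x y hx hy =>
      simp only [TensorProduct.tmul_add, map_add, LinearMap.add_apply, fnAct_add, dualAct_add,
        ← hx, ← hy]
    | tmul ψ c =>
    simp only [dualMul, Algebra.TensorProduct.tmul_mul_tmul, TensorProduct.map_tmul,
      Algebra.TensorProduct.comm_tmul, pl_tmul, one_mul, LinearMap.id_apply, AlgHom.comp_apply,
      iL_apply, iR_apply, mul_one, compTensor_tmul, fiveAct, onLeft_tmul, onRight_tmul,
      LinearMap.comp_apply, TensorProduct.assoc_symm_tmul, dualTensorHom_apply,
      Module.Dual.transpose_apply, AlgHom.toLinearMap_apply]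
    generalize H.Δ x = D
    induction D using TensorProduct.induction_on with
    | zero => simp
    | add x y hx hy => simp only [mul_add, map_add, LinearMap.add_apply, add_smul, hx, hy]
    | tmul x₁ x₂ => simp [lmul, Sinv_mul, mul_assoc, smul_smul]
  exact (key H.f _).trans (by rw [pl_ΦInv]; rfl)

/-! ### Associativity of the double -/

section
variable (l₁ l₂ l₃ l₄ l₅ : G →ₐ[K] B) [Commuting l₁ l₂] [Commuting l₁ l₃] [Commuting l₁ l₄]
  [Commuting l₁ l₅] [Commuting l₂ l₃] [Commuting l₂ l₄] [Commuting l₂ l₅] [Commuting l₃ l₄]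
  [Commuting l₃ l₅] [Commuting l₄ l₅]

theorem map_reasΦInv (h : B →ₐ[K] C) : h (H.reasΦInv l₁ l₂ l₃ l₄ l₅) =
    H.reasΦInv (h.comp l₁) (h.comp l₂) (h.comp l₃) (h.comp l₄) (h.comp l₅) := by
  simp only [reasΦInv, map_mul, map_reas, map_reasInv, comp_star]

end

section
variable {V W M : Type*} [Ring V] [Algebra K V] [Ring W] [Algebra K W] [AddCommGroup M]
  [Module K M]

theorem fnAct_mul (g : G →ₗ[K] G) (a v : G) (w) :
    H.fnAct g (v * a) w = H.fnAct g v (k₁ a * w) := by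
  induction w using TensorProduct.induction_on with
  | zero => simp
  | add x y hx hy => simp only [mul_add, map_add, hx, hy]
  | tmul d c =>
    rw [show (k₁ a : (G ⊗[K] G) ⊗[K] G) = (a ⊗ₜ 1) ⊗ₜ 1 from rfl,
      Algebra.TensorProduct.tmul_mul_tmul, fnAct_tmul, fnAct_tmul, sand_mul]
    simp

theorem fnAct_Sinv_mul (g : G →ₗ[K] G) (a v : G) (w) :
    H.fnAct g (H.Sinv a * v) w = H.fnAct g v (k₁' a * w) := by
  induction w using TensorProduct.induction_on with
  | zero => simp
  | add x y hx hy => simp only [mul_add, map_add, hx, hy]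
  | tmul d c =>
    rw [show (k₁' a : (G ⊗[K] G) ⊗[K] G) = (1 ⊗ₜ a) ⊗ₜ 1 from rfl,
      Algebra.TensorProduct.tmul_mul_tmul, fnAct_tmul, fnAct_tmul, sand_mul]
    simp

theorem mul_fnAct (g : G →ₗ[K] G) (c v : G) (w) :
    c * H.fnAct g v w = H.fnAct g v (k₀ c * w) := by
  rw [show (k₀ c : (G ⊗[K] G) ⊗[K] G) = 1 ⊗ₜ c from rfl, fnAct_tmul_mul]
  congr 2
  rw [Algebra.TensorProduct.one_def, sand_tmul]; simp

variable {R : V →ₗ[K] W →ₗ[K] M} (χ : Module.Dual K G)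

theorem dualAct_mul {s : V} {r : W} (h : ∀ v w, R (v * s) w = R v (r * w)) (a : G) (v) (w) :
    H.dualAct χ R (v * (a ⊗ₜ s)) w = H.dualAct χ R v ((iL (iL a) * iR r) * w) := by
  induction v using TensorProduct.induction_on with
  | zero => simp
  | add x y hx hy => simp only [add_mul, map_add, LinearMap.add_apply, hx, hy]
  | tmul v₁ v =>
    induction w using TensorProduct.induction_on with
    | zero => simp
    | add x y hx hy => simp only [mul_add, map_add, hx, hy]
    | tmul d w =>
      simp only [iL_apply, iR_apply, Algebra.TensorProduct.tmul_mul_tmul, dualAct_tmul, h,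
        sand_mul, mul_one, one_mul]
      simp

theorem dualAct_Sinv_mul {s : V} {r : W} (h : ∀ v w, R (s * v) w = R v (r * w)) (a : G) (v) (w) :
    H.dualAct χ R ((H.Sinv a ⊗ₜ s) * v) w = H.dualAct χ R v ((iL (iR a) * iR r) * w) := by
  induction v using TensorProduct.induction_on with
  | zero => simp
  | add x y hx hy => simp only [mul_add, map_add, LinearMap.add_apply, hx, hy]
  | tmul v₁ v =>
    induction w using TensorProduct.induction_on with
    | zero => simp
    | add x y hx hy => simp only [mul_add, map_add, hx, hy]
    | tmul d w =>
      simp only [iL_apply, iR_apply, Algebra.TensorProduct.tmul_mul_tmul, dualAct_tmul, h,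
        sand_mul, mul_one, one_mul]
      simp

theorem smul_dualAct {m : M →ₗ[K] M} {r : W} (h : ∀ v w, m (R v w) = R v (r * w)) (v) (w) :
    m (H.dualAct χ R v w) = H.dualAct χ R v (iR r * w) := by
  induction v using TensorProduct.induction_on with
  | zero => simp
  | add x y hx hy => simp only [map_add, LinearMap.add_apply, hx, hy]
  | tmul v₁ v =>
    induction w using TensorProduct.induction_on with
    | zero => simp
    | add x y hx hy => simp only [mul_add, map_add, hx, hy]
    | tmul d w => simp [h]

theorem dualAct_lact_ract (p q : G) (v) (w) :
    H.dualAct (lact p (ract (H.Sinv q) χ)) R v w =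
      H.dualAct χ R v (w * (iL (iL p) * iL (iR q))) := by
  induction v using TensorProduct.induction_on with
  | zero => simp
  | add x y hx hy => simp only [map_add, LinearMap.add_apply, hx, hy]
  | tmul v₁ v =>
    induction w using TensorProduct.induction_on with
    | zero => simp
    | add x y hx hy => simp only [add_mul, map_add, hx, hy]
    | tmul d w =>
      simp only [iL_apply, iR_apply, Algebra.TensorProduct.tmul_mul_tmul, dualAct_tmul,
        sand_mul, mul_one, one_mul, lact_apply, ract_apply, sand_tmul, mul_assoc]

end

section
variable (g : G →ₗ[K] G) (χ ψ : Module.Dual K G)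

theorem dualAct_fnAct_mul (v t : G ⊗[K] G) (w) :
    H.dualAct χ (H.fnAct g) (v * t) w = H.dualAct χ (H.fnAct g) v (pl l₁ l₂ t * w) := by
  induction t using TensorProduct.induction_on with
  | zero => simp
  | add x y hx hy => simp only [mul_add, add_mul, map_add, LinearMap.add_apply, hx, hy]
  | tmul a b => exact H.dualAct_mul χ (H.fnAct_mul g b) a v w

theorem dualAct_fnAct_inv_mul (v t : G ⊗[K] G) (w) :
    H.dualAct χ (H.fnAct g) ((pl (H.invLeg iR) (H.invLeg iL) t).unop * v) w =
      H.dualAct χ (H.fnAct g) v (pl l₂' l₁' t * w) := by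
  induction t using TensorProduct.induction_on with
  | zero => simp
  | add x y hx hy =>
    simp only [add_mul, map_add, MulOpposite.unop_add, LinearMap.add_apply, hx, hy]
  | tmul b a =>
    have h := dualAct_Sinv_mul H χ (H.fnAct_Sinv_mul g b) a v w
    convert h using 2
    · simp
    · simp

theorem mul_dualAct_fnAct (c : G) (v) (w) :
    c * H.dualAct χ (H.fnAct g) v w = H.dualAct χ (H.fnAct g) v (l₀ c * w) :=
  H.smul_dualAct χ (m := LinearMap.mulLeft K c) (H.mul_fnAct g c) v w

theorem dualAct₂_mul (v t : G ⊗[K] (G ⊗[K] G)) (w) :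
    H.dualAct χ (H.dualAct ψ (H.fnAct g)) (v * t) w =
      H.dualAct χ (H.dualAct ψ (H.fnAct g)) v (pl m₁ (pl m₂ m₃) t * w) := by
  induction t using TensorProduct.induction_on with
  | zero => simp
  | add x y hx hy => simp only [mul_add, add_mul, map_add, LinearMap.add_apply, hx, hy]
  | tmul a b =>
    rw [dualAct_mul H χ (fun v w => H.dualAct_fnAct_mul g ψ v b w) a v w, pl_tmul, map_pl]
    rfl

theorem dualAct₂_inv_mul (v t : G ⊗[K] (G ⊗[K] G)) (w) :
    H.dualAct χ (H.dualAct ψ (H.fnAct g)) ((pl (H.invLeg (iR.comp iR))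
      (pl (H.invLeg (iR.comp iL)) (H.invLeg iL)) t).unop * v) w =
      H.dualAct χ (H.dualAct ψ (H.fnAct g)) v (pl m₃' (pl m₂' m₁') t * w) := by
  induction t using TensorProduct.induction_on with
  | zero => simp
  | add x y hx hy =>
    simp only [add_mul, map_add, MulOpposite.unop_add, LinearMap.add_apply, hx, hy]
  | tmul c t =>
    induction t using TensorProduct.induction_on with
    | zero => simp
    | add x y hx hy =>
      simp only [TensorProduct.tmul_add, add_mul, map_add, MulOpposite.unop_add,
        LinearMap.add_apply, hx, hy]
    | tmul b a =>
      have h := dualAct_Sinv_mul H χ (R := H.dualAct ψ (H.fnAct g))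
        (s := (pl (H.invLeg (iR : G →ₐ[K] G ⊗[K] G)) (H.invLeg iL) (c ⊗ₜ[K] b)).unop)
        (r := pl (l₂' : G →ₐ[K] _) l₁' (c ⊗ₜ[K] b))
        (fun v w => H.dualAct_fnAct_inv_mul g ψ v _ w) a v w
      convert h using 2
      · simp
      · simp

end

/-- The four legs of a coproduct of two pairs, with the remaining leg carried along. -/
def pairΔ : (G ⊗[K] G) ⊗[K] G →ₐ[K] (G ⊗[K] G) ⊗[K] ((G ⊗[K] G) ⊗[K] G) :=
  pl (pl (l₁ ⋆ l₂) (l₂' ⋆ l₁')) l₀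

theorem fnAct_outer (ψ : Module.Dual K G) (z : Module.Dual K G ⊗[K] G) (v : G) (w) :
    H.fnAct (hat (H.outer ψ z)) v w = H.dualAct ψ (H.fnAct (hat z)) (H.fσ * H.Δ v)
      (H.pairΔ w * H.reasΦInv l₁ l₂ l₀ l₂' l₁') := by
  induction w using TensorProduct.induction_on with
  | zero => simp
  | add x y hx hy => simp only [add_mul, map_add, hx, hy]
  | tmul d c =>
    induction d using TensorProduct.induction_on with
    | zero => simp
    | add x y hx hy =>
      simp only [TensorProduct.add_tmul, add_mul, map_add, hx, hy]
    | tmul p q =>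
      rw [fnAct_tmul, sand_tmul, hat_outer, map_mul H.Δ, map_mul H.Δ, ← mul_assoc, fσ_mul_Δ_Sinv,
        mul_assoc, star_apply, dualAct_fnAct_inv_mul, ← mul_assoc, dualAct_fnAct_mul,
        mul_dualAct_fnAct, pairΔ, pl_tmul, pl_tmul, ← star_apply, ← star_apply]
      have c₁ := Commuting.eq (B := (G ⊗[K] G) ⊗[K] ((G ⊗[K] G) ⊗[K] G)) l₀ (l₁ ⋆ l₂) c p
      have c₂ := Commuting.eq (B := (G ⊗[K] G) ⊗[K] ((G ⊗[K] G) ⊗[K] G)) l₀ (l₂' ⋆ l₁') c q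
      rw [← mul_assoc (l₀ c), c₁, mul_assoc, ← mul_assoc (l₀ c), c₂]
      simp only [mul_assoc]

theorem exch_mul [FiniteDimensional K G] (a b : G) (z : Module.Dual K G ⊗[K] G) :
    H.exch (a * b) z = H.exch a (H.exch b z) := by
  refine hat_injective (LinearMap.ext fun x => ?_)
  rw [hat_exch, hat_exch, fnAct_exch, map_mul]

/-- The two-sided coaction on the legs of `(G ⊗ G) ⊗ G`. -/
abbrev coact : G →ₐ[K] (G ⊗[K] G) ⊗[K] G := k₁ ⋆ k₀ ⋆ k₁'

theorem dualAct_fnAct_exch (χ : Module.Dual K G) (a : G) (z : Module.Dual K G ⊗[K] G) (v) (w) :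
    H.dualAct χ (H.fnAct (hat (H.exch a z))) v w =
      H.dualAct χ (H.fnAct (hat z)) v (w * iR (H.coact a)) := by
  have e : H.fnAct (hat (H.exch a z)) = (H.fnAct (hat z)).compl₁₂ LinearMap.id
      (LinearMap.mulRight K (H.coact a)) := by
    refine LinearMap.ext fun v => LinearMap.ext fun w => ?_
    rw [fnAct_exch]; rfl
  rw [e, dualAct_compl, TensorProduct.map_id, LinearMap.id_apply]
  congr 1
  induction w using TensorProduct.induction_on with
  | zero => simp
  | add x y hx hy => simp only [map_add, add_mul, hx, hy]
  | tmul d c => simp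

/-- One of the two exchange rules to which associativity reduces: `a (ψ (b z)) = (a (ψ ⊗ b)) z`. -/
theorem exch_outer [FiniteDimensional K G] (a b : G) (ψ : Module.Dual K G)
    (z : Module.Dual K G ⊗[K] G) :
    H.exch a (H.outer ψ (H.exch b z)) = H.doubleMul (H.exch a (ψ ⊗ₜ b)) z := by
  refine hat_injective (LinearMap.ext fun x => ?_)
  have key : ∀ t : G ⊗[K] (G ⊗[K] G), hat (H.doubleMul ((onLeft G lact ⊚
      onRight (Module.Dual K G) lmul ⊚ onLeft G (ract ∘ₗ H.Sinv)) t (ψ ⊗ₜ b)) z) x =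
      H.dualAct ψ (H.fnAct (hat (H.exch b z))) (H.fσ * H.Δ x)
        (H.reasΦInv l₁ l₂ l₀ l₂' l₁' * pl l₁ (pl (l₂ ⋆ l₀ ⋆ l₂') l₁') t) := by
    intro t
    induction t using TensorProduct.induction_on with
    | zero => simp
    | add x y hx hy => simp only [mul_add, map_add, LinearMap.add_apply, hx, hy]
    | tmul p t =>
      induction t using TensorProduct.induction_on with
      | zero => simp
      | add x y hx hy =>
        simp only [TensorProduct.tmul_add, mul_add, map_add, LinearMap.add_apply, hx, hy]
      | tmul c q =>
        have e₁ : (onLeft G lact ⊚ onRight (Module.Dual K G) lmul ⊚ onLeft G (ract ∘ₗ H.Sinv))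
          (p ⊗ₜ[K] (c ⊗ₜ[K] q)) (ψ ⊗ₜ[K] b) = lact p (ract (H.Sinv q) ψ) ⊗ₜ (c * b) := by
          simp [lmul]
        have e₂ : iR (H.coact c) = ((l₂ ⋆ l₀ ⋆ l₂') c : (G ⊗[K] G) ⊗[K] ((G ⊗[K] G) ⊗[K] G)) := by
          simp only [← AlgHom.comp_apply, comp_star]
        rw [e₁, doubleMul, compTensor_tmul, exch_mul, hat_outer, dualAct_fnAct_exch,
          dualAct_lact_ract, e₂, pl_tmul, pl_tmul]
        congr 1
        have c₁ := Commuting.eq (B := (G ⊗[K] G) ⊗[K] ((G ⊗[K] G) ⊗[K] G)) l₁ (l₂ ⋆ l₀ ⋆ l₂') p c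
        rw [← mul_assoc (l₁ p), c₁]
        simp only [mul_assoc]
        rfl
  have e : H.exch a (ψ ⊗ₜ b) = (onLeft G lact ⊚
      onRight (Module.Dual K G) lmul ⊚ onLeft G (ract ∘ₗ H.Sinv)) (H.δ₂ a) (ψ ⊗ₜ b) := rfl
  rw [e, key, pl_δ₂, reasΦInv_intw, hat_exch, fnAct_outer]
  congr 2
  have i₁ : H.pairΔ.comp k₁ = l₁ ⋆ l₂ := by rw [pairΔ, ← AlgHom.comp_assoc]; simp
  have i₂ : H.pairΔ.comp k₁' = l₂' ⋆ l₁' := by rw [pairΔ, ← AlgHom.comp_assoc]; simp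
  have i₃ : H.pairΔ.comp k₀ = l₀ := by rw [pairΔ, pl_comp_iR]
  simp only [← AlgHom.comp_apply, comp_star, i₁, i₂, i₃]

theorem pl_iR_iL_iR {A C D : Type*} [Ring A] [Algebra K A] [Ring C] [Algebra K C] [Ring D]
    [Algebra K D] (x : A ⊗[K] C) :
    pl (iR.comp iL : A →ₐ[K] D ⊗[K] (A ⊗[K] C)) (iR.comp iR) x = iR x := by
  rw [← map_pl, pl_iL_iR, AlgHom.id_apply]

theorem pl_iL_iL_iR {A C D : Type*} [Ring A] [Algebra K A] [Ring C] [Algebra K C] [Ring D]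
    [Algebra K D] (x : A ⊗[K] C) :
    pl (iL.comp iL : A →ₐ[K] (A ⊗[K] C) ⊗[K] D) (iL.comp iR) x = iL x := by
  rw [← map_pl, pl_iL_iR, AlgHom.id_apply]

theorem pl_pl_iL {A A' C D : Type*} [Ring A] [Algebra K A] [Ring A'] [Algebra K A'] [Ring C]
    [Algebra K C] [Ring D] [Algebra K D] (h : C →ₐ[K] D) (P : C →ₐ[K] (A ⊗[K] A') ⊗[K] D)
    [Commuting (pl (iL.comp (iL : A →ₐ[K] A ⊗[K] A')) (iL.comp iR)) P] (hP : P = iR.comp h)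
    (r : D) (w : (A ⊗[K] A') ⊗[K] C) :
    TensorProduct.map LinearMap.id (LinearMap.mulRight K r ∘ₗ h.toLinearMap) w =
      pl (pl (iL.comp (iL : A →ₐ[K] A ⊗[K] A')) (iL.comp iR)) P w * iR r := by
  subst hP
  induction w using TensorProduct.induction_on with
  | zero => simp
  | add x y hx hy => simp only [map_add, add_mul, hx, hy]
  | tmul d w =>
    rw [pl_tmul, pl_iL_iL_iR]
    simp

theorem iL_star_iR : (iL ⋆ iR : G →ₐ[K] G ⊗[K] G) = H.Δ := by
  rw [QuasiBialgebra.star, pl_iL_iR, AlgHom.id_comp]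

theorem map_dualAct_fnAct_outer (φ ψ : Module.Dual K G) (z : Module.Dual K G ⊗[K] G) (u) (w) :
    H.dualAct φ (H.fnAct (hat (H.outer ψ z))) u w = H.dualAct φ (H.dualAct ψ (H.fnAct (hat z)))
      (pl (iR.comp iL) (iR.comp iR) H.fσ * pl iL (iR.comp iL ⋆ iR.comp iR) u)
      (pl (pl m₁ m₁') (pl (pl (m₂ ⋆ m₃) (m₃' ⋆ m₂')) m₀) w * H.reasΦInv m₂ m₃ m₀ m₃' m₂') := by
  have e : H.fnAct (hat (H.outer ψ z)) = (H.dualAct ψ (H.fnAct (hat z))).compl₁₂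
      (LinearMap.mulLeft K H.fσ ∘ₗ H.Δ.toLinearMap)
      (LinearMap.mulRight K (H.reasΦInv l₁ l₂ l₀ l₂' l₁') ∘ₗ H.pairΔ.toLinearMap) := by
    refine LinearMap.ext fun v => LinearMap.ext fun w => ?_
    rw [fnAct_outer]; rfl
  rw [e, dualAct_compl]
  have hu : TensorProduct.map LinearMap.id (LinearMap.mulLeft K H.fσ ∘ₗ H.Δ.toLinearMap) u =
      pl (iR.comp iL) (iR.comp iR) H.fσ * pl iL (iR.comp iL ⋆ iR.comp iR) u := by
    rw [pl_iR_iL_iR]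
    induction u using TensorProduct.induction_on with
    | zero => simp
    | add x y hx hy => simp only [map_add, mul_add, hx, hy]
    | tmul a b => rw [pl_tmul, ← comp_star, iL_star_iR]; simp
  have hw : TensorProduct.map LinearMap.id (LinearMap.mulRight K (H.reasΦInv l₁ l₂ l₀ l₂' l₁') ∘ₗ
      H.pairΔ.toLinearMap) w =
      pl (pl m₁ m₁') (pl (pl (m₂ ⋆ m₃) (m₃' ⋆ m₂')) m₀) w * H.reasΦInv m₂ m₃ m₀ m₃' m₂' := by
    have e₁ : H.reasΦInv m₂ m₃ m₀ m₃' m₂' = iR (H.reasΦInv l₁ l₂ l₀ l₂' l₁') :=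
      (H.map_reasΦInv l₁ l₂ l₀ l₂' l₁' iR).symm
    have e₂ : pl (pl (m₂ ⋆ m₃) (m₃' ⋆ m₂')) m₀ = iR.comp H.pairΔ := by
      rw [pairΔ]
      simp only [comp_pl, comp_star]
    rw [e₁]
    exact pl_pl_iL H.pairΔ _ e₂ _ w
  exact congrArg₂ (fun a b => H.dualAct φ (H.dualAct ψ (H.fnAct (hat z))) a b) hu hw

/-- For `k : G → G` and a bilinear map `R`, the bilinear map
`u₁ ⊗ u₂, d ⊗ w ↦ R(u₂, w δ(k(S⁻¹(q) u₁ p)))` with `d = p ⊗ q`. -/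
def coactAct (k : G →ₗ[K] G) (R : G →ₗ[K] (G ⊗[K] G) ⊗[K] G →ₗ[K] G) :
    G ⊗[K] G →ₗ[K] (G ⊗[K] G) ⊗[K] ((G ⊗[K] G) ⊗[K] G) →ₗ[K] G :=
  (TensorProduct.map₂ (H.sand.flip.compr₂ (H.coact.toLinearMap ∘ₗ k))
    (((LinearMap.llcomp K ((G ⊗[K] G) ⊗[K] G) ((G ⊗[K] G) ⊗[K] G) G) ∘ₗ R).compl₂
      (LinearMap.mul K ((G ⊗[K] G) ⊗[K] G)))).compr₂ (TensorProduct.lift LinearMap.applyₗ)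

@[simp] theorem coactAct_tmul (k : G →ₗ[K] G) (R : G →ₗ[K] (G ⊗[K] G) ⊗[K] G →ₗ[K] G) (u₁ u₂ : G)
    (d : G ⊗[K] G) (w) :
    H.coactAct k R (u₁ ⊗ₜ u₂) (d ⊗ₜ w) = R u₂ (w * H.coact (k (H.sand d u₁))) := by
  simp [coactAct]

@[simp] theorem coactAct_zero (R : G →ₗ[K] (G ⊗[K] G) ⊗[K] G →ₗ[K] G) :
    H.coactAct 0 R = 0 := by
  refine TensorProduct.ext' fun u₁ u₂ => TensorProduct.ext' fun d w => ?_
  rw [coactAct_tmul]; simp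

theorem coactAct_add (k k' : G →ₗ[K] G) (R : G →ₗ[K] (G ⊗[K] G) ⊗[K] G →ₗ[K] G) :
    H.coactAct (k + k') R = H.coactAct k R + H.coactAct k' R := by
  refine TensorProduct.ext' fun u₁ u₂ => TensorProduct.ext' fun d w => ?_
  simp only [LinearMap.add_apply, coactAct_tmul, map_add, mul_add]

theorem hat_doubleMul (y z : Module.Dual K G ⊗[K] G) (x : G) :
    hat (H.doubleMul y z) x = H.coactAct (hat y) (H.fnAct (hat z)) (H.fσ * H.Δ x)
      (H.reasΦInv l₁ l₂ l₀ l₂' l₁') := by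
  induction y using TensorProduct.induction_on with
  | zero => simp
  | add y y' hy hy' => simp only [map_add, LinearMap.add_apply, coactAct_add, hy, hy']
  | tmul χ a =>
    have e : H.coactAct (hat (χ ⊗ₜ[K] a)) (H.fnAct (hat z)) =
        H.dualAct χ (H.fnAct (hat (H.exch a z))) := by
      refine TensorProduct.ext' fun u₁ u₂ => TensorProduct.ext' fun d w => ?_
      rw [coactAct_tmul, dualAct_tmul, fnAct_exch]
      simp
    rw [e, ← hat_outer, doubleMul, compTensor_tmul]

/-- The two-sided coaction applied to the last leg. -/
abbrev lastCoact : (G ⊗[K] G) ⊗[K] ((G ⊗[K] G) ⊗[K] G) →ₐ[K]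
    (G ⊗[K] G) ⊗[K] ((G ⊗[K] G) ⊗[K] ((G ⊗[K] G) ⊗[K] G)) :=
  Algebra.TensorProduct.map (AlgHom.id K _) (Algebra.TensorProduct.map (AlgHom.id K _) H.coact)

theorem fnAct_coact_dualAct (φ ψ : Module.Dual K G) (c : G) (z : Module.Dual K G ⊗[K] G)
    (U : G ⊗[K] G) (u₂ : G) (X) (w) :
    H.fnAct (hat z) u₂ (w * H.coact (H.dualAct φ (H.fnAct (hat (ψ ⊗ₜ c))) U X)) =
      H.dualAct φ (H.dualAct ψ (H.fnAct (hat (H.exch c z))))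
        (TensorProduct.assoc K G G G (U ⊗ₜ u₂)) (iR (iR w) * H.lastCoact X) := by
  induction U using TensorProduct.induction_on with
  | zero => simp
  | add x y hx hy =>
    simp only [TensorProduct.add_tmul, map_add, mul_add, LinearMap.add_apply, hx, hy]
  | tmul U₁ U₂ =>
    induction X using TensorProduct.induction_on with
    | zero => simp
    | add x y hx hy => simp only [map_add, mul_add, hx, hy]
    | tmul d X =>
      induction X using TensorProduct.induction_on with
      | zero => simp
      | add x y hx hy => simp only [TensorProduct.tmul_add, map_add, mul_add, hx, hy]
      | tmul d' e =>
        rw [lastCoact, Algebra.TensorProduct.map_tmul, Algebra.TensorProduct.map_tmul, iR_apply,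
          iR_apply, Algebra.TensorProduct.tmul_mul_tmul, Algebra.TensorProduct.tmul_mul_tmul,
          TensorProduct.assoc_tmul, dualAct_tmul, dualAct_tmul, dualAct_tmul, fnAct_tmul,
          fnAct_exch, dualTensorHom_apply, AlgHom.id_apply, AlgHom.id_apply, one_mul, one_mul,
          mul_smul_comm, map_smul, map_smul, mul_smul_comm, mul_smul_comm, map_smul, map_smul,
          map_mul H.coact,
          mul_assoc]

theorem tensorMap_comp_iL {A A' D D' : Type*} [Ring A] [Algebra K A] [Ring A'] [Algebra K A']
    [Ring D] [Algebra K D] [Ring D'] [Algebra K D'] (f : A →ₐ[K] A') (h : D →ₐ[K] D') :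
    (Algebra.TensorProduct.map f h).comp iL = iL.comp f := by ext; simp

theorem tensorMap_comp_iR {A A' D D' : Type*} [Ring A] [Algebra K A] [Ring A'] [Algebra K A']
    [Ring D] [Algebra K D] [Ring D'] [Algebra K D'] (f : A →ₐ[K] A') (h : D →ₐ[K] D') :
    (Algebra.TensorProduct.map f h).comp iR = iR.comp h := by ext; simp

theorem assoc_tmul_eq (U : G ⊗[K] G) (u : G) : TensorProduct.assoc K G G G (U ⊗ₜ u) =
    pl iL (iR.comp iL) U * iR (iR u) := by
  induction U using TensorProduct.induction_on with
  | zero => simp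
  | add x y hx hy => simp only [TensorProduct.add_tmul, map_add, add_mul, hx, hy]
  | tmul a b => simp

theorem pl_comp_iL_comp {A C D : Type*} [Ring A] [Algebra K A] [Ring C] [Algebra K C] [Ring D]
    [Algebra K D] (f : A →ₐ[K] B) (g : C →ₐ[K] B) [Commuting f g] (h : D →ₐ[K] A) :
    (pl f g).comp (iL.comp h) = f.comp h := by
  rw [← AlgHom.comp_assoc, pl_comp_iL]

theorem pl_comp_iR_comp {A C D : Type*} [Ring A] [Algebra K A] [Ring C] [Algebra K C] [Ring D]
    [Algebra K D] (f : A →ₐ[K] B) (g : C →ₐ[K] B) [Commuting f g] (h : D →ₐ[K] C) :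
    (pl f g).comp (iR.comp h) = g.comp h := by
  rw [← AlgHom.comp_assoc, pl_comp_iR]

theorem lastCoact_comp_iL (f : G →ₐ[K] G ⊗[K] G) :
    H.lastCoact.comp (iL.comp f) = iL.comp f := by
  rw [← AlgHom.comp_assoc, tensorMap_comp_iL, AlgHom.comp_id]

theorem lastCoact_comp_iR (f : G →ₐ[K] (G ⊗[K] G) ⊗[K] G) : H.lastCoact.comp (iR.comp f) =
    iR.comp ((Algebra.TensorProduct.map (AlgHom.id K _) H.coact).comp f) := by
  rw [← AlgHom.comp_assoc, tensorMap_comp_iR, AlgHom.comp_assoc]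

theorem lastCoact_comp_iR_iL (f : G →ₐ[K] G ⊗[K] G) :
    H.lastCoact.comp (iR.comp (iL.comp f)) = iR.comp (iL.comp f) := by
  rw [lastCoact_comp_iR, ← AlgHom.comp_assoc (Algebra.TensorProduct.map _ _), tensorMap_comp_iL,
    AlgHom.comp_id]

theorem lastCoact_reasΦInv : H.lastCoact (H.reasΦInv l₁ l₂ l₀ l₂' l₁') =
    H.reasΦInv m₁ m₂ (m₃ ⋆ m₀ ⋆ m₃') m₂' m₁' := by
  have h₀ : H.lastCoact.comp l₀ = m₃ ⋆ m₀ ⋆ m₃' := by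
    rw [lastCoact_comp_iR, tensorMap_comp_iR]
    simp only [comp_star]
  simp only [map_reasΦInv, lastCoact_comp_iL, lastCoact_comp_iR_iL, h₀]

theorem coactAct_outer (φ ψ : Module.Dual K G) (c : G) (z : Module.Dual K G ⊗[K] G) (u) (w) :
    H.coactAct (hat (H.outer φ (ψ ⊗ₜ c))) (H.fnAct (hat z)) u w =
      H.dualAct φ (H.dualAct ψ (H.fnAct (hat (H.exch c z))))
        (pl iL (iR.comp iL) H.fσ * pl (iL ⋆ iR.comp iL) (iR.comp iR) u)
        (pl (pl (m₁ ⋆ m₂) (m₂' ⋆ m₁')) (iR.comp iR) w *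
          H.reasΦInv m₁ m₂ (m₃ ⋆ m₀ ⋆ m₃') m₂' m₁') := by
  induction u using TensorProduct.induction_on with
  | zero => simp
  | add x y hx hy => simp only [map_add, mul_add, LinearMap.add_apply, hx, hy]
  | tmul u₁ u₂ =>
    induction w using TensorProduct.induction_on with
    | zero => simp
    | add x y hx hy => simp only [map_add, add_mul, hx, hy]
    | tmul d w =>
      have e₀ : hat (H.outer φ (ψ ⊗ₜ c)) (H.sand d u₁) =
          H.fnAct (hat (H.outer φ (ψ ⊗ₜ c))) u₁ (d ⊗ₜ 1) := by rw [fnAct_tmul, one_mul]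
      rw [coactAct_tmul, e₀, fnAct_outer, fnAct_coact_dualAct]
      refine congrArg₂ (fun a b => H.dualAct φ (H.dualAct ψ (H.fnAct (hat (H.exch c z)))) a b) ?_ ?_
      · rw [assoc_tmul_eq, map_mul, mul_assoc]; rfl
      · have e₂ : H.lastCoact (H.pairΔ (d ⊗ₜ 1)) = pl (m₁ ⋆ m₂) (m₂' ⋆ m₁') d := by
          rw [pairΔ, pl_tmul, map_one, mul_one, map_pl]
          simp only [comp_star, lastCoact_comp_iL, lastCoact_comp_iR_iL]
        rw [map_mul, lastCoact_reasΦInv, e₂, pl_tmul, ← mul_assoc]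
        refine congrArg (· * _) ?_
        exact Commuting.eq (B := (G ⊗[K] G) ⊗[K] ((G ⊗[K] G) ⊗[K] ((G ⊗[K] G) ⊗[K] G)))
          (iR.comp iR) (pl (m₁ ⋆ m₂) (m₂' ⋆ m₁')) w d

theorem fσ_compat_apply (a b c : G →ₐ[K] B) [Commuting a b] [Commuting a c] [Commuting b c]
    (x : G) : (φ[H.invLeg c, H.invLeg b, H.invLeg a]).unop *
      (pl a b H.fσ * pl (a ⋆ b) c (H.fσ * H.Δ x)) =
    pl b c H.fσ * pl a (b ⋆ c) (H.fσ * H.Δ x) * φ[a, b, c] := by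
  have h₁ : pl (a ⋆ b) c (H.Δ x) = (a ⋆ b ⋆ c) x := rfl
  have h₂ : pl a (b ⋆ c) (H.Δ x) = (a ⋆ (b ⋆ c)) x := rfl
  rw [map_mul, map_mul, h₁, h₂, mul_assoc (pl b c _), mul_assoc _ _ φ[a, b, c],
    ← (H.intw_reas a b c).eq, ← mul_assoc (pl a (b ⋆ c) _), ← mul_assoc (pl b c _),
    ← mul_assoc (pl b c _), H.fσ_compat]
  simp only [mul_assoc]

theorem pair_reasΦInv₁ : pl (pl m₁ m₁') (pl (pl (m₂ ⋆ m₃) (m₃' ⋆ m₂')) m₀)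
    (H.reasΦInv l₁ l₂ l₀ l₂' l₁') = H.reasΦInv m₁ (m₂ ⋆ m₃) m₀ (m₃' ⋆ m₂') m₁' := by
  simp only [map_reasΦInv, pl_comp_iL_comp, pl_comp_iR_comp, pl_comp_iL, pl_comp_iR]

theorem pair_reasΦInv₂ : pl (pl (m₁ ⋆ m₂) (m₂' ⋆ m₁')) (iR.comp iR)
    (H.reasΦInv l₁ l₂ l₀ l₂' l₁') = H.reasΦInv (m₁ ⋆ m₂) m₃ m₀ m₃' (m₂' ⋆ m₁') := by
  simp only [map_reasΦInv, pl_comp_iL_comp, pl_comp_iR_comp, pl_comp_iL, pl_comp_iR]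
  rfl

theorem dualAct₂_transfer (φ ψ : Module.Dual K G) (g : G →ₗ[K] G) (x : G) (w) :
    H.dualAct φ (H.dualAct ψ (H.fnAct g))
      (pl iL (iR.comp iL) H.fσ * pl (iL ⋆ iR.comp iL) (iR.comp iR) (H.fσ * H.Δ x))
      (φ[m₃', m₂', m₁'] * (φ⁻[m₁, m₂, m₃] * w)) =
    H.dualAct φ (H.dualAct ψ (H.fnAct g))
      (pl (iR.comp iL) (iR.comp iR) H.fσ * pl iL (iR.comp iL ⋆ iR.comp iR) (H.fσ * H.Δ x)) w := by
  have e₃ := fun v w => H.dualAct₂_inv_mul g φ ψ v (H.φ : G ⊗[K] (G ⊗[K] G)) w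
  have e₄ := fun v w => H.dualAct₂_mul g φ ψ v (H.φ : G ⊗[K] (G ⊗[K] G)) w
  have r := H.fσ_compat_apply (iL : G →ₐ[K] G ⊗[K] (G ⊗[K] G)) (iR.comp iL) (iR.comp iR) x
  rw [reas_legs, reas] at r
  rw [reas, ← e₃, r, e₄, ← reas, reas_mul_reasInv_mul]

/-- The second exchange rule to which associativity reduces. On functions, it says that `fσ` is a
twist of the reassociator and that `Φ⁻¹` satisfies a pentagon. -/
theorem outer_outer [FiniteDimensional K G] (φ ψ : Module.Dual K G) (c : G)
    (z : Module.Dual K G ⊗[K] G) :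
    H.outer φ (H.outer ψ (H.exch c z)) = H.doubleMul (H.outer φ (ψ ⊗ₜ c)) z := by
  refine hat_injective (LinearMap.ext fun x => ?_)
  rw [hat_outer, map_dualAct_fnAct_outer, hat_doubleMul, coactAct_outer, pair_reasΦInv₁,
    pair_reasΦInv₂, ← reasΦInv_pentagon, dualAct₂_transfer]

theorem outer_doubleMul [FiniteDimensional K G] (φ : Module.Dual K G)
    (y z : Module.Dual K G ⊗[K] G) :
    H.outer φ (H.doubleMul y z) = H.doubleMul (H.outer φ y) z := by
  induction y using TensorProduct.induction_on with
  | zero => simp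
  | add x y hx hy => simp only [map_add, LinearMap.add_apply, hx, hy]
  | tmul ψ c => rw [← outer_outer, doubleMul, compTensor_tmul]

theorem doubleMul_assoc [FiniteDimensional K G] (x y z : Module.Dual K G ⊗[K] G) :
    H.doubleMul (H.doubleMul x y) z = H.doubleMul x (H.doubleMul y z) := by
  induction x using TensorProduct.induction_on with
  | zero => simp
  | add x y hx hy => simp only [map_add, LinearMap.add_apply, hx, hy]
  | tmul φ a =>
    rw [doubleMul, compTensor_tmul, compTensor_tmul, ← doubleMul, ← outer_doubleMul]
    congr 1
    induction y using TensorProduct.induction_on with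
    | zero => simp
    | add x y hx hy => simp only [map_add, LinearMap.add_apply, hx, hy]
    | tmul ψ b => rw [← exch_outer, doubleMul, compTensor_tmul]

/-! ### The unit of the double -/

theorem counit_S (hα : H.ε H.α = 1) (x : G) : H.ε (H.S x) = H.ε x := by
  have h := congrArg H.ε (H.antipode_left x)
  have e : ∀ d : G ⊗[K] G, H.ε ((H.S.toLinearMap ⊛ LinearMap.mulLeft K H.α) d) =
      H.ε (H.S (pl (AlgHom.id K G) H.triv d)) := by
    intro d
    induction d using TensorProduct.induction_on with
    | zero => simp
    | add x y hx hy => simp only [map_add, hx, hy]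
    | tmul p q => simp [hα, Algebra.algebraMap_eq_smul_one, S_one, mul_comm]
  rw [e, ← star_apply, star_triv] at h
  simpa [hα] using h

theorem counit_Sinv (hα : H.ε H.α = 1) (x : G) : H.ε (H.Sinv x) = H.ε x := by
  rw [← H.counit_S hα, S_Sinv]

/-- The twist is counital; this uses `ε(α) = 1`. -/
theorem right_counit_f (hα : H.ε H.α = 1) : pl (AlgHom.id K G) H.triv H.f = 1 := by
  have hγ : pl (AlgHom.id K G) H.triv H.γ = H.α := by
    have e : (pl (AlgHom.id K G) H.triv).toLinearMap ∘ₗ H.ev₂ =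
        H.evLin ∘ₗ (pl (AlgHom.id K (G ⊗[K] G)) (pl H.triv H.triv)).toLinearMap := by
      ext
      simp [ev₂, evLin, hα, H.counit_S hα, Algebra.algebraMap_eq_smul_one, smul_smul, mul_comm]
    have h := DFunLike.congr_fun e (φ⁻[e₁, e₂, e₄] * φ[e₃, e₁, e₂ ⋆ e₄])
    rw [LinearMap.comp_apply, ← γ_eq] at h
    refine h.trans ?_
    simp only [LinearMap.comp_apply, AlgHom.toLinearMap_apply, map_mul, map_reas, map_reasInv,
      comp_star, pl_comp_iL_comp, pl_comp_iR_comp, pl_comp_iL, pl_comp_iR,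
      reasInv_triv_right, reas_triv_left, mul_one]
    simp [evLin, Algebra.TensorProduct.one_def, S_one]
  have hS : ∀ x, pl (AlgHom.id K G) H.triv (H.SSΔop x) = H.S x := by
    intro x
    have e : ∀ d : G ⊗[K] G, pl (AlgHom.id K G) H.triv (TensorProduct.map H.S.toLinearMap
        H.S.toLinearMap (Algebra.TensorProduct.comm K G G d)) =
        H.S (pl H.triv (AlgHom.id K G) d) := by
      intro d
      induction d using TensorProduct.induction_on with
      | zero => simp
      | add x y hx hy => simp only [map_add, hx, hy]
      | tmul p q =>
        simp [H.counit_S hα, Algebra.algebraMap_eq_smul_one]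
    exact (e _).trans (congrArg H.S (DFunLike.congr_fun (H.triv_star (AlgHom.id K G)) x))
  have hΔ : ∀ x, pl (AlgHom.id K G) H.triv (H.Δ x) = x := fun x => by
    rw [← star_apply, star_triv]; rfl
  have e : (pl (AlgHom.id K G) H.triv).toLinearMap ∘ₗ (H.SSΔop ⊛ (LinearMap.mulLeft K H.γ ∘ₗ
      H.Δ.toLinearMap ∘ₗ LinearMap.mulRight K H.β) ⊛ (H.Δ.toLinearMap ∘ₗ H.S.toLinearMap)) =
      H.S.toLinearMap ⊛ LinearMap.mulLeft K H.α ⊛ (LinearMap.mulLeft K H.β ∘ₗ H.S.toLinearMap) := by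
    ext p q r
    simp [hS, hΔ, hγ, mul_assoc]
  rw [← H.reassoc_inv_antipode, ← e]
  rfl

theorem left_counit_f (hα : H.ε H.α = 1) : pl H.triv (AlgHom.id K G) H.f = 1 := by
  have hγ : pl H.triv (AlgHom.id K G) H.γ = H.α := by
    have e : (pl H.triv (AlgHom.id K G)).toLinearMap ∘ₗ H.ev₂ =
        H.evLin ∘ₗ (pl (pl H.triv H.triv) (AlgHom.id K (G ⊗[K] G))).toLinearMap := by
      ext
      simp [ev₂, evLin, hα, H.counit_S hα, Algebra.algebraMap_eq_smul_one, smul_smul, mul_comm]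
    have h := DFunLike.congr_fun e (φ⁻[e₁, e₂, e₄] * φ[e₃, e₁, e₂ ⋆ e₄])
    rw [LinearMap.comp_apply, ← γ_eq] at h
    refine h.trans ?_
    simp only [LinearMap.comp_apply, AlgHom.toLinearMap_apply, map_mul, map_reas, map_reasInv,
      comp_star, pl_comp_iL_comp, pl_comp_iR_comp, pl_comp_iL, pl_comp_iR,
      reasInv_triv_left, reas_triv_mid, mul_one]
    simp [evLin, Algebra.TensorProduct.one_def, S_one]
  have hS : ∀ x, pl H.triv (AlgHom.id K G) (H.SSΔop x) = H.S x := by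
    intro x
    have e : ∀ d : G ⊗[K] G, pl H.triv (AlgHom.id K G) (TensorProduct.map H.S.toLinearMap
        H.S.toLinearMap (Algebra.TensorProduct.comm K G G d)) =
        H.S (pl (AlgHom.id K G) H.triv d) := by
      intro d
      induction d using TensorProduct.induction_on with
      | zero => simp
      | add x y hx hy => simp only [map_add, hx, hy]
      | tmul p q =>
        simp [H.counit_S hα, Algebra.algebraMap_eq_smul_one]
    exact (e _).trans (congrArg H.S (DFunLike.congr_fun (H.star_triv (AlgHom.id K G)) x))
  have hΔ : ∀ x, pl H.triv (AlgHom.id K G) (H.Δ x) = x := fun x => by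
    rw [← star_apply, triv_star]; rfl
  have e : (pl H.triv (AlgHom.id K G)).toLinearMap ∘ₗ (H.SSΔop ⊛ (LinearMap.mulLeft K H.γ ∘ₗ
      H.Δ.toLinearMap ∘ₗ LinearMap.mulRight K H.β) ⊛ (H.Δ.toLinearMap ∘ₗ H.S.toLinearMap)) =
      H.S.toLinearMap ⊛ LinearMap.mulLeft K H.α ⊛ (LinearMap.mulLeft K H.β ∘ₗ H.S.toLinearMap) := by
    ext p q r
    simp [hS, hΔ, hγ, mul_assoc]
  rw [← H.reassoc_inv_antipode, ← e]
  rfl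

theorem right_counit_fσ (hα : H.ε H.α = 1) : pl (AlgHom.id K G) H.triv H.fσ = 1 := by
  have e : ∀ w : G ⊗[K] G, pl (AlgHom.id K G) H.triv (Algebra.TensorProduct.comm K G G
      (TensorProduct.map H.Sinv H.Sinv w)) = H.Sinv (pl H.triv (AlgHom.id K G) w) := by
    intro w
    induction w using TensorProduct.induction_on with
    | zero => simp
    | add x y hx hy => simp only [map_add, hx, hy]
    | tmul p q => simp [H.counit_Sinv hα, Algebra.algebraMap_eq_smul_one]
  rw [fσ, e, H.left_counit_f hα, Sinv_one]

theorem left_counit_fσ (hα : H.ε H.α = 1) : pl H.triv (AlgHom.id K G) H.fσ = 1 := by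
  have e : ∀ w : G ⊗[K] G, pl H.triv (AlgHom.id K G) (Algebra.TensorProduct.comm K G G
      (TensorProduct.map H.Sinv H.Sinv w)) = H.Sinv (pl (AlgHom.id K G) H.triv w) := by
    intro w
    induction w using TensorProduct.induction_on with
    | zero => simp
    | add x y hx hy => simp only [map_add, hx, hy]
    | tmul p q => simp [H.counit_Sinv hα, Algebra.algebraMap_eq_smul_one]
  rw [fσ, e, H.right_counit_f hα, Sinv_one]

theorem exch_doubleOne [FiniteDimensional K G] (hα : H.ε H.α = 1) (a : G) :
    H.exch a H.doubleOne = H.ε.toLinearMap ⊗ₜ a := by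
  refine hat_injective (LinearMap.ext fun x => ?_)
  have e : (H.fnAct (hat H.doubleOne) x) =
      H.ε x • (pl (pl H.triv H.triv) (AlgHom.id K G)).toLinearMap := by
    ext p q c
    simp [doubleOne, H.counit_Sinv hα, Algebra.algebraMap_eq_smul_one, smul_smul]
    ring_nf
  rw [hat_exch, e, LinearMap.smul_apply, AlgHom.toLinearMap_apply, ← AlgHom.comp_apply]
  simp only [comp_star, pl_comp_iL_comp, pl_comp_iL, pl_comp_iR, triv_star, star_triv]
  simp

theorem outer_counit [FiniteDimensional K G] (hα : H.ε H.α = 1) (z : Module.Dual K G ⊗[K] G) :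
    H.outer H.ε.toLinearMap z = z := by
  refine hat_injective (LinearMap.ext fun x => ?_)
  have e : H.dualAct H.ε.toLinearMap (H.fnAct (hat z)) = (H.fnAct (hat z)).compl₁₂
      (pl H.triv (AlgHom.id K G)).toLinearMap
        (pl (pl H.triv H.triv) (AlgHom.id K ((G ⊗[K] G) ⊗[K] G))).toLinearMap := by
    refine TensorProduct.ext' fun v₁ v => TensorProduct.ext' fun d w => ?_
    induction d using TensorProduct.induction_on with
    | zero => simp
    | add x y hx hy => simp only [TensorProduct.add_tmul, map_add, hx, hy]
    | tmul p q =>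
      simp [H.counit_Sinv hα, Algebra.algebraMap_eq_smul_one, smul_smul]
      ring_nf
  rw [hat_outer, e, LinearMap.compl₁₂_apply]
  have h₁ : pl H.triv (AlgHom.id K G) (H.Δ x) = x :=
    DFunLike.congr_fun (H.triv_star (AlgHom.id K G)) x
  simp only [AlgHom.toLinearMap_apply, map_mul, H.left_counit_fσ hα, h₁, reasΦInv, map_reas,
    map_reasInv, comp_star,
    pl_comp_iL_comp, pl_comp_iL, pl_comp_iR, pl_comp_iR_comp, reas_triv_right,
    reasInv_triv_left, one_mul]
  rw [Algebra.TensorProduct.one_def, fnAct_tmul, Algebra.TensorProduct.one_def, sand_tmul]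
  simp

theorem outer_tmul_counit [FiniteDimensional K G] (hα : H.ε H.α = 1) (χ : Module.Dual K G)
    (a : G) : H.outer χ (H.ε.toLinearMap ⊗ₜ a) = χ ⊗ₜ a := by
  refine hat_injective (LinearMap.ext fun x => ?_)
  have e : H.dualAct χ (H.fnAct (hat (H.ε.toLinearMap ⊗ₜ a))) =
      (H.fnAct (hat (χ ⊗ₜ a))).compl₁₂ (pl (AlgHom.id K G) H.triv).toLinearMap
        (pl iL (pl (pl H.triv H.triv) iR)).toLinearMap := by
    refine TensorProduct.ext' fun v₁ v => TensorProduct.ext' fun d w => ?_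
    induction w using TensorProduct.induction_on with
    | zero => simp
    | add x y hx hy => simp only [TensorProduct.tmul_add, map_add, hx, hy]
    | tmul d' c =>
      induction d' using TensorProduct.induction_on with
      | zero => simp
      | add x y hx hy => simp only [TensorProduct.add_tmul, TensorProduct.tmul_add, map_add, hx, hy]
      | tmul p q =>
        simp [H.counit_Sinv hα, Algebra.algebraMap_eq_smul_one, smul_smul]
        ring_nf
  rw [hat_outer, e, LinearMap.compl₁₂_apply]
  have h₁ : pl (AlgHom.id K G) H.triv (H.Δ x) = x :=
    DFunLike.congr_fun (H.star_triv (AlgHom.id K G)) x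
  simp only [AlgHom.toLinearMap_apply, map_mul, H.right_counit_fσ hα, h₁, reasΦInv, map_reas,
    map_reasInv, comp_star,
    pl_comp_iL_comp, pl_comp_iL, pl_comp_iR, pl_comp_iR_comp, reas_triv_mid, star_triv,
    reasInv_triv_mid, reasInv_triv_right, triv_star, one_mul]
  rw [Algebra.TensorProduct.one_def, fnAct_tmul, Algebra.TensorProduct.one_def, sand_tmul]
  simp

/-- The double is an algebra. -/
theorem doubleIsAlgebra [FiniteDimensional K G] (hα : H.ε H.α = 1) : H.DoubleIsAlgebra where
  mul_assoc := H.doubleMul_assoc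
  one_mul x := by
    have e : H.exch 1 x = x := by
      refine hat_injective (LinearMap.ext fun y => ?_)
      rw [hat_exch, map_one, Algebra.TensorProduct.one_def, fnAct_tmul,
        Algebra.TensorProduct.one_def, sand_tmul]
      simp
    rw [doubleOne, doubleMul, compTensor_tmul, e, H.outer_counit hα]
  mul_one x := by
    induction x using TensorProduct.induction_on with
    | zero => simp
    | add x y hx hy => simp only [map_add, LinearMap.add_apply, hx, hy]
    | tmul χ a =>
      rw [doubleMul, compTensor_tmul, H.exch_doubleOne hα, H.outer_tmul_counit hα]

/-! ### Flip operators and generating elements -/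

section

/-- `x ⊗ x° ↦ S⁻¹(x°) S⁻¹(α) x`. -/
def evInv : G ⊗[K] G →ₗ[K] G := H.Sinv ∘ₗ H.evLin

@[simp] theorem evInv_tmul (x y : G) :
    H.evInv (x ⊗ₜ y) = H.Sinv y * (H.Sinv H.α * x) := by
  simp [evInv, evLin, Sinv_mul, mul_assoc]

theorem leftEq_evInv : LeftEq H.evInv (iL ⋆ iR) H.triv := H.leftEq_evLin.postcomp _

/-- `X ⊗ Y ⊗ Z ↦ S⁻¹(α Z) Y ⊗ X`. -/
def qLin : G ⊗[K] (G ⊗[K] G) →ₗ[K] G ⊗[K] G :=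
  TensorProduct.map H.evInv LinearMap.id ∘ₗ (pl iR (pl (iL.comp iL) (iL.comp iR))).toLinearMap

@[simp] theorem qLin_tmul (x y z : G) : H.qLin (x ⊗ₜ (y ⊗ₜ z)) = H.evInv (y ⊗ₜ z) ⊗ₜ x := by
  simp [qLin]

/-- The element `S⁻¹(α Z) Y ⊗ X`, where `φ = X ⊗ Y ⊗ Z`. -/
def qop : G ⊗[K] G := H.qLin (H.φ : G ⊗[K] (G ⊗[K] G))

variable (j : G →ₐ[K] A)

/-- `id ⊗ j`. -/
abbrev onSnd : G ⊗[K] G →ₐ[K] G ⊗[K] A := Algebra.TensorProduct.map (AlgHom.id K G) j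

/-- The right action `L ↦ (S⁻¹(q) ⊗ 1) L (x ⊗ j(g))` of `(x ⊗ g) ⊗ q` on `G ⊗ A`. -/
def sandL : (G ⊗[K] G) ⊗[K] G →ₗ[K] Module.End K (G ⊗[K] A) :=
  (rmul ∘ₗ (onSnd j).toLinearMap) ⊚ (lmul ∘ₗ (iL : G →ₐ[K] G ⊗[K] A).toLinearMap ∘ₗ H.Sinv)

theorem sandL_tmul (L : G ⊗[K] A) (d : G ⊗[K] G) (q : G) :
    H.sandL j (d ⊗ₜ q) L = H.Sinv q ⊗ₜ 1 * (L * onSnd j d) := by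
  rw [sandL, compTensor_tmul, ← mul_assoc]; rfl

theorem sandL_mul (L : G ⊗[K] A) (w w' : (G ⊗[K] G) ⊗[K] G) :
    H.sandL j (w * w') L = H.sandL j w' (H.sandL j w L) := by
  induction w using TensorProduct.induction_on with
  | zero => simp
  | add x y hx hy => simp only [add_mul, map_add, LinearMap.add_apply, hx, hy]
  | tmul d q =>
    induction w' using TensorProduct.induction_on with
    | zero => simp
    | add x y hx hy => simp only [mul_add, map_add, LinearMap.add_apply, hx, hy]
    | tmul d' q' =>
      rw [Algebra.TensorProduct.tmul_mul_tmul, sandL_tmul, sandL_tmul, sandL_tmul, Sinv_mul,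
        map_mul, show (H.Sinv q' * H.Sinv q) ⊗ₜ[K] (1 : A) =
          H.Sinv q' ⊗ₜ[K] (1 : A) * H.Sinv q ⊗ₜ[K] (1 : A) by simp]
      simp only [mul_assoc]

theorem pl_onSnd (x : G →ₐ[K] B) (m : A →ₐ[K] B) [Commuting x m] (d : G ⊗[K] G) :
    pl x m (onSnd j d) = pl x (m.comp j) d :=
  eq_pl_apply (h := (pl x m).comp (onSnd j)) (by ext; simp) (by ext; simp) d

/-- `L` is moved past `j(a)` like the generating element of the double. -/
def IsExchange (L : G ⊗[K] A) : Prop :=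
  ∀ a, iR (j a) * L = H.sandL j ((iL.comp H.Δ ⋆ iR) a) L

/-- `T (id ⊗ j)(Δ(a)) = (id ⊗ j)(Δᵒᵖ(a)) T`. -/
def IsFlip (T : G ⊗[K] A) : Prop := ∀ a, T * onSnd j (H.Δ a) = onSnd j (H.Δop a) * T

/-- The generating element belonging to a flip operator. -/
def genOfFlip (T : G ⊗[K] A) : G ⊗[K] A := onSnd j H.qop * T

/-- The flip operator belonging to a generating element. -/
def flipOfGen (L : G ⊗[K] A) : G ⊗[K] A :=
  H.sandL j (Algebra.TensorProduct.map H.Δ (AlgHom.id K G) H.pρ) L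

variable {j}

theorem IsFlip.intw {T : G ⊗[K] A} (h : H.IsFlip j T) (x : G →ₐ[K] B) (m : A →ₐ[K] B)
    [Commuting x m] : Intw (pl x m T) (x ⋆ m.comp j) (m.comp j ⋆ x) := ⟨fun a => by
  have h' := congrArg (pl x m) (h a)
  rw [map_mul, map_mul, pl_onSnd, pl_onSnd] at h'
  refine h'.trans (congrArg (· * _) ?_)
  exact pl_swap (m.comp j) x (H.Δ a)⟩

/-- `x ⊗ x° ⊗ a ↦ S⁻¹(x°) S⁻¹(α) x ⊗ a`. -/
abbrev evInvFst : (G ⊗[K] G) ⊗[K] A →ₗ[K] G ⊗[K] A := TensorProduct.map H.evInv LinearMap.id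

theorem evInvFst_mul_pl (u : (G ⊗[K] G) ⊗[K] A) (d : G ⊗[K] A) :
    H.evInvFst (u * pl (iL.comp iL) iR d) = H.evInvFst u * d := by
  suffices h : ((LinearMap.mul K _).compl₁₂ LinearMap.id
    (pl (iL.comp iL) iR : G ⊗[K] A →ₐ[K] (G ⊗[K] G) ⊗[K] A).toLinearMap).compr₂ H.evInvFst =
    (LinearMap.mul K _).compl₁₂ H.evInvFst LinearMap.id from
    DFunLike.congr_fun (DFunLike.congr_fun h u) d
  ext
  simp [mul_assoc]

theorem evInvFst_iR_mul (u : (G ⊗[K] G) ⊗[K] A) (b : A) :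
    H.evInvFst (iR b * u) = iR b * H.evInvFst u := by
  induction u using TensorProduct.induction_on with
  | zero => simp
  | add x y hx hy => simp only [mul_add, map_add, hx, hy]
  | tmul d c => simp

theorem evInvFst_mul_sandL (u : (G ⊗[K] G) ⊗[K] A) (w : (G ⊗[K] G) ⊗[K] G) :
    H.evInvFst (u * pl (pl (iL.comp iL) (iR.comp j)) (iL.comp iR) w) =
      H.sandL j w (H.evInvFst u) := by
  suffices h : ((LinearMap.mul K _).compl₁₂ LinearMap.id (pl (pl (iL.comp iL) (iR.comp j))
      (iL.comp iR) : (G ⊗[K] G) ⊗[K] G →ₐ[K] (G ⊗[K] G) ⊗[K] A).toLinearMap).compr₂ H.evInvFst =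
    ((H.sandL j).compl₁₂ LinearMap.id H.evInvFst).flip from
    DFunLike.congr_fun (DFunLike.congr_fun h u) w
  ext
  simp [mul_assoc, sandL_tmul, Sinv_mul]

theorem leftEq_evInvFst : LeftEq (H.evInvFst (A := A)) (iL.comp iL ⋆ iL.comp iR) H.triv :=
  leftEq_star_map_left _ H.leftEq_evInv _

theorem evInvFst_pl (d : G ⊗[K] (G ⊗[K] G)) :
    H.evInvFst (pl (iR.comp j) (pl (iL.comp iL) (iL.comp iR)) d) = onSnd j (H.qLin d) := by
  suffices h : H.evInvFst ∘ₗ (pl (iR.comp j) (pl (iL.comp iL) (iL.comp iR)) :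
      G ⊗[K] (G ⊗[K] G) →ₐ[K] (G ⊗[K] G) ⊗[K] A).toLinearMap = (onSnd j).toLinearMap ∘ₗ H.qLin from
    DFunLike.congr_fun h d
  ext
  simp

theorem evInvFst_reas : H.evInvFst φ[(iR : A →ₐ[K] (G ⊗[K] G) ⊗[K] A).comp j,
    iL.comp iL, iL.comp iR] = onSnd j H.qop := H.evInvFst_pl _

theorem genOfFlip_eq (T : G ⊗[K] A) : H.genOfFlip j T =
    H.evInvFst (φ[iR.comp j, iL.comp iL, iL.comp iR] * pl (iL.comp iL) iR T) := by
  rw [evInvFst_mul_pl, evInvFst_reas, genOfFlip]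

theorem IsFlip.isExchange {T : G ⊗[K] A} (h : H.IsFlip j T) :
    H.IsExchange j (H.genOfFlip j T) := by
  intro a
  have k₅ := H.leftEq_evInvFst (A := A)
  have i := h.intw H (iL.comp iL : G →ₐ[K] (G ⊗[K] G) ⊗[K] A) iR
  have i' : Intw φ[(iR : A →ₐ[K] (G ⊗[K] G) ⊗[K] A).comp j, iL.comp iL, iL.comp iR]
    (iR.comp j ⋆ iL.comp iL ⋆ iL.comp iR) (iR.comp j ⋆ (iL.comp iL ⋆ iL.comp iR)) := inferInstance
  have e : pl (pl (iL.comp iL) (iR.comp j)) (iL.comp iR) ((iL.comp H.Δ ⋆ iR) a) =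
      (iL.comp iL ⋆ (iR : A →ₐ[K] (G ⊗[K] G) ⊗[K] A).comp j ⋆ iL.comp iR) a := by
    rw [← AlgHom.comp_apply]
    simp only [comp_star, pl_comp_iR, ← AlgHom.comp_assoc, pl_comp_iL]
    rfl
  rw [genOfFlip_eq, ← evInvFst_mul_sandL, e, ← evInvFst_iR_mul]
  have l := (inferInstance : LeftEq (H.evInvFst (A := A))
    (iR.comp j ⋆ (iL.comp iL ⋆ iL.comp iR)) (iR.comp j)).eq a
    (φ[iR.comp j, iL.comp iL, iL.comp iR] * pl (iL.comp iL) iR T)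
  rw [AlgHom.comp_apply] at l
  rw [← l]
  congr 1
  rw [← mul_assoc, ← i'.eq, mul_assoc, mul_assoc]
  congr 1
  exact ((inferInstance : Intw (pl (iL.comp iL) iR T) (iL.comp iL ⋆ iR.comp j ⋆ iL.comp iR)
    (iR.comp j ⋆ iL.comp iL ⋆ iL.comp iR)).eq a).symm

end

section

variable (j : G →ₐ[K] A)

theorem mul_tmul_one (x y : G) : (x * y) ⊗ₜ[K] (1 : A) = x ⊗ₜ 1 * y ⊗ₜ 1 := by simp

theorem tmul_one_mul_one_tmul (x : G) (b : A) (w : G ⊗[K] A) :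
    x ⊗ₜ 1 * ((1 ⊗ₜ b) * w) = (1 ⊗ₜ b) * (x ⊗ₜ 1 * w) := by
  rw [← mul_assoc, ← mul_assoc]; simp

section
variable {V : Type*} [Ring V] [Algebra K V]

/-- `(x ⊗ g) ⊗ x° ⊗ v ↦ (S⁻¹(x° r(v)) ⊗ 1) L (x ⊗ j(g))`. -/
def sandTail (r : V →ₗ[K] G) (L : G ⊗[K] A) : (G ⊗[K] G) ⊗[K] (G ⊗[K] V) →ₗ[K] G ⊗[K] A :=
  (H.sandL j).flip L ∘ₗ TensorProduct.map LinearMap.id (LinearMap.id ⊛ r)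

variable (r : V →ₗ[K] G) {L : G ⊗[K] A}

theorem sandTail_tmul (d : G ⊗[K] G) (q : G) (v : V) : H.sandTail j r L (d ⊗ₜ (q ⊗ₜ v)) =
    H.Sinv (q * r v) ⊗ₜ 1 * (L * onSnd j d) := by
  simp [sandTail, sandL_tmul]

theorem sandTail_map_iL_mul (u : (G ⊗[K] G) ⊗[K] G) (v : V) :
    H.sandTail j r L (Algebra.TensorProduct.map (AlgHom.id K _) iL u * iR (iR v)) =
      H.Sinv (r v) ⊗ₜ 1 * H.sandL j u L := by
  induction u using TensorProduct.induction_on with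
  | zero => simp
  | add x y hx hy => simp only [map_add, add_mul, mul_add, LinearMap.add_apply, hx, hy]
  | tmul d q =>
    rw [sandL_tmul]
    simp only [Algebra.TensorProduct.map_tmul, AlgHom.id_apply, iL_apply, iR_apply,
      Algebra.TensorProduct.tmul_mul_tmul, mul_one, one_mul, sandTail_tmul, Sinv_mul]
    rw [mul_tmul_one, mul_assoc]

theorem sandTail_mul_onSnd (w) (d : G ⊗[K] G) :
    H.sandTail j r L (w * iL d) = H.sandTail j r L w * onSnd j d := by
  induction w using TensorProduct.induction_on with
  | zero => simp
  | add x y hx hy => simp only [map_add, add_mul, hx, hy]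
  | tmul d' q =>
    induction q using TensorProduct.induction_on with
    | zero => simp
    | add x y hx hy => simp only [TensorProduct.tmul_add, map_add, add_mul, hx, hy]
    | tmul q v =>
      rw [iL_apply, Algebra.TensorProduct.tmul_mul_tmul, mul_one, sandTail_tmul, sandTail_tmul,
        map_mul (onSnd j), mul_assoc, mul_assoc]

theorem sandL_iR_mul (L : G ⊗[K] A) (b : A) (u : (G ⊗[K] G) ⊗[K] G) :
    H.sandL j u (iR b * L) = iR b * H.sandL j u L := by
  induction u using TensorProduct.induction_on with
  | zero => simp
  | add x y hx hy => simp only [map_add, mul_add, LinearMap.add_apply, hx, hy]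
  | tmul d q =>
    rw [sandL_tmul, sandL_tmul, iR_apply, mul_assoc, tmul_one_mul_one_tmul]

theorem sandTail_exchange (h : H.IsExchange j L) (a : G) (w) :
    H.sandTail j r L ((iL.comp iL ⋆ iL.comp iR ⋆ iR.comp iL) a * w) =
      iR (j a) * H.sandTail j r L w := by
  have e : (iL.comp iL ⋆ iL.comp iR ⋆ (iR.comp iL : G →ₐ[K] (G ⊗[K] G) ⊗[K] (G ⊗[K] V))) a =
      Algebra.TensorProduct.map (AlgHom.id K _) iL ((iL.comp H.Δ ⋆ iR) a) := by
    rw [← AlgHom.comp_apply (Algebra.TensorProduct.map _ _), comp_star]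
    refine congrArg (fun f : G →ₐ[K] (G ⊗[K] G) ⊗[K] (G ⊗[K] V) => f a) ?_
    have h₁ : (Algebra.TensorProduct.map (AlgHom.id K (G ⊗[K] G))
        (iL : G →ₐ[K] G ⊗[K] V)).comp (iL.comp H.Δ) = iL.comp iL ⋆ iL.comp iR := by
      rw [← comp_star, iL_star_iR]; ext; simp [Algebra.TensorProduct.one_def]
    have h₂ : (Algebra.TensorProduct.map (AlgHom.id K (G ⊗[K] G))
        (iL : G →ₐ[K] G ⊗[K] V)).comp iR = iR.comp iL := by ext; simp
    simp only [h₁, h₂]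
  rw [e]
  have key : ∀ (u : (G ⊗[K] G) ⊗[K] G) (v : V), H.sandTail j r L
      (Algebra.TensorProduct.map (AlgHom.id K _) iL ((iL.comp H.Δ ⋆ iR) a) *
        (Algebra.TensorProduct.map (AlgHom.id K _) iL u * iR (iR v))) =
      iR (j a) * H.sandTail j r L (Algebra.TensorProduct.map (AlgHom.id K _) iL u * iR (iR v)) := by
    intro u v
    rw [← mul_assoc, ← map_mul, sandTail_map_iL_mul, sandTail_map_iL_mul, sandL_mul, ← h a,
      sandL_iR_mul, iR_apply, tmul_one_mul_one_tmul]
  induction w using TensorProduct.induction_on with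
  | zero => simp
  | add x y hx hy => simp only [map_add, mul_add, hx, hy]
  | tmul d q =>
    induction q using TensorProduct.induction_on with
    | zero => simp
    | add x y hx hy => simp only [TensorProduct.tmul_add, map_add, mul_add, hx, hy]
    | tmul q v =>
      have := key (d ⊗ₜ q) v
      simpa using this

end

theorem pρ_eq : H.pρ = TensorProduct.map LinearMap.id H.coevLin
    (↑H.φ⁻¹ : G ⊗[K] (G ⊗[K] G)) := by
  rw [pρ]
  refine DFunLike.congr_fun (?_ : TensorProduct.map _ _ = TensorProduct.map _ _) _
  congr 1
  ext
  simp [coevLin, mul_assoc]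

theorem flipOfGen_eq (L : G ⊗[K] A) : H.flipOfGen j L =
    H.sandTail j (LinearMap.mulLeft K H.β ∘ₗ H.S.toLinearMap) L φ⁻[e₁ ⋆ e₂, e₃, e₄] := by
  rw [flipOfGen, pρ_eq, reasInv]
  suffices h : (H.sandL j).flip L ∘ₗ (Algebra.TensorProduct.map H.Δ (AlgHom.id K G)).toLinearMap ∘ₗ
      TensorProduct.map LinearMap.id H.coevLin =
      H.sandTail j (LinearMap.mulLeft K H.β ∘ₗ H.S.toLinearMap) L ∘ₗ
        (pl (e₁ ⋆ e₂) (pl e₃ e₄)).toLinearMap from DFunLike.congr_fun h _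
  refine TensorProduct.ext_threefold' fun a b c => ?_
  have h₁ : (e₁ ⋆ e₂ : G →ₐ[K] (G ⊗[K] G) ⊗[K] (G ⊗[K] G)) = iL.comp H.Δ := by
    rw [← iL_star_iR, comp_star]
  simp only [LinearMap.comp_apply, AlgHom.toLinearMap_apply, pl_tmul, h₁, AlgHom.comp_apply,
    iL_apply, iR_apply, TensorProduct.map_tmul, Algebra.TensorProduct.map_tmul,
    Algebra.TensorProduct.tmul_mul_tmul, mul_one, one_mul, sandTail_tmul, LinearMap.flip_apply,
    sandL_tmul, LinearMap.id_apply, AlgHom.id_apply, coevLin, mulTensor_tmul]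

/-- A generating element with the exchange rule gives a flip operator. -/
theorem IsExchange.isFlip {L : G ⊗[K] A} (h : H.IsExchange j L) :
    H.IsFlip j (H.flipOfGen j L) := by
  intro a
  set F := H.sandTail j (LinearMap.mulLeft K H.β ∘ₗ H.S.toLinearMap) L with hF
  have k : RightEq F (e₃ ⋆ e₄) H.triv :=
    (rightEq_star_map_right _ H.rightEq_coevLin _).postcomp _
  rw [flipOfGen_eq, ← sandTail_mul_onSnd]
  have h₁ : iL (H.Δ a) = (e₁ ⋆ e₂ : G →ₐ[K] (G ⊗[K] G) ⊗[K] (G ⊗[K] G)) a := by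
    rw [← comp_star, iL_star_iR]; rfl
  rw [h₁, ← (inferInstance : RightEq F (e₁ ⋆ e₂ ⋆ (e₃ ⋆ e₄)) (e₁ ⋆ e₂)).eq,
    (H.intw_reasInv _ _ _).eq, star_apply, Δop, AlgHom.comp_apply]
  generalize H.Δ a = d
  induction d using TensorProduct.induction_on with
  | zero => simp
  | add x y hx hy => simp only [map_add, add_mul, hx, hy]
  | tmul p q =>
    rw [pl_tmul, mul_assoc, hF, sandTail_exchange _ _ _ h]
    have k₂ : ∀ w, H.sandTail j (LinearMap.mulLeft K H.β ∘ₗ H.S.toLinearMap) L (e₄ q * w) =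
        q ⊗ₜ 1 * H.sandTail j (LinearMap.mulLeft K H.β ∘ₗ H.S.toLinearMap) L w := by
      intro w
      suffices h : H.sandTail j (LinearMap.mulLeft K H.β ∘ₗ H.S.toLinearMap) L ∘ₗ
          LinearMap.mulLeft K (e₄ q) = LinearMap.mulLeft K (q ⊗ₜ 1) ∘ₗ
          H.sandTail j (LinearMap.mulLeft K H.β ∘ₗ H.S.toLinearMap) L from DFunLike.congr_fun h w
      ext x g y z
      simp [sandTail_tmul, S_mul, Sinv_mul, mul_assoc]
      rw [mul_tmul_one, mul_assoc]
    rw [k₂, ← mul_assoc]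
    congr 1
    simp

/-- With `flipOfGen_genOfFlip`: generating elements and flip operators determine one another. Here
the product of `q` with `p_ρ` collapses by the zigzag `X β S(Y) α Z = 1`, after rebracketing. -/
theorem genOfFlip_flipOfGen {L : G ⊗[K] A} (h : H.IsExchange j L) :
    H.genOfFlip j (H.flipOfGen j L) = L := by
  set r : G ⊗[K] G →ₗ[K] G :=
    (LinearMap.mulLeft K H.β ∘ₗ H.S.toLinearMap) ⊛ LinearMap.mulLeft K H.α with hr
  set F := H.sandTail j r L with hF
  let h₁ : G →ₐ[K] (G ⊗[K] G) ⊗[K] (G ⊗[K] (G ⊗[K] G)) := iL.comp iL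
  let h₂ : G →ₐ[K] (G ⊗[K] G) ⊗[K] (G ⊗[K] (G ⊗[K] G)) := iL.comp iR
  let h₃ : G →ₐ[K] (G ⊗[K] G) ⊗[K] (G ⊗[K] (G ⊗[K] G)) := iR.comp iL
  let h₄ : G →ₐ[K] (G ⊗[K] G) ⊗[K] (G ⊗[K] (G ⊗[K] G)) := iR.comp (iR.comp iL)
  let h₅ : G →ₐ[K] (G ⊗[K] G) ⊗[K] (G ⊗[K] (G ⊗[K] G)) := iR.comp (iR.comp iR)
  have k₁ : RightEq F (h₃ ⋆ h₄) H.triv :=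
    (rightEq_star_map_right _ H.rightEq_zigLin _).postcomp _
  have k₂ : LeftEq F (h₄ ⋆ h₅) H.triv :=
    (leftEq_star_map_right _ H.leftEq_zigLin _).postcomp _
  have key : ∀ (u : G ⊗[K] (G ⊗[K] G)) (v : (G ⊗[K] G) ⊗[K] (G ⊗[K] G)), onSnd j (H.qLin u) *
      H.sandTail j (LinearMap.mulLeft K H.β ∘ₗ H.S.toLinearMap) L v =
      F (pl (h₁ ⋆ h₂ ⋆ h₃) (pl h₄ h₅) u *
        Algebra.TensorProduct.map (AlgHom.id K _) leg12 v) := by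
    intro u v
    induction u using TensorProduct.induction_on with
    | zero => simp
    | add x y hx hy => simp only [map_add, add_mul, hx, hy]
    | tmul X u =>
    induction u using TensorProduct.induction_on with
    | zero => simp
    | add x y hx hy => simp only [TensorProduct.tmul_add, map_add, add_mul, hx, hy]
    | tmul Y Z =>
    induction v using TensorProduct.induction_on with
    | zero => simp
    | add x y hx hy => simp only [map_add, mul_add, hx, hy]
    | tmul d v =>
    induction v using TensorProduct.induction_on with
    | zero => simp
    | add x y hx hy => simp only [TensorProduct.tmul_add, map_add, mul_add, hx, hy]
    | tmul q y =>
      have e₀ : onSnd j (H.qLin (X ⊗ₜ (Y ⊗ₜ Z))) = 1 ⊗ₜ (j X) * H.evInv (Y ⊗ₜ Z) ⊗ₜ 1 := by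
        simp
      rw [e₀, pl_tmul, mul_assoc, hF, mul_assoc]
      refine Eq.trans ?_ (H.sandTail_exchange j r h X _).symm
      rw [iR_apply]
      congr 1
      simp [h₄, h₅, leg12, sandTail_tmul, hr, S_mul, Sinv_mul, mul_assoc]
      rw [← mul_assoc, Algebra.TensorProduct.tmul_mul_tmul, mul_one]
      simp only [mul_assoc]
  have e : φ⁻[h₁ ⋆ h₂, h₃, h₄] =
      Algebra.TensorProduct.map (AlgHom.id K _) leg12 φ⁻[e₁ ⋆ e₂, e₃, e₄] := by
    have p₁ : (Algebra.TensorProduct.map (AlgHom.id K (G ⊗[K] G))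
        (leg12 (K := K) (A := G) (B := G) (C := G))).comp e₁ = h₁ := by
      ext; simp [h₁, leg12, Algebra.TensorProduct.one_def]
    have p₂ : (Algebra.TensorProduct.map (AlgHom.id K (G ⊗[K] G))
        (leg12 (K := K) (A := G) (B := G) (C := G))).comp e₂ = h₂ := by
      ext; simp [h₂, leg12, Algebra.TensorProduct.one_def]
    have p₃ : (Algebra.TensorProduct.map (AlgHom.id K (G ⊗[K] G))
        (leg12 (K := K) (A := G) (B := G) (C := G))).comp e₃ = h₃ := by
      ext; simp [h₃, leg12, Algebra.TensorProduct.one_def]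
    have p₄ : (Algebra.TensorProduct.map (AlgHom.id K (G ⊗[K] G))
        (leg12 (K := K) (A := G) (B := G) (C := G))).comp e₄ = h₄ := by
      ext; simp [h₄, leg12, Algebra.TensorProduct.one_def]
    rw [map_reasInv]
    simp only [comp_star, p₁, p₂, p₃, p₄]
  rw [genOfFlip, flipOfGen_eq, qop, key, ← e]
  change F (φ[h₁ ⋆ h₂ ⋆ h₃, h₄, h₅] * _) = _
  have w : φ[h₁ ⋆ h₂ ⋆ h₃, h₄, h₅] * φ⁻[h₁ ⋆ h₂, h₃, h₄] =
      φ⁻[h₁ ⋆ h₂, h₃, h₄ ⋆ h₅] * (φ[h₃, h₄, h₅] * φ[h₁ ⋆ h₂, h₃ ⋆ h₄, h₅]) := by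
    simp [H.reas_left (h₁ ⋆ h₂) h₃ h₄ h₅, mul_assoc]
  rw [w, left_reasInv₃, right_reas₂]
  have w' : φ[h₃, h₄, h₅] = 1 ⊗ₜ[K] (H.φ : G ⊗[K] (G ⊗[K] G)) := by
    rw [← iR_apply, ← reas_legs, map_reas]
  have z : ((LinearMap.id : G →ₗ[K] G) ⊛ r) (H.φ : G ⊗[K] (G ⊗[K] G)) = 1 := H.reassoc_antipode
  rw [w', hF, sandTail, LinearMap.comp_apply, TensorProduct.map_tmul, z, LinearMap.flip_apply,
    LinearMap.id_apply, ← Algebra.TensorProduct.one_def, Algebra.TensorProduct.one_def, sandL_tmul]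
  simp [← Algebra.TensorProduct.one_def]

end

/-- `∑ (S⁻¹(p²) ⊗ 1) q Δᵒᵖ(p¹) = 1`, where `q = S⁻¹(α Z) Y ⊗ X` and `p_ρ = p¹ ⊗ p²`. -/
theorem qop_pρ : ((rmul ∘ₗ H.Δop.toLinearMap) ⊚
    (lmul ∘ₗ (iL : G →ₐ[K] G ⊗[K] G).toLinearMap ∘ₗ H.Sinv)) H.pρ H.qop = 1 := by
  let F : G ⊗[K] (G ⊗[K] (G ⊗[K] G)) →ₗ[K] G ⊗[K] G :=
    (TensorProduct.comm K G G).toLinearMap ∘ₗ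
      TensorProduct.map LinearMap.id (H.Sinv ∘ₗ H.zagLin)
  let t : G →ₐ[K] G ⊗[K] (G ⊗[K] (G ⊗[K] G)) := iL
  let w : G →ₐ[K] G ⊗[K] (G ⊗[K] (G ⊗[K] G)) := iR.comp iL
  let x : G →ₐ[K] G ⊗[K] (G ⊗[K] (G ⊗[K] G)) := iR.comp (iR.comp iL)
  let y : G →ₐ[K] G ⊗[K] (G ⊗[K] (G ⊗[K] G)) := iR.comp (iR.comp iR)
  have k₁ : LeftEq F (w ⋆ x) H.triv :=
    (leftEq_star_map_right _ (H.leftEq_zagLin.postcomp H.Sinv) _).postcomp _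
  have k₂ : RightEq F (x ⋆ y) H.triv :=
    (rightEq_star_map_right _ (H.rightEq_zagLin.postcomp H.Sinv) _).postcomp _
  have key : ∀ u v : G ⊗[K] (G ⊗[K] G), ((rmul ∘ₗ H.Δop.toLinearMap) ⊚
      (lmul ∘ₗ (iL : G →ₐ[K] G ⊗[K] G).toLinearMap ∘ₗ H.Sinv))
      (TensorProduct.map LinearMap.id H.coevLin v) (H.qLin u) =
      F (pl t (pl w x) u * pl (t ⋆ w) (pl x y) v) := by
    intro u v
    induction v using TensorProduct.induction_on with
    | zero => simp
    | add x y hx hy => simp only [map_add, mul_add, LinearMap.add_apply, hx, hy]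
    | tmul P v =>
    induction v using TensorProduct.induction_on with
    | zero => simp
    | add x y hx hy =>
      simp only [TensorProduct.tmul_add, map_add, mul_add, LinearMap.add_apply, hx, hy]
    | tmul Q R =>
    induction u using TensorProduct.induction_on with
    | zero => simp
    | add x y hx hy => simp only [map_add, add_mul, hx, hy]
    | tmul X u =>
    induction u using TensorProduct.induction_on with
    | zero => simp
    | add x y hx hy => simp only [TensorProduct.tmul_add, map_add, add_mul, hx, hy]
    | tmul Y Z =>
      rw [pl_tmul (t ⋆ w), star_apply, TensorProduct.map_tmul, compTensor_tmul,
        LinearMap.comp_apply, AlgHom.toLinearMap_apply, Δop, AlgHom.comp_apply]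
      simp only [LinearMap.id_apply]
      generalize H.Δ P = d
      induction d using TensorProduct.induction_on with
      | zero => simp
      | add x y hx hy => simp only [map_add, add_mul, mul_add, LinearMap.add_apply, hx, hy]
      | tmul P₁ P₂ =>
        simp [F, t, w, x, y, lmul, rmul, zagLin, coevLin, Sinv_mul, mul_assoc]
  have h : φ[t, w, x] * φ⁻[t ⋆ w, x, y] = φ⁻[t, w ⋆ x, y] * (φ⁻[w, x, y] * φ[t, w, x ⋆ y]) := by
    simp [H.reas_right t w x y, mul_assoc]
  have h' : φ⁻[w, x, y] = 1 ⊗ₜ[K] (↑H.φ⁻¹ : G ⊗[K] (G ⊗[K] G)) := by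
    rw [← iR_apply, ← reasInv_legs, map_reasInv]
  have z : H.zagLin (↑H.φ⁻¹ : G ⊗[K] (G ⊗[K] G)) = 1 := H.reassoc_inv_antipode
  rw [pρ_eq, qop, key]
  change F (φ[t, w, x] * φ⁻[t ⋆ w, x, y]) = 1
  rw [h, left_reasInv₂, right_reas₃, h']
  simp [F, z, Algebra.TensorProduct.one_def]

/-- An element intertwining `a ⋆ c` with `c ⋆ a` is recovered from its multiple by `q`. -/
theorem sand_qop_mul (a c : G →ₐ[K] B) [Commuting a c] (N : B) [hN : Intw N (a ⋆ c) (c ⋆ a)] :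
    ((rmul ∘ₗ (a ⋆ c).toLinearMap) ⊚ (lmul ∘ₗ a.toLinearMap ∘ₗ H.Sinv)) H.pρ
      (pl a c H.qop * N) = N := by
  have key : ∀ p q : G ⊗[K] G,
      ((rmul ∘ₗ (a ⋆ c).toLinearMap) ⊚ (lmul ∘ₗ a.toLinearMap ∘ₗ H.Sinv)) p (pl a c q * N) =
      pl a c (((rmul ∘ₗ H.Δop.toLinearMap) ⊚
        (lmul ∘ₗ (iL : G →ₐ[K] G ⊗[K] G).toLinearMap ∘ₗ H.Sinv)) p q) * N := by
    intro p q
    induction p using TensorProduct.induction_on with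
    | zero => simp
    | add x y hx hy => simp only [map_add, add_mul, LinearMap.add_apply, hx, hy]
    | tmul P Q =>
      have h : pl a c (H.Δop P) = (c ⋆ a) P := pl_swap c a (H.Δ P)
      have h' := hN.eq P
      simp only [compTensor_tmul, LinearMap.comp_apply, AlgHom.toLinearMap_apply, lmul, rmul,
        LinearMap.flip_apply, LinearMap.mul_apply', map_mul (pl a c), pl_iL, h, mul_assoc, h']
  rw [key, qop_pρ, map_one, one_mul]

theorem eq_zero_of_qop_mul (a c : G →ₐ[K] B) [Commuting a c] (N : B) [Intw N (a ⋆ c) (c ⋆ a)]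
    (h : pl a c H.qop * N = 0) : N = 0 := by
  rw [← H.sand_qop_mul a c N, h, map_zero]

theorem flipOfGen_genOfFlip {j : G →ₐ[K] A} {T : G ⊗[K] A} (h : H.IsFlip j T) :
    H.flipOfGen j (H.genOfFlip j T) = T := by
  have i : Intw T (iL ⋆ iR.comp j) (iR.comp j ⋆ iL) := by
    have := h.intw H iL iR
    rwa [pl_iL_iR] at this
  have e : onSnd j H.qop = pl iL (iR.comp j) H.qop := by
    rw [← pl_onSnd, pl_iL_iR]; rfl
  conv_rhs => rw [← H.sand_qop_mul iL (iR.comp j) T, ← e]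
  rw [flipOfGen, genOfFlip]
  generalize H.pρ = p
  induction p using TensorProduct.induction_on with
  | zero => simp
  | add x y hx hy => simp only [map_add, LinearMap.add_apply, hx, hy]
  | tmul P Q =>
    have e' : onSnd j (H.Δ P) = (iL ⋆ iR.comp j) P := by
      rw [star_apply, ← pl_onSnd, pl_iL_iR]; rfl
    rw [Algebra.TensorProduct.map_tmul, sandL_tmul, e', AlgHom.id_apply, ← mul_assoc]
    rfl

section

/-! ### Evaluating a product of two generating elements -/

/-- Right multiplication along the leg `x`, as a right action. -/
def rightAct (x : C →ₐ[K] B) : C →ₐ[K] (Module.End K B)ᵐᵒᵖ :=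
  AlgHom.ofLinearMap ((MulOpposite.opLinearEquiv K).toLinearMap ∘ₗ rmul ∘ₗ x.toLinearMap)
    (by apply MulOpposite.unop_injective; ext; simp [rmul])
    (fun a b => by apply MulOpposite.unop_injective; ext; simp [rmul, mul_assoc])

/-- Left multiplication by `x(S⁻¹(g))`, as a right action. -/
def invLeftAct (x : G →ₐ[K] B) : G →ₐ[K] (Module.End K B)ᵐᵒᵖ :=
  AlgHom.ofLinearMap ((MulOpposite.opLinearEquiv K).toLinearMap ∘ₗ lmul ∘ₗ x.toLinearMap ∘ₗ H.Sinv)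
    (by apply MulOpposite.unop_injective; ext; simp [lmul])
    (fun a b => by apply MulOpposite.unop_injective; ext; simp [lmul, mul_assoc, Sinv_mul])

@[simp] theorem rightAct_apply (x : C →ₐ[K] B) (g : C) (N : B) :
    (rightAct x g).unop N = N * x g := rfl

@[simp] theorem invLeftAct_apply (x : G →ₐ[K] B) (g : G) (N : B) :
    (H.invLeftAct x g).unop N = x (H.Sinv g) * N := rfl

instance (x : C →ₐ[K] B) (y : A →ₐ[K] B) [Commuting x y] :
    Commuting (rightAct x) (rightAct y) :=
  ⟨fun a b => MulOpposite.unop_injective (LinearMap.ext fun N => by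
    change (N * x a) * y b = (N * y b) * x a
    rw [mul_assoc, Commuting.eq x y, mul_assoc])⟩

instance (x : G →ₐ[K] B) (y : A →ₐ[K] B) : Commuting (H.invLeftAct x) (rightAct y) :=
  ⟨fun a b => MulOpposite.unop_injective (LinearMap.ext fun N => by
    change x _ * N * y b = x _ * (N * y b)
    rw [mul_assoc])⟩

instance (x y : G →ₐ[K] B) [Commuting x y] : Commuting (H.invLeftAct x) (H.invLeftAct y) :=
  ⟨fun a b => MulOpposite.unop_injective (LinearMap.ext fun N => by
    change y _ * (x _ * N) = x _ * (y _ * N)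
    rw [← mul_assoc, ← Commuting.eq x y, mul_assoc])⟩

variable (j : G →ₐ[K] A)

/-- The right action `N ↦ (S⁻¹(x°) ⊗ S⁻¹(y°) ⊗ 1) N (x ⊗ y ⊗ j(g))` of
`(x ⊗ x°) ⊗ (y ⊗ y°) ⊗ g` on `G ⊗ G ⊗ A`. -/
def sandN : (G ⊗[K] G) ⊗[K] ((G ⊗[K] G) ⊗[K] G) →ₐ[K]
    (Module.End K (G ⊗[K] (G ⊗[K] A)))ᵐᵒᵖ :=
  pl (pl (rightAct iL) (H.invLeftAct iL)) (pl (pl (rightAct (iR.comp iL))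
    (H.invLeftAct (iR.comp iL))) (rightAct ((iR.comp iR).comp j)))

/-- `(x ⊗ x°) ⊗ (y ⊗ y°) ⊗ a ↦ S⁻¹(x°) S⁻¹(α) x ⊗ S⁻¹(y°) S⁻¹(α) y ⊗ a`. -/
abbrev evInv₂ : (G ⊗[K] G) ⊗[K] ((G ⊗[K] G) ⊗[K] A) →ₗ[K] G ⊗[K] (G ⊗[K] A) :=
  TensorProduct.map H.evInv H.evInvFst

section Legs
/-- Legs of `(G ⊗ G) ⊗ (G ⊗ G) ⊗ A`. -/
abbrev xx : G →ₐ[K] (G ⊗[K] G) ⊗[K] ((G ⊗[K] G) ⊗[K] A) := iL.comp iL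
abbrev xx' : G →ₐ[K] (G ⊗[K] G) ⊗[K] ((G ⊗[K] G) ⊗[K] A) := iL.comp iR
abbrev yy : G →ₐ[K] (G ⊗[K] G) ⊗[K] ((G ⊗[K] G) ⊗[K] A) := iR.comp (iL.comp iL)
abbrev yy' : G →ₐ[K] (G ⊗[K] G) ⊗[K] ((G ⊗[K] G) ⊗[K] A) := iR.comp (iL.comp iR)
abbrev mm : A →ₐ[K] (G ⊗[K] G) ⊗[K] ((G ⊗[K] G) ⊗[K] A) := iR.comp iR
abbrev tt : G →ₐ[K] (G ⊗[K] G) ⊗[K] ((G ⊗[K] G) ⊗[K] A) := mm.comp j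
end Legs

theorem evInv₂_mul_pl (u) (d : G ⊗[K] (G ⊗[K] A)) :
    H.evInv₂ (u * pl xx (pl yy mm) d) = H.evInv₂ u * d := by
  suffices h : ((LinearMap.mul K _).compl₁₂ LinearMap.id
    (pl xx (pl yy mm) : G ⊗[K] (G ⊗[K] A) →ₐ[K] _).toLinearMap).compr₂ H.evInv₂ =
    (LinearMap.mul K _).compl₁₂ H.evInv₂ LinearMap.id from
    DFunLike.congr_fun (DFunLike.congr_fun h u) d
  ext
  simp [mul_assoc]

theorem evInv₂_mul_sandN (u) (w : (G ⊗[K] G) ⊗[K] ((G ⊗[K] G) ⊗[K] G)) :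
    H.evInv₂ (u * pl (pl xx xx') (pl (pl yy yy') (tt j)) w) =
      (H.sandN j w).unop (H.evInv₂ u) := by
  suffices h : ((LinearMap.mul K _).compl₁₂ LinearMap.id
      (pl (pl xx xx') (pl (pl yy yy') (tt j))).toLinearMap).compr₂ H.evInv₂ =
    (((MulOpposite.opLinearEquiv K).symm.toLinearMap ∘ₗ (H.sandN j).toLinearMap).compl₁₂
      LinearMap.id H.evInv₂).flip from
    DFunLike.congr_fun (DFunLike.congr_fun h u) w
  ext
  simp [mul_assoc, sandN, Sinv_mul]

theorem evInv₂_mul (U V : (G ⊗[K] G) ⊗[K] A) :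
    H.evInv₂ (pl iL mm U * iR V) = leg13 (H.evInvFst U) * leg23 (H.evInvFst V) := by
  induction U using TensorProduct.induction_on with
  | zero => simp
  | add x y hx hy => simp only [map_add, add_mul, hx, hy]
  | tmul p a =>
    induction V using TensorProduct.induction_on with
    | zero => simp
    | add x y hx hy => simp only [map_add, mul_add, hx, hy]
    | tmul q b => simp [leg13, leg23]

/-- The formula `f Δ(α) = γ`, transported by the inverse antipode. -/
theorem fσ_mul_Δ_Sinv_α : H.fσ * H.Δ (H.Sinv H.α) =
    TensorProduct.map H.evInv H.evInv (φ⁻[e₃, e₄, e₂] * φ[e₁, e₃, e₄ ⋆ e₂]) := by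
  have h₁ := H.fσ_mul_Δ_Sinv H.α
  have h₂ := congrArg (fun z => (pl (H.invLeg iR) (H.invLeg iL) z).unop) H.f_mul_Δ_α
  simp only [map_mul, MulOpposite.unop_mul, pl_invLeg, MulOpposite.unop_op, pl_iL_iR,
    AlgHom.id_apply] at h₂
  have h₃ : ((H.invLeg iR ⋆ H.invLeg iL) H.α).unop =
      Algebra.TensorProduct.comm K G G (TensorProduct.map H.Sinv H.Sinv (H.Δ H.α)) := by
    rw [star_apply, pl_invLeg, pl_iL_iR]; rfl
  have h₄ : φ⁻[e₃, e₄, e₂] * φ[e₁, e₃, e₄ ⋆ e₂] =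
      Algebra.TensorProduct.comm K (G ⊗[K] G) (G ⊗[K] G)
        (φ⁻[e₁, e₂, e₄] * φ[e₃, e₁, e₂ ⋆ e₄]) := by
    have p₁ : (Algebra.TensorProduct.comm K (G ⊗[K] G) (G ⊗[K] G)).toAlgHom.comp e₁ = e₃ := by
      ext; simp [Algebra.TensorProduct.one_def]
    have p₂ : (Algebra.TensorProduct.comm K (G ⊗[K] G) (G ⊗[K] G)).toAlgHom.comp e₂ = e₄ := by
      ext; simp [Algebra.TensorProduct.one_def]
    have p₃ : (Algebra.TensorProduct.comm K (G ⊗[K] G) (G ⊗[K] G)).toAlgHom.comp e₃ = e₁ := by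
      ext; simp [Algebra.TensorProduct.one_def]
    have p₄ : (Algebra.TensorProduct.comm K (G ⊗[K] G) (G ⊗[K] G)).toAlgHom.comp e₄ = e₂ := by
      ext; simp [Algebra.TensorProduct.one_def]
    change _ = (Algebra.TensorProduct.comm K (G ⊗[K] G) (G ⊗[K] G)).toAlgHom _
    rw [map_mul, map_reas, map_reasInv]
    simp only [comp_star, p₁, p₂, p₃, p₄]
  rw [h₁, h₃, fσ, h₂, h₄, γ_eq]
  generalize φ⁻[e₁, e₂, e₄] * φ[e₃, e₁, e₂ ⋆ e₄] = w
  induction w using TensorProduct.induction_on with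
  | zero => simp
  | add x y hx hy => simp only [map_add, hx, hy]
  | tmul p q => simp [ev₂, evInv]

theorem evInv₂_mul_op (u) (d : G ⊗[K] G) : H.evInv₂ (A := A) (u * pl yy' xx' d) =
    (pl (H.invLeg (iR.comp iL)) (H.invLeg iL) d).unop * H.evInv₂ u := by
  suffices h : ((LinearMap.mul K _).compl₁₂ LinearMap.id
      (pl (A := G) (B := (G ⊗[K] G) ⊗[K] ((G ⊗[K] G) ⊗[K] A)) yy' xx').toLinearMap).compr₂
        H.evInv₂ =
    ((LinearMap.mul K _).compl₁₂ (unopLin (pl (H.invLeg (iR.comp iL)) (H.invLeg iL)))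
      H.evInv₂).flip from
    DFunLike.congr_fun (DFunLike.congr_fun h u) d
  ext
  simp [mul_assoc, Sinv_mul]

theorem evInv₂_four (w : (G ⊗[K] G) ⊗[K] (G ⊗[K] G)) :
    H.evInv₂ (A := A) (pl (pl xx xx') (pl yy yy') w) =
      pl iL (iR.comp iL) (TensorProduct.map H.evInv H.evInv w) := by
  suffices h : H.evInv₂ (A := A) ∘ₗ (pl (pl xx xx') (pl yy yy')).toLinearMap =
    (pl iL (iR.comp iL)).toLinearMap ∘ₗ (TensorProduct.map H.evInv H.evInv) from
    DFunLike.congr_fun h w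
  ext
  simp

theorem pl_reorder (x x' y y' t : G →ₐ[K] B) [Commuting x y] [Commuting x x'] [Commuting x y']
    [Commuting x t] [Commuting x' y] [Commuting x' y'] [Commuting x' t] [Commuting y y']
    [Commuting y t] [Commuting y' t] (X Y Z : G) :
    pl t (pl (x ⋆ y) (y' ⋆ x')) (X ⊗ₜ (Y ⊗ₜ Z)) = pl y' x' (H.Δ Z) * ((x ⋆ y) Y * t X) := by
  rw [pl_tmul, pl_tmul, ← star_apply, Commuting.eq (x ⋆ y) (y' ⋆ x'), ← mul_assoc,
    Commuting.eq t (y' ⋆ x'), mul_assoc, Commuting.eq t (x ⋆ y)]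

theorem pl_pl_star (x y : G →ₐ[K] B) (m : A →ₐ[K] B) [Commuting x y] [Commuting x m]
    [Commuting y m] (Y : G) (b : A) :
    pl x (pl y m) (pl (iL ⋆ iR.comp iL) (iR.comp iR) (Y ⊗ₜ b)) = (x ⋆ y) Y * m b := by
  have : pl x (pl y m) ((iL ⋆ iR.comp iL : G →ₐ[K] G ⊗[K] (G ⊗[K] A)) Y) = (x ⋆ y) Y := by
    rw [← AlgHom.comp_apply, comp_star]
    simp only [pl_comp_iL, ← AlgHom.comp_assoc, pl_comp_iR]
  rw [pl_tmul, map_mul, this, AlgHom.comp_apply, pl_iR, pl_iR]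

theorem pl_four (x x' y y' : G →ₐ[K] B) [Commuting x y] [Commuting x x'] [Commuting x y']
    [Commuting x' y] [Commuting x' y'] [Commuting y y'] :
    pl (pl x x') (pl y y') (φ⁻[e₃, e₄, e₂] * φ[e₁, e₃, e₄ ⋆ e₂]) =
      φ⁻[y, y', x'] * φ[x, y, y' ⋆ x'] := by
  rw [map_mul, map_reas, map_reasInv]
  simp only [comp_star, ← AlgHom.comp_assoc, pl_comp_iL, pl_comp_iR]

theorem pl_two (X Y Z : G) :
    pl (iL ⋆ iR.comp iL) ((iR.comp iR).comp j) (H.qLin (X ⊗ₜ (Y ⊗ₜ Z))) =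
        pl iL (iR.comp iL) (H.Δ (H.Sinv Z)) * (pl iL (iR.comp iL) (H.Δ (H.Sinv H.α)) *
          pl (iL ⋆ iR.comp iL) (iR.comp iR) (Y ⊗ₜ j X)) := by
  rw [qLin_tmul, evInv_tmul, pl_tmul, map_mul, map_mul]
  simp only [mul_assoc, pl_tmul]
  rfl

theorem evInv₂_reas (u : G ⊗[K] (G ⊗[K] G)) :
    H.evInv₂ (φ⁻[yy, yy', xx'] * φ[xx, yy, yy' ⋆ xx'] *
      pl (tt j) (pl (xx ⋆ yy) (yy' ⋆ xx')) u) =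
    pl iL (iR.comp iL) H.fσ * pl (iL ⋆ iR.comp iL) ((iR.comp iR).comp j) (H.qLin u) := by
  induction u using TensorProduct.induction_on with
  | zero => simp
  | add x y hx hy => simp only [map_add, mul_add, hx, hy]
  | tmul X u =>
  induction u using TensorProduct.induction_on with
  | zero => simp
  | add x y hx hy => simp only [TensorProduct.tmul_add, map_add, mul_add, hx, hy]
  | tmul Y Z =>
    have e₄ := congrArg (pl (iL : G →ₐ[K] G ⊗[K] (G ⊗[K] A)) (iR.comp iL)) (H.fσ_mul_Δ_Sinv Z)
    rw [map_mul, map_mul] at e₄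
    have e₅ : (pl (H.invLeg (iR.comp iL)) (H.invLeg (iL : G →ₐ[K] G ⊗[K] (G ⊗[K] A)))
        (H.Δ Z)).unop = pl iL (iR.comp iL) ((H.invLeg iR ⋆ H.invLeg iL) Z).unop := by
      rw [star_apply, pl_invLeg, pl_invLeg, pl_iL_iR]; rfl
    rw [pl_reorder, AlgHom.comp_apply mm j, ← pl_pl_star, ← mul_assoc, evInv₂_mul_pl, evInv₂_mul_op,
      ← pl_four, evInv₂_four, ← fσ_mul_Δ_Sinv_α, pl_two, e₅, map_mul, ← mul_assoc,
      ← mul_assoc, ← mul_assoc, e₄]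

theorem reas_eq_pl (a b c : G →ₐ[K] B) [Commuting a b] [Commuting a c] [Commuting b c] :
    φ[a, b, c] = pl a (pl b c) (H.φ : G ⊗[K] (G ⊗[K] G)) := rfl

theorem evInv₂_word (C' : G ⊗[K] (G ⊗[K] A)) :
    (H.sandN j (H.reasΦInv l₁ l₂ l₀ l₂' l₁')).unop (pl iL (iR.comp iL) H.fσ *
      (pl (iL ⋆ iR.comp iL) ((iR.comp iR).comp j) H.qop * C')) =
    H.evInv₂ (φ⁻[yy, yy', xx'] * φ[xx, yy, yy' ⋆ xx'] * φ[tt j, xx ⋆ yy, yy' ⋆ xx'] *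
      pl xx (pl yy mm) C' * H.reasΦInv xx yy (tt j) yy' xx') := by
  have e : H.reasΦInv xx yy (tt j) yy' xx' = pl (pl xx xx') (pl (pl yy yy') (tt j))
      (H.reasΦInv l₁ l₂ l₀ l₂' l₁') := by
    rw [map_reasΦInv]
    simp only [← AlgHom.comp_assoc, pl_comp_iL, pl_comp_iR]
  rw [e, evInv₂_mul_sandN, evInv₂_mul_pl, H.reas_eq_pl (tt j), evInv₂_reas, qop, mul_assoc]

end

end QuasiHopfAlgebra

/-! ### Coherence of flip operators -/

namespace QuasiBialgebra

variable {K : Type u} [Field K] {G : Type v} [Ring G] [Algebra K G] (H : QuasiBialgebra K G)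
variable {B : Type*} [Ring B] [Algebra K B]

local infixl:72 " ⋆ " => QuasiBialgebra.star H
local notation "φ[" a ", " b ", " c "]" => reas H a b c
local notation "φ⁻[" a ", " b ", " c "]" => reasInv H a b c

attribute [local instance 10] Commuting.flip

section
variable (x y x' y' t : G →ₐ[K] B) [Commuting x y] [Commuting x x'] [Commuting x y']
    [Commuting x t] [Commuting x' y] [Commuting x' y'] [Commuting x' t] [Commuting y y']
    [Commuting y t] [Commuting y' t] (Tx Ty : B)

/-- The value on `x ⋆ y` that coherence prescribes, given the values `Tx`, `Ty` on `x`, `y`. -/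
def flipStar : B := φ[t, x, y] * (Tx * (φ⁻[x, t, y] * (Ty * φ[x, y, t])))

instance [Intw Tx (x ⋆ t) (t ⋆ x)] [Intw Ty (y ⋆ t) (t ⋆ y)] [Intw Tx y y] [Intw Ty x x] :
    Intw (H.flipStar x y t Tx Ty) (x ⋆ y ⋆ t) (t ⋆ (x ⋆ y)) :=
  Intw.mul (f' := t ⋆ x ⋆ y) inferInstance <| Intw.mul (f' := x ⋆ t ⋆ y) inferInstance <|
    Intw.mul (f' := x ⋆ (t ⋆ y)) inferInstance <| Intw.mul (f' := x ⋆ (y ⋆ t)) inferInstance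
      inferInstance

instance {C : Type*} [Ring C] [Algebra K C] (f : C →ₐ[K] B) [Commuting x f] [Commuting y f]
    [Commuting t f] [Intw Tx f f] [Intw Ty f f] : Intw (H.flipStar x y t Tx Ty) f f :=
  Intw.mul (f' := f) inferInstance <| Intw.mul (f' := f) inferInstance <|
    Intw.mul (f' := f) inferInstance <| Intw.mul (f' := f) inferInstance inferInstance

theorem flipStar_bracket : φ⁻[y, y', x'] * (φ[x, y, y' ⋆ x'] * (φ[t, x ⋆ y, y' ⋆ x'] *
    (φ[t ⋆ (x ⋆ y), y', x'] * (φ[t, x, y] * φ⁻[t ⋆ x, y, y'])))) =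
      φ[t, x, y ⋆ y' ⋆ x'] * φ[t ⋆ x, y ⋆ y', x'] := by
  have e₁ : φ[t ⋆ (x ⋆ y), y', x'] = _ := H.reas_conj t x y (t ⋆ x ⋆ y) y' x' _ _ _
  have e₂ : φ[t, x, y ⋆ y' ⋆ x'] = _ := H.reas_conjInv y y' x' t x (y ⋆ (y' ⋆ x')) _ _ _
  rw [e₁, e₂]
  simp [H.reas_right t x y (y' ⋆ x'), H.reas_left (t ⋆ x) y y' x', mul_assoc]

/-- A product of two generating elements in terms of flip operators. The word on the left comes from
the product of the double, the right-hand side involves the values `Tx` and `Ty` separately. -/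
theorem flipStar_word [Intw Tx (x ⋆ t) (t ⋆ x)] [Intw Ty (y ⋆ t) (t ⋆ y)] [Intw Tx y y]
    [Intw Ty x x] [Intw Tx x' x'] [Intw Tx y' y'] [Intw Ty x' x'] [Intw Ty y' y'] :
    φ⁻[y, y', x'] * φ[x, y, y' ⋆ x'] * φ[t, x ⋆ y, y' ⋆ x'] * H.flipStar x y t Tx Ty *
      H.reasΦInv x y t y' x' = φ[t, x, y ⋆ y' ⋆ x'] * (φ[t ⋆ x, y ⋆ y', x'] *
        (Tx * (φ⁻[x, t, y ⋆ y'] * (φ[t, y, y'] * Ty)))) := by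
  have h₁ := H.intw_reas_eq (H.flipStar x y t Tx Ty) (x ⋆ y ⋆ t) y' x' (t ⋆ (x ⋆ y)) y' x'
  have h₂ := H.intw_reasInv_eq Ty x (y ⋆ t) y' x (t ⋆ y) y'
  have h₃ := H.intw_reasInv_eq Tx (x ⋆ t) y y' (t ⋆ x) y y'
  have h₄ : φ⁻[x, t, y] * φ⁻[x, t ⋆ y, y'] =
      φ⁻[x ⋆ t, y, y'] * (φ⁻[x, t, y ⋆ y'] * φ[t, y, y']) := by
    rw [H.reasInv_left x t y y']; simp [mul_assoc]
  have h₅ := H.flipStar_bracket x y x' y' t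
  simp only [reasΦInv, mul_assoc]
  rw [mul_rw h₁]
  simp only [flipStar, mul_assoc, reas_mul_reasInv_mul]
  rw [h₂, mul_rw h₄]
  simp only [mul_assoc]
  rw [mul_rw h₃]
  have h₆ := congrArg (· * (Tx * (φ⁻[x, t, y ⋆ y'] * (φ[t, y, y'] * Ty)))) h₅
  simp only [mul_assoc] at h₆ ⊢
  exact h₆

instance (u : B) : Intw u (H.triv : G →ₐ[K] B) H.triv :=
  ⟨fun x => (Algebra.commutes _ u).symm⟩

/-- When the pair `y`, `y'` can be annihilated, the word of `flipStar_word` decomposes. -/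
theorem left_flipStar_word {M : Type*} [AddCommGroup M] [Module K M] (F : B →ₗ[K] M)
    [LeftEq F (y ⋆ y') H.triv] [Intw Tx (x ⋆ t) (t ⋆ x)] [Intw Ty (y ⋆ t) (t ⋆ y)] [Intw Tx y y]
    [Intw Ty x x] [Intw Tx x' x'] [Intw Tx y' y'] [Intw Ty x' x'] [Intw Ty y' y'] :
    F (φ⁻[y, y', x'] * φ[x, y, y' ⋆ x'] * φ[t, x ⋆ y, y' ⋆ x'] * H.flipStar x y t Tx Ty *
      H.reasΦInv x y t y' x') = F (φ[t, x, x'] * Tx * (φ[t, y, y'] * Ty)) := by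
  have k₃ := H.left_reas₂ (F ∘ₗ LinearMap.mulLeft K φ[t, x, x']) (t ⋆ x)
    (y ⋆ y') x' (Tx * (φ⁻[x, t, y ⋆ y'] * (φ[t, y, y'] * Ty)))
  have k₄ := H.left_reasInv₃ (F ∘ₗ LinearMap.mulLeft K (φ[t, x, x'] * Tx))
    x t (y ⋆ y') (φ[t, y, y'] * Ty)
  simp only [LinearMap.comp_apply, LinearMap.mulLeft_apply, mul_assoc] at k₃ k₄
  rw [flipStar_word, H.leftEq_reas F t x (y ⋆ y' ⋆ x') t x x', k₃, k₄, mul_assoc]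

end

end QuasiBialgebra

namespace QuasiHopfAlgebra

open QuasiBialgebra

variable {K : Type u} [Field K] {G : Type v} [Ring G] [Algebra K G] (H : QuasiHopfAlgebra K G)
variable {A B C : Type*} [Ring A] [Algebra K A] [Ring B] [Algebra K B] [Ring C] [Algebra K C]

local infixl:72 " ⋆ " => QuasiBialgebra.star (toQuasiBialgebra H)
local notation "φ[" a ", " b ", " c "]" => reas (toQuasiBialgebra H) a b c
local notation "φ⁻[" a ", " b ", " c "]" => reasInv (toQuasiBialgebra H) a b c

attribute [local instance 10] Commuting.flip

section

instance intw_pl_comm (x : G →ₐ[K] B) (m : A →ₐ[K] B) (y : C →ₐ[K] B) [Commuting x m]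
    [Commuting x y] [Commuting y m] (T : G ⊗[K] A) : Intw (pl x m T) y y :=
  ⟨fun z => Commuting.eq (pl x m) y T z⟩

variable (j : G →ₐ[K] A) (T : G ⊗[K] A)

/-- Coherence of a flip operator, `φ³¹² T¹³ (φ⁻¹)¹³² T²³ φ = (Δ ⊗ id)(T)`: the value on a
convolution of two legs is the one prescribed by the values on the two legs. -/
def IsCoherent : Prop :=
  H.flipStar iL (iR.comp iL) ((iR.comp iR).comp j) (leg13 T) (leg23 T) =
    pl (iL ⋆ iR.comp iL) (iR.comp iR) T

/-- `L` is multiplicative with respect to the product of the double. -/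
def IsOuter (L : G ⊗[K] A) : Prop :=
  (H.sandN j (H.reasΦInv l₁ l₂ l₀ l₂' l₁')).unop (pl iL (iR.comp iL) H.fσ *
    pl (iL ⋆ iR.comp iL) (iR.comp iR) L) = leg13 L * leg23 L

theorem leg13_eq (T : G ⊗[K] A) : (leg13 T : G ⊗[K] (G ⊗[K] A)) = pl iL (iR.comp iR) T :=
  eq_pl_apply (h := (leg13 : G ⊗[K] A →ₐ[K] G ⊗[K] (G ⊗[K] A)))
    (by ext; simp [leg13, Algebra.TensorProduct.one_def])
    (by ext; simp [leg13]) T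

theorem leg23_eq (T : G ⊗[K] A) : (leg23 T : G ⊗[K] (G ⊗[K] A)) =
    pl (iR.comp iL) (iR.comp iR) T :=
  eq_pl_apply (h := (leg23 : G ⊗[K] A →ₐ[K] G ⊗[K] (G ⊗[K] A)))
    (by ext; simp [leg23]) (by ext; simp [leg23]) T

variable {j T}

theorem map_flipStar (h : B →ₐ[K] C) (x y t : G →ₐ[K] B) [Commuting x y] [Commuting x t]
    [Commuting y t] (Tx Ty : B) : h (H.flipStar x y t Tx Ty) =
      H.flipStar (h.comp x) (h.comp y) (h.comp t) (h Tx) (h Ty) := by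
  simp only [flipStar, map_mul, map_reas, map_reasInv]

theorem IsCoherent.eq (hc : H.IsCoherent j T) (x y : G →ₐ[K] B) (m : A →ₐ[K] B) [Commuting x y]
    [Commuting x m] [Commuting y m] :
    pl (x ⋆ y) m T = H.flipStar x y (m.comp j) (pl x m T) (pl y m T) := by
  have h := congrArg (pl x (pl y m)) hc
  rw [map_flipStar, leg13_eq, leg23_eq] at h
  simp only [map_pl, comp_star, ← AlgHom.comp_assoc, pl_comp_iL, pl_comp_iR] at h
  exact h.symm

/-- Modulo the evaluations, the word of `flipStar_word` is the product of two generating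
elements. -/
theorem evInv₂_flipStar (h : H.IsFlip j T) :
    H.evInv₂ (φ⁻[yy, yy', xx'] * φ[xx, yy, yy' ⋆ xx'] * φ[tt j, xx ⋆ yy, yy' ⋆ xx'] *
      H.flipStar xx yy (tt j) (pl xx mm T) (pl yy mm T) * H.reasΦInv xx yy (tt j) yy' xx') =
    leg13 (H.genOfFlip j T) * leg23 (H.genOfFlip j T) := by
  have i₁ := h.intw H (xx : G →ₐ[K] _) mm
  have i₂ := h.intw H (yy : G →ₐ[K] _) mm
  have k₁ : LeftEq H.evInv₂ (yy ⋆ yy' : G →ₐ[K] (G ⊗[K] G) ⊗[K] ((G ⊗[K] G) ⊗[K] A)) H.triv := by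
    have := leftEq_star_map_right _ (H.leftEq_evInvFst (A := A)) H.evInv
    exact this
  have e₁ : φ[tt j, xx, xx'] * pl xx mm T = pl (B := (G ⊗[K] G) ⊗[K] ((G ⊗[K] G) ⊗[K] A)) iL mm
      (φ[iR.comp j, iL.comp iL, iL.comp iR] * pl (iL.comp iL) iR T) := by
    rw [map_mul, map_reas, map_pl]
    simp only [← AlgHom.comp_assoc, pl_comp_iL, pl_comp_iR]
  have e₂ : φ[tt j, yy, yy'] * pl yy mm T = (iR : _ →ₐ[K] (G ⊗[K] G) ⊗[K] ((G ⊗[K] G) ⊗[K] A))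
      (φ[iR.comp j, iL.comp iL, iL.comp iR] * pl (iL.comp iL) iR T) := by
    rw [map_mul, map_reas, map_pl]
    rfl
  rw [left_flipStar_word, genOfFlip_eq, ← evInv₂_mul, e₁, e₂]

theorem sandN_genOfFlip (h : H.IsFlip j T) :
    (H.sandN j (H.reasΦInv l₁ l₂ l₀ l₂' l₁')).unop (pl iL (iR.comp iL) H.fσ *
      (pl (iL ⋆ iR.comp iL) ((iR.comp iR).comp j) H.qop *
        H.flipStar iL (iR.comp iL) ((iR.comp iR).comp j) (leg13 T) (leg23 T))) =
    leg13 (H.genOfFlip j T) * leg23 (H.genOfFlip j T) := by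
  rw [evInv₂_word, map_flipStar, leg13_eq T, leg23_eq T, map_pl, map_pl, ← evInv₂_flipStar H h]
  simp only [← AlgHom.comp_assoc, pl_comp_iL, pl_comp_iR]

theorem pl_genOfFlip (x : G →ₐ[K] B) (m : A →ₐ[K] B) [Commuting x m] :
    pl x m (H.genOfFlip j T) = pl x (m.comp j) H.qop * pl x m T := by
  rw [genOfFlip, map_mul, pl_onSnd]

theorem IsCoherent.isOuter (hc : H.IsCoherent j T) (h : H.IsFlip j T) :
    H.IsOuter j (H.genOfFlip j T) := by
  rw [IsOuter, pl_genOfFlip, ← hc, sandN_genOfFlip H h]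

theorem isUnit_pl_fσ (x y : G →ₐ[K] B) [Commuting x y] : IsUnit (pl x y H.fσ) := by
  have h₁ : H.fσ * Algebra.TensorProduct.comm K G G (TensorProduct.map H.Sinv H.Sinv H.fInv)
      = 1 := by
    have h := congrArg (fun z => (pl (H.invLeg iR) (H.invLeg iL) z).unop) H.fInv_mul_f
    rw [fσ]
    simpa only [map_mul, MulOpposite.unop_mul, pl_invLeg, MulOpposite.unop_op, pl_iL_iR,
      AlgHom.id_apply, map_one, MulOpposite.unop_one] using h
  have h₂ : Algebra.TensorProduct.comm K G G (TensorProduct.map H.Sinv H.Sinv H.fInv) * H.fσ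
      = 1 := by
    have h := congrArg (fun z => (pl (H.invLeg iR) (H.invLeg iL) z).unop) H.f_mul_fInv
    rw [fσ]
    simpa only [map_mul, MulOpposite.unop_mul, pl_invLeg, MulOpposite.unop_op, pl_iL_iR,
      AlgHom.id_apply, map_one, MulOpposite.unop_one] using h
  exact IsUnit.map (pl x y) ⟨⟨_, _, h₁, h₂⟩, rfl⟩

theorem isUnit_reasΦInv : IsUnit (H.reasΦInv l₁ l₂ l₀ l₂' l₁') :=
  (isUnit_reas _ _ _ _).mul ((isUnit_reasInv _ _ _ _).mul (isUnit_reasInv _ _ _ _))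

/-- The converse of `IsCoherent.isOuter`: the maps in the definition of `IsOuter` are
injective. -/
theorem IsOuter.isCoherent (ho : H.IsOuter j (H.genOfFlip j T)) (h : H.IsFlip j T) :
    H.IsCoherent j T := by
  have e := ho.trans (H.sandN_genOfFlip h).symm
  have u : IsUnit (H.sandN j (H.reasΦInv l₁ l₂ l₀ l₂' l₁')).unop :=
    (H.isUnit_reasΦInv.map (H.sandN j)).unop
  have e' := ((Module.End.isUnit_iff _).1 u).1 e
  rw [pl_genOfFlip] at e'
  have e'' := (H.isUnit_pl_fσ iL (iR.comp iL)).mul_left_cancel e'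
  have i₁ := h.intw H (iL : G →ₐ[K] G ⊗[K] (G ⊗[K] A)) (iR.comp iR)
  have i₂ := h.intw H (iR.comp iL : G →ₐ[K] G ⊗[K] (G ⊗[K] A)) (iR.comp iR)
  have i₃ := h.intw H (iL ⋆ iR.comp iL : G →ₐ[K] G ⊗[K] (G ⊗[K] A)) (iR.comp iR)
  rw [← leg13_eq] at i₁
  rw [← leg23_eq] at i₂
  have i₄ : Intw (leg13 T) (iR.comp iL : G →ₐ[K] G ⊗[K] (G ⊗[K] A)) (iR.comp iL) := by
    rw [leg13_eq]; infer_instance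
  have i₅ : Intw (leg23 T) (iL : G →ₐ[K] G ⊗[K] (G ⊗[K] A)) iL := by
    rw [leg23_eq]; infer_instance
  have i₆ : Intw (H.flipStar iL (iR.comp iL) ((iR.comp iR).comp j) (leg13 T) (leg23 T))
    (iL ⋆ iR.comp iL ⋆ (iR.comp iR).comp j) ((iR.comp iR).comp j ⋆ (iL ⋆ iR.comp iL)) :=
    inferInstance
  have i₇ : Intw (pl (iL ⋆ iR.comp iL) (iR.comp iR) T -
      H.flipStar iL (iR.comp iL) ((iR.comp iR).comp j) (leg13 T) (leg23 T))
    (iL ⋆ iR.comp iL ⋆ (iR.comp iR).comp j) ((iR.comp iR).comp j ⋆ (iL ⋆ iR.comp iL)) :=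
    ⟨fun a => by rw [sub_mul, mul_sub, i₃.eq, i₆.eq]⟩
  have z := H.eq_zero_of_qop_mul (iL ⋆ iR.comp iL) ((iR.comp iR).comp j)
    (pl (iL ⋆ iR.comp iL) (iR.comp iR) T -
      H.flipStar iL (iR.comp iL) ((iR.comp iR).comp j) (leg13 T) (leg23 T))
    (by rw [mul_sub, e'', sub_self])
  exact (sub_eq_zero.1 z).symm

end

section

/-! ### Contraction of generating elements with functionals -/

section Contraction
variable {M N : Type*} [AddCommGroup M] [Module K M] [AddCommGroup N] [Module K N]

/-- `x ⊗ m ↦ ψ(x) m`. -/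
def con (ψ : Module.Dual K G) : G ⊗[K] M →ₗ[K] M :=
  (TensorProduct.lid K M).toLinearMap ∘ₗ TensorProduct.map ψ LinearMap.id

@[simp] theorem con_tmul (ψ : Module.Dual K G) (x : G) (m : M) : con ψ (x ⊗ₜ[K] m) = ψ x • m := by
  simp [con]

theorem con_map (ψ : Module.Dual K G) (k : M →ₗ[K] N) (w : G ⊗[K] M) :
    con ψ (TensorProduct.map LinearMap.id k w) = k (con ψ w) := by
  induction w using TensorProduct.induction_on with
  | zero => simp
  | add x y hx hy => simp only [map_add, hx, hy]
  | tmul x m => simp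

/-- Functionals separate the first factor. -/
theorem ext_con [FiniteDimensional K G] {w w' : G ⊗[K] M} (h : ∀ ψ, con ψ w = con ψ w') :
    w = w' := by
  have e : ∀ w : G ⊗[K] M, w = ∑ μ, Module.finBasis K G μ ⊗ₜ[K]
      con ((Module.finBasis K G).coord μ) w := by
    intro w
    induction w using TensorProduct.induction_on with
    | zero => simp
    | add x y hx hy =>
      simp only [map_add, TensorProduct.tmul_add, Finset.sum_add_distrib, ← hx, ← hy]
    | tmul x m =>
      conv_lhs => rw [← (Module.finBasis K G).sum_repr x, TensorProduct.sum_tmul]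
      simp [TensorProduct.smul_tmul]
  rw [e w, e w']
  simp only [h]

end Contraction

theorem con_iR_mul (ψ : Module.Dual K G) (b : A) (w : G ⊗[K] A) :
    con ψ (iR b * w) = b * con ψ w := by
  induction w using TensorProduct.induction_on with
  | zero => simp
  | add x y hx hy => simp only [map_add, mul_add, hx, hy]
  | tmul x m => simp

theorem con_counit (w : G ⊗[K] A) : con H.ε.toLinearMap w = pl H.triv (AlgHom.id K A) w := by
  induction w using TensorProduct.induction_on with
  | zero => simp
  | add x y hx hy => simp only [map_add, hx, hy]
  | tmul x m => simp [Algebra.smul_def]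

variable (j : G →ₐ[K] A)

/-- `x ⊗ a ↦ a j(g(x))`. -/
def pairing (g : G →ₗ[K] G) : G ⊗[K] A →ₗ[K] A :=
  (LinearMap.id ⊛ (j.toLinearMap ∘ₗ g)) ∘ₗ (TensorProduct.comm K G A).toLinearMap

@[simp] theorem pairing_tmul (g : G →ₗ[K] G) (x : G) (a : A) :
    pairing j g (x ⊗ₜ a) = a * j (g x) := by
  simp [pairing]

theorem pairing_add (g g' : G →ₗ[K] G) (L : G ⊗[K] A) :
    pairing j (g + g') L = pairing j g L + pairing j g' L := by
  induction L using TensorProduct.induction_on with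
  | zero => simp
  | add x y hx hy => simp only [map_add, hx, hy]; abel
  | tmul x m => simp [mul_add]

theorem pairing_smul (c : K) (g : G →ₗ[K] G) (L : G ⊗[K] A) :
    pairing j (c • g) L = c • pairing j g L := by
  induction L using TensorProduct.induction_on with
  | zero => simp
  | add x y hx hy => simp only [map_add, hx, hy, smul_add]
  | tmul x m => simp

/-- `pairing`, as a linear map of `g`. -/
def pairingHom (L : G ⊗[K] A) : (G →ₗ[K] G) →ₗ[K] A where
  toFun g := pairing j g L
  map_add' g g' := pairing_add j g g' L
  map_smul' c g := pairing_smul j c g L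

theorem pairing_zero (L : G ⊗[K] A) : pairing j (0 : G →ₗ[K] G) L = 0 :=
  (pairingHom j L).map_zero

theorem pairing_hat (ψ : Module.Dual K G) (b : G) (L : G ⊗[K] A) :
    pairing j (hat (ψ ⊗ₜ b)) L = con ψ L * j b := by
  induction L using TensorProduct.induction_on with
  | zero => simp
  | add x y hx hy => simp only [map_add, add_mul, hx, hy]
  | tmul x m => simp

theorem pairing_iR_mul (g : G →ₗ[K] G) (b : A) (L : G ⊗[K] A) :
    pairing j g (iR b * L) = b * pairing j g L := by
  induction L using TensorProduct.induction_on with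
  | zero => simp
  | add x y hx hy => simp only [map_add, mul_add, hx, hy]
  | tmul x m => simp [mul_assoc]

theorem pairing_sandL (g : G →ₗ[K] G) (u : (G ⊗[K] G) ⊗[K] G) (L : G ⊗[K] A) :
    pairing j g (H.sandL j u L) =
      pairing j ((H.fnAct g).flip (pl (pl k₁ k₀) k₁' u)) L := by
  induction u using TensorProduct.induction_on with
  | zero => simp [pairing_zero]
  | add x y hx hy => simp only [map_add, LinearMap.add_apply, pairing_add, hx, hy]
  | tmul d q =>
  induction d using TensorProduct.induction_on with
  | zero => simp [pairing_zero]
  | add x y hx hy =>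
    simp only [TensorProduct.add_tmul, map_add, LinearMap.add_apply, pairing_add, hx, hy]
  | tmul p c =>
  induction L using TensorProduct.induction_on with
  | zero => simp
  | add x y hx hy => simp only [map_add, hx, hy]
  | tmul x a => simp [sandL_tmul, mul_assoc]

theorem hat_exch_eq (a : G) (z : Module.Dual K G ⊗[K] G) : hat (H.exch a z) =
    (H.fnAct (hat z)).flip (pl (pl k₁ k₀) k₁' ((iL.comp H.Δ ⋆ iR) a)) := by
  have e : pl (pl k₁ k₀) k₁' ((iL.comp H.Δ ⋆ iR) a) = (k₁ ⋆ k₀ ⋆ k₁') a := by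
    rw [← AlgHom.comp_apply]
    simp only [comp_star, pl_comp_iR, ← AlgHom.comp_assoc, pl_comp_iL]
    rfl
  rw [e]
  exact LinearMap.ext fun x => H.hat_exch a z x

theorem pairing_exch {L : G ⊗[K] A} (hL : H.IsExchange j L) (a : G)
    (z : Module.Dual K G ⊗[K] G) :
    pairing j (hat (H.exch a z)) L = j a * pairing j (hat z) L := by
  rw [hat_exch_eq, ← pairing_sandL, ← hL a, pairing_iR_mul]

theorem pairing_con_leg (g : G →ₗ[K] G) (χ : Module.Dual K G) (L : G ⊗[K] A) (L' : G ⊗[K] A) :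
    pairing j g (con χ (leg13 L * leg23 L')) = con χ L * pairing j g L' := by
  induction L using TensorProduct.induction_on with
  | zero => simp
  | add x y hx hy => simp only [map_add, add_mul, hx, hy]
  | tmul x a =>
  induction L' using TensorProduct.induction_on with
  | zero => simp
  | add x y hx hy => simp only [map_add, mul_add, hx, hy]
  | tmul y b => simp [leg13, leg23, mul_assoc]

theorem pairing_con_sandN (g : G →ₗ[K] G) (χ : Module.Dual K G) (d : G ⊗[K] G) (a : A)
    (w : (G ⊗[K] G) ⊗[K] ((G ⊗[K] G) ⊗[K] G)) :
    pairing j g (con χ ((H.sandN j w).unop (pl (pl iL (iR.comp iL)) (iR.comp iR) (d ⊗ₜ a)))) =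
      a * j (H.dualAct χ (H.fnAct g) d w) := by
  induction d using TensorProduct.induction_on with
  | zero => simp
  | add x y hx hy => simp only [TensorProduct.add_tmul, map_add, mul_add, LinearMap.add_apply,
      hx, hy]
  | tmul v₁ v₂ =>
  induction w using TensorProduct.induction_on with
  | zero => simp
  | add x y hx hy => simp only [map_add, MulOpposite.unop_add, mul_add, LinearMap.add_apply,
      hx, hy]
  | tmul d w =>
  induction w using TensorProduct.induction_on with
  | zero => simp
  | add x y hx hy => simp only [TensorProduct.tmul_add, map_add, MulOpposite.unop_add, mul_add,
      LinearMap.add_apply, hx, hy]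
  | tmul e c =>
  induction d using TensorProduct.induction_on with
  | zero => simp
  | add x y hx hy => simp only [TensorProduct.add_tmul, map_add, MulOpposite.unop_add, mul_add,
      LinearMap.add_apply, hx, hy]
  | tmul x x' =>
  induction e using TensorProduct.induction_on with
  | zero => simp
  | add x y hx hy => simp only [TensorProduct.add_tmul, TensorProduct.tmul_add, map_add,
      MulOpposite.unop_add, mul_add, LinearMap.add_apply, hx, hy]
  | tmul y y' => simp [sandN, mul_assoc]

theorem pairing_outer (χ : Module.Dual K G) (z : Module.Dual K G ⊗[K] G) (L : G ⊗[K] A) :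
    pairing j (hat (H.outer χ z)) L = pairing j (hat z) (con χ
      ((H.sandN j (H.reasΦInv l₁ l₂ l₀ l₂' l₁')).unop (pl iL (iR.comp iL) H.fσ *
        pl (iL ⋆ iR.comp iL) (iR.comp iR) L))) := by
  induction L using TensorProduct.induction_on with
  | zero => simp
  | add x y hx hy => simp only [map_add, mul_add, hx, hy]
  | tmul x a =>
    have e : pl iL (iR.comp iL) H.fσ * pl (iL ⋆ iR.comp iL) (iR.comp iR) (x ⊗ₜ a) =
        pl (pl iL (iR.comp iL)) (iR.comp iR) ((H.fσ * H.Δ x) ⊗ₜ a) := by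
      rw [pl_tmul, pl_tmul, map_mul, mul_assoc]; rfl
    rw [e, pairing_con_sandN, pairing_tmul, hat_outer]

end

section

/-! ### The universal property of the double -/

theorem counit_qop (hα : H.ε H.α = 1) : pl H.triv (AlgHom.id K G) H.qop = 1 := by
  have e : (pl H.triv (AlgHom.id K G)).toLinearMap ∘ₗ H.qLin =
      (pl (AlgHom.id K G) (pl H.triv H.triv)).toLinearMap := by
    refine TensorProduct.ext_threefold' fun a b c => ?_
    simp [H.counit_Sinv hα, hα, Algebra.algebraMap_eq_smul_one, smul_smul, mul_comm]
  have h := DFunLike.congr_fun e (H.φ : G ⊗[K] (G ⊗[K] G))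
  exact h.trans (H.reas_triv_mid _ _)

variable {j : G →ₐ[K] A}

theorem con_genOfFlip (hα : H.ε H.α = 1) (T : G ⊗[K] A) :
    con H.ε.toLinearMap (H.genOfFlip j T) = con H.ε.toLinearMap T := by
  have e : pl H.triv (AlgHom.id K A) (onSnd j H.qop) = j (pl H.triv (AlgHom.id K G) H.qop) := by
    rw [pl_onSnd, map_pl]
    simp only [comp_triv]
    rfl
  rw [genOfFlip, con_counit, con_counit, map_mul, e, counit_qop H hα, map_one, one_mul]

section Map
variable {k : A →ₐ[K] B}

theorem map_onSnd (d : G ⊗[K] G) : Algebra.TensorProduct.map (AlgHom.id K G) k (onSnd j d) =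
    onSnd (k.comp j) d := by
  induction d using TensorProduct.induction_on with
  | zero => simp
  | add x y hx hy => simp only [map_add, hx, hy]
  | tmul x a => simp

theorem map_genOfFlip (T : G ⊗[K] A) :
    Algebra.TensorProduct.map (AlgHom.id K G) k (H.genOfFlip j T) =
      H.genOfFlip (k.comp j) (Algebra.TensorProduct.map (AlgHom.id K G) k T) := by
  rw [genOfFlip, map_mul, map_onSnd, genOfFlip]

theorem map_sandL (u : (G ⊗[K] G) ⊗[K] G) (L : G ⊗[K] A) :
    Algebra.TensorProduct.map (AlgHom.id K G) k (H.sandL j u L) =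
      H.sandL (k.comp j) u (Algebra.TensorProduct.map (AlgHom.id K G) k L) := by
  induction u using TensorProduct.induction_on with
  | zero => simp
  | add x y hx hy => simp only [map_add, LinearMap.add_apply, hx, hy]
  | tmul d q =>
    rw [sandL_tmul, sandL_tmul, map_mul, map_mul, map_onSnd]
    simp

theorem map_flipOfGen (L : G ⊗[K] A) :
    Algebra.TensorProduct.map (AlgHom.id K G) k (H.flipOfGen j L) =
      H.flipOfGen (k.comp j) (Algebra.TensorProduct.map (AlgHom.id K G) k L) := map_sandL ..

end Map

section Double
variable [FiniteDimensional K G] (h : H.DoubleIsAlgebra) (hα : H.ε H.α = 1)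

theorem toDouble_mul (χ : Module.Dual K G) (a : G) (z : Module.Dual K G ⊗[K] G) :
    H.toDouble h (χ ⊗ₜ a) * H.toDouble h z = H.toDouble h (H.outer χ (H.exch a z)) := rfl

variable (hα : H.ε H.α = 1)

theorem exch_one (h : H.DoubleIsAlgebra) (hα : H.ε H.α = 1) (z : Module.Dual K G ⊗[K] G) :
    H.exch 1 z = z :=
  (H.outer_counit hα _).symm.trans (h.one_mul z)

theorem exch_counit_tmul (hα : H.ε H.α = 1) (a b : G) :
    H.exch a (H.ε.toLinearMap ⊗ₜ b) = H.ε.toLinearMap ⊗ₜ (a * b) := by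
  rw [← H.exch_doubleOne hα, ← H.exch_doubleOne hα, exch_mul]

/-- The embedding `i_D`, as a homomorphism of algebras. -/
def iDHom : G →ₐ[K] H.Double h :=
  AlgHom.ofLinearMap (H.iD h) rfl fun a b => by
    change _ = H.toDouble h (H.outer H.ε.toLinearMap (H.exch a (H.ε.toLinearMap ⊗ₜ b)))
    rw [H.outer_counit hα, H.exch_counit_tmul hα]
    rfl

theorem iDHom_mul (a : G) (z : Module.Dual K G ⊗[K] G) :
    H.iDHom h hα a * H.toDouble h z = H.toDouble h (H.exch a z) := by
  change H.toDouble h (H.outer H.ε.toLinearMap (H.exch a z)) = _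
  rw [H.outer_counit hα]

theorem mul_iDHom (χ : Module.Dual K G) (b : G) :
    H.toDouble h (χ ⊗ₜ 1) * H.iDHom h hα b = H.toDouble h (χ ⊗ₜ b) := by
  change H.toDouble h (H.outer χ (H.exch 1 (H.ε.toLinearMap ⊗ₜ b))) = _
  rw [H.exch_one h hα, H.outer_tmul_counit hα]

theorem con_canonElt (ψ : Module.Dual K G) :
    con ψ (canonElt : G ⊗[K] (Module.Dual K G ⊗[K] G)) = ψ ⊗ₜ 1 := by
  unfold canonElt
  rw [map_sum]
  simp only [con_tmul, TensorProduct.smul_tmul', ← TensorProduct.sum_tmul]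
  congr 1
  refine (Module.finBasis K G).ext fun i => ?_
  simp [Finsupp.single_apply]

/-- The canonical element, with second factor in the double. -/
def genD : G ⊗[K] H.Double h :=
  TensorProduct.map LinearMap.id (H.toDouble h).toLinearMap canonElt

theorem con_genD (ψ : Module.Dual K G) : con ψ (H.genD h) = H.toDouble h (ψ ⊗ₜ 1) := by
  rw [genD, con_map, con_canonElt]; rfl

theorem pairing_genD (z : Module.Dual K G ⊗[K] G) :
    pairing (H.iDHom h hα) (hat z) (H.genD h) = H.toDouble h z := by
  induction z using TensorProduct.induction_on with
  | zero => simp only [map_zero, pairing_zero]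
  | add x y hx hy => simp only [map_add, pairing_add, hx, hy]
  | tmul ψ b => rw [pairing_hat, con_genD, mul_iDHom]

theorem con_eq_pairing (ψ : Module.Dual K G) (L : G ⊗[K] A) (j : G →ₐ[K] A) :
    con ψ L = pairing j (hat (ψ ⊗ₜ 1)) L := by
  rw [pairing_hat, map_one, mul_one]

theorem isExchange_genD : H.IsExchange (H.iDHom h hα) (H.genD h) := by
  intro a
  refine ext_con fun ψ => ?_
  have e : hat (H.exch a (ψ ⊗ₜ 1)) = (H.fnAct (hat (ψ ⊗ₜ 1))).flip (pl (pl k₁ k₀) k₁'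
      ((iL.comp H.Δ ⋆ iR) a)) := H.hat_exch_eq a _
  rw [con_iR_mul, con_genD, iDHom_mul, con_eq_pairing ψ _ (H.iDHom h hα), pairing_sandL, ← e,
    pairing_genD]

theorem isOuter_genD : H.IsOuter (H.iDHom h hα) (H.genD h) := by
  refine ext_con fun χ => ext_con fun ψ => ?_
  rw [con_eq_pairing ψ _ (H.iDHom h hα), con_eq_pairing ψ _ (H.iDHom h hα), ← pairing_outer,
    pairing_genD, pairing_con_leg, pairing_genD, con_genD, toDouble_mul, H.exch_one h hα]

/-- The universal flip operator belongs to the canonical element. -/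
theorem flipOp_eq : H.flipOp h = H.flipOfGen (H.iDHom h hα) (H.genD h) := by
  rw [flipOp, flipOfGen]
  generalize H.pρ = p
  induction p using TensorProduct.induction_on with
  | zero => simp
  | add x y hx hy => simp only [map_add, LinearMap.add_apply, hx, hy]
  | tmul P Q =>
    rw [Algebra.TensorProduct.map_tmul, sandL_tmul, AlgHom.id_apply, compTensor_tmul,
      LinearMap.comp_apply, AlgHom.toLinearMap_apply]
    generalize H.Δ P = d
    induction d using TensorProduct.induction_on with
    | zero => simp
    | add x y hx hy => simp only [map_add, mul_add, LinearMap.add_apply, hx, hy]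
    | tmul P₁ P₂ =>
      rw [genD]
      unfold canonElt
      simp only [map_sum, Finset.mul_sum, Finset.sum_mul]
      refine Finset.sum_congr rfl fun μ _ => ?_
      have e := H.mul_iDHom h hα ((Module.finBasis K G).coord μ) P₂
      simp only [compTensor_tmul, onLeft_tmul, onRight_tmul, TensorProduct.map_tmul,
        LinearMap.id_apply, LinearEquiv.coe_coe, Algebra.TensorProduct.map_tmul,
        Algebra.TensorProduct.tmul_mul_tmul, e, AlgHom.id_apply, one_mul]
      simp [lmul, rmul, mul_assoc]

theorem isFlip_flipOp : H.IsFlip (H.iDHom h hα) (H.flipOp h) := by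
  rw [H.flipOp_eq h hα]; exact IsExchange.isFlip _ _ (H.isExchange_genD h hα)

theorem genOfFlip_flipOp : H.genOfFlip (H.iDHom h hα) (H.flipOp h) = H.genD h := by
  rw [H.flipOp_eq h hα]; exact genOfFlip_flipOfGen _ _ (H.isExchange_genD h hα)

theorem isCoherent_flipOp : H.IsCoherent (H.iDHom h hα) (H.flipOp h) :=
  IsOuter.isCoherent H (by rw [H.genOfFlip_flipOp h hα]; exact H.isOuter_genD h hα)
    (H.isFlip_flipOp h hα)

theorem con_flipOp (hα : H.ε H.α = 1) : con H.ε.toLinearMap (H.flipOp h) = 1 := by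
  rw [← H.con_genOfFlip (j := H.iDHom h hα) hα, genOfFlip_flipOp, con_genD]
  rfl

/-- The algebra homomorphism on the double determined by a coherent flip operator. -/
def liftDouble {T : G ⊗[K] A} (hf : H.IsFlip j T) (hc : H.IsCoherent j T)
    (hn : con H.ε.toLinearMap T = 1) : H.Double h →ₐ[K] A :=
  AlgHom.ofLinearMap
    (((pairingHom j (H.genOfFlip j T)) ∘ₗ dualTensorHom K G G) ∘ₗ (H.toDouble h).symm.toLinearMap)
    (by
      change pairing j (hat (H.ε.toLinearMap ⊗ₜ 1)) _ = 1
      rw [pairing_hat, map_one, mul_one, H.con_genOfFlip hα, hn])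
    (fun x y => by
      obtain ⟨x, rfl⟩ := (H.toDouble h).surjective x
      obtain ⟨y, rfl⟩ := (H.toDouble h).surjective y
      induction x using TensorProduct.induction_on with
      | zero => simp
      | add x y hx hy => simp only [map_add, add_mul, hx, hy]
      | tmul χ a =>
        rw [toDouble_mul]
        change pairing j (hat (H.outer χ (H.exch a y))) _ =
          pairing j (hat (χ ⊗ₜ a)) _ * pairing j (hat y) _
        rw [pairing_outer, (hc.isOuter H hf), pairing_con_leg,
          H.pairing_exch j (hf.isExchange H), pairing_hat, mul_assoc])

section
variable {T : G ⊗[K] A} (hf : H.IsFlip j T) (hc : H.IsCoherent j T)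
  (hn : con H.ε.toLinearMap T = 1)

theorem liftDouble_comp_iDHom : (H.liftDouble h hα hf hc hn).comp (H.iDHom h hα) = j := by
  ext a
  change pairing j (hat (H.ε.toLinearMap ⊗ₜ a)) _ = j a
  rw [pairing_hat, H.con_genOfFlip hα, hn, one_mul]

theorem map_liftDouble_flipOp : Algebra.TensorProduct.map (AlgHom.id K G)
    (H.liftDouble h hα hf hc hn) (H.flipOp h) = T := by
  have e : Algebra.TensorProduct.map (AlgHom.id K G) (H.liftDouble h hα hf hc hn) (H.genD h) =
      H.genOfFlip j T := by
    refine ext_con fun ψ => ?_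
    refine (con_map ψ (H.liftDouble h hα hf hc hn).toLinearMap (H.genD h)).trans ?_
    rw [con_genD]
    change pairing j (hat (ψ ⊗ₜ 1)) _ = _
    rw [pairing_hat, map_one, mul_one]
  rw [H.flipOp_eq h hα, map_flipOfGen, liftDouble_comp_iDHom, e, flipOfGen_genOfFlip H hf]

end

theorem genD_eq (k : H.Double h →ₐ[K] A) : Algebra.TensorProduct.map (AlgHom.id K G) k (H.genD h) =
    onSnd (k.comp (H.iDHom h hα)) H.qop *
      Algebra.TensorProduct.map (AlgHom.id K G) k (H.flipOp h) := by
  rw [← H.genOfFlip_flipOp h hα, map_genOfFlip, genOfFlip]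

/-- Homomorphisms on the double are determined by their values on `i_D(G)` and on the universal flip
operator. -/
theorem double_hom_ext {k k' : H.Double h →ₐ[K] A}
    (h₁ : k.comp (H.iDHom h hα) = k'.comp (H.iDHom h hα))
    (h₂ : Algebra.TensorProduct.map (AlgHom.id K G) k (H.flipOp h) =
      Algebra.TensorProduct.map (AlgHom.id K G) k' (H.flipOp h)) : k = k' := by
  have e := H.genD_eq h hα k
  rw [h₁, h₂, ← H.genD_eq h hα k'] at e
  ext x
  obtain ⟨x, rfl⟩ := (H.toDouble h).surjective x
  induction x using TensorProduct.induction_on with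
  | zero => simp
  | add x y hx hy => simp only [map_add, hx, hy]
  | tmul χ a =>
    have e₁ := congrArg (con χ) e
    have e₂ := con_map χ k.toLinearMap (H.genD h)
    have e₃ := con_map χ k'.toLinearMap (H.genD h)
    rw [con_genD] at e₂ e₃
    rw [← H.mul_iDHom h hα, map_mul, map_mul]
    exact congrArg₂ (· * ·) (e₂.symm.trans (e₁.trans e₃)) (DFunLike.congr_fun h₁ a)

end Double

end

end QuasiHopfAlgebra

/-! ### The flip operator of a product of two arguments -/

namespace QuasiBialgebra

variable {K : Type u} [Field K] {G : Type v} [Ring G] [Algebra K G] (H : QuasiBialgebra K G)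
variable {B : Type*} [Ring B] [Algebra K B]

local infixl:72 " ⋆ " => QuasiBialgebra.star H
local notation "φ[" a ", " b ", " c "]" => reas H a b c
local notation "φ⁻[" a ", " b ", " c "]" => reasInv H a b c

attribute [local instance 10] Commuting.flip

section Costar
variable (m n p x y : G →ₐ[K] B) [Commuting m n] [Commuting m p] [Commuting n p] [Commuting m x]
  [Commuting n x] [Commuting p x] [Commuting m y] [Commuting n y] [Commuting x y]

/-- The flip operator for `m ⋆ n` obtained from the ones for `m` and `n`. -/
def flipCostar (Tm Tn : B) : B := φ⁻[m, n, x] * (Tn * (φ[m, x, n] * (Tm * φ⁻[x, m, n])))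

variable (Tm Tn Tp : B)

instance [Intw Tm (x ⋆ m) (m ⋆ x)] [Intw Tn (x ⋆ n) (n ⋆ x)] [Intw Tm n n] [Intw Tn m m] :
    Intw (H.flipCostar m n x Tm Tn) (x ⋆ (m ⋆ n)) (m ⋆ n ⋆ x) :=
  Intw.mul (f' := m ⋆ (n ⋆ x)) inferInstance <| Intw.mul (f' := m ⋆ (x ⋆ n)) inferInstance <|
    Intw.mul (f' := m ⋆ x ⋆ n) inferInstance <| Intw.mul (f' := x ⋆ m ⋆ n) inferInstance
      inferInstance

theorem map_flipCostar {C : Type*} [Ring C] [Algebra K C] (h : B →ₐ[K] C) :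
    h (H.flipCostar m n x Tm Tn) =
      H.flipCostar (h.comp m) (h.comp n) (h.comp x) (h Tm) (h Tn) := by
  simp only [flipCostar, map_mul, map_reas, map_reasInv]

theorem flipCostar_triv : H.flipCostar m n H.triv 1 1 = 1 := by simp [flipCostar]

theorem flipCostar_triv_left : H.flipCostar H.triv n x 1 Tn = Tn := by simp [flipCostar]

theorem flipCostar_triv_right : H.flipCostar m H.triv x Tm 1 = Tm := by simp [flipCostar]

/-- The iterated `flipCostar` is natural with respect to rebracketing; this gives coassociativity up
to `φ` on the slices of a flip operator. -/
theorem reas_mul_flipCostar [Intw Tm (x ⋆ m) (m ⋆ x)] [Intw Tn (x ⋆ n) (n ⋆ x)]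
    [Intw Tp (x ⋆ p) (p ⋆ x)] [Intw Tm n n] [Intw Tm p p] [Intw Tn m m] [Intw Tn p p]
    [Intw Tp m m] [Intw Tp n n] :
    φ[m, n, p] * H.flipCostar (m ⋆ n) p x (H.flipCostar m n x Tm Tn) Tp =
      H.flipCostar m (n ⋆ p) x Tm (H.flipCostar n p x Tn Tp) * φ[m, n, p] := by
  have h₁ : φ⁻[x, m, n] * φ⁻[x, m ⋆ n, p] =
      φ⁻[x ⋆ m, n, p] * (φ⁻[x, m, n ⋆ p] * φ[m, n, p]) := by
    rw [H.reasInv_right x m n p]; simp [mul_assoc]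
  have h₂ := H.intw_reasInv_eq Tm (x ⋆ m) n p (m ⋆ x) n p
  have h₃ : φ[m, n, p] * φ⁻[m ⋆ n, p, x] = φ⁻[m, n ⋆ p, x] * (φ⁻[n, p, x] * φ[m, n, p ⋆ x]) := by
    rw [H.reasInv_left m n p x]; simp [mul_assoc]
  have h₄ := H.intw_reas_eq Tp m n (x ⋆ p) m n (p ⋆ x)
  have h₅ : φ[m, n, x ⋆ p] * (φ[m ⋆ n, x, p] * φ⁻[m, n, x]) = φ[n, x, p] * φ[m, n ⋆ x, p] := by
    rw [H.reas_right m n x p]; simp [mul_assoc]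
  have h₆ := H.intw_reas_eq Tn m (x ⋆ n) p m (n ⋆ x) p
  have h₇ : φ[m, x ⋆ n, p] * (φ[m, x, n] * φ⁻[m ⋆ x, n, p]) = φ⁻[x, n, p] * φ[m, x, n ⋆ p] := by
    rw [H.reas_right m x n p]; simp [mul_assoc]
  simp only [flipCostar, mul_assoc]
  rw [h₁, mul_rw h₂, mul_rw h₃]
  simp only [mul_assoc]
  rw [mul_rw h₄.symm]
  have e₅ := mul_rw h₅
  have e₇ := mul_rw h₇
  simp only [mul_assoc] at e₅ e₇
  simp only [mul_assoc]
  rw [e₅, mul_rw h₆.symm]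
  simp only [mul_assoc]
  rw [e₇]

/-- The `flipCostar` of coherent values is coherent. -/
theorem flipCostar_star (Txm Txn Tym Tyn : B) [Intw Txm (x ⋆ m) (m ⋆ x)]
    [Intw Txn (x ⋆ n) (n ⋆ x)] [Intw Tym (y ⋆ m) (m ⋆ y)] [Intw Tyn (y ⋆ n) (n ⋆ y)]
    [Intw Txm n n] [Intw Txm y y] [Intw Txn m m] [Intw Txn y y] [Intw Tym n n] [Intw Tym x x]
    [Intw Tyn m m] [Intw Tyn x x] (hT : Commute Txm Tyn) :
    H.flipCostar m n (x ⋆ y) (H.flipStar x y m Txm Tym) (H.flipStar x y n Txn Tyn) =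
      H.flipStar x y (m ⋆ n) (H.flipCostar m n x Txm Txn) (H.flipCostar m n y Tym Tyn) := by
  have h₁ : φ⁻[y, m, n] * φ[x, y, m ⋆ n] = φ[x, y ⋆ m, n] * (φ[x, y, m] * φ⁻[x ⋆ y, m, n]) := by
    rw [H.reas_right x y m n]; simp [mul_assoc]
  have h₂ := H.intw_reas_eq Tym x (y ⋆ m) n x (m ⋆ y) n
  have h₃ : φ[m ⋆ n, x, y] * φ⁻[m, n, x] = φ⁻[m, n, x ⋆ y] * (φ[n, x, y] * φ[m, n ⋆ x, y]) := by
    rw [H.reas_left m n x y]; simp [mul_assoc]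
  have h₄ := H.intw_reas_eq Txn m (x ⋆ n) y m (n ⋆ x) y
  have h₅ : φ[x, y, n] * (φ[m, x ⋆ y, n] * φ[m, x, y]) = φ[m, x, y ⋆ n] * φ[m ⋆ x, y, n] := by
    rw [H.reas_right m x y n]; simp [mul_assoc]
  have h₆ := H.intw_reas_eq Tyn m x (y ⋆ n) m x (n ⋆ y)
  have h₇ := H.intw_reas_eq Txm (x ⋆ m) y n (m ⋆ x) y n
  have h₈ : φ[m, x ⋆ n, y] * φ[m, x, n] = φ⁻[x, n, y] * (φ[m, x, n ⋆ y] * φ[m ⋆ x, n, y]) := by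
    rw [H.reas_right m x n y]; simp [mul_assoc]
  have h₉ := H.intw_reas_eq Txm (x ⋆ m) n y (m ⋆ x) n y
  have h₁₀ : φ[x ⋆ m, n, y] * (φ⁻[x, m, n] * (φ⁻[x, m ⋆ n, y] * φ⁻[m, n, y])) =
      φ⁻[x, m, n ⋆ y] := by
    rw [H.reasInv_right x m n y]
  have h₁₁ := H.intw_reasInv_eq Tyn x m (y ⋆ n) x m (n ⋆ y)
  have h₁₂ : φ⁻[x, m, y ⋆ n] * (φ[m, y, n] * φ[x, m ⋆ y, n]) = φ[x ⋆ m, y, n] * φ⁻[x, m, y] := by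
    rw [H.reasInv_right x m y n]; simp [mul_assoc]
  have e₅ := mul_rw h₅
  have e₁₀ := mul_rw h₁₀
  have e₁₂ := mul_rw h₁₂
  simp only [mul_assoc] at e₅ e₁₀ e₁₂
  simp only [flipCostar, flipStar, mul_assoc]
  rw [e₅, mul_rw h₆]
  simp only [mul_assoc]
  rw [mul_rw h₇.symm, h₁, mul_rw h₂, mul_rw h₃]
  simp only [mul_assoc]
  rw [mul_rw h₄.symm]
  simp only [mul_assoc]
  rw [mul_rw h₈]
  simp only [mul_assoc]
  rw [mul_rw h₉.symm]
  simp only [mul_assoc]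
  rw [e₁₀, mul_rw h₁₁.symm]
  simp only [mul_assoc]
  rw [e₁₂, mul_rw hT.eq]
  simp only [mul_assoc]

/-- Compatibility of `flipCostar` with the flip operator `T` of `m` and `n` themselves. -/
theorem mul_flipCostar (T Txm Txn : B)
    (h : Txm * H.flipStar x m n Txn T = H.flipStar m x n T Txn * Txm) :
    T * H.flipCostar m n x Txm Txn = H.flipCostar n m x Txn Txm * T := by
  have h' := congrArg (fun w => φ⁻[n, m, x] * (w * φ⁻[x, m, n])) h
  simp only [flipStar, mul_assoc, reas_mul_reasInv, mul_one, reasInv_mul_reas_mul] at h'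
  simp only [flipCostar, mul_assoc]
  exact h'.symm

end Costar

end QuasiBialgebra

/-! ### The relations of the double, and invertibility of flip operators -/

namespace QuasiHopfAlgebra

open QuasiBialgebra

variable {K : Type u} [Field K] {G : Type v} [Ring G] [Algebra K G] (H : QuasiHopfAlgebra K G)
variable {A B C : Type*} [Ring A] [Algebra K A] [Ring B] [Algebra K B] [Ring C] [Algebra K C]

local infixl:72 " ⋆ " => QuasiBialgebra.star (toQuasiBialgebra H)
local notation "φ[" a ", " b ", " c "]" => reas (toQuasiBialgebra H) a b c
local notation "φ⁻[" a ", " b ", " c "]" => reasInv (toQuasiBialgebra H) a b c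

attribute [local instance 10] Commuting.flip

theorem assoc_map {P : Type*} [Ring P] [Algebra K P] (Δ : P →ₐ[K] B ⊗[K] C) (w : P ⊗[K] A) :
    Algebra.TensorProduct.assoc K K K B C A (Algebra.TensorProduct.map Δ (AlgHom.id K A) w) =
      pl ((pl iL (iR.comp iL)).comp Δ) (iR.comp iR) w := by
  refine eq_pl_apply (h := (Algebra.TensorProduct.assoc K K K B C A).toAlgHom.comp
    (Algebra.TensorProduct.map Δ (AlgHom.id K A))) ?_ ?_ w
  · have e : (Algebra.TensorProduct.map Δ (AlgHom.id K A)).comp (iL : P →ₐ[K] P ⊗[K] A) =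
        iL.comp Δ := by ext; simp
    rw [AlgHom.comp_assoc, e, ← AlgHom.comp_assoc]
    congr 1
    exact tensorHom_ext (by ext; simp [Algebra.TensorProduct.one_def]) (by ext; simp)
  · ext; simp [Algebra.TensorProduct.one_def]

section Invertible
variable {j : G →ₐ[K] A} {T : G ⊗[K] A}

theorem IsCoherent.eq_one (hc : H.IsCoherent j T) (hn : con H.ε.toLinearMap T = 1)
    (m : A →ₐ[K] B) : pl H.triv m T = 1 := by
  rw [con_counit] at hn
  have h := congrArg m hn
  rw [map_pl, map_one] at h
  simpa only [comp_triv, AlgHom.comp_id] using h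

/-- `z ⊗ x* ⊗ x ⊗ t ↦ z β S(x*) α x ⊗ t` kills the legs `z`, `x*` and `x*`, `x`. -/
abbrev zigFst : (G ⊗[K] (G ⊗[K] G)) ⊗[K] A →ₗ[K] G ⊗[K] A :=
  TensorProduct.map H.zigLin LinearMap.id

theorem zigFst_mul (u : G ⊗[K] (G ⊗[K] G)) (v : G ⊗[K] A) :
    H.zigFst (iL u * pl (iL.comp (iR.comp iR)) iR v) = H.zigLin u ⊗ₜ 1 * v := by
  induction v using TensorProduct.induction_on with
  | zero => simp
  | add x y hx hy => simp only [map_add, mul_add, hx, hy]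
  | tmul g a =>
    suffices h : H.zigLin ∘ₗ LinearMap.mulRight K (iR (iR g)) =
        LinearMap.mulRight K g ∘ₗ H.zigLin by
      have := DFunLike.congr_fun h u
      simp only [LinearMap.comp_apply, LinearMap.mulRight_apply] at this
      simpa using congrArg (· ⊗ₜ[K] a) this
    ext
    simp [zigLin, mul_assoc]

section Words
variable {M : Type*} [AddCommGroup M] [Module K M] (F : B →ₗ[K] M) (z y x t : G →ₐ[K] B)
  [Commuting z y] [Commuting z x] [Commuting z t] [Commuting y x] [Commuting y t] [Commuting x t]

theorem left_flipStar_mul [LeftEq F (y ⋆ x) H.triv] (Ty Tx v : B) [Intw Tx (x ⋆ t) (t ⋆ x)]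
    [Intw Tx z z] [Intw Tx y y] (hv : Tx * v = 0) :
    F (H.flipStar y x t Ty Tx * (φ⁻[y, x, t] * (φ[z, y, x ⋆ t] * v))) = 0 := by
  have h := H.intw_reas_eq Tx z y (x ⋆ t) z y (t ⋆ x)
  rw [flipStar]
  simp only [mul_assoc, reas_mul_reasInv_mul]
  rw [mul_rw h]
  simp only [mul_assoc, hv, mul_zero, map_zero]

theorem left_right_zigzag [LeftEq F (y ⋆ x) H.triv] [RightEq F (z ⋆ y) H.triv] (v : B)
    [Intw v z z] [Intw v y y] :
    F (φ⁻[y, x, t] * (φ[z, y, x ⋆ t] * v)) = F (φ[z, y, x] * v) := by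
  have h : φ⁻[y, x, t] * φ[z, y, x ⋆ t] = φ[z, y ⋆ x, t] * (φ[z, y, x] * φ⁻[z ⋆ y, x, t]) := by
    rw [H.reas_right z y x t]; simp
  have h' := H.right_reasInv₁ (F ∘ₗ LinearMap.mulRight K v) (z ⋆ y) x t φ[z, y, x]
  simp only [LinearMap.comp_apply, LinearMap.mulRight_apply, mul_assoc] at h'
  rw [mul_rw h]
  simp only [mul_assoc]
  rw [H.left_reas₂ F z (y ⋆ x) t, h']

end Words

/-- Multiplication by a coherent normal flip operator is injective: the flip operator of the
annihilated pair `y`, `x` is trivial, but coherence writes it with the flip operator of `x` as a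
factor. -/
theorem IsFlip.eq_zero (hf : H.IsFlip j T) (hc : H.IsCoherent j T)
    (hn : con H.ε.toLinearMap T = 1) (v : G ⊗[K] A) (hv : T * v = 0) : v = 0 := by
  let z : G →ₐ[K] (G ⊗[K] (G ⊗[K] G)) ⊗[K] A := iL.comp iL
  let y : G →ₐ[K] (G ⊗[K] (G ⊗[K] G)) ⊗[K] A := iL.comp (iR.comp iL)
  let x : G →ₐ[K] (G ⊗[K] (G ⊗[K] G)) ⊗[K] A := iL.comp (iR.comp iR)
  let m : A →ₐ[K] (G ⊗[K] (G ⊗[K] G)) ⊗[K] A := iR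
  let F : (G ⊗[K] (G ⊗[K] G)) ⊗[K] A →ₗ[K] G ⊗[K] A := H.zigFst
  have i₁ : LeftEq F (y ⋆ x) H.triv := leftEq_star_map_left _ H.leftEq_zigLin _
  have i₂ : RightEq F (z ⋆ y) H.triv := rightEq_star_map_left _ H.rightEq_zigLin _
  have i₃ := hf.intw H x m
  have e₁ : F (pl (y ⋆ x) m T * (φ⁻[y, x, m.comp j] * (φ[z, y, x ⋆ m.comp j] * pl x m v))) = 0 := by
    rw [hc.eq]
    exact H.left_flipStar_mul F z y x (m.comp j) _ _ _ (by rw [← map_mul, hv, map_zero])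
  have e₂ := (LeftEq.pl F (y ⋆ x) H.triv m m).eq T
    (φ⁻[y, x, m.comp j] * (φ[z, y, x ⋆ m.comp j] * pl x m v))
  rw [e₁, hc.eq_one H hn, one_mul, H.left_right_zigzag F z y x (m.comp j)] at e₂
  have e₃ : φ[z, y, x] = iL (H.φ : G ⊗[K] (G ⊗[K] G)) := by
    rw [← H.reas_legs, map_reas]
  rw [e₃] at e₂
  have e₄ := e₂.trans (H.zigFst_mul _ v)
  rw [show H.zigLin (H.φ : G ⊗[K] (G ⊗[K] G)) = 1 from H.reassoc_antipode,
    ← Algebra.TensorProduct.one_def, one_mul] at e₄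
  exact e₄.symm

/-- A coherent normal flip operator with values in a finite-dimensional algebra is invertible. -/
theorem IsFlip.isUnit [FiniteDimensional K G] [FiniteDimensional K A] (hf : H.IsFlip j T)
    (hc : H.IsCoherent j T) (hn : con H.ε.toLinearMap T = 1) : IsUnit T := by
  have hi : Function.Injective (LinearMap.mulLeft K T) :=
    (injective_iff_map_eq_zero _).2 fun v hv => hf.eq_zero H hc hn v hv
  obtain ⟨u, hu⟩ := LinearMap.injective_iff_surjective.1 hi 1
  have hu : T * u = 1 := hu
  refine ⟨⟨T, u, hu, sub_eq_zero.1 (hf.eq_zero H hc hn _ ?_)⟩, rfl⟩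
  rw [mul_sub, ← mul_assoc, hu, one_mul, mul_one, sub_self]

end Invertible

section Double
variable [FiniteDimensional K G] (h : H.DoubleIsAlgebra) (hα : H.ε H.α = 1)

instance : FiniteDimensional K (H.Double h) :=
  Module.Finite.equiv (H.toDouble h)

theorem iD_injective : Function.Injective (H.iD h) := by
  intro a b hab
  have e : H.ε.toLinearMap ⊗ₜ[K] a = H.ε.toLinearMap ⊗ₜ[K] b := hab
  have e' := congrArg (TensorProduct.lid K G ∘
    TensorProduct.map (Module.Dual.eval K G 1) LinearMap.id) e
  simpa using e'

section
variable (j : G →ₐ[K] A)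

/-- `id ⊗ id ⊗ j`. -/
abbrev onThird : G ⊗[K] (G ⊗[K] G) →ₐ[K] G ⊗[K] (G ⊗[K] A) :=
  Algebra.TensorProduct.map (AlgHom.id K G) (onSnd j)

theorem onThird_φ : onThird j (H.φ : G ⊗[K] (G ⊗[K] G)) =
    φ[iL, iR.comp iL, (iR.comp iR).comp j] :=
  H.apply_eq_reas _ _ _ (by ext; simp) (by ext; simp) (by ext; simp)

theorem onThird_perm312 : onThird j (perm312 (H.φ : G ⊗[K] (G ⊗[K] G))) =
    φ[(iR.comp iR).comp j, iL, iR.comp iL] :=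
  H.apply_eq_reas _ _ _ (h := (onThird j).comp perm312)
    (by ext; simp [perm312, Algebra.TensorProduct.one_def])
    (by ext; simp [perm312, Algebra.TensorProduct.one_def])
    (by ext; simp [perm312, Algebra.TensorProduct.one_def])

theorem onThird_perm132 : onThird j (perm132 (↑H.φ⁻¹ : G ⊗[K] (G ⊗[K] G))) =
    φ⁻[iL, (iR.comp iR).comp j, iR.comp iL] :=
  H.apply_eq_reasInv _ _ _ (h := (onThird j).comp perm132)
    (by ext; simp [perm132, Algebra.TensorProduct.one_def])
    (by ext; simp [perm132, Algebra.TensorProduct.one_def])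
    (by ext; simp [perm132, Algebra.TensorProduct.one_def])

end

theorem doubleRelations (h : H.DoubleIsAlgebra) (hα : H.ε H.α = 1) : H.DoubleRelations h where
  iD_mul a b := ((H.iDHom h hα).map_mul a b).symm
  flip_intertwines := H.isFlip_flipOp h hα
  flip_coherent := by
    have hc := H.isCoherent_flipOp h hα
    have e := assoc_map H.Δ (H.flipOp h)
    rw [IsCoherent] at hc
    refine Eq.trans ?_ (hc.trans e.symm)
    rw [flipStar, ← onThird_perm132, ← onThird_perm312, ← onThird_φ]
    simp only [mul_assoc]
    rfl

theorem isUnit_flipOp (h : H.DoubleIsAlgebra) (hα : H.ε H.α = 1) : IsUnit (H.flipOp h) :=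
  (H.isFlip_flipOp h hα).isUnit H (H.isCoherent_flipOp h hα) (H.con_flipOp h hα)

theorem counit_flipOp (h : H.DoubleIsAlgebra) (hα : H.ε H.α = 1) :
    TensorProduct.lid K (H.Double h)
      (TensorProduct.map H.ε.toLinearMap LinearMap.id (H.flipOp h)) = 1 := by
  rw [← H.con_flipOp h hα]
  rfl

end Double

/-! ### Products of flip operators -/

section Prod
variable {A₁ A₂ : Type*} [Ring A₁] [Algebra K A₁] [Ring A₂] [Algebra K A₂]

/-- `a ↦ (j ⊗ k)(Δ(a))`. -/
abbrev prodHom (j : G →ₐ[K] A₁) (k : G →ₐ[K] A₂) : G →ₐ[K] A₁ ⊗[K] A₂ := iL.comp j ⋆ iR.comp k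

variable (j : G →ₐ[K] A₁) (k : G →ₐ[K] A₂) (T : G ⊗[K] A₁) (U : G ⊗[K] A₂)

/-- The flip operator for `prodHom j k` obtained from flip operators for `j` and `k`. -/
def prodFlip : G ⊗[K] (A₁ ⊗[K] A₂) :=
  H.flipCostar ((iR.comp iL).comp j) ((iR.comp iR).comp k) iL (pl iL (iR.comp iL) T)
    (pl iL (iR.comp iR) U)

theorem pl_prodFlip (x : G →ₐ[K] B) (m : A₁ ⊗[K] A₂ →ₐ[K] B) [Commuting x m] :
    pl x m (H.prodFlip j k T U) = H.flipCostar ((m.comp iL).comp j) ((m.comp iR).comp k) x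
      (pl x (m.comp iL) T) (pl x (m.comp iR) U) := by
  rw [prodFlip, map_flipCostar, map_pl, map_pl]
  simp only [← AlgHom.comp_assoc, pl_comp_iL, pl_comp_iR]

theorem comp_prodHom (m : A₁ ⊗[K] A₂ →ₐ[K] B) :
    m.comp (H.prodHom j k) = (m.comp iL).comp j ⋆ (m.comp iR).comp k := by
  rw [comp_star]; rfl

variable {j k T U}

theorem isFlip_iff : H.IsFlip j T ↔ Intw T (iL ⋆ iR.comp j) (iR.comp j ⋆ iL) := by
  have h₁ : ∀ d, onSnd j d = pl iL (iR.comp j) d := fun d =>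
    eq_pl_apply (by ext; simp) (by ext; simp) d
  have h₂ : ∀ d, onSnd j (Algebra.TensorProduct.comm K G G d) = pl (iR.comp j) iL d := fun d => by
    rw [h₁, pl_swap (iR.comp j) iL]
  exact ⟨fun h => ⟨fun a => ((congrArg (T * ·) (h₁ _)).symm.trans (h a)).trans
      (congrArg (· * T) (h₂ _))⟩,
    fun h a => ((congrArg (T * ·) (h₁ _)).trans (h.eq a)).trans (congrArg (· * T) (h₂ _)).symm⟩

theorem IsFlip.prod (hT : H.IsFlip j T) (hU : H.IsFlip k U) :
    H.IsFlip (H.prodHom j k) (H.prodFlip j k T U) := by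
  have i₁ := hT.intw H (iL : G →ₐ[K] G ⊗[K] (A₁ ⊗[K] A₂)) (iR.comp iL)
  have i₂ := hU.intw H (iL : G →ₐ[K] G ⊗[K] (A₁ ⊗[K] A₂)) (iR.comp iR)
  rw [isFlip_iff]
  simp only [comp_prodHom]
  exact inferInstanceAs (Intw (H.flipCostar _ _ _ _ _) _ _)

theorem pl_star_prodFlip (hT : H.IsFlip j T) (hU : H.IsFlip k U) (cT : H.IsCoherent j T)
    (cU : H.IsCoherent k U) (x y : G →ₐ[K] B) (m : A₁ ⊗[K] A₂ →ₐ[K] B) [Commuting x y]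
    [Commuting x m] [Commuting y m] : pl (x ⋆ y) m (H.prodFlip j k T U) =
      H.flipStar x y ((m.comp iL).comp j ⋆ (m.comp iR).comp k) (pl x m (H.prodFlip j k T U))
        (pl y m (H.prodFlip j k T U)) := by
  have i₁ := hT.intw H x (m.comp iL)
  have i₂ := hU.intw H x (m.comp iR)
  have i₃ := hT.intw H y (m.comp iL)
  have i₄ := hU.intw H y (m.comp iR)
  rw [pl_prodFlip, pl_prodFlip, pl_prodFlip, cT.eq, cU.eq]
  exact H.flipCostar_star _ _ _ _ _ _ _ _ (Commuting.comm _ _)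

theorem IsCoherent.prod (hT : H.IsFlip j T) (hU : H.IsFlip k U) (cT : H.IsCoherent j T)
    (cU : H.IsCoherent k U) : H.IsCoherent (H.prodHom j k) (H.prodFlip j k T U) := by
  have h := H.pl_star_prodFlip hT hU cT cU iL (iR.comp iL) (iR.comp iR)
  rw [IsCoherent, leg13_eq, leg23_eq, h]
  simp only [comp_prodHom]

theorem con_prodFlip (hT : con H.ε.toLinearMap T = 1) (hU : con H.ε.toLinearMap U = 1)
    (cT : H.IsCoherent j T) (cU : H.IsCoherent k U) :
    con H.ε.toLinearMap (H.prodFlip j k T U) = 1 := by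
  rw [con_counit, pl_prodFlip, cT.eq_one H hT, cU.eq_one H hU, flipCostar_triv]

end Prod

/-! ### The quasi-bialgebra generated by a flip operator -/

section Generating
variable {D : Type*} [Ring D] [Algebra K D]

/-- A coherent normal flip operator `T` for `i` such that the elements `i a` and the slices of `T`
generate the algebra `D`. -/
structure IsGenerating (i : G →ₐ[K] D) (T : G ⊗[K] D) : Prop where
  isFlip : H.IsFlip i T
  isCoherent : H.IsCoherent i T
  normal : con H.ε.toLinearMap T = 1
  generates : ∀ S : Subalgebra K D, (∀ a, i a ∈ S) → (∀ χ, con χ T ∈ S) → ∀ x, x ∈ S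

theorem con_mul_iR (χ : Module.Dual K G) (w : G ⊗[K] A) (b : A) :
    con χ (w * iR b) = con χ w * b := by
  induction w using TensorProduct.induction_on with
  | zero => simp
  | add x y hx hy => simp only [map_add, add_mul, hx, hy]
  | tmul x a => simp

theorem con_pl_iR (χ : Module.Dual K G) (k : A →ₐ[K] B) (w : G ⊗[K] A) :
    con χ (pl iL (iR.comp k) w) = k (con χ w) := by
  induction w using TensorProduct.induction_on with
  | zero => simp
  | add x y hx hy => simp only [map_add, hx, hy]
  | tmul x a => simp

variable {i : G →ₐ[K] D} {T : G ⊗[K] D}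

/-- An intertwining relation between homomorphisms on `D` may be checked on `i(G)` and on the flip
operator. -/
theorem IsGenerating.intw (hg : H.IsGenerating i T) {k k' : D →ₐ[K] A} {u : A}
    (h₁ : Intw u (k.comp i) (k'.comp i))
    (h₂ : iR u * pl iL (iR.comp k) T = pl iL (iR.comp k') T * iR u) : Intw u k k' := by
  let S : Subalgebra K D :=
    { carrier := {x | u * k x = k' x * u}
      mul_mem' := fun {x y} hx hy => by
        have hx : u * k x = k' x * u := hx
        have hy : u * k y = k' y * u := hy
        change u * k (x * y) = k' (x * y) * u
        rw [map_mul, map_mul, ← mul_assoc, hx, mul_assoc, hy, mul_assoc]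
      add_mem' := fun {x y} hx hy => by
        have hx : u * k x = k' x * u := hx
        have hy : u * k y = k' y * u := hy
        change u * k (x + y) = k' (x + y) * u
        rw [map_add, map_add, mul_add, add_mul, hx, hy]
      algebraMap_mem' := fun r => by
        change u * k _ = k' _ * u
        rw [AlgHom.commutes, AlgHom.commutes, Algebra.commutes] }
  refine ⟨hg.generates S (fun a => h₁.eq a) fun χ => ?_⟩
  have h := congrArg (con χ) h₂
  rwa [con_iR_mul, con_mul_iR, con_pl_iR, con_pl_iR] at h

theorem IsGenerating.hom_ext (hg : H.IsGenerating i T) {k k' : D →ₐ[K] A}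
    (h₁ : k.comp i = k'.comp i) (h₂ : pl iL (iR.comp k) T = pl iL (iR.comp k') T) : k = k' := by
  have h := hg.intw H (u := 1) (k := k) (k' := k') ⟨fun x => by rw [h₁, one_mul, mul_one]⟩
    (by rw [h₂, map_one, one_mul, mul_one])
  ext x
  simpa using h.eq x

variable {Δ : D →ₐ[K] D ⊗[K] D}

theorem pl_comp_coproduct (h : pl iL (iR.comp Δ) T = H.prodFlip i i T T) (x : G →ₐ[K] B)
    (m : D ⊗[K] D →ₐ[K] B) [Commuting x m] : pl x (m.comp Δ) T =
      H.flipCostar ((m.comp iL).comp i) ((m.comp iR).comp i) x (pl x (m.comp iL) T)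
        (pl x (m.comp iR) T) := by
  rw [← pl_prodFlip, ← h, map_pl]
  simp only [← AlgHom.comp_assoc, pl_comp_iL, pl_comp_iR]

section
variable (i)

/-- `i ⊗ i ⊗ i`. -/
abbrev tripleHom : G ⊗[K] (G ⊗[K] G) →ₐ[K] D ⊗[K] (D ⊗[K] D) :=
  Algebra.TensorProduct.map i (Algebra.TensorProduct.map i i)

theorem tripleHom_φ : tripleHom i (H.φ : G ⊗[K] (G ⊗[K] G)) =
    φ[iL.comp i, (iR.comp iL).comp i, (iR.comp iR).comp i] :=
  H.apply_eq_reas _ _ _ (by ext; simp [Algebra.TensorProduct.one_def])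
    (by ext; simp [Algebra.TensorProduct.one_def]) (by ext; simp [Algebra.TensorProduct.one_def])

theorem tripleHom_φInv : tripleHom i (↑H.φ⁻¹ : G ⊗[K] (G ⊗[K] G)) =
    φ⁻[iL.comp i, (iR.comp iL).comp i, (iR.comp iR).comp i] :=
  H.apply_eq_reasInv _ _ _ (by ext; simp [Algebra.TensorProduct.one_def])
    (by ext; simp [Algebra.TensorProduct.one_def]) (by ext; simp [Algebra.TensorProduct.one_def])

end

theorem comp_coproduct (h : Δ.comp i = H.prodHom i i) (m : D ⊗[K] D →ₐ[K] B) :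
    (m.comp Δ).comp i = (m.comp iL).comp i ⋆ (m.comp iR).comp i := by
  rw [AlgHom.comp_assoc, h, comp_prodHom]

theorem reas_mul_pl_coproduct (hf : H.IsFlip i T) (h₁ : Δ.comp i = H.prodHom i i)
    (h₂ : pl iL (iR.comp Δ) T = H.prodFlip i i T T) (x : G →ₐ[K] B) (m n p : D →ₐ[K] B)
    [Commuting x m] [Commuting x n] [Commuting x p] [Commuting m n] [Commuting m p]
    [Commuting n p] : φ[m.comp i, n.comp i, p.comp i] *
      pl x ((pl ((pl m n).comp Δ) p).comp Δ) T =
        pl x ((pl m ((pl n p).comp Δ)).comp Δ) T * φ[m.comp i, n.comp i, p.comp i] := by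
  have i₁ := hf.intw H x m
  have i₂ := hf.intw H x n
  have i₃ := hf.intw H x p
  have e := H.reas_mul_flipCostar (m.comp i) (n.comp i) (p.comp i) x (pl x m T) (pl x n T)
    (pl x p T)
  simp only [H.pl_comp_coproduct h₂, pl_comp_iL, pl_comp_iR, H.comp_coproduct h₁]
  exact e

/-- `(id ⊗ Δ)(Δ(x)) φ = φ (Δ ⊗ id)(Δ(x))`, for commuting legs. -/
theorem IsGenerating.quasi_coassoc (hg : H.IsGenerating i T) (h₁ : Δ.comp i = H.prodHom i i)
    (h₂ : pl iL (iR.comp Δ) T = H.prodFlip i i T T) (m n p : D →ₐ[K] B) [Commuting m n]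
    [Commuting m p] [Commuting n p] : Intw φ[m.comp i, n.comp i, p.comp i]
      ((pl ((pl m n).comp Δ) p).comp Δ) ((pl m ((pl n p).comp Δ)).comp Δ) := by
  refine hg.intw H ?_ ?_
  · simp only [H.comp_coproduct h₁, pl_comp_iL, pl_comp_iR]
    infer_instance
  · have e := H.reas_mul_pl_coproduct hg.isFlip h₁ h₂ (iL : G →ₐ[K] G ⊗[K] B) (iR.comp m)
      (iR.comp n) (iR.comp p)
    simpa only [map_reas, ← AlgHom.comp_assoc, comp_pl] using e

/-- The flip operator placed at two legs of the double intertwines the coproduct with its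
opposite. -/
theorem IsGenerating.intw_coproduct (hg : H.IsGenerating i T) (h₁ : Δ.comp i = H.prodHom i i)
    (h₂ : pl iL (iR.comp Δ) T = H.prodFlip i i T T) (m n : D →ₐ[K] B) [Commuting m n]
    [Commuting n m] : Intw (pl (m.comp i) n T) ((pl m n).comp Δ) ((pl n m).comp Δ) := by
  have i₀ := hg.isFlip.intw H (m.comp i) n
  refine hg.intw H ?_ ?_
  · simp only [H.comp_coproduct h₁, pl_comp_iL, pl_comp_iR]
    exact i₀
  · let x : G →ₐ[K] G ⊗[K] B := iL
    let m' : D →ₐ[K] G ⊗[K] B := iR.comp m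
    let n' : D →ₐ[K] G ⊗[K] B := iR.comp n
    have i₁ := hg.isFlip.intw H x m'
    have e := Intw.pl_eq (pl x m' T) (x ⋆ m'.comp i) (m'.comp i ⋆ x) n' n' T
    rw [hg.isCoherent.eq, hg.isCoherent.eq] at e
    have e' := H.mul_flipCostar (m'.comp i) (n'.comp i) x _ _ _ e
    have e₁ := H.pl_comp_coproduct h₂ x (pl m' n')
    have e₂ := H.pl_comp_coproduct h₂ x (pl n' m')
    simp only [pl_comp_iL, pl_comp_iR] at e₁ e₂
    rw [← e₁, ← e₂] at e'
    simpa only [map_pl, ← AlgHom.comp_assoc, comp_pl] using e'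

theorem IsGenerating.counit_left (hg : H.IsGenerating i T) (h₁ : Δ.comp i = H.prodHom i i)
    (h₂ : pl iL (iR.comp Δ) T = H.prodFlip i i T T) {t : D →ₐ[K] B} (ht : t.comp i = H.triv)
    (ht' : pl iL ((iR : B →ₐ[K] G ⊗[K] B).comp t) T = 1) (m : D →ₐ[K] B) [Commuting t m] :
    (pl t m).comp Δ = m := by
  refine hg.hom_ext H ?_ ?_
  · simp only [H.comp_coproduct h₁, pl_comp_iL, pl_comp_iR, ht, triv_star]
  · have e₁ := H.pl_comp_coproduct h₂ (iL : G →ₐ[K] G ⊗[K] B) (iR.comp (pl t m))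
    simp only [AlgHom.comp_assoc, pl_comp_iL, pl_comp_iR, ht, ht', comp_triv,
      flipCostar_triv_left] at e₁
    exact e₁

theorem IsGenerating.counit_right (hg : H.IsGenerating i T) (h₁ : Δ.comp i = H.prodHom i i)
    (h₂ : pl iL (iR.comp Δ) T = H.prodFlip i i T T) {t : D →ₐ[K] B} (ht : t.comp i = H.triv)
    (ht' : pl iL ((iR : B →ₐ[K] G ⊗[K] B).comp t) T = 1) (m : D →ₐ[K] B) [Commuting m t] :
    (pl m t).comp Δ = m := by
  refine hg.hom_ext H ?_ ?_
  · simp only [H.comp_coproduct h₁, pl_comp_iL, pl_comp_iR, ht, star_triv]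
  · have e₁ := H.pl_comp_coproduct h₂ (iL : G →ₐ[K] G ⊗[K] B) (iR.comp (pl m t))
    simp only [AlgHom.comp_assoc, pl_comp_iL, pl_comp_iR, ht, ht', comp_triv,
      flipCostar_triv_right] at e₁
    exact e₁

end Generating

section Generating
variable {D : Type*} [Ring D] [Algebra K D]

theorem map_id_eq {P : Type*} [Ring P] [Algebra K P] (Δ : P →ₐ[K] B ⊗[K] C) (w : A ⊗[K] P) :
    Algebra.TensorProduct.map (AlgHom.id K A) Δ w =
      pl iL ((pl (iR.comp iL) (iR.comp iR)).comp Δ) w := by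
  refine eq_pl_apply (by ext; simp) ?_ w
  rw [← comp_pl, pl_iL_iR, AlgHom.comp_id]
  ext
  simp

variable {i : G →ₐ[K] D} {T : G ⊗[K] D} {Δ : D →ₐ[K] D ⊗[K] D}

theorem reas_map_coproduct_right (h₁ : Δ.comp i = H.prodHom i i) :
    Algebra.TensorProduct.map (AlgHom.id K D) (Algebra.TensorProduct.map (AlgHom.id K D) Δ)
      (tripleHom i (H.φ : G ⊗[K] (G ⊗[K] G))) = φ[iL.comp i, (iR.comp iL).comp i,
        ((iR.comp iR).comp iL).comp i ⋆ ((iR.comp iR).comp iR).comp i] := by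
  have e : Algebra.TensorProduct.map (AlgHom.id K D) Δ =
      pl iL ((pl (iR.comp iL) (iR.comp iR)).comp Δ) := AlgHom.ext (map_id_eq Δ)
  rw [e, map_id_eq, tripleHom_φ, map_reas]
  simp only [← AlgHom.comp_assoc, comp_pl, pl_comp_iL, pl_comp_iR, H.comp_coproduct h₁]

theorem reas_map_coproduct_left (h₁ : Δ.comp i = H.prodHom i i) :
    Algebra.TensorProduct.assoc K K K D D (D ⊗[K] D)
      (Algebra.TensorProduct.map Δ (AlgHom.id K (D ⊗[K] D))
        (tripleHom i (H.φ : G ⊗[K] (G ⊗[K] G)))) = φ[iL.comp i ⋆ (iR.comp iL).comp i,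
        ((iR.comp iR).comp iL).comp i, ((iR.comp iR).comp iR).comp i] := by
  rw [assoc_map, tripleHom_φ, map_reas]
  simp only [← AlgHom.comp_assoc, comp_pl, pl_comp_iL, pl_comp_iR, H.comp_coproduct h₁]

theorem reas_map_coproduct_mid (h₁ : Δ.comp i = H.prodHom i i) :
    Algebra.TensorProduct.map (AlgHom.id K D)
        ((Algebra.TensorProduct.assoc K K K D D D).toAlgHom.comp
          (Algebra.TensorProduct.map Δ (AlgHom.id K D)))
        (tripleHom i (H.φ : G ⊗[K] (G ⊗[K] G))) = φ[iL.comp i,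
        (iR.comp iL).comp i ⋆ ((iR.comp iR).comp iL).comp i,
        ((iR.comp iR).comp iR).comp i] := by
  have e : (Algebra.TensorProduct.assoc K K K D D D).toAlgHom.comp
      (Algebra.TensorProduct.map Δ (AlgHom.id K D)) =
        pl ((pl iL (iR.comp iL)).comp Δ) (iR.comp iR) := AlgHom.ext (assoc_map Δ)
  rw [e, map_id_eq, tripleHom_φ, map_reas]
  simp only [← AlgHom.comp_assoc, comp_pl, pl_comp_iL, pl_comp_iR, H.comp_coproduct h₁]

variable {ε : D →ₐ[K] K}

/-- The quasi-bialgebra structure on an algebra generated by a flip operator. -/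
def IsGenerating.quasiBialgebra (hg : H.IsGenerating i T) (h₁ : Δ.comp i = H.prodHom i i)
    (h₂ : pl iL (iR.comp Δ) T = H.prodFlip i i T T) (h₃ : ε.comp i = H.ε)
    (h₄ : pl iL ((iR : D →ₐ[K] G ⊗[K] D).comp ((Algebra.ofId K D).comp ε)) T = 1) :
    QuasiBialgebra K D where
  Δ := Δ
  ε := ε
  φ := Units.map (tripleHom i : _ →* _) H.φ
  quasi_coassoc a := by
    have e := (hg.quasi_coassoc H h₁ h₂ (iL : D →ₐ[K] D ⊗[K] (D ⊗[K] D)) (iR.comp iL)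
      (iR.comp iR)).eq a
    rw [AlgHom.comp_apply, AlgHom.comp_apply, ← map_id_eq, ← assoc_map, ← tripleHom_φ] at e
    exact e.symm
  pentagon := by
    have e := H.reas_pentagon (iL.comp i : G →ₐ[K] D ⊗[K] (D ⊗[K] (D ⊗[K] D)))
      ((iR.comp iL).comp i) (((iR.comp iR).comp iL).comp i) (((iR.comp iR).comp iR).comp i)
    have e₁ : (1 : D) ⊗ₜ[K] tripleHom i (H.φ : G ⊗[K] (G ⊗[K] G)) =
        φ[(iR.comp iL).comp i, ((iR.comp iR).comp iL).comp i, ((iR.comp iR).comp iR).comp i] :=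
      H.apply_eq_reas _ _ _ (h := iR.comp (tripleHom i))
        (by ext; simp [Algebra.TensorProduct.one_def])
        (by ext; simp [Algebra.TensorProduct.one_def])
        (by ext; simp [Algebra.TensorProduct.one_def])
    have e₂ : leg123 (tripleHom i (H.φ : G ⊗[K] (G ⊗[K] G))) =
        φ[iL.comp i, (iR.comp iL).comp i, ((iR.comp iR).comp iL).comp i] :=
      H.apply_eq_reas _ _ _ (h := leg123.comp (tripleHom i))
        (by ext; simp [leg123, Algebra.TensorProduct.one_def])
        (by ext; simp [leg123, Algebra.TensorProduct.one_def])
        (by ext; simp [leg123, Algebra.TensorProduct.one_def])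
    rw [← e₁, ← e₂, ← reas_map_coproduct_right H h₁, ← reas_map_coproduct_left H h₁,
      ← reas_map_coproduct_mid H h₁] at e
    exact e
  counit_left a := by
    haveI : Commuting ((Algebra.ofId K D).comp ε) (AlgHom.id K D) :=
      ⟨fun _ _ => Algebra.commutes _ _⟩
    have e := hg.counit_left H h₁ h₂ (t := (Algebra.ofId K D).comp ε)
      (by rw [AlgHom.comp_assoc, h₃]; rfl) h₄ (AlgHom.id K D)
    refine Eq.trans ?_ (DFunLike.congr_fun e a)
    exact eq_pl_apply (h := (Algebra.TensorProduct.lid K D).toAlgHom.comp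
      (Algebra.TensorProduct.map ε (AlgHom.id K D))) (by ext; simp [Algebra.algebraMap_eq_smul_one])
      (by ext; simp) _
  counit_right a := by
    haveI : Commuting (AlgHom.id K D) ((Algebra.ofId K D).comp ε) :=
      ⟨fun _ _ => (Algebra.commutes _ _).symm⟩
    have e := hg.counit_right H h₁ h₂ (t := (Algebra.ofId K D).comp ε)
      (by rw [AlgHom.comp_assoc, h₃]; rfl) h₄ (AlgHom.id K D)
    refine Eq.trans ?_ (DFunLike.congr_fun e a)
    exact eq_pl_apply (h := (Algebra.TensorProduct.rid K K D).toAlgHom.comp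
      (Algebra.TensorProduct.map (AlgHom.id K D) ε)) (by ext; simp)
      (by ext; simp [Algebra.algebraMap_eq_smul_one]) _
  counit_mid := by
    refine (H.apply_eq_reas (iL.comp i) H.triv (iR.comp i) (h := (Algebra.TensorProduct.map
      (AlgHom.id K D) ((Algebra.TensorProduct.lid K D).toAlgHom.comp
      (Algebra.TensorProduct.map ε (AlgHom.id K D)))).comp (tripleHom i)) ?_ ?_ ?_).trans
      (H.reas_triv_mid _ _)
    · ext; simp [Algebra.TensorProduct.one_def]
    · ext a
      have e := DFunLike.congr_fun h₃ a
      simp only [AlgHom.comp_apply] at e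
      simp [e, Algebra.algebraMap_eq_smul_one, Algebra.TensorProduct.one_def]
    · ext; simp

theorem map_perm231 : perm231 (tripleHom i (↑H.φ⁻¹ : G ⊗[K] (G ⊗[K] G))) =
    φ⁻[(iR.comp iL).comp i, (iR.comp iR).comp i, iL.comp i] :=
  H.apply_eq_reasInv _ _ _ (h := perm231.comp (tripleHom i))
    (by ext; simp [perm231, Algebra.TensorProduct.one_def])
    (by ext; simp [perm231, Algebra.TensorProduct.one_def])
    (by ext; simp [perm231, Algebra.TensorProduct.one_def])

theorem map_perm213 : perm213 (tripleHom i (H.φ : G ⊗[K] (G ⊗[K] G))) =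
    φ[(iR.comp iL).comp i, iL.comp i, (iR.comp iR).comp i] :=
  H.apply_eq_reas _ _ _ (h := perm213.comp (tripleHom i))
    (by ext; simp [perm213, Algebra.TensorProduct.one_def])
    (by ext; simp [perm213, Algebra.TensorProduct.one_def])
    (by ext; simp [perm213, Algebra.TensorProduct.one_def])

theorem map_perm312 : perm312 (tripleHom i (H.φ : G ⊗[K] (G ⊗[K] G))) =
    φ[(iR.comp iR).comp i, iL.comp i, (iR.comp iL).comp i] :=
  H.apply_eq_reas _ _ _ (h := perm312.comp (tripleHom i))
    (by ext; simp [perm312, Algebra.TensorProduct.one_def])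
    (by ext; simp [perm312, Algebra.TensorProduct.one_def])
    (by ext; simp [perm312, Algebra.TensorProduct.one_def])

theorem map_perm132 : perm132 (tripleHom i (↑H.φ⁻¹ : G ⊗[K] (G ⊗[K] G))) =
    φ⁻[iL.comp i, (iR.comp iR).comp i, (iR.comp iL).comp i] :=
  H.apply_eq_reasInv _ _ _ (h := perm132.comp (tripleHom i))
    (by ext; simp [perm132, Algebra.TensorProduct.one_def])
    (by ext; simp [perm132, Algebra.TensorProduct.one_def])
    (by ext; simp [perm132, Algebra.TensorProduct.one_def])

theorem leg12_map (w : G ⊗[K] D) : (leg12 (Algebra.TensorProduct.map i (AlgHom.id K D) w) :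
    D ⊗[K] (D ⊗[K] D)) = pl (iL.comp i) (iR.comp iL) w :=
  eq_pl_apply (h := leg12.comp (Algebra.TensorProduct.map i (AlgHom.id K D)))
    (by ext; simp [leg12, Algebra.TensorProduct.one_def]) (by ext; simp [leg12]) w

theorem leg13_map (w : G ⊗[K] D) : (leg13 (Algebra.TensorProduct.map i (AlgHom.id K D) w) :
    D ⊗[K] (D ⊗[K] D)) = pl (iL.comp i) (iR.comp iR) w :=
  eq_pl_apply (h := leg13.comp (Algebra.TensorProduct.map i (AlgHom.id K D)))
    (by ext; simp [leg13, Algebra.TensorProduct.one_def]) (by ext; simp [leg13]) w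

theorem leg23_map (w : G ⊗[K] D) : (leg23 (Algebra.TensorProduct.map i (AlgHom.id K D) w) :
    D ⊗[K] (D ⊗[K] D)) = pl ((iR.comp iL).comp i) (iR.comp iR) w :=
  eq_pl_apply (h := leg23.comp (Algebra.TensorProduct.map i (AlgHom.id K D)))
    (by ext; simp [leg23]) (by ext; simp [leg23]) w

theorem map_id_map {P : Type*} [Ring P] [Algebra K P] (i : A →ₐ[K] B) (k : P →ₐ[K] C)
    (w : A ⊗[K] P) : Algebra.TensorProduct.map (AlgHom.id K B) k
      (Algebra.TensorProduct.map i (AlgHom.id K P) w) = Algebra.TensorProduct.map i k w := by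
  induction w using TensorProduct.induction_on with
  | zero => simp
  | add x y hx hy => simp only [map_add, hx, hy]
  | tmul x a => simp

/-- The right-hand side of the second hexagon. -/
theorem flipCostar_map : H.flipCostar ((iR.comp iL).comp i) ((iR.comp iR).comp i) (iL.comp i)
    (pl (iL.comp i) (iR.comp iL) T) (pl (iL.comp i) (iR.comp iR) T) =
      perm231 (tripleHom i (↑H.φ⁻¹ : G ⊗[K] (G ⊗[K] G))) *
        leg13 (Algebra.TensorProduct.map i (AlgHom.id K D) T) *
        perm213 (tripleHom i (H.φ : G ⊗[K] (G ⊗[K] G))) *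
        leg12 (Algebra.TensorProduct.map i (AlgHom.id K D) T) *
        tripleHom i (↑H.φ⁻¹ : G ⊗[K] (G ⊗[K] G)) := by
  rw [map_perm231, map_perm213, leg13_map, leg12_map, tripleHom_φInv, flipCostar]
  simp only [mul_assoc]

theorem map_coproduct_flip (h₂ : pl iL (iR.comp Δ) T = H.prodFlip i i T T) :
    Algebra.TensorProduct.map i Δ T = perm231 (tripleHom i (↑H.φ⁻¹ : G ⊗[K] (G ⊗[K] G))) *
        leg13 (Algebra.TensorProduct.map i (AlgHom.id K D) T) *
        perm213 (tripleHom i (H.φ : G ⊗[K] (G ⊗[K] G))) *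
        leg12 (Algebra.TensorProduct.map i (AlgHom.id K D) T) *
        tripleHom i (↑H.φ⁻¹ : G ⊗[K] (G ⊗[K] G)) := by
  rw [← flipCostar_map]
  have e := H.pl_comp_coproduct h₂ (iL.comp i : G →ₐ[K] D ⊗[K] (D ⊗[K] D))
    (pl (iR.comp iL) (iR.comp iR))
  simp only [pl_comp_iL, pl_comp_iR] at e
  rw [← e]
  refine eq_pl_apply (by ext; simp) ?_ T
  rw [← comp_pl, pl_iL_iR, AlgHom.comp_id]
  ext
  simp

theorem IsGenerating.isRMatrix (hg : H.IsGenerating i T) (h₁ : Δ.comp i = H.prodHom i i)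
    (h₂ : pl iL (iR.comp Δ) T = H.prodFlip i i T T) (h₃ : ε.comp i = H.ε)
    (h₄ : pl iL ((iR : D →ₐ[K] G ⊗[K] D).comp ((Algebra.ofId K D).comp ε)) T = 1)
    (hu : IsUnit T) : (hg.quasiBialgebra H h₁ h₂ h₃ h₄).IsRMatrix
      (Algebra.TensorProduct.map i (AlgHom.id K D) T) where
  isUnit := hu.map _
  intertwines a := by
    have e := (hg.intw_coproduct H h₁ h₂ (iL : D →ₐ[K] D ⊗[K] D) iR).eq a
    have e₁ : Algebra.TensorProduct.map i (AlgHom.id K D) T = pl (iL.comp i) iR T :=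
      eq_pl_apply (by ext; simp) (by ext; simp) T
    have e₂ : Algebra.TensorProduct.comm K D D (Δ a) = pl iR iL (Δ a) :=
      eq_pl_apply (h := (Algebra.TensorProduct.comm K D D).toAlgHom) (by ext; simp) (by ext; simp) _
    rw [AlgHom.comp_apply, AlgHom.comp_apply, pl_iL_iR, AlgHom.id_apply, ← e₁, ← e₂] at e
    exact e.symm
  hexagon_left := by
    have e := hg.isCoherent.eq H (iL.comp i : G →ₐ[K] D ⊗[K] (D ⊗[K] D)) ((iR.comp iL).comp i)
      (iR.comp iR)
    rw [flipStar, ← map_perm312, ← map_perm132, ← tripleHom_φ, ← leg13_map, ← leg23_map] at e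
    change Algebra.TensorProduct.assoc K K K D D D (Algebra.TensorProduct.map Δ (AlgHom.id K D)
      (Algebra.TensorProduct.map i (AlgHom.id K D) T)) = perm312 (tripleHom i _) * _ *
        perm132 (tripleHom i (↑H.φ⁻¹ : G ⊗[K] (G ⊗[K] G))) * _ * tripleHom i _
    rw [assoc_map, pl_map]
    simp only [H.comp_coproduct h₁, pl_comp_iL, pl_comp_iR, AlgHom.comp_id]
    simpa only [mul_assoc] using e
  hexagon_right := by
    exact (map_id_map i Δ T).trans (H.map_coproduct_flip h₂)

end Generating

end QuasiHopfAlgebra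

/-! ### Annihilating flip operators by evaluations -/

namespace QuasiBialgebra

variable {K : Type u} [Field K] {G : Type v} [Ring G] [Algebra K G] (H : QuasiBialgebra K G)
variable {B : Type*} [Ring B] [Algebra K B]

local infixl:72 " ⋆ " => QuasiBialgebra.star H
local notation "φ[" a ", " b ", " c "]" => reas H a b c
local notation "φ⁻[" a ", " b ", " c "]" => reasInv H a b c

attribute [local instance 10] Commuting.flip

section
variable {M : Type*} [AddCommGroup M] [Module K M] (F : B →ₗ[K] M) (x y t n : G →ₐ[K] B)
  [Commuting x y] [Commuting x t] [Commuting x n] [Commuting y t] [Commuting y n] [Commuting t n]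
  {Txt Txt' Tyn Tyt : B}

/-- If `F` annihilates the pairs `y`, `x` and `n`, `t`, and if it identifies the flip operator of
`y`, `n` with the one of `x`, `t`, then it annihilates the flip operator of `y` and `n ⋆ t`. -/
theorem left_flipCostar [LeftEq F (y ⋆ x) H.triv] [LeftEq F (n ⋆ t) H.triv]
    [Intw Tyn (y ⋆ n) (n ⋆ y)] [Intw Tyt (y ⋆ t) (t ⋆ y)] [Intw Txt (x ⋆ t) (t ⋆ x)]
    [Intw Tyn x x] [Intw Tyn t t] [Intw Tyt x x] [Intw Tyt n n] [Intw Txt y y] [Intw Txt n n]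
    (hinv : Txt * Txt' = 1) (hcomm : Commute Tyn Txt)
    (hN : ∀ w, F (H.flipStar y x t Tyt Txt * w) = F w)
    (hK : ∀ w, F (φ⁻[y, x, t] * φ[n, y, x ⋆ t] * (Tyn * w)) =
      F (φ⁻[n, t, x] * φ[y, n, t ⋆ x] * (Txt * w))) (w : B) :
    F (H.flipCostar n t y Tyn Tyt * w) = F w := by
  have h₁ : ∀ w, F (φ[t, y, x] * (Tyt * (φ⁻[y, t, x] * (φ[n, y, t ⋆ x] * (Tyn * w))))) =
      F (φ⁻[n, t, x] * (φ[y, n, t ⋆ x] * w)) := by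
    intro w
    have e := hK (Txt' * w)
    have h := H.intw_reas_eq Txt n y (x ⋆ t) n y (t ⋆ x)
    rw [← hN] at e
    simp only [flipStar, mul_assoc, reas_mul_reasInv_mul] at e
    rw [mul_rw h, mul_assoc, ← mul_assoc Txt, ← hcomm.eq] at e
    simp only [mul_assoc] at e
    rwa [← mul_assoc Txt, hinv, one_mul] at e
  have h₂ : φ⁻[y, t, x] * φ[n, y, t ⋆ x] = φ[n, y ⋆ t, x] * (φ[n, y, t] * φ⁻[n ⋆ y, t, x]) := by
    rw [H.reas_right n y t x]; simp
  have h₃ := H.intw_reas_eq Tyt n (y ⋆ t) x n (t ⋆ y) x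
  have h₄ := H.intw_reasInv_eq Tyn (y ⋆ n) t x (n ⋆ y) t x
  have h₅ : φ[t, y, x] * φ[n, t ⋆ y, x] = φ[n, t, y ⋆ x] * (φ[n ⋆ t, y, x] * φ⁻[n, t, y]) := by
    rw [H.reas_right n t y x]; simp [mul_assoc]
  have h₆ : φ⁻[n, t, x] * φ[y, n, t ⋆ x] = φ[y, n ⋆ t, x] * (φ[y, n, t] * φ⁻[y ⋆ n, t, x]) := by
    rw [H.reas_right y n t x]; simp
  have e := h₁ (φ[y ⋆ n, t, x] * (φ⁻[y, n, t] * w))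
  rw [mul_rw h₂, mul_rw h₆] at e
  simp only [mul_assoc] at e
  rw [mul_rw h₃, mul_rw h₄.symm] at e
  simp only [mul_assoc] at e
  rw [mul_rw h₅] at e
  simp only [mul_assoc, reasInv_mul_reas_mul, reas_mul_reasInv_mul] at e
  rw [H.left_reas₃, H.left_reas₁, H.left_reas₂] at e
  simpa only [flipCostar, mul_assoc] using e

/-- The mirror image of `left_flipCostar`. -/
theorem right_flipCostar [RightEq F (x ⋆ y) H.triv] [RightEq F (t ⋆ n) H.triv]
    [Intw Tyn (y ⋆ n) (n ⋆ y)] [Intw Tyt (y ⋆ t) (t ⋆ y)] [Intw Txt (x ⋆ t) (t ⋆ x)]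
    [Intw Tyn x x] [Intw Tyn t t] [Intw Tyt x x] [Intw Tyt n n] [Intw Txt y y] [Intw Txt n n]
    (hinv : Txt' * Txt = 1) (hcomm : Commute Tyn Txt)
    (hN : ∀ w, F (w * H.flipStar x y t Txt Tyt) = F w)
    (hK : ∀ w, F (w * Txt * (φ[x ⋆ t, n, y] * φ⁻[x, t, n])) =
      F (w * Tyn * (φ[t ⋆ x, y, n] * φ⁻[t, x, y]))) (w : B) :
    F (w * H.flipCostar t n y Tyt Tyn) = F w := by
  have h₁ : ∀ w, F (w * (Tyn * (φ[x ⋆ t, y, n] * (φ⁻[x, t, y] * (Tyt * φ[x, y, t]))))) =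
      F (w * (φ[x ⋆ t, n, y] * φ⁻[x, t, n])) := by
    intro w
    have e := hK (w * Txt')
    have h := H.intw_reas_eq Txt (x ⋆ t) y n (t ⋆ x) y n
    rw [← hN (_ * Tyn * _)] at e
    simp only [flipStar, mul_assoc, reasInv_mul_reas_mul] at e
    rw [mul_rw h.symm, mul_assoc, mul_rw hcomm.eq] at e
    simp only [mul_assoc] at e
    rw [mul_rw hinv, mul_rw hinv, one_mul, one_mul] at e
    exact e.symm
  have h₂ : φ[x ⋆ t, y, n] * φ⁻[x, t, y] = φ⁻[x, t, y ⋆ n] * (φ[t, y, n] * φ[x, t ⋆ y, n]) := by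
    rw [H.reas_left x t y n]; simp [mul_assoc]
  have h₃ := H.intw_reas_eq Tyt x (y ⋆ t) n x (t ⋆ y) n
  have h₄ := H.intw_reasInv_eq Tyn x t (y ⋆ n) x t (n ⋆ y)
  have h₅ : φ[x, y ⋆ t, n] * φ[x, y, t] = φ⁻[y, t, n] * (φ[x, y, t ⋆ n] * φ[x ⋆ y, t, n]) := by
    rw [H.reas_right x y t n]; simp [mul_assoc]
  have h₆ : φ[x ⋆ t, n, y] * φ⁻[x, t, n] = φ⁻[x, t, n ⋆ y] * (φ[t, n, y] * φ[x, t ⋆ n, y]) := by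
    rw [H.reas_left x t n y]; simp [mul_assoc]
  have e := h₁ (w * (φ⁻[t, n, y] * φ[x, t, n ⋆ y]))
  rw [mul_rw h₂, h₆] at e
  simp only [mul_assoc] at e
  rw [mul_rw h₃.symm, mul_rw h₄] at e
  simp only [mul_assoc] at e
  rw [h₅] at e
  simp only [mul_assoc, reasInv_mul_reas_mul, reas_mul_reasInv_mul] at e
  simp only [← mul_assoc] at e
  rw [H.right_reas₁, H.right_reas₃, H.right_reas₂] at e
  simpa only [flipCostar, mul_assoc] using e

/-- If `F` does not see a factor `Z` that flips `y` past a leg `s` annihilated by `F`, then it does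
not see it behind `φ⁻[y, x, z]` either. -/
theorem left_reasInv_mul (s z : G →ₐ[K] B) [Commuting x z] [Commuting y z] [Commuting s x]
    [Commuting s y] [Commuting s z] [LeftEq F s H.triv] {Z : B} [Intw Z (y ⋆ s) (s ⋆ y)]
    [Intw Z x x] [Intw Z z z] (hZ : ∀ w, F (Z * w) = F w) (w : B) :
    F (φ⁻[y, x, z] * (Z * w)) = F (φ⁻[y, x, z] * w) := by
  rw [← H.leftEq_reasInv F (s ⋆ y) x z y x z, ← H.leftEq_reasInv F (y ⋆ s) x z y x z,
    mul_rw (H.intw_reasInv_eq Z (y ⋆ s) x z (s ⋆ y) x z).symm, mul_assoc, hZ]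

/-- The mirror image of `left_reasInv_mul`. -/
theorem right_mul_reasInv (s z : G →ₐ[K] B) [Commuting x z] [Commuting y z] [Commuting s x]
    [Commuting s y] [Commuting s z] [RightEq F s H.triv] {Z : B} [Intw Z (y ⋆ s) (s ⋆ y)]
    [Intw Z x x] [Intw Z z z] (hZ : ∀ w, F (w * Z) = F w) (w : B) :
    F (w * Z * φ⁻[z, x, y]) = F (w * φ⁻[z, x, y]) := by
  rw [← H.rightEq_reasInv F z x (y ⋆ s) z x y, ← H.rightEq_reasInv F z x (s ⋆ y) z x y,
    mul_assoc, H.intw_reasInv_eq Z z x (y ⋆ s) z x (s ⋆ y), ← mul_assoc, hZ]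

end

end QuasiBialgebra

/-! ### The flip operator of the opposite algebra -/

namespace QuasiHopfAlgebra

open QuasiBialgebra

variable {K : Type u} [Field K] {G : Type v} [Ring G] [Algebra K G] (H : QuasiHopfAlgebra K G)
variable {A B C : Type*} [Ring A] [Algebra K A] [Ring B] [Algebra K B] [Ring C] [Algebra K C]

local infixl:72 " ⋆ " => QuasiBialgebra.star (toQuasiBialgebra H)
local notation "φ[" a ", " b ", " c "]" => reas (toQuasiBialgebra H) a b c
local notation "φ⁻[" a ", " b ", " c "]" => reasInv (toQuasiBialgebra H) a b c

attribute [local instance 10] Commuting.flip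

section

open MulOpposite

section
variable (a b c : G →ₐ[K] B) [Commuting a b] [Commuting a c] [Commuting b c]

@[simp] theorem pl_f_mul_fInv_mul (w : B) : pl a b H.f * (pl a b H.fInv * w) = w := by
  rw [← mul_assoc, ← map_mul, f_mul_fInv, map_one, one_mul]

@[simp] theorem pl_fInv_mul_f_mul (w : B) : pl a b H.fInv * (pl a b H.f * w) = w := by
  rw [← mul_assoc, ← map_mul, fInv_mul_f, map_one, one_mul]

theorem pl_f_mul_fInv : pl a b H.f * pl a b H.fInv = 1 := by rw [← map_mul, f_mul_fInv, map_one]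

theorem pl_fInv_mul_f : pl a b H.fInv * pl a b H.f = 1 := by rw [← map_mul, fInv_mul_f, map_one]

/-- The image of the reassociator under the antipode. -/
theorem unop_reas_opLeg : φ[H.opLeg c, H.opLeg b, H.opLeg a].unop = pl b c H.f *
    (pl a (b ⋆ c) H.f * (φ[a, b, c] * (pl (a ⋆ b) c H.fInv * pl a b H.fInv))) := by
  have h := congrArg (· * (pl (a ⋆ b) c H.fInv * pl a b H.fInv)) (H.f_compat a b c)
  simpa only [mul_assoc, pl_f_mul_fInv_mul, pl_f_mul_fInv, mul_one] using h

theorem unop_reasInv_opLeg : φ⁻[H.opLeg c, H.opLeg b, H.opLeg a].unop = pl a b H.f *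
    (pl (a ⋆ b) c H.f * (φ⁻[a, b, c] * (pl a (b ⋆ c) H.fInv * pl b c H.fInv))) := by
  have h := congrArg unop (H.reas_mul_reasInv (H.opLeg c) (H.opLeg b) (H.opLeg a))
  rw [unop_mul, unop_one, unop_reas_opLeg] at h
  have h' := congrArg (· * (pl b c H.f * (pl a (b ⋆ c) H.f * (φ[a, b, c] *
    (pl (a ⋆ b) c H.fInv * pl a b H.fInv))))) h
  have h'' := congrArg (· * (pl a b H.f * (pl (a ⋆ b) c H.f * (φ⁻[a, b, c] *
    (pl a (b ⋆ c) H.fInv * pl b c H.fInv))))) h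
  simpa only [mul_assoc, pl_f_mul_fInv_mul, pl_fInv_mul_f_mul, reas_mul_reasInv_mul,
    pl_f_mul_fInv, mul_one, one_mul] using h''

end

theorem flipStar_opLeg (x y t : G →ₐ[K] B) [Commuting x y] [Commuting x t] [Commuting y t]
    (Tx Ty : B) [Intw Tx (x ⋆ t) (t ⋆ x)] [Intw Ty (y ⋆ t) (t ⋆ y)] [Intw Tx y y] [Intw Ty x x] :
    H.flipStar (H.opLeg x) (H.opLeg y) (H.opLeg t)
        (op (pl t x H.f * (Tx * pl x t H.fInv))) (op (pl t y H.f * (Ty * pl y t H.fInv))) =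
      op (pl y x H.f * (pl t (y ⋆ x) H.f * (H.flipStar y x t Ty Tx *
        (pl (y ⋆ x) t H.fInv * pl y x H.fInv)))) := by
  apply unop_injective
  have h₁ : pl (t ⋆ y) x H.fInv * Ty = Ty * pl (y ⋆ t) x H.fInv :=
    (Intw.pl_eq Ty (y ⋆ t) (t ⋆ y) x x H.fInv).symm
  have h₂ : pl y (t ⋆ x) H.fInv * Tx = Tx * pl y (x ⋆ t) H.fInv :=
    (Intw.pl_eq Tx y y (x ⋆ t) (t ⋆ x) H.fInv).symm
  simp only [flipStar, unop_mul, unop_op, unop_reas_opLeg, unop_reasInv_opLeg, mul_assoc,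
    pl_fInv_mul_f_mul]
  rw [mul_rw h₁, mul_assoc, pl_fInv_mul_f_mul, mul_rw h₂, mul_assoc, pl_fInv_mul_f_mul]

theorem _root_.QH.Intw.inv {u v : B} {f f' : A →ₐ[K] B} (h : Intw u f f') (huv : u * v = 1)
    (hvu : v * u = 1) : Intw v f' f :=
  ⟨fun x => by
    have e := congrArg (fun w => v * w * v) (h.eq x)
    simp only [mul_assoc, huv, mul_one] at e
    rw [← mul_assoc v u, hvu, one_mul] at e
    exact e.symm⟩

theorem intw_op_flip (x t : G →ₐ[K] B) [Commuting x t] (Tx : B) [h : Intw Tx (x ⋆ t) (t ⋆ x)] :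
    Intw (op (pl t x H.f * (Tx * pl x t H.fInv))) (H.opLeg x ⋆ H.opLeg t)
      (H.opLeg t ⋆ H.opLeg x) := by
  have i₁ : Intw (op (pl x t H.fInv)) (H.opLeg (x ⋆ t)) (H.opLeg t ⋆ H.opLeg x) :=
    (H.intw_op_f x t).inv (by rw [← op_mul, pl_fInv_mul_f, op_one])
      (by rw [← op_mul, pl_f_mul_fInv, op_one])
  have i₂ : Intw (op Tx) (H.opLeg (t ⋆ x)) (H.opLeg (x ⋆ t)) :=
    ⟨fun a => unop_injective (h.eq (H.S a)).symm⟩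
  rw [op_mul, op_mul]
  exact (i₁.mul i₂).mul (H.intw_op_f t x)

section
variable {D : Type*} [Ring D] [Algebra K D] (i : G →ₐ[K] D) (T : G ⊗[K] D)

/-- `(id ⊗ i)(fᵒᵖ) T (id ⊗ i)(f⁻¹)`. -/
def twistFlip : G ⊗[K] D :=
  onSnd i (Algebra.TensorProduct.comm K G G H.f) * (T * onSnd i H.fInv)

/-- The twisted flip operator as a flip operator with values in the opposite algebra. -/
def opFlip : G ⊗[K] Dᵐᵒᵖ :=
  TensorProduct.map H.Sinv (opLinearEquiv K).toLinearMap (H.twistFlip i T)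

theorem pl_twistFlip (x : G →ₐ[K] B) (m : D →ₐ[K] B) [Commuting x m] :
    pl x m (H.twistFlip i T) =
      pl (m.comp i) x H.f * (pl x m T * pl x (m.comp i) H.fInv) := by
  rw [twistFlip, map_mul, map_mul, pl_onSnd, pl_onSnd, pl_swap (m.comp i) x]

theorem pl_opFlip (x : G →ₐ[K] B) (m : D →ₐ[K] B) [Commuting x m] :
    pl (H.opLeg x) (AlgHom.op m) (H.opFlip i T) = op (pl x m (H.twistFlip i T)) := by
  rw [opFlip]
  generalize H.twistFlip i T = w
  induction w using TensorProduct.induction_on with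
  | zero => simp
  | add u v hu hv => simp only [map_add, hu, hv, op_add]
  | tmul g d =>
    have e := Commuting.eq x m g d
    simp [e, op_mul]

theorem opPair_injective : Function.Injective
    (pl (H.opLeg iL) (AlgHom.op iR) : G ⊗[K] Dᵐᵒᵖ →ₐ[K] (G ⊗[K] D)ᵐᵒᵖ) := by
  let E : G ⊗[K] Dᵐᵒᵖ ≃ₗ[K] (G ⊗[K] D)ᵐᵒᵖ :=
    (TensorProduct.congr H.S (opLinearEquiv K).symm).trans (opLinearEquiv K)
  have e : (pl (H.opLeg iL) (AlgHom.op iR) : G ⊗[K] Dᵐᵒᵖ →ₐ[K] (G ⊗[K] D)ᵐᵒᵖ).toLinearMap =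
      E.toLinearMap := by
    ext g d
    simp [E, ← op_mul]
  intro u v huv
  exact E.injective (((DFunLike.congr_fun e u).symm.trans huv).trans (DFunLike.congr_fun e v))

theorem opTriple_injective : Function.Injective
    (pl (H.opLeg iL) (pl (H.opLeg (iR.comp iL)) (AlgHom.op (iR.comp iR))) :
      G ⊗[K] (G ⊗[K] Dᵐᵒᵖ) →ₐ[K] (G ⊗[K] (G ⊗[K] D))ᵐᵒᵖ) := by
  let E : G ⊗[K] (G ⊗[K] Dᵐᵒᵖ) ≃ₗ[K] (G ⊗[K] (G ⊗[K] D))ᵐᵒᵖ :=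
    (TensorProduct.congr H.S (TensorProduct.congr H.S (opLinearEquiv K).symm)).trans
      (opLinearEquiv K)
  have e : (pl (H.opLeg iL) (pl (H.opLeg (iR.comp iL)) (AlgHom.op (iR.comp iR))) :
      G ⊗[K] (G ⊗[K] Dᵐᵒᵖ) →ₐ[K] (G ⊗[K] (G ⊗[K] D))ᵐᵒᵖ).toLinearMap = E.toLinearMap := by
    ext g g' d
    simp [E, ← op_mul]
  intro u v huv
  exact E.injective (((DFunLike.congr_fun e u).symm.trans huv).trans (DFunLike.congr_fun e v))

variable {i T}

theorem isFlip_of_injective {j : G →ₐ[K] A} {T : G ⊗[K] A} (x : G →ₐ[K] B) (m : A →ₐ[K] B)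
    [Commuting x m] (hi : Function.Injective (pl x m))
    (h : Intw (pl x m T) (x ⋆ m.comp j) (m.comp j ⋆ x)) : H.IsFlip j T := by
  rw [isFlip_iff]
  refine ⟨fun a => hi ?_⟩
  have e₁ : (pl x m).comp (iL ⋆ iR.comp j) = x ⋆ m.comp j := by
    rw [comp_star]; simp only [← AlgHom.comp_assoc, pl_comp_iL, pl_comp_iR]
  have e₂ : (pl x m).comp (iR.comp j ⋆ iL) = m.comp j ⋆ x := by
    rw [comp_star]; simp only [← AlgHom.comp_assoc, pl_comp_iL, pl_comp_iR]
  have e := h.eq a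
  rw [← e₁, ← e₂] at e
  rw [map_mul, map_mul]
  exact e

theorem isCoherent_of_injective {j : G →ₐ[K] A} {T : G ⊗[K] A} (x y : G →ₐ[K] B) (m : A →ₐ[K] B)
    [Commuting x y] [Commuting x m] [Commuting y m] (hi : Function.Injective (pl x (pl y m)))
    (h : H.flipStar x y (m.comp j) (pl x m T) (pl y m T) = pl (x ⋆ y) m T) :
    H.IsCoherent j T := by
  apply hi
  rw [map_flipStar, leg13_eq, leg23_eq]
  simp only [map_pl, comp_star, ← AlgHom.comp_assoc, pl_comp_iL, pl_comp_iR]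
  exact h

theorem IsFlip.opFlip (h : H.IsFlip i T) : H.IsFlip (H.opLeg i) (H.opFlip i T) := by
  have i₁ := h.intw H (iL : G →ₐ[K] G ⊗[K] D) iR
  have i₂ := H.intw_op_flip (iL : G →ₐ[K] G ⊗[K] D) (iR.comp i) (pl iL iR T)
  rw [← pl_twistFlip, ← pl_opFlip] at i₂
  exact H.isFlip_of_injective (H.opLeg iL) (AlgHom.op iR) H.opPair_injective i₂

theorem pl_star_opFlip (h : H.IsFlip i T) (hc : H.IsCoherent i T) (x y : G →ₐ[K] B)
    (m : D →ₐ[K] B) [Commuting x y] [Commuting x m] [Commuting y m] :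
    H.flipStar (H.opLeg x) (H.opLeg y) (H.opLeg (m.comp i))
        (pl (H.opLeg x) (AlgHom.op m) (H.opFlip i T))
        (pl (H.opLeg y) (AlgHom.op m) (H.opFlip i T)) =
      pl (H.opLeg x ⋆ H.opLeg y) (AlgHom.op m) (H.opFlip i T) := by
  have i₁ := h.intw H x m
  have i₂ := h.intw H y m
  have i₃ : Intw (op (pl y x H.f)) (AlgHom.op m) (AlgHom.op m) :=
    ⟨fun z => unop_injective (Commuting.eq (pl y x) m H.f (unop z)).symm⟩
  have e := Intw.pl_eq (op (pl y x H.f)) (H.opLeg x ⋆ H.opLeg y) (H.opLeg (y ⋆ x)) (AlgHom.op m)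
    (AlgHom.op m) (H.opFlip i T)
  rw [pl_opFlip, pl_twistFlip, ← op_mul] at e
  have e' := congrArg (op (pl y x H.fInv) * ·) e
  simp only [← mul_assoc] at e'
  rw [← op_mul, pl_f_mul_fInv, op_one, one_mul, ← op_mul] at e'
  rw [e', pl_opFlip, pl_opFlip, pl_twistFlip, pl_twistFlip, flipStar_opLeg, hc.eq]
  simp only [mul_assoc]

theorem IsCoherent.opFlip (h : H.IsFlip i T) (hc : H.IsCoherent i T) :
    H.IsCoherent (H.opLeg i) (H.opFlip i T) :=
  H.isCoherent_of_injective (H.opLeg iL) (H.opLeg (iR.comp iL)) (AlgHom.op (iR.comp iR))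
    H.opTriple_injective (H.pl_star_opFlip h hc iL (iR.comp iL) (iR.comp iR))

theorem con_opFlip (hα : H.ε H.α = 1) (hn : con H.ε.toLinearMap T = 1) :
    con H.ε.toLinearMap (H.opFlip i T) = 1 := by
  have e₁ : ∀ w : G ⊗[K] D, con H.ε.toLinearMap
      (TensorProduct.map H.Sinv (opLinearEquiv K).toLinearMap w) =
        op (con H.ε.toLinearMap w) := by
    intro w
    induction w using TensorProduct.induction_on with
    | zero => simp
    | add u v hu hv => simp only [map_add, hu, hv, op_add]
    | tmul g d => simp [H.counit_Sinv hα]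
  have e₂ : pl H.triv i H.fInv = 1 := by
    have h := H.pl_fInv_mul_f H.triv i
    have h' := congrArg i (H.left_counit_f hα)
    simp only [map_pl, map_one, AlgHom.comp_id, comp_triv] at h'
    rwa [h', mul_one] at h
  have e₃ : pl i H.triv H.f = 1 := by
    have h' := congrArg i (H.right_counit_f hα)
    simpa only [map_pl, map_one, AlgHom.comp_id, comp_triv] using h'
  rw [con_counit] at hn
  rw [QuasiHopfAlgebra.opFlip, e₁, con_counit, pl_twistFlip]
  simp only [AlgHom.id_comp, e₂, e₃, hn, mul_one, op_one]

end

end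

/-! ### The antipode of the double: left antipode axiom -/

section AntipodeLeft
variable {D : Type*} [Ring D] [Algebra K D] {i : G →ₐ[K] D} {T : G ⊗[K] D} {s : D →ₐ[K] Dᵐᵒᵖ}
  {Δ : D →ₐ[K] D ⊗[K] D} {ε : D →ₐ[K] K}

variable (i s) in
/-- `n ⊗ t ↦ s(n) i(α) t`. -/
def evD : D ⊗[K] D →ₗ[K] D := unopLin s ⊛ LinearMap.mulLeft K (i H.α)

variable (i s) in
/-- `y ⊗ x ⊗ n ⊗ t ↦ S(y) α x ⊗ s(n) i(α) t`. -/
def pairEv : (G ⊗[K] G) ⊗[K] (D ⊗[K] D) →ₗ[K] G ⊗[K] D := TensorProduct.map H.evLin (H.evD i s)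

/-- The evaluation `evD` collapses a pair of legs in `i(G)`. -/
theorem leftEq_evD (hs : s.comp i = H.opLeg i) :
    LeftEq (H.evD i s) (iL.comp i ⋆ iR.comp i) H.triv :=
  ⟨fun x w => by
    have hs' : ∀ p, s (i p) = H.opLeg i p := fun p => DFunLike.congr_fun hs p
    induction w using TensorProduct.induction_on with
    | zero => simp
    | add y z hy hz => simp only [mul_add, map_add, hy, hz]
    | tmul b c =>
      have key : ∀ d : G ⊗[K] G, H.evD i s (pl (iL.comp i) (iR.comp i) d * b ⊗ₜ c) = unopLin s b *
          (unopLin (H.opLeg i) ⊛ (LinearMap.mulLeft K (i H.α) ∘ₗ i.toLinearMap)) d * c := by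
        intro d
        induction d using TensorProduct.induction_on with
        | zero => simp
        | add y z hy hz => simp only [mul_add, add_mul, map_add, hy, hz]
        | tmul p q => simp [evD, mul_assoc, hs']
      rw [star_apply, key, (H.antipodeAlong i).ev.eq]
      simp [evD, Algebra.algebraMap_eq_smul_one, mul_assoc]⟩

theorem pairEv_congr {u u' : (G ⊗[K] G) ⊗[K] (D ⊗[K] D)} (h : H.pairEv i s u = H.pairEv i s u')
    (w) : H.pairEv i s (u * w) = H.pairEv i s (u' * w) := by
  induction w using TensorProduct.induction_on with
  | zero => simp
  | add x y hx hy => simp only [mul_add, map_add, hx, hy]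
  | tmul v v' =>
    induction v using TensorProduct.induction_on with
    | zero => simp
    | add x y hx hy => simp only [TensorProduct.add_tmul, mul_add, map_add, hx, hy]
    | tmul a b =>
      induction v' using TensorProduct.induction_on with
      | zero => simp
      | add x y hx hy => simp only [TensorProduct.tmul_add, mul_add, map_add, hx, hy]
      | tmul c d =>
        have key : ∀ u, H.pairEv i s (u * (a ⊗ₜ b) ⊗ₜ (c ⊗ₜ d)) =
            H.S a ⊗ₜ unopLin s c * H.pairEv i s u * b ⊗ₜ d := by
          intro u
          suffices e : H.pairEv i s ∘ₗ LinearMap.mulRight K ((a ⊗ₜ b) ⊗ₜ (c ⊗ₜ d)) =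
              LinearMap.mulRight K (b ⊗ₜ d) ∘ₗ LinearMap.mulLeft K (H.S a ⊗ₜ unopLin s c) ∘ₗ
                H.pairEv i s from DFunLike.congr_fun e u
          ext
          simp [pairEv, evLin, evD, mul_assoc, S_mul]
        rw [key, key, h]

theorem pairEv_mul_right (w) (d : G ⊗[K] D) :
    H.pairEv i s (w * pl (iL.comp iR) (iR.comp iR) d) = H.pairEv i s w * d := by
  induction d using TensorProduct.induction_on with
  | zero => simp
  | add x y hx hy => simp only [map_add, mul_add, hx, hy]
  | tmul a b =>
    suffices H.pairEv i s ∘ₗ LinearMap.mulRight K (pl (iL.comp iR) (iR.comp iR) (a ⊗ₜ[K] b)) =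
      LinearMap.mulRight K (a ⊗ₜ[K] b) ∘ₗ H.pairEv i s from DFunLike.congr_fun this w
    ext; simp [pairEv, evLin, evD, mul_assoc]

/-- The flip operator of the left legs of the two pairs is mapped by the antipodes to its twisted
form. -/
theorem pairEv_mul_left (w) (d : G ⊗[K] D) :
    H.pairEv i s (w * pl (iL.comp iL) (iR.comp iL) d) =
      TensorProduct.map H.S.toLinearMap (unopLin s) d * H.pairEv i s w := by
  induction d using TensorProduct.induction_on with
  | zero => simp
  | add x y hx hy => simp only [map_add, mul_add, add_mul, hx, hy]
  | tmul a b =>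
    suffices H.pairEv i s ∘ₗ LinearMap.mulRight K (pl (iL.comp iL) (iR.comp iL) (a ⊗ₜ[K] b)) =
      LinearMap.mulLeft K (H.S a ⊗ₜ[K] unopLin s b) ∘ₗ H.pairEv i s from DFunLike.congr_fun this w
    ext; simp [pairEv, evLin, evD, mul_assoc, S_mul]

variable (i) in
/-- `id ⊗ id ⊗ i ⊗ i`. -/
abbrev onSndPair : (G ⊗[K] G) ⊗[K] (G ⊗[K] G) →ₐ[K] (G ⊗[K] G) ⊗[K] (D ⊗[K] D) :=
  Algebra.TensorProduct.map (AlgHom.id K _) (Algebra.TensorProduct.map i i)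

variable (i) in
theorem onSndPair_legs : (onSndPair i).comp e₁ = iL.comp iL ∧ (onSndPair i).comp e₂ = iL.comp iR ∧
    (onSndPair i).comp e₃ = (iR.comp iL).comp i ∧ (onSndPair i).comp e₄ = (iR.comp iR).comp i :=
  ⟨by ext; simp [Algebra.TensorProduct.one_def], by ext; simp [Algebra.TensorProduct.one_def],
    by ext; simp [Algebra.TensorProduct.one_def], by ext; simp [Algebra.TensorProduct.one_def]⟩

theorem pairEv_onSndPair (hs : s.comp i = H.opLeg i) (w : (G ⊗[K] G) ⊗[K] (G ⊗[K] G)) :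
    H.pairEv i s (onSndPair i w) = onSnd i (H.ev₂ w) := by
  have hs' : ∀ p, s (i p) = H.opLeg i p := fun p => DFunLike.congr_fun hs p
  suffices e : H.pairEv i s ∘ₗ (onSndPair i).toLinearMap = (onSnd i).toLinearMap ∘ₗ H.ev₂ from
    DFunLike.congr_fun e w
  ext
  simp [pairEv, evLin, evD, ev₂, hs']

/-- The opposite of `γ`: the roles of the two pairs are exchanged. -/
theorem comm_γ_eq : Algebra.TensorProduct.comm K G G H.γ =
    H.ev₂ (φ⁻[e₃, e₄, e₂] * φ[e₁, e₃, e₄ ⋆ e₂]) := by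
  let σ : (G ⊗[K] G) ⊗[K] (G ⊗[K] G) →ₐ[K] (G ⊗[K] G) ⊗[K] (G ⊗[K] G) :=
    (Algebra.TensorProduct.comm K _ _).toAlgHom
  have h : ∀ w, Algebra.TensorProduct.comm K G G (H.ev₂ w) = H.ev₂ (σ w) := fun w => by
    suffices e : (Algebra.TensorProduct.comm K G G).toLinearMap ∘ₗ H.ev₂ = H.ev₂ ∘ₗ σ.toLinearMap
      from DFunLike.congr_fun e w
    ext
    simp [ev₂, σ]
  have h₁ : σ.comp e₁ = e₃ := by ext; simp [σ]
  have h₂ : σ.comp e₂ = e₄ := by ext; simp [σ]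
  have h₃ : σ.comp e₃ = e₁ := by ext; simp [σ]
  have h₄ : σ.comp e₄ = e₂ := by ext; simp [σ]
  rw [γ_eq, h]
  simp only [map_mul, map_reas, map_reasInv, comp_star, h₁, h₂, h₃, h₄]

theorem pairEv_γ (hs : s.comp i = H.opLeg i) : H.pairEv i s
    (φ⁻[iL.comp iL, iL.comp iR, (iR.comp iR).comp i] *
      φ[(iR.comp iL).comp i, iL.comp iL, iL.comp iR ⋆ (iR.comp iR).comp i]) = onSnd i H.γ := by
  obtain ⟨h₁, h₂, h₃, h₄⟩ := onSndPair_legs (K := K) (G := G) i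
  rw [γ_eq, ← pairEv_onSndPair H hs]
  simp only [map_mul, map_reas, map_reasInv, comp_star, h₁, h₂, h₃, h₄]

theorem pairEv_comm_γ (hs : s.comp i = H.opLeg i) : H.pairEv i s
    (φ⁻[(iR.comp iL).comp i, (iR.comp iR).comp i, iL.comp iR] *
      φ[iL.comp iL, (iR.comp iL).comp i, (iR.comp iR).comp i ⋆ iL.comp iR]) =
        onSnd i (Algebra.TensorProduct.comm K G G H.γ) := by
  obtain ⟨h₁, h₂, h₃, h₄⟩ := onSndPair_legs (K := K) (G := G) i
  rw [comm_γ_eq, ← pairEv_onSndPair H hs]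
  simp only [map_mul, map_reas, map_reasInv, comp_star, h₁, h₂, h₃, h₄]

/-- Up to the twist, the flip operator exchanges `γ` with its opposite, because `γ = f Δ(α)`. -/
theorem IsFlip.twistFlip_mul_γ (hf : H.IsFlip i T) : H.twistFlip i T * onSnd i H.γ =
    onSnd i (Algebra.TensorProduct.comm K G G H.γ) * T := by
  have e : onSnd i H.fInv * onSnd i H.γ = onSnd i (H.Δ H.α) := by
    rw [← map_mul, ← f_mul_Δ_α, ← mul_assoc, fInv_mul_f, one_mul]
  rw [twistFlip, mul_assoc, mul_assoc, e, hf, ← mul_assoc, ← map_mul, Δop, AlgHom.comp_apply]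
  congr 2
  rw [← f_mul_Δ_α, map_mul]
  rfl

/-- The evaluations of both factors annihilate the flip operator of `y` and `Δ`, by
`left_flipCostar`. -/
theorem pairEv_coproduct (hf : H.IsFlip i T) (hc : H.IsCoherent i T)
    (hn : con H.ε.toLinearMap T = 1) (hu : IsUnit T)
    (h₂ : pl iL (iR.comp Δ) T = H.prodFlip i i T T) (hs : s.comp i = H.opLeg i)
    (hs' : TensorProduct.map H.S.toLinearMap (unopLin s) T = H.twistFlip i T) (w) :
    H.pairEv i s (pl (iL.comp iL) (iR.comp Δ) T * w) = H.pairEv i s w := by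
  let y : G →ₐ[K] (G ⊗[K] G) ⊗[K] (D ⊗[K] D) := iL.comp iL
  let x : G →ₐ[K] (G ⊗[K] G) ⊗[K] (D ⊗[K] D) := iL.comp iR
  let N : D →ₐ[K] (G ⊗[K] G) ⊗[K] (D ⊗[K] D) := iR.comp iL
  let M : D →ₐ[K] (G ⊗[K] G) ⊗[K] (D ⊗[K] D) := iR.comp iR
  obtain ⟨⟨T, T', hT, hT'⟩, rfl⟩ := hu
  simp only at hf hc hn h₂ hs' ⊢
  have i₁ : LeftEq (H.pairEv i s) (y ⋆ x) H.triv := leftEq_star_map_left _ H.leftEq_evLin _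
  have i₂ : LeftEq (H.pairEv i s) (N.comp i ⋆ M.comp i) H.triv := by
    have h := (H.leftEq_evD hs).map_right H.evLin
    simp only [comp_star, comp_triv] at h
    exact h
  have i₃ := hf.intw H y N
  have i₄ := hf.intw H y M
  have i₅ := hf.intw H x M
  have e := H.pl_comp_coproduct h₂ y (iR : D ⊗[K] D →ₐ[K] (G ⊗[K] G) ⊗[K] (D ⊗[K] D))
  change H.pairEv i s (pl y (iR.comp Δ) T * w) = _
  rw [e]
  refine H.left_flipCostar (H.pairEv i s) x y (M.comp i) (N.comp i) (Txt := pl x M T)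
    (Txt' := pl x M T') ?_ ?_ ?_ ?_ w
  · rw [← map_mul, hT, map_one]
  · exact Commuting.eq (pl y N) (pl x M) T T
  · intro w
    rw [← hc.eq, (LeftEq.pl (H.pairEv i s) (y ⋆ x) H.triv M M).eq, hc.eq_one H hn, one_mul]
  · intro w
    rw [← mul_assoc, ← mul_assoc (_ * _) (pl x M T)]
    refine H.pairEv_congr ?_ w
    rw [pairEv_mul_left, pairEv_mul_right, hs']
    exact (congrArg (H.twistFlip i T * ·) (H.pairEv_γ hs)).trans
      ((hf.twistFlip_mul_γ H).trans (congrArg (· * T) (H.pairEv_comm_γ hs)).symm)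

end AntipodeLeft

section AntipodeLeft
variable {D : Type*} [Ring D] [Algebra K D] {i : G →ₐ[K] D} {T : G ⊗[K] D} {s : D →ₐ[K] Dᵐᵒᵖ}
  {Δ : D →ₐ[K] D ⊗[K] D} {ε : D →ₐ[K] K}

variable (i s) in
/-- `y ⊗ x ⊗ z ⊗ n ⊗ t ↦ S(y) α x β S(z) ⊗ s(n) i(α) t`. -/
def zagEv : (G ⊗[K] (G ⊗[K] G)) ⊗[K] (D ⊗[K] D) →ₗ[K] G ⊗[K] D :=
  TensorProduct.map H.zagLin (H.evD i s)

theorem zagEv_mul_right (u : (G ⊗[K] G) ⊗[K] (D ⊗[K] D)) (c : G) :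
    H.zagEv i s (Algebra.TensorProduct.map leg12 (AlgHom.id K _) u * iL (iR (iR c))) =
      H.pairEv i s u * iL (H.β * H.S c) := by
  suffices e : H.zagEv i s ∘ₗ LinearMap.mulRight K (iL (iR (iR c))) ∘ₗ
      (Algebra.TensorProduct.map leg12 (AlgHom.id K (D ⊗[K] D))).toLinearMap =
      LinearMap.mulRight K (iL (H.β * H.S c)) ∘ₗ H.pairEv i s from DFunLike.congr_fun e u
  ext
  simp [pairEv, evLin, evD, zagEv, zagLin, leg12, mul_assoc]

theorem zagEv_mul_of_pairEv_mul {Z : (G ⊗[K] G) ⊗[K] (D ⊗[K] D)}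
    (hZ : ∀ w, H.pairEv i s (Z * w) = H.pairEv i s w) (w) :
    H.zagEv i s (Algebra.TensorProduct.map leg12 (AlgHom.id K _) Z * w) = H.zagEv i s w := by
  suffices e : H.zagEv i s ∘ₗ LinearMap.mulLeft K
      (Algebra.TensorProduct.map leg12 (AlgHom.id K _) Z) = H.zagEv i s from
    DFunLike.congr_fun e w
  ext a b c n t
  have h : ((a ⊗ₜ (b ⊗ₜ c)) ⊗ₜ (n ⊗ₜ t) : (G ⊗[K] (G ⊗[K] G)) ⊗[K] (D ⊗[K] D)) =
      Algebra.TensorProduct.map (leg12 : G ⊗[K] G →ₐ[K] G ⊗[K] (G ⊗[K] G))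
        (AlgHom.id K (D ⊗[K] D)) ((a ⊗ₜ b) ⊗ₜ (n ⊗ₜ t)) * iL (iR (iR c)) := by simp [leg12]
  simp only [TensorProduct.AlgebraTensorModule.curry_apply, LinearMap.restrictScalars_self,
    TensorProduct.curry_apply, LinearMap.comp_apply, LinearMap.mulLeft_apply]
  rw [h, ← mul_assoc, ← map_mul, zagEv_mul_right, zagEv_mul_right, hZ]

theorem zagEv_iL_mul (u : G ⊗[K] (G ⊗[K] G)) (d : G ⊗[K] (D ⊗[K] D)) :
    H.zagEv i s (iL u * pl (iL.comp iL) iR d) =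
      TensorProduct.map H.S.toLinearMap LinearMap.id
        (TensorProduct.map LinearMap.id (H.evD i s) d) * iL (H.zagLin u) := by
  induction d using TensorProduct.induction_on with
  | zero => simp
  | add x y hx hy => simp only [map_add, mul_add, add_mul, hx, hy]
  | tmul g v =>
    suffices e : H.zagLin ∘ₗ LinearMap.mulRight K (iL g) =
        LinearMap.mulLeft K (H.S g) ∘ₗ H.zagLin by
      have e' := DFunLike.congr_fun e u
      simp only [LinearMap.comp_apply, LinearMap.mulRight_apply, LinearMap.mulLeft_apply] at e'
      rw [iL_apply] at e'
      simp [zagEv, e']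
    ext
    simp [zagLin, mul_assoc, S_mul]

/-- The same behind `φ⁻¹` with a third leg `z`; under `zagEv`, the zigzag `S(P) α Q β S(R) = 1` then
leaves only the leg `y`. -/
theorem zagEv_coproduct (hf : H.IsFlip i T) (hc : H.IsCoherent i T)
    (hn : con H.ε.toLinearMap T = 1) (hu : IsUnit T)
    (h₂ : pl iL (iR.comp Δ) T = H.prodFlip i i T T) (hs : s.comp i = H.opLeg i)
    (hs' : TensorProduct.map H.S.toLinearMap (unopLin s) T = H.twistFlip i T) (w) :
    H.zagEv i s (iL (↑H.φ⁻¹ : G ⊗[K] (G ⊗[K] G)) * (pl (iL.comp iL) (iR.comp Δ) T * w)) =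
      H.zagEv i s (iL (↑H.φ⁻¹ : G ⊗[K] (G ⊗[K] G)) * w) := by
  let y : G →ₐ[K] (G ⊗[K] (G ⊗[K] G)) ⊗[K] (D ⊗[K] D) := iL.comp iL
  let x : G →ₐ[K] (G ⊗[K] (G ⊗[K] G)) ⊗[K] (D ⊗[K] D) := iL.comp (iR.comp iL)
  let z : G →ₐ[K] (G ⊗[K] (G ⊗[K] G)) ⊗[K] (D ⊗[K] D) := iL.comp (iR.comp iR)
  let N : D →ₐ[K] (G ⊗[K] (G ⊗[K] G)) ⊗[K] (D ⊗[K] D) := iR.comp iL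
  let M : D →ₐ[K] (G ⊗[K] (G ⊗[K] G)) ⊗[K] (D ⊗[K] D) := iR.comp iR
  have e₀ : φ⁻[y, x, z] = iL (↑H.φ⁻¹ : G ⊗[K] (G ⊗[K] G)) := by
    rw [← H.reasInv_legs, map_reasInv]
  have i₂ : LeftEq (H.zagEv i s) (N.comp i ⋆ M.comp i) H.triv := by
    have h := (H.leftEq_evD hs).map_right H.zagLin
    simp only [comp_star, comp_triv] at h
    exact h
  have i₃ := hf.intw H y N
  have i₄ := hf.intw H y M
  have e := H.pl_comp_coproduct h₂ y
    (iR : D ⊗[K] D →ₐ[K] (G ⊗[K] (G ⊗[K] G)) ⊗[K] (D ⊗[K] D))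
  have e₁ : pl y (iR.comp Δ) T = Algebra.TensorProduct.map leg12 (AlgHom.id K (D ⊗[K] D))
      (pl (iL.comp iL) (iR.comp Δ) T) := by
    rw [map_pl]
    simp only [y]
    congr 2
  have hZ : ∀ w, H.zagEv i s (pl y (iR.comp Δ) T * w) = H.zagEv i s w := fun w => by
    rw [e₁]
    exact H.zagEv_mul_of_pairEv_mul (H.pairEv_coproduct hf hc hn hu h₂ hs hs') w
  have i₅ : Intw (pl y (iR.comp Δ) T) (y ⋆ (N.comp i ⋆ M.comp i)) (N.comp i ⋆ M.comp i ⋆ y) := by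
    rw [e]
    exact inferInstanceAs (Intw (H.flipCostar _ _ _ _ _) _ _)
  have i₆ : Intw (pl y (iR.comp Δ) T) x x := inferInstance
  have i₇ : Intw (pl y (iR.comp Δ) T) z z := inferInstance
  rw [← e₀]
  exact H.left_reasInv_mul (H.zagEv i s) x y (N.comp i ⋆ M.comp i) z hZ w

/-- The left antipode axiom for the slices of the flip operator. -/
theorem map_evD_coproduct (hf : H.IsFlip i T) (hc : H.IsCoherent i T)
    (hn : con H.ε.toLinearMap T = 1) (hu : IsUnit T)
    (h₂ : pl iL (iR.comp Δ) T = H.prodFlip i i T T) (hs : s.comp i = H.opLeg i)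
    (hs' : TensorProduct.map H.S.toLinearMap (unopLin s) T = H.twistFlip i T) (v : D ⊗[K] D) :
    TensorProduct.map LinearMap.id (H.evD i s) (pl iL (iR.comp Δ) T * iR v) =
      (1 : G) ⊗ₜ[K] H.evD i s v := by
  have e := H.zagEv_coproduct hf hc hn hu h₂ hs hs' (iR v)
  have e₁ : pl (iL.comp iL) (iR.comp Δ) T * iR v =
      pl (iL.comp (iL : G →ₐ[K] G ⊗[K] (G ⊗[K] G))) iR (pl iL (iR.comp Δ) T * iR v) := by
    rw [map_mul, map_pl, pl_iR]
    simp only [← AlgHom.comp_assoc, pl_comp_iL, pl_comp_iR]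
  have e₂ : (iR v : (G ⊗[K] (G ⊗[K] G)) ⊗[K] (D ⊗[K] D)) = pl (iL.comp iL) iR (iR v) := by
    rw [pl_iR]
  rw [e₁] at e
  rw [e₂] at e
  rw [zagEv_iL_mul, zagEv_iL_mul,
    show H.zagLin (↑H.φ⁻¹ : G ⊗[K] (G ⊗[K] G)) = 1 from H.reassoc_inv_antipode, map_one, mul_one,
    mul_one] at e
  have hi : Function.Injective
      (TensorProduct.map H.S.toLinearMap (LinearMap.id : D →ₗ[K] D)) :=
    (TensorProduct.congr H.S (LinearEquiv.refl K D)).injective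
  rw [hi e]
  simp

/-- The axiom `S(x₁) α x₂ = ε(x) α`. In this form, the elements `x` that satisfy it form a
subalgebra, so that it suffices to consider generators. -/
theorem IsGenerating.evD_coproduct (hg : H.IsGenerating i T) (hu : IsUnit T)
    (h₁ : Δ.comp i = H.prodHom i i) (h₂ : pl iL (iR.comp Δ) T = H.prodFlip i i T T)
    (h₃ : ε.comp i = H.ε)
    (h₄ : pl iL ((iR : D →ₐ[K] G ⊗[K] D).comp ((Algebra.ofId K D).comp ε)) T = 1)
    (hs : s.comp i = H.opLeg i)
    (hs' : TensorProduct.map H.S.toLinearMap (unopLin s) T = H.twistFlip i T) (x : D)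
    (v : D ⊗[K] D) : H.evD i s (Δ x * v) = ε x • H.evD i s v := by
  let S : Subalgebra K D :=
    { carrier := {x | ∀ v, H.evD i s (Δ x * v) = ε x • H.evD i s v}
      mul_mem' := fun {x y} hx hy v => by
        have hx : ∀ v, H.evD i s (Δ x * v) = ε x • H.evD i s v := hx
        have hy : ∀ v, H.evD i s (Δ y * v) = ε y • H.evD i s v := hy
        rw [map_mul Δ, mul_assoc, hx, hy, map_mul, smul_smul]
      add_mem' := fun {x y} hx hy v => by
        rw [map_add, add_mul, map_add, hx, hy, map_add, add_smul]
      algebraMap_mem' := fun r v => by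
        rw [AlgHom.commutes, AlgHom.commutes, ← Algebra.smul_def, map_smul]
        rfl }
  refine hg.generates S (fun a v => ?_) (fun χ v => ?_) x v
  · have e : Δ (i a) = (iL.comp i ⋆ iR.comp i) a := DFunLike.congr_fun h₁ a
    have e' : ε (i a) = H.ε a := DFunLike.congr_fun h₃ a
    rw [e, e', (H.leftEq_evD hs).eq a v, triv_apply, ← Algebra.smul_def, map_smul]
  · have e := congrArg (con χ)
      (H.map_evD_coproduct hg.isFlip hg.isCoherent hg.normal hu h₂ hs hs' v)
    rw [con_map, con_mul_iR, con_pl_iR, con_tmul] at e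
    have e' := congrArg (con χ) h₄
    rw [con_pl_iR, Algebra.TensorProduct.one_def, con_tmul] at e'
    rw [e]
    have e'' := congrArg (· * H.evD i s v) e'
    simpa [Algebra.ofId_apply, ← Algebra.smul_def] using e''.symm

end AntipodeLeft

/-! ### The antipode of the double: right antipode axiom -/

section AntipodeRight
variable {D : Type*} [Ring D] [Algebra K D] {i : G →ₐ[K] D} {T : G ⊗[K] D} {s : D →ₐ[K] Dᵐᵒᵖ}
  {Δ : D →ₐ[K] D ⊗[K] D} {ε : D →ₐ[K] K}

variable (i s) in
/-- `t ⊗ n ↦ t i(β) s(n)`. -/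
def coevD : D ⊗[K] D →ₗ[K] D := LinearMap.id ⊛ (LinearMap.mulLeft K (i H.β) ∘ₗ unopLin s)

variable (i s) in
/-- `x ⊗ y ⊗ t ⊗ n ↦ x β S(y) ⊗ t i(β) s(n)`. -/
def pairCoev : (G ⊗[K] G) ⊗[K] (D ⊗[K] D) →ₗ[K] G ⊗[K] D :=
  TensorProduct.map H.coevLin (H.coevD i s)

/-- The coevaluation `coevD` collapses a pair of legs in `i(G)`. -/
theorem rightEq_coevD (hs : s.comp i = H.opLeg i) :
    RightEq (H.coevD i s) (iL.comp i ⋆ iR.comp i) H.triv :=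
  ⟨fun x w => by
    have hs' : ∀ p, s (i p) = H.opLeg i p := fun p => DFunLike.congr_fun hs p
    induction w using TensorProduct.induction_on with
    | zero => simp
    | add y z hy hz => simp only [add_mul, map_add, hy, hz]
    | tmul b c =>
      have key : ∀ d : G ⊗[K] G, H.coevD i s (b ⊗ₜ c * pl (iL.comp i) (iR.comp i) d) = b *
          (i.toLinearMap ⊛ (LinearMap.mulLeft K (i H.β) ∘ₗ unopLin (H.opLeg i))) d *
            unopLin s c := by
        intro d
        induction d using TensorProduct.induction_on with
        | zero => simp
        | add y z hy hz => simp only [mul_add, add_mul, map_add, hy, hz]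
        | tmul p q => simp [coevD, mul_assoc, hs']
      rw [star_apply, key, (H.antipodeAlong i).coev.eq]
      simp [coevD, Algebra.algebraMap_eq_smul_one, mul_assoc]⟩

theorem pairCoev_congr {u u' : (G ⊗[K] G) ⊗[K] (D ⊗[K] D)}
    (h : H.pairCoev i s u = H.pairCoev i s u') (w) :
    H.pairCoev i s (w * u) = H.pairCoev i s (w * u') := by
  induction w using TensorProduct.induction_on with
  | zero => simp
  | add x y hx hy => simp only [add_mul, map_add, hx, hy]
  | tmul v v' =>
    induction v using TensorProduct.induction_on with
    | zero => simp
    | add x y hx hy => simp only [TensorProduct.add_tmul, add_mul, map_add, hx, hy]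
    | tmul a b =>
      induction v' using TensorProduct.induction_on with
      | zero => simp
      | add x y hx hy => simp only [TensorProduct.tmul_add, add_mul, map_add, hx, hy]
      | tmul c d =>
        have key : ∀ u, H.pairCoev i s ((a ⊗ₜ b) ⊗ₜ (c ⊗ₜ d) * u) =
            a ⊗ₜ c * H.pairCoev i s u * H.S b ⊗ₜ unopLin s d := by
          intro u
          suffices e : H.pairCoev i s ∘ₗ LinearMap.mulLeft K ((a ⊗ₜ b) ⊗ₜ (c ⊗ₜ d)) =
              LinearMap.mulRight K (H.S b ⊗ₜ unopLin s d) ∘ₗ LinearMap.mulLeft K (a ⊗ₜ c) ∘ₗ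
                H.pairCoev i s from DFunLike.congr_fun e u
          ext
          simp [pairCoev, coevLin, coevD, mul_assoc, S_mul]
        rw [key, key, h]

theorem pairCoev_left_mul (w) (d : G ⊗[K] D) :
    H.pairCoev i s (pl (iL.comp iL) (iR.comp iL) d * w) = d * H.pairCoev i s w := by
  induction d using TensorProduct.induction_on with
  | zero => simp
  | add x y hx hy => simp only [map_add, add_mul, hx, hy]
  | tmul a b =>
    suffices H.pairCoev i s ∘ₗ LinearMap.mulLeft K (pl (iL.comp iL) (iR.comp iL) (a ⊗ₜ[K] b)) =
      LinearMap.mulLeft K (a ⊗ₜ[K] b) ∘ₗ H.pairCoev i s from DFunLike.congr_fun this w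
    ext; simp [pairCoev, coevLin, coevD, mul_assoc]

theorem pairCoev_right_mul (w) (d : G ⊗[K] D) :
    H.pairCoev i s (pl (iL.comp iR) (iR.comp iR) d * w) =
      H.pairCoev i s w * TensorProduct.map H.S.toLinearMap (unopLin s) d := by
  induction d using TensorProduct.induction_on with
  | zero => simp
  | add x y hx hy => simp only [map_add, mul_add, add_mul, hx, hy]
  | tmul a b =>
    suffices H.pairCoev i s ∘ₗ LinearMap.mulLeft K (pl (iL.comp iR) (iR.comp iR) (a ⊗ₜ[K] b)) =
      LinearMap.mulRight K (H.S a ⊗ₜ[K] unopLin s b) ∘ₗ H.pairCoev i s from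
        DFunLike.congr_fun this w
    ext; simp [pairCoev, coevLin, coevD, mul_assoc, S_mul]

theorem pairCoev_onSndPair (hs : s.comp i = H.opLeg i) (w : (G ⊗[K] G) ⊗[K] (G ⊗[K] G)) :
    H.pairCoev i s (onSndPair i w) = onSnd i (H.coev₂ w) := by
  have hs' : ∀ p, s (i p) = H.opLeg i p := fun p => DFunLike.congr_fun hs p
  suffices e : H.pairCoev i s ∘ₗ (onSndPair i).toLinearMap = (onSnd i).toLinearMap ∘ₗ H.coev₂ from
    DFunLike.congr_fun e w
  ext
  simp [pairCoev, coevLin, coevD, coev₂, hs']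

/-- The opposite of `δ`: the roles of the two pairs are exchanged. -/
theorem comm_δ_eq : Algebra.TensorProduct.comm K G G H.δ =
    H.coev₂ (φ[e₃ ⋆ e₁, e₂, e₄] * φ⁻[e₃, e₁, e₂]) := by
  let σ : (G ⊗[K] G) ⊗[K] (G ⊗[K] G) →ₐ[K] (G ⊗[K] G) ⊗[K] (G ⊗[K] G) :=
    (Algebra.TensorProduct.comm K _ _).toAlgHom
  have h : ∀ w, Algebra.TensorProduct.comm K G G (H.coev₂ w) = H.coev₂ (σ w) := fun w => by
    suffices e : (Algebra.TensorProduct.comm K G G).toLinearMap ∘ₗ H.coev₂ =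
        H.coev₂ ∘ₗ σ.toLinearMap from DFunLike.congr_fun e w
    ext
    simp [coev₂, σ]
  have h₁ : σ.comp e₁ = e₃ := by ext; simp [σ]
  have h₂ : σ.comp e₂ = e₄ := by ext; simp [σ]
  have h₃ : σ.comp e₃ = e₁ := by ext; simp [σ]
  have h₄ : σ.comp e₄ = e₂ := by ext; simp [σ]
  rw [δ_eq, h]
  simp only [map_mul, map_reas, map_reasInv, comp_star, h₁, h₂, h₃, h₄]

theorem pairCoev_δ (hs : s.comp i = H.opLeg i) : H.pairCoev i s
    (φ[iL.comp iL ⋆ (iR.comp iL).comp i, (iR.comp iR).comp i, iL.comp iR] *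
      φ⁻[iL.comp iL, (iR.comp iL).comp i, (iR.comp iR).comp i]) = onSnd i H.δ := by
  obtain ⟨h₁, h₂, h₃, h₄⟩ := onSndPair_legs (K := K) (G := G) i
  rw [δ_eq, ← pairCoev_onSndPair H hs]
  simp only [map_mul, map_reas, map_reasInv, comp_star, h₁, h₂, h₃, h₄]

theorem pairCoev_comm_δ (hs : s.comp i = H.opLeg i) : H.pairCoev i s
    (φ[(iR.comp iL).comp i ⋆ iL.comp iL, iL.comp iR, (iR.comp iR).comp i] *
      φ⁻[(iR.comp iL).comp i, iL.comp iL, iL.comp iR]) =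
        onSnd i (Algebra.TensorProduct.comm K G G H.δ) := by
  obtain ⟨h₁, h₂, h₃, h₄⟩ := onSndPair_legs (K := K) (G := G) i
  rw [comm_δ_eq, ← pairCoev_onSndPair H hs]
  simp only [map_mul, map_reas, map_reasInv, comp_star, h₁, h₂, h₃, h₄]

/-- The counterpart of `IsFlip.twistFlip_mul_γ`, because `δ f = Δ(β)`. -/
theorem IsFlip.mul_δ (hf : H.IsFlip i T) : T * onSnd i H.δ =
    onSnd i (Algebra.TensorProduct.comm K G G H.δ) * H.twistFlip i T := by
  have e : H.δ = H.Δ H.β * H.fInv := by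
    rw [← δ_mul_f, mul_assoc, f_mul_fInv, mul_one]
  have e' : onSnd i (Algebra.TensorProduct.comm K G G H.δ) *
      onSnd i (Algebra.TensorProduct.comm K G G H.f) = onSnd i (H.Δop H.β) := by
    rw [← map_mul, ← map_mul, δ_mul_f]
    rfl
  rw [twistFlip, ← mul_assoc, e', ← mul_assoc, ← hf, e, map_mul, mul_assoc]

/-- The coevaluations of both factors annihilate the flip operator of `y` and `Δ`, by
`right_flipCostar`. -/
theorem pairCoev_coproduct (hf : H.IsFlip i T) (hc : H.IsCoherent i T)
    (hn : con H.ε.toLinearMap T = 1) (hu : IsUnit T)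
    (h₂ : pl iL (iR.comp Δ) T = H.prodFlip i i T T) (hs : s.comp i = H.opLeg i)
    (hs' : TensorProduct.map H.S.toLinearMap (unopLin s) T = H.twistFlip i T) (w) :
    H.pairCoev i s (w * pl (iL.comp iR) (iR.comp Δ) T) = H.pairCoev i s w := by
  let x : G →ₐ[K] (G ⊗[K] G) ⊗[K] (D ⊗[K] D) := iL.comp iL
  let y : G →ₐ[K] (G ⊗[K] G) ⊗[K] (D ⊗[K] D) := iL.comp iR
  let M : D →ₐ[K] (G ⊗[K] G) ⊗[K] (D ⊗[K] D) := iR.comp iL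
  let N : D →ₐ[K] (G ⊗[K] G) ⊗[K] (D ⊗[K] D) := iR.comp iR
  obtain ⟨⟨T, T', hT, hT'⟩, rfl⟩ := hu
  simp only at hf hc hn h₂ hs' ⊢
  have i₁ : RightEq (H.pairCoev i s) (x ⋆ y) H.triv :=
    rightEq_star_map_left _ H.rightEq_coevLin _
  have i₂ : RightEq (H.pairCoev i s) (M.comp i ⋆ N.comp i) H.triv := by
    have h := (H.rightEq_coevD hs).map_right H.coevLin
    simp only [comp_star, comp_triv] at h
    exact h
  have i₃ := hf.intw H y N
  have i₄ := hf.intw H y M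
  have i₅ := hf.intw H x M
  have e := H.pl_comp_coproduct h₂ y (iR : D ⊗[K] D →ₐ[K] (G ⊗[K] G) ⊗[K] (D ⊗[K] D))
  change H.pairCoev i s (w * pl y (iR.comp Δ) T) = _
  rw [e]
  refine H.right_flipCostar (H.pairCoev i s) x y (M.comp i) (N.comp i) (Txt := pl x M T)
    (Txt' := pl x M T') ?_ ?_ ?_ ?_ w
  · rw [← map_mul, hT', map_one]
  · exact Commuting.eq (pl y N) (pl x M) T T
  · intro w
    rw [← hc.eq, (RightEq.pl (H.pairCoev i s) (x ⋆ y) H.triv M M).eq, hc.eq_one H hn, mul_one]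
  · intro w
    rw [mul_assoc, mul_assoc w (pl y N T)]
    refine H.pairCoev_congr ?_ w
    rw [pairCoev_left_mul, pairCoev_right_mul, hs']
    exact (congrArg (T * ·) (H.pairCoev_δ hs)).trans
      ((hf.mul_δ H).trans (congrArg (· * H.twistFlip i T) (H.pairCoev_comm_δ hs)).symm)

variable (i s) in
/-- `z ⊗ x ⊗ y ⊗ t ⊗ n ↦ S(z) α x β S(y) ⊗ t i(β) s(n)`. -/
def zagCoev : (G ⊗[K] (G ⊗[K] G)) ⊗[K] (D ⊗[K] D) →ₗ[K] G ⊗[K] D :=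
  TensorProduct.map H.zagLin (H.coevD i s)

theorem zagCoev_left_mul (u : (G ⊗[K] G) ⊗[K] (D ⊗[K] D)) (c : G) :
    H.zagCoev i s (iL (iL c) * Algebra.TensorProduct.map leg23 (AlgHom.id K _) u) =
      iL (H.S c * H.α) * H.pairCoev i s u := by
  suffices e : H.zagCoev i s ∘ₗ LinearMap.mulLeft K (iL (iL c)) ∘ₗ
      (Algebra.TensorProduct.map leg23 (AlgHom.id K (D ⊗[K] D))).toLinearMap =
      LinearMap.mulLeft K (iL (H.S c * H.α)) ∘ₗ H.pairCoev i s from DFunLike.congr_fun e u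
  ext
  simp [pairCoev, coevLin, coevD, zagCoev, zagLin, leg23, mul_assoc]

theorem zagCoev_mul_of_pairCoev_mul {Z : (G ⊗[K] G) ⊗[K] (D ⊗[K] D)}
    (hZ : ∀ w, H.pairCoev i s (w * Z) = H.pairCoev i s w) (w) :
    H.zagCoev i s (w * Algebra.TensorProduct.map leg23 (AlgHom.id K _) Z) = H.zagCoev i s w := by
  suffices e : H.zagCoev i s ∘ₗ LinearMap.mulRight K
      (Algebra.TensorProduct.map leg23 (AlgHom.id K _) Z) = H.zagCoev i s from
    DFunLike.congr_fun e w
  ext c a b n t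
  have h : ((c ⊗ₜ (a ⊗ₜ b)) ⊗ₜ (n ⊗ₜ t) : (G ⊗[K] (G ⊗[K] G)) ⊗[K] (D ⊗[K] D)) =
      iL (iL c) * Algebra.TensorProduct.map (leg23 : G ⊗[K] G →ₐ[K] G ⊗[K] (G ⊗[K] G))
        (AlgHom.id K (D ⊗[K] D)) ((a ⊗ₜ b) ⊗ₜ (n ⊗ₜ t)) := by simp [leg23]
  simp only [TensorProduct.AlgebraTensorModule.curry_apply, LinearMap.restrictScalars_self,
    TensorProduct.curry_apply, LinearMap.comp_apply, LinearMap.mulRight_apply]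
  rw [h, mul_assoc, ← map_mul, zagCoev_left_mul, zagCoev_left_mul, hZ]

theorem zagCoev_mul_iL (u : G ⊗[K] (G ⊗[K] G)) (d : G ⊗[K] (D ⊗[K] D)) :
    H.zagCoev i s (pl (iL.comp (iR.comp iR)) iR d * iL u) =
      iL (H.zagLin u) * TensorProduct.map H.S.toLinearMap LinearMap.id
        (TensorProduct.map LinearMap.id (H.coevD i s) d) := by
  induction d using TensorProduct.induction_on with
  | zero => simp
  | add x y hx hy => simp only [map_add, mul_add, add_mul, hx, hy]
  | tmul g v =>
    suffices e : H.zagLin ∘ₗ LinearMap.mulLeft K (iR (iR g)) =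
        LinearMap.mulRight K (H.S g) ∘ₗ H.zagLin by
      have e' := DFunLike.congr_fun e u
      simp only [LinearMap.comp_apply, LinearMap.mulRight_apply, LinearMap.mulLeft_apply,
        iR_apply] at e'
      simp [zagCoev, e']
    ext
    simp [zagLin, mul_assoc, S_mul]

/-- The same in front of `φ⁻¹` with a third leg `z`; under `zagCoev`, the zigzag `S(P) α Q β S(R) =
1` then leaves only the leg `y`. -/
theorem zagCoev_coproduct (hf : H.IsFlip i T) (hc : H.IsCoherent i T)
    (hn : con H.ε.toLinearMap T = 1) (hu : IsUnit T)
    (h₂ : pl iL (iR.comp Δ) T = H.prodFlip i i T T) (hs : s.comp i = H.opLeg i)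
    (hs' : TensorProduct.map H.S.toLinearMap (unopLin s) T = H.twistFlip i T) (w) :
    H.zagCoev i s (w * pl (iL.comp (iR.comp iR)) (iR.comp Δ) T *
        iL (↑H.φ⁻¹ : G ⊗[K] (G ⊗[K] G))) =
      H.zagCoev i s (w * iL (↑H.φ⁻¹ : G ⊗[K] (G ⊗[K] G))) := by
  let z : G →ₐ[K] (G ⊗[K] (G ⊗[K] G)) ⊗[K] (D ⊗[K] D) := iL.comp iL
  let x : G →ₐ[K] (G ⊗[K] (G ⊗[K] G)) ⊗[K] (D ⊗[K] D) := iL.comp (iR.comp iL)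
  let y : G →ₐ[K] (G ⊗[K] (G ⊗[K] G)) ⊗[K] (D ⊗[K] D) := iL.comp (iR.comp iR)
  let M : D →ₐ[K] (G ⊗[K] (G ⊗[K] G)) ⊗[K] (D ⊗[K] D) := iR.comp iL
  let N : D →ₐ[K] (G ⊗[K] (G ⊗[K] G)) ⊗[K] (D ⊗[K] D) := iR.comp iR
  have e₀ : φ⁻[z, x, y] = iL (↑H.φ⁻¹ : G ⊗[K] (G ⊗[K] G)) := by
    rw [← H.reasInv_legs, map_reasInv]
  have i₂ : RightEq (H.zagCoev i s) (M.comp i ⋆ N.comp i) H.triv := by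
    have h := (H.rightEq_coevD hs).map_right H.zagLin
    simp only [comp_star, comp_triv] at h
    exact h
  have i₃ := hf.intw H y N
  have i₄ := hf.intw H y M
  have e := H.pl_comp_coproduct h₂ y
    (iR : D ⊗[K] D →ₐ[K] (G ⊗[K] (G ⊗[K] G)) ⊗[K] (D ⊗[K] D))
  have e₁ : pl y (iR.comp Δ) T = Algebra.TensorProduct.map leg23 (AlgHom.id K (D ⊗[K] D))
      (pl (iL.comp iR) (iR.comp Δ) T) := by
    rw [map_pl]
    simp only [y]
    congr 2
  have hZ : ∀ w, H.zagCoev i s (w * pl y (iR.comp Δ) T) = H.zagCoev i s w := fun w => by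
    rw [e₁]
    exact H.zagCoev_mul_of_pairCoev_mul (H.pairCoev_coproduct hf hc hn hu h₂ hs hs') w
  have i₅ : Intw (pl y (iR.comp Δ) T) (y ⋆ (M.comp i ⋆ N.comp i)) (M.comp i ⋆ N.comp i ⋆ y) := by
    rw [e]
    exact inferInstanceAs (Intw (H.flipCostar _ _ _ _ _) _ _)
  have i₆ : Intw (pl y (iR.comp Δ) T) x x := inferInstance
  have i₇ : Intw (pl y (iR.comp Δ) T) z z := inferInstance
  rw [← e₀]
  exact H.right_mul_reasInv (H.zagCoev i s) x y (M.comp i ⋆ N.comp i) z hZ w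

/-- The right antipode axiom for the slices of the flip operator. -/
theorem map_coevD_coproduct (hf : H.IsFlip i T) (hc : H.IsCoherent i T)
    (hn : con H.ε.toLinearMap T = 1) (hu : IsUnit T)
    (h₂ : pl iL (iR.comp Δ) T = H.prodFlip i i T T) (hs : s.comp i = H.opLeg i)
    (hs' : TensorProduct.map H.S.toLinearMap (unopLin s) T = H.twistFlip i T) (v : D ⊗[K] D) :
    TensorProduct.map LinearMap.id (H.coevD i s) (iR v * pl iL (iR.comp Δ) T) =
      (1 : G) ⊗ₜ[K] H.coevD i s v := by
  have e := H.zagCoev_coproduct hf hc hn hu h₂ hs hs' (iR v)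
  have e₁ : iR v * pl (iL.comp (iR.comp iR)) (iR.comp Δ) T =
      pl (iL.comp (iR.comp iR : G →ₐ[K] G ⊗[K] (G ⊗[K] G))) iR
        (iR v * pl iL (iR.comp Δ) T) := by
    rw [map_mul, map_pl, pl_iR]
    simp only [← AlgHom.comp_assoc, pl_comp_iL, pl_comp_iR]
  have e₂ : (iR v : (G ⊗[K] (G ⊗[K] G)) ⊗[K] (D ⊗[K] D)) =
      pl (iL.comp (iR.comp iR)) iR (iR v) := by rw [pl_iR]
  rw [e₁] at e
  rw [e₂] at e
  rw [zagCoev_mul_iL, zagCoev_mul_iL,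
    show H.zagLin (↑H.φ⁻¹ : G ⊗[K] (G ⊗[K] G)) = 1 from H.reassoc_inv_antipode, map_one, one_mul,
    one_mul] at e
  have hi : Function.Injective
      (TensorProduct.map H.S.toLinearMap (LinearMap.id : D →ₗ[K] D)) :=
    (TensorProduct.congr H.S (LinearEquiv.refl K D)).injective
  rw [hi e]
  simp

/-- The axiom `x₁ β S(x₂) = ε(x) β`; see `IsGenerating.evD_coproduct`. -/
theorem IsGenerating.coevD_coproduct (hg : H.IsGenerating i T) (hu : IsUnit T)
    (h₁ : Δ.comp i = H.prodHom i i) (h₂ : pl iL (iR.comp Δ) T = H.prodFlip i i T T)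
    (h₃ : ε.comp i = H.ε)
    (h₄ : pl iL ((iR : D →ₐ[K] G ⊗[K] D).comp ((Algebra.ofId K D).comp ε)) T = 1)
    (hs : s.comp i = H.opLeg i)
    (hs' : TensorProduct.map H.S.toLinearMap (unopLin s) T = H.twistFlip i T) (x : D)
    (v : D ⊗[K] D) : H.coevD i s (v * Δ x) = ε x • H.coevD i s v := by
  let S : Subalgebra K D :=
    { carrier := {x | ∀ v, H.coevD i s (v * Δ x) = ε x • H.coevD i s v}
      mul_mem' := fun {x y} hx hy v => by
        have hx : ∀ v, H.coevD i s (v * Δ x) = ε x • H.coevD i s v := hx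
        have hy : ∀ v, H.coevD i s (v * Δ y) = ε y • H.coevD i s v := hy
        rw [map_mul Δ, ← mul_assoc, hy, hx, map_mul, smul_smul, mul_comm]
      add_mem' := fun {x y} hx hy v => by
        rw [map_add, mul_add, map_add, hx, hy, map_add, add_smul]
      algebraMap_mem' := fun r v => by
        rw [AlgHom.commutes, AlgHom.commutes, ← Algebra.commutes, ← Algebra.smul_def, map_smul]
        rfl }
  refine hg.generates S (fun a v => ?_) (fun χ v => ?_) x v
  · have e : Δ (i a) = (iL.comp i ⋆ iR.comp i) a := DFunLike.congr_fun h₁ a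
    have e' : ε (i a) = H.ε a := DFunLike.congr_fun h₃ a
    rw [e, e', (H.rightEq_coevD hs).eq a v, triv_apply, ← Algebra.commutes, ← Algebra.smul_def,
      map_smul]
  · have e := congrArg (con χ)
      (H.map_coevD_coproduct hg.isFlip hg.isCoherent hg.normal hu h₂ hs hs' v)
    rw [con_map, con_iR_mul, con_pl_iR, con_tmul] at e
    have e' := congrArg (con χ) h₄
    rw [con_pl_iR, Algebra.TensorProduct.one_def, con_tmul] at e'
    rw [e]
    have e'' := congrArg (· * H.coevD i s v) e'
    simpa [Algebra.ofId_apply, ← Algebra.smul_def] using e''.symm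

end AntipodeRight

/-! ### The quasi-Hopf algebra generated by a flip operator -/

section Structure
variable {D : Type*} [Ring D] [Algebra K D] {i : G →ₐ[K] D} {T : G ⊗[K] D} {s : D →ₐ[K] Dᵐᵒᵖ}
  {Δ : D →ₐ[K] D ⊗[K] D} {ε : D →ₐ[K] K}

/-- A subalgebra containing `i(G)` and the slices of `w` contains the slices of `(id ⊗ i)(d) w`. -/
theorem con_onSnd_mul_mem {S : Subalgebra K D} (hi : ∀ a, i a ∈ S) {w : G ⊗[K] D}
    (hw : ∀ χ, con χ w ∈ S) (d : G ⊗[K] G) (χ : Module.Dual K G) :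
    con χ (onSnd i d * w) ∈ S := by
  induction d using TensorProduct.induction_on with
  | zero => simpa using zero_mem S
  | add x y hx hy => simpa only [map_add, add_mul] using add_mem hx hy
  | tmul p q =>
    have e : con χ (p ⊗ₜ[K] i q * w) = i q * con (χ ∘ₗ LinearMap.mulLeft K p) w := by
      clear hw
      induction w using TensorProduct.induction_on with
      | zero => simp
      | add x y hx hy => simp only [map_add, mul_add, hx, hy]
      | tmul x m => simp
    simpa [e] using mul_mem (hi q) (hw _)

theorem con_mul_onSnd_mem {S : Subalgebra K D} (hi : ∀ a, i a ∈ S) {w : G ⊗[K] D}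
    (hw : ∀ χ, con χ w ∈ S) (d : G ⊗[K] G) (χ : Module.Dual K G) :
    con χ (w * onSnd i d) ∈ S := by
  induction d using TensorProduct.induction_on with
  | zero => simpa using zero_mem S
  | add x y hx hy => simpa only [map_add, mul_add] using add_mem hx hy
  | tmul p q =>
    have e : con χ (w * p ⊗ₜ[K] i q) = con (χ ∘ₗ LinearMap.mulRight K p) w * i q := by
      clear hw
      induction w using TensorProduct.induction_on with
      | zero => simp
      | add x y hx hy => simp only [map_add, add_mul, hx, hy]
      | tmul x m => simp
    simpa [e] using mul_mem (hw _) (hi q)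

theorem con_map_S (k : D →ₗ[K] A) (χ : Module.Dual K G) (w : G ⊗[K] D) :
    con χ (TensorProduct.map H.S.toLinearMap k w) = k (con (χ ∘ₗ H.S.toLinearMap) w) := by
  induction w using TensorProduct.induction_on with
  | zero => simp
  | add x y hx hy => simp only [map_add, hx, hy]
  | tmul x m => simp

/-- The flip operator is recovered from its twisted form. -/
theorem eq_twistFlip (T : G ⊗[K] D) :
    T = onSnd i (Algebra.TensorProduct.comm K G G H.fInv) *
      (H.twistFlip i T * onSnd i H.f) := by
  rw [twistFlip]
  simp only [mul_assoc]
  rw [← map_mul (onSnd i), fInv_mul_f, map_one, mul_one, ← mul_assoc, ← map_mul, ← map_mul,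
    fInv_mul_f, map_one, map_one, one_mul]

/-- The image of the antipode is a subalgebra. It contains the slices of `T` because `T` is
recovered from `(S ⊗ s)(T)` by multiplication with elements of `G ⊗ i(G)`. -/
theorem IsGenerating.surjective_antipode (hg : H.IsGenerating i T) (hs : s.comp i = H.opLeg i)
    (hs' : TensorProduct.map H.S.toLinearMap (unopLin s) T = H.twistFlip i T) :
    Function.Surjective (unopLin s) := by
  let S : Subalgebra K D :=
    { carrier := {x | ∃ y, unopLin s y = x}
      mul_mem' := fun {x x'} hx hx' => by
        obtain ⟨y, rfl⟩ := hx
        obtain ⟨y', rfl⟩ := hx'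
        exact ⟨y' * y, by simp⟩
      add_mem' := fun {x x'} hx hx' => by
        obtain ⟨y, rfl⟩ := hx
        obtain ⟨y', rfl⟩ := hx'
        exact ⟨y + y', by simp⟩
      algebraMap_mem' := fun r => ⟨algebraMap K D r, by
        rw [unopLin_apply, AlgHom.commutes]; rfl⟩ }
  have hi : ∀ a, i a ∈ S := fun a => ⟨i (H.Sinv a), by
    have e : s (i (H.Sinv a)) = H.opLeg i (H.Sinv a) := DFunLike.congr_fun hs _
    rw [unopLin_apply, e]
    simp [Sinv]⟩
  refine hg.generates S hi fun χ => ?_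
  rw [H.eq_twistFlip (i := i) T]
  refine con_onSnd_mul_mem hi (con_mul_onSnd_mem hi (fun χ => ?_) _) _ χ
  rw [← hs', con_map_S]
  exact ⟨_, rfl⟩

theorem map_zigLin (hs : s.comp i = H.opLeg i) (w : G ⊗[K] (G ⊗[K] G)) :
    (LinearMap.id ⊛ (LinearMap.mulLeft K (i H.β) ∘ₗ unopLin s) ⊛ LinearMap.mulLeft K (i H.α))
      (tripleHom i w) = i (H.zigLin w) := by
  have hs' : ∀ p, s (i p) = H.opLeg i p := fun p => DFunLike.congr_fun hs p
  suffices e : (LinearMap.id ⊛ (LinearMap.mulLeft K (i H.β) ∘ₗ unopLin s) ⊛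
      LinearMap.mulLeft K (i H.α)) ∘ₗ (tripleHom i).toLinearMap = i.toLinearMap ∘ₗ H.zigLin from
    DFunLike.congr_fun e w
  refine TensorProduct.ext_threefold' fun a b c => ?_
  simp [zigLin, hs']

theorem map_zagLin (hs : s.comp i = H.opLeg i) (w : G ⊗[K] (G ⊗[K] G)) :
    (unopLin s ⊛ LinearMap.mulLeft K (i H.α) ⊛ (LinearMap.mulLeft K (i H.β) ∘ₗ unopLin s))
      (tripleHom i w) = i (H.zagLin w) := by
  have hs' : ∀ p, s (i p) = H.opLeg i p := fun p => DFunLike.congr_fun hs p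
  suffices e : (unopLin s ⊛ LinearMap.mulLeft K (i H.α) ⊛
      (LinearMap.mulLeft K (i H.β) ∘ₗ unopLin s)) ∘ₗ (tripleHom i).toLinearMap =
        i.toLinearMap ∘ₗ H.zagLin from DFunLike.congr_fun e w
  refine TensorProduct.ext_threefold' fun a b c => ?_
  simp [zagLin, hs']

/-- The quasi-Hopf algebra structure on an algebra generated by a flip operator. -/
def IsGenerating.quasiHopfAlgebra [FiniteDimensional K D] (hg : H.IsGenerating i T)
    (hu : IsUnit T) (h₁ : Δ.comp i = H.prodHom i i)
    (h₂ : pl iL (iR.comp Δ) T = H.prodFlip i i T T) (h₃ : ε.comp i = H.ε)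
    (h₄ : pl iL ((iR : D →ₐ[K] G ⊗[K] D).comp ((Algebra.ofId K D).comp ε)) T = 1)
    (hs : s.comp i = H.opLeg i)
    (hs' : TensorProduct.map H.S.toLinearMap (unopLin s) T = H.twistFlip i T) :
    QuasiHopfAlgebra K D where
  toQuasiBialgebra := hg.quasiBialgebra H h₁ h₂ h₃ h₄
  S := LinearEquiv.ofBijective (unopLin s)
    ⟨LinearMap.injective_iff_surjective.2 (hg.surjective_antipode H hs hs'),
      hg.surjective_antipode H hs hs'⟩
  S_mul a b := by
    change unopLin s (a * b) = unopLin s b * unopLin s a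
    simp
  α := i H.α
  β := i H.β
  antipode_left x := by
    have e := hg.evD_coproduct H hu h₁ h₂ h₃ h₄ hs hs' x 1
    have e₁ : H.evD i s 1 = i H.α := by simp [evD, Algebra.TensorProduct.one_def]
    rw [mul_one, e₁] at e
    exact e
  antipode_right x := by
    have e := hg.coevD_coproduct H hu h₁ h₂ h₃ h₄ hs hs' x 1
    have e₁ : H.coevD i s 1 = i H.β := by simp [coevD, Algebra.TensorProduct.one_def]
    rw [one_mul, e₁] at e
    exact e
  reassoc_antipode := (H.map_zigLin hs _).trans
    ((congrArg i H.reassoc_antipode).trans (map_one i))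
  reassoc_inv_antipode := (H.map_zagLin hs _).trans
    ((congrArg i H.reassoc_inv_antipode).trans (map_one i))

end Structure

/-! ### The quasi-Hopf algebra structure of the double -/

theorem map_id_eq_pl (k : A →ₐ[K] B) (w : G ⊗[K] A) :
    Algebra.TensorProduct.map (AlgHom.id K G) k w = pl iL (iR.comp k) w :=
  eq_pl_apply (by ext; simp) (by ext; simp) w

/-- The flip operator `1` for the counit, from which the counit of the double arises. -/
theorem isFlip_counit : H.IsFlip H.ε (1 : G ⊗[K] K) := by
  have e : (iR : K →ₐ[K] G ⊗[K] K).comp H.ε = H.triv :=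
    congrArg (AlgHom.comp · H.ε) (Subsingleton.elim _ _)
  rw [isFlip_iff]
  simp only [e, star_triv, triv_star]
  exact ⟨fun x => by rw [one_mul, mul_one]⟩

theorem isCoherent_counit : H.IsCoherent H.ε (1 : G ⊗[K] K) := by
  have e : (iR.comp iR : K →ₐ[K] G ⊗[K] (G ⊗[K] K)).comp H.ε = H.triv :=
    congrArg (AlgHom.comp · H.ε) (Subsingleton.elim _ _)
  rw [IsCoherent, flipStar]
  simp only [e, map_one, one_mul, mul_one, reas_triv_left, reasInv_triv_mid, reas_triv_right]

section Double
variable [FiniteDimensional K G] (h : H.DoubleIsAlgebra) (hα : H.ε H.α = 1)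

/-- The double is generated by `i_D(G)` and the slices of the canonical element, which lie in the
algebra generated by `i_D(G)` and the slices of the universal flip operator. -/
theorem isGenerating_flipOp : H.IsGenerating (H.iDHom h hα) (H.flipOp h) where
  isFlip := H.isFlip_flipOp h hα
  isCoherent := H.isCoherent_flipOp h hα
  normal := H.con_flipOp h hα
  generates S hi hχ x := by
    obtain ⟨x, rfl⟩ := (H.toDouble h).surjective x
    induction x using TensorProduct.induction_on with
    | zero => simp
    | add x y hx hy => simpa only [map_add] using add_mem hx hy
    | tmul χ a =>
      rw [← H.mul_iDHom h hα, ← con_genD, ← H.genOfFlip_flipOp h hα]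
      exact mul_mem (con_onSnd_mul_mem hi hχ _ _) (hi a)

/-- The coproduct of the double. -/
def doubleΔ : H.Double h →ₐ[K] H.Double h ⊗[K] H.Double h :=
  H.liftDouble h hα ((H.isFlip_flipOp h hα).prod H (H.isFlip_flipOp h hα))
    (IsCoherent.prod H (H.isFlip_flipOp h hα) (H.isFlip_flipOp h hα) (H.isCoherent_flipOp h hα)
      (H.isCoherent_flipOp h hα))
    (H.con_prodFlip (H.con_flipOp h hα) (H.con_flipOp h hα) (H.isCoherent_flipOp h hα)
      (H.isCoherent_flipOp h hα))

theorem doubleΔ_comp_iDHom :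
    (H.doubleΔ h hα).comp (H.iDHom h hα) = H.prodHom (H.iDHom h hα) (H.iDHom h hα) :=
  H.liftDouble_comp_iDHom ..

theorem map_doubleΔ_flipOp : Algebra.TensorProduct.map (AlgHom.id K G) (H.doubleΔ h hα)
    (H.flipOp h) = H.prodFlip (H.iDHom h hα) (H.iDHom h hα) (H.flipOp h) (H.flipOp h) :=
  H.map_liftDouble_flipOp ..

/-- The counit of the double. -/
def doubleε : H.Double h →ₐ[K] K :=
  H.liftDouble h hα H.isFlip_counit H.isCoherent_counit (by simp [Algebra.TensorProduct.one_def])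

theorem doubleε_comp_iDHom : (H.doubleε h hα).comp (H.iDHom h hα) = H.ε :=
  H.liftDouble_comp_iDHom ..

theorem map_doubleε_flipOp :
    Algebra.TensorProduct.map (AlgHom.id K G) (H.doubleε h hα) (H.flipOp h) = 1 :=
  H.map_liftDouble_flipOp ..

theorem pl_doubleε_flipOp : pl iL ((iR : H.Double h →ₐ[K] G ⊗[K] H.Double h).comp
    ((Algebra.ofId K (H.Double h)).comp (H.doubleε h hα))) (H.flipOp h) = 1 := by
  have e := congrArg (Algebra.TensorProduct.map (AlgHom.id K G) (Algebra.ofId K (H.Double h)))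
    (H.map_doubleε_flipOp h hα)
  rw [map_id_eq_pl, map_id_eq_pl, map_pl, map_one] at e
  simpa only [← AlgHom.comp_assoc, pl_comp_iL, pl_comp_iR] using e

/-- The antipode of the double, as a homomorphism to the opposite algebra. -/
def doubleSop : H.Double h →ₐ[K] (H.Double h)ᵐᵒᵖ :=
  H.liftDouble h hα ((H.isFlip_flipOp h hα).opFlip H)
    (IsCoherent.opFlip H (H.isFlip_flipOp h hα) (H.isCoherent_flipOp h hα))
    (H.con_opFlip hα (H.con_flipOp h hα))

theorem doubleSop_comp_iDHom :
    (H.doubleSop h hα).comp (H.iDHom h hα) = H.opLeg (H.iDHom h hα) :=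
  H.liftDouble_comp_iDHom ..

theorem map_doubleSop_flipOp : Algebra.TensorProduct.map (AlgHom.id K G) (H.doubleSop h hα)
    (H.flipOp h) = H.opFlip (H.iDHom h hα) (H.flipOp h) :=
  H.map_liftDouble_flipOp ..

/-- The two descriptions of the flip operator that prescribes an antipode: with `S` on the first
factor, or with `S⁻¹` in the opposite algebra. -/
theorem map_S_unopLin_eq_iff {D : Type*} [Ring D] [Algebra K D] (i : G →ₐ[K] D) (T : G ⊗[K] D)
    (s : D →ₐ[K] Dᵐᵒᵖ) : TensorProduct.map H.S.toLinearMap (unopLin s) T = H.twistFlip i T ↔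
      Algebra.TensorProduct.map (AlgHom.id K G) s T = H.opFlip i T := by
  let E := TensorProduct.congr H.S (MulOpposite.opLinearEquiv K (M := D)).symm
  have e₁ : ∀ w, TensorProduct.map H.S.toLinearMap (unopLin s) w =
      E (Algebra.TensorProduct.map (AlgHom.id K G) s w) := fun w => by
    induction w using TensorProduct.induction_on with
    | zero => simp
    | add x y hx hy => simp only [map_add, hx, hy]
    | tmul g d => simp [E]
  have e₂ : H.twistFlip i T = E (H.opFlip i T) := by
    rw [opFlip]
    generalize H.twistFlip i T = w
    induction w using TensorProduct.induction_on with
    | zero => simp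
    | add x y hx hy => simpa only [map_add] using congrArg₂ (· + ·) hx hy
    | tmul g d => simp [E, Sinv]
  rw [e₁, e₂, E.injective.eq_iff]

theorem map_S_doubleSop_flipOp : TensorProduct.map H.S.toLinearMap (unopLin (H.doubleSop h hα))
    (H.flipOp h) = H.twistFlip (H.iDHom h hα) (H.flipOp h) :=
  (H.map_S_unopLin_eq_iff _ _ _).2 (H.map_doubleSop_flipOp h hα)

/-- The quasi-Hopf algebra structure of the double. -/
def doubleQuasiHopf : QuasiHopfAlgebra K (H.Double h) :=
  (H.isGenerating_flipOp h hα).quasiHopfAlgebra H (H.isUnit_flipOp h hα)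
    (H.doubleΔ_comp_iDHom h hα)
    ((map_id_eq_pl _ _).symm.trans (H.map_doubleΔ_flipOp h hα))
    (H.doubleε_comp_iDHom h hα) (H.pl_doubleε_flipOp h hα) (H.doubleSop_comp_iDHom h hα)
    (H.map_S_doubleSop_flipOp h hα)

theorem isRMatrix_RD : (H.doubleQuasiHopf h hα).IsRMatrix (H.RD h) :=
  (H.isGenerating_flipOp h hα).isRMatrix H (H.doubleΔ_comp_iDHom h hα)
    ((map_id_eq_pl _ _).symm.trans (H.map_doubleΔ_flipOp h hα))
    (H.doubleε_comp_iDHom h hα) (H.pl_doubleε_flipOp h hα) (H.isUnit_flipOp h hα)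

theorem iD₃_eq (w : G ⊗[K] (G ⊗[K] G)) : H.iD₃ h w = tripleHom (H.iDHom h hα) w := rfl

theorem RD_eq : H.RD h = Algebra.TensorProduct.map (H.iDHom h hα) (AlgHom.id K (H.Double h))
    (H.flipOp h) := rfl

theorem isCoproduct_doubleΔ : H.IsCoproduct h (H.doubleΔ h hα) where
  on_iD a := by
    refine (DFunLike.congr_fun (H.doubleΔ_comp_iDHom h hα) a).trans ?_
    exact (eq_pl_apply (h := Algebra.TensorProduct.map (H.iDHom h hα) (H.iDHom h hα))
      (by ext; simp) (by ext; simp) _).symm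
  on_flip := by
    have e := H.map_coproduct_flip ((map_id_eq_pl _ _).symm.trans (H.map_doubleΔ_flipOp h hα))
    rw [← RD_eq, ← iD₃_eq, ← iD₃_eq] at e
    exact e

/-- The equation for the coproduct involves `i_D ⊗ id`, which is injective; hence the coproduct is
determined on the universal flip operator itself. -/
theorem isCoproduct_iff (Δ' : H.Double h →ₐ[K] H.Double h ⊗[K] H.Double h) :
    H.IsCoproduct h Δ' ↔ Δ' = H.doubleΔ h hα := by
  refine ⟨fun h' => ?_, fun h' => h' ▸ H.isCoproduct_doubleΔ h hα⟩
  have h₀ := H.isCoproduct_doubleΔ h hα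
  refine H.double_hom_ext h hα (AlgHom.ext fun a => (h'.on_iD a).trans (h₀.on_iD a).symm) ?_
  have e : ∀ k : H.Double h →ₗ[K] H.Double h ⊗[K] H.Double h, TensorProduct.map (H.iD h) k
      (H.flipOp h) = LinearMap.rTensor _ (H.iD h) (TensorProduct.map LinearMap.id k (H.flipOp h)) :=
    fun k => by
      rw [LinearMap.rTensor, ← LinearMap.comp_apply, ← TensorProduct.map_comp]
      rfl
  have e' := h'.on_flip.trans h₀.on_flip.symm
  rw [e, e] at e'
  exact Module.Flat.rTensor_preserves_injective_linearMap _ (H.iD_injective h) e'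

theorem isCounit_iff (ε' : H.Double h →ₐ[K] K) : H.IsCounit h ε' ↔ ε' = H.doubleε h hα := by
  have e : ∀ ε' : H.Double h →ₐ[K] K, TensorProduct.rid K G
      (TensorProduct.map LinearMap.id ε'.toLinearMap (H.flipOp h)) = 1 ↔
        Algebra.TensorProduct.map (AlgHom.id K G) ε' (H.flipOp h) = 1 := fun ε' => by
    rw [← (TensorProduct.rid K G).injective.eq_iff (b := 1)]
    simp only [Algebra.TensorProduct.one_def, TensorProduct.rid_tmul, one_smul]
    rfl
  refine ⟨fun h' => H.double_hom_ext h hα (AlgHom.ext fun a => (h'.on_iD a).trans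
    (DFunLike.congr_fun (H.doubleε_comp_iDHom h hα) a).symm)
    (((e _).1 h'.on_flip).trans (H.map_doubleε_flipOp h hα).symm), fun h' => h' ▸
    ⟨DFunLike.congr_fun (H.doubleε_comp_iDHom h hα), (e _).2 (H.map_doubleε_flipOp h hα)⟩⟩

theorem twistFlip_flipOp : H.twistFlip (H.iDHom h hα) (H.flipOp h) =
    H.idiD h (Algebra.TensorProduct.comm K G G H.f) * H.flipOp h * H.idiD h H.fInv := by
  rw [twistFlip, ← mul_assoc]
  rfl

theorem isAntipode_unopLin_doubleSop : H.IsAntipode h (unopLin (H.doubleSop h hα)) where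
  anti_mul x y := by simp
  on_iD a := congrArg MulOpposite.unop (DFunLike.congr_fun (H.doubleSop_comp_iDHom h hα) a)
  on_flip := (H.map_S_doubleSop_flipOp h hα).trans (H.twistFlip_flipOp h hα)

theorem isAntipode_iff (S' : H.Double h →ₗ[K] H.Double h) :
    H.IsAntipode h S' ↔ S' = unopLin (H.doubleSop h hα) := by
  refine ⟨fun h' => ?_, fun h' => h' ▸ H.isAntipode_unopLin_doubleSop h hα⟩
  have h₁ : S' 1 = 1 := by
    have e := h'.on_iD 1
    rw [S_one] at e
    exact e
  let s' : H.Double h →ₐ[K] (H.Double h)ᵐᵒᵖ :=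
    AlgHom.ofLinearMap ((MulOpposite.opLinearEquiv K).toLinearMap ∘ₗ S') (by simp [h₁])
      (fun x y => by simp [h'.anti_mul])
  have e : s' = H.doubleSop h hα := by
    refine H.double_hom_ext h hα (AlgHom.ext fun a => ?_) ?_
    · rw [doubleSop_comp_iDHom]
      exact congrArg MulOpposite.op (h'.on_iD a)
    · rw [map_doubleSop_flipOp, ← map_S_unopLin_eq_iff, twistFlip_flipOp]
      exact h'.on_flip
  rw [← e]
  rfl

end Double

end QuasiHopfAlgebra

end QH

end

theorem theorem3p9 {G : Type*} [Ring G] [Algebra ℂ G] [FiniteDimensional ℂ G]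
    (H : QH.QuasiHopfAlgebra ℂ G) (hα : H.ε H.α = 1) :
    (H.f * H.fInv = 1 ∧ H.fInv * H.f = 1) ∧
    ∃ h : H.DoubleIsAlgebra,
      Function.Injective (H.iD h) ∧ H.DoubleRelations h ∧
      IsUnit (H.flipOp h) ∧
      TensorProduct.lid ℂ (H.Double h)
        (TensorProduct.map H.ε.toLinearMap LinearMap.id (H.flipOp h)) = 1 ∧
      ∃ Q : QH.QuasiHopfAlgebra ℂ (H.Double h),
        Q.IsRMatrix (H.RD h) ∧
        (Q.φ : TensorProduct ℂ (H.Double h) (TensorProduct ℂ (H.Double h) (H.Double h))) =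
          H.iD₃ h H.φ ∧
        Q.α = H.iD h H.α ∧
        Q.β = H.iD h H.β ∧
        (∀ Δ', H.IsCoproduct h Δ' ↔ Δ' = Q.Δ) ∧
        (∀ ε', H.IsCounit h ε' ↔ ε' = Q.ε) ∧
        (∀ S', H.IsAntipode h S' ↔ S' = Q.S.toLinearMap) := by
  have h := H.doubleIsAlgebra hα
  exact ⟨⟨H.f_mul_fInv, H.fInv_mul_f⟩, h, H.iD_injective h, H.doubleRelations h hα,
    H.isUnit_flipOp h hα, H.counit_flipOp h hα, H.doubleQuasiHopf h hα, H.isRMatrix_RD h hα, rfl,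
    rfl, rfl, H.isCoproduct_iff h hα, H.isCounit_iff h hα, H.isAntipode_iff h hα⟩
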